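/- **Setting.** Let $\Gamma(t)=\partial\Omega(t)\subset\mathbb R^3$, $t\in[0,T]$, be connected closed surfaces of class $C^4$, each bounding a bounded open set $\Omega(t)$, with outward unit normal $\mathbf n(\cdot,t)$. They evolve by a flow $\Phi_t:\Gamma(0)\to\Gamma(t)$ of $C^3$-diffeomorphisms, $\Phi_0=\mathrm{id}$, with purely normal velocity, $\partial_t\Phi_t=(V_\Gamma\mathbf n)\circ\Phi_t$, where $\Phi$ and $\partial_t\Phi$ are continuous in time with values in $C^3$. Let $k_g\ge1$, $k_u\ge2$, $k_{pr}=k_u-1$, $1\le k_\lambda\le k_u$ be integers. A conforming triangulation of $\Gamma(0)$ by flat triangles has its vertices on $\Gamma(0)$ and is mapped bijectively onto $\Gamma(0)$ by the closest point projection $\pi$, which is well defined on it. The order-$k_g$ Lagrange nodes of the flat triangles are projected to $\Gamma(0)$ by $\pi$ and then moved with $\Phi_t$; the element $T(t)$ of the discrete surface $\Gamma_h(t)$ is the image of the reference triangle $\hat T$ under the polynomial $F_{T(t)}$ of degree $k_g$ interpolating its nodes at time $t$. Put $h=\sup_{t\in[0,T]}\max_T\operatorname{diam}T(t)$. The mesh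 is uniformly quasi-uniform with parameter $\rho>0$: for all $t\in[0,T]$ and all elements, the inscribed circle of the flat triangle spanned by the vertices of $T(t)$ has radius at least $\rho h$. Let $\mathbf n_h$ be the elementwise outward unit normal of $\Gamma_h(t)$. Let $S_h^k(t)$ be the continuous functions on $\Gamma_h(t)$ that are polynomials of degree $\le k$ on each element in reference coordinates, with nodal basis $\chi_j^k(\cdot,t)$, and set $\mathbf V_h(t)=S_h^{k_u}(t)^3$, $Q_h(t)=\{q\in S_h^{k_{pr}}(t):\int_{\Gamma_h(t)}q=0\}$, $\Lambda_h(t)=S_h^{k_\lambda}(t)$. With all operators taken elementwise on $\Gamma_h(t)$, define $$\mathbf m_h(t;\mathbf w,\mathbf v)=\int_{\Gamma_h(t)}\mathbf w\cdot\mathbf v,\qquad b_h^L(t;\mathbf w,\{q,\xi\})=\int_{\Gamma_h(t)}\mathbf w\cdot\nabla_{\Gamma_h}q+\int_{\Gamma_h(t)}\xi\,\mathbf w\cdot\mathbf n_h,$$ $$\mathbf V_h^{div}(t)=\{\mathbf w\in\mathbf V_h(t):b_h^L(t;\mathbf w,\{q,\xi\})=0\ \ \forall\{q,\xi\}\in Q_h(t)\times\Lambda_h(t)\},$$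 $$\|\mathbf w\|_{a_h}=\|E_h(\mathbf w)\|_{L^2(\Gamma_h(t))}+\|\mathbf w\|_{L^2(\Gamma_h(t))},$$ where $\mathbf P_h=\mathbf I-\mathbf n_h\otimes\mathbf n_h$, $E_h(\mathbf w)$ is the symmetric part of $\mathbf P_h\nabla_{\Gamma_h}\mathbf w$, and $\|\{q,\xi\}\|_{L^2}=(\|q\|_{L^2}^2+\|\xi\|_{L^2}^2)^{1/2}$. For $z=\sum_jz_j\chi_j^k(\cdot,s)$ the time-lift to time $t$ is $\underline z(\cdot,t)=\sum_jz_j\chi_j^k(\cdot,t)$ (componentwise for vector fields). Let $\Delta t=T/N$, $t_n=n\Delta t$, and let a superscript $n$ denote evaluation at $t_n$. **Lemma.** There are constants $c,h_0,\tau_0>0$, depending only on the evolving surface, on $k_g,k_u,k_\lambda$ and on $\rho$ (not on the mesh, $h$, $N$ or $n$), such that the following holds whenever $h<h_0$, $1\le n\le N$ and $\Delta t\le\tau_0$. For every $\mathbf w_h^{n-1}\in\mathbf V_h^{div}(t_{n-1})$ there is a unique $(\hat{\mathbf w}_h^{n-1},\{\hat p_h^n,\hat\lambda_h^n\})\in\mathbf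 V_h^n\times(Q_h^n\times\Lambda_h^n)$ (the discrete Leray time-projection) with $$\mathbf m_h(t_n;\hat{\mathbf w}_h^{n-1},\mathbf v)+b_h^L(t_n;\mathbf v,\{\hat p_h^n,\hat\lambda_h^n\})=\mathbf m_h(t_{n-1};\mathbf w_h^{n-1},\underline{\mathbf v}(\cdot,t_{n-1})),\qquad b_h^L(t_n;\hat{\mathbf w}_h^{n-1},\{q,\xi\})=0$$ for all $\mathbf v\in\mathbf V_h^n$, $\{q,\xi\}\in Q_h^n\times\Lambda_h^n$. In particular $\hat{\mathbf w}_h^{n-1}\in\mathbf V_h^{div}(t_n)$, and $$\|\hat{\mathbf w}_h^{n-1}\|_{L^2(\Gamma_h^n)}\le c\,\|\mathbf w_h^{n-1}\|_{L^2(\Gamma_h^{n-1})},$$ $$\|\{\hat p_h^n,\hat\lambda_h^n\}\|_{L^2(\Gamma_h^n)}\le\|\underline{\mathbf w_h^{n-1}}(\cdot,t_n)-\hat{\mathbf w}_h^{n-1}\|_{L^2(\Gamma_h^n)}+c\,\Delta t\,\|\mathbf w_h^{n-1}\|_{L^2(\Gamma_h^{n-1})},$$ $$\|\underline{\mathbf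 w_h^{n-1}}(\cdot,t_n)-\hat{\mathbf w}_h^{n-1}\|_{L^2(\Gamma_h^n)}\le c\,\Delta t\,\|\mathbf w_h^{n-1}\|_{a_h}.$$ -/

import Mathlib

open scoped Topology
open Set MeasureTheory

noncomputable section

/-- Euclidean three-space. -/
abbrev E3 := EuclideanSpace ℝ (Fin 3)

/-- Coordinates on the reference triangle. -/
abbrev R2 := Fin 2 → ℝ

/-- The vector product of `ℝ³`. -/
def cross3 (u v : E3) : E3 := WithLp.toLp 2 (crossProduct (WithLp.ofLp u) (WithLp.ofLp v))

/-! ### Closed surfaces and their evolution -/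

/-- `φ` is a `C^m` function with nonzero gradient at `x` such that, near `x`, the set `Ω` is
the sublevel set `{φ < 0}`. -/
def IsLocalDefiningFunction (m : ℕ) (Ω : Set E3) (x : E3) (φ : E3 → ℝ) : Prop :=
  ContDiff ℝ m φ ∧ gradient φ x ≠ 0 ∧ ∀ᶠ y in 𝓝 x, (y ∈ Ω ↔ φ y < 0)

/-- A nonempty bounded open set with `C^m` boundary; the boundary is then a closed compact
embedded hypersurface of class `C^m`. -/
def IsBoundedCmDomain (m : ℕ) (Ω : Set E3) : Prop :=
  IsOpen Ω ∧ Ω.Nonempty ∧ Bornology.IsBounded Ω ∧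
    ∀ x ∈ frontier Ω, ∃ φ : E3 → ℝ, IsLocalDefiningFunction m Ω x φ

/-- `ν` is the unit normal at the boundary point `x` of `Ω` that points out of `Ω`. -/
def IsOutwardUnitNormal (Ω : Set E3) (x ν : E3) : Prop :=
  ∃ φ : E3 → ℝ, IsLocalDefiningFunction 1 Ω x φ ∧ ν = ‖gradient φ x‖⁻¹ • gradient φ x

/-- `f` belongs to `C⁰([0,T]; C³)`: every `f t` is three times continuously differentiable in
space and all spatial derivatives up to order three are jointly continuous in time and space. -/
def IsContinuousInC3 (T : ℝ) (f : ℝ → E3 → E3) : Prop :=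
  (∀ t ∈ Icc 0 T, ContDiff ℝ 3 (f t)) ∧
    ∀ j : ℕ, j ≤ 3 →
      ContinuousOn (fun p : ℝ × E3 => iteratedFDeriv ℝ j (f p.1) p.2) (Icc 0 T ×ˢ univ)

/-- A connected closed evolving surface `Γ(t) = ∂Ω(t)`, `t ∈ [0,T]`, of class `C⁴`, transported
by the flow `Φ` of a purely normal velocity field `speed • normal`.  Only the values of `Φ` and
`dΦ` on `Γ(0)` matter; as usual, `C³` functions on the surface are represented by `C³`
extensions to the ambient space. -/
structure EvolvingSurface where
  /-- final time -/
  T : ℝ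
  T_pos : 0 < T
  /-- the domain enclosed by the surface -/
  Ω : ℝ → Set E3
  /-- outward unit normal of the surface -/
  normal : ℝ → E3 → E3
  /-- scalar normal velocity of the surface -/
  speed : ℝ → E3 → ℝ
  /-- normal trajectories -/
  Φ : ℝ → E3 → E3
  /-- time derivative of the normal trajectories -/
  dΦ : ℝ → E3 → E3
  domain : ∀ t ∈ Icc 0 T, IsBoundedCmDomain 4 (Ω t)
  connected : IsConnected (frontier (Ω 0))
  normal_spec : ∀ t ∈ Icc 0 T, ∀ x ∈ frontier (Ω t), IsOutwardUnitNormal (Ω t) x (normal t x)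
  flow_zero : ∀ z ∈ frontier (Ω 0), Φ 0 z = z
  flow_image : ∀ t ∈ Icc 0 T, Φ t '' frontier (Ω 0) = frontier (Ω t)
  flow_diffeo : ∀ t ∈ Icc 0 T, ∃ Ψ : E3 → E3, ContDiff ℝ 3 Ψ ∧
    ∀ z ∈ frontier (Ω 0), Ψ (Φ t z) = z
  flow_regular : IsContinuousInC3 T Φ
  dflow_regular : IsContinuousInC3 T dΦ
  flow_deriv : ∀ t ∈ Icc 0 T, ∀ x, HasDerivWithinAt (fun s => Φ s x) (dΦ t x) (Icc 0 T) t
  flow_ode : ∀ t ∈ Icc 0 T, ∀ z ∈ frontier (Ω 0),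
    dΦ t z = speed t (Φ t z) • normal t (Φ t z)

namespace EvolvingSurface

/-- The surface `Γ(t)`. -/
def Γ (S : EvolvingSurface) (t : ℝ) : Set E3 := frontier (S.Ω t)

/-- The `n`-th node `t_n = n Δt`, `Δt = T / N`, of the uniform partition of `[0,T]`. -/
def time (S : EvolvingSurface) (N n : ℕ) : ℝ := n * (S.T / N)

end EvolvingSurface

/-- A closest point of `Γ` to `x` (the closest point projection where that point is unique). -/
def closestPoint (Γ : Set E3) (x : E3) : E3 :=
  Classical.epsilon fun y => y ∈ Γ ∧ dist x y = Metric.infDist x Γ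

/-! ### Triangulations and Lagrange finite elements -/

/-- The reference triangle. -/
def refTriangle : Set R2 := {x | 0 ≤ x 0 ∧ 0 ≤ x 1 ∧ x 0 + x 1 ≤ 1}

/-- Barycentric coordinates on the reference triangle. -/
def bary (x : R2) : Fin 3 → ℝ := ![1 - x 0 - x 1, x 0, x 1]

/-- Indices `(i₀,i₁,i₂)`, `i₀ + i₁ + i₂ = k`, of the principal lattice of order `k`. -/
abbrev LatticeIndex (k : ℕ) := {i : Fin 3 → ℕ // i ∈ Finset.Nat.antidiagonalTuple 3 k}

/-- The Lagrange shape function of degree `k` on the reference triangle that equals one at the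
lattice point with barycentric coordinates `i / k` and zero at the other lattice points. -/
def shape (k : ℕ) (i : Fin 3 → ℕ) (x : R2) : ℝ :=
  ∏ l : Fin 3, ∏ m ∈ Finset.range (i l), ((k : ℝ) * bary x l - m) / ((i l : ℝ) - m)

/-- An admissible conforming triangulation by flat triangles, with vertices on the closed
surface `Γ`, which the closest point projection maps bijectively onto `Γ`. -/
structure Triangulation (Γ : Set E3) where
  /-- number of vertices -/
  nV : ℕ
  /-- number of triangles -/
  nK : ℕ
  vert : Fin nV → E3
  tri : Fin nK → Fin 3 → Fin nV
  vert_mem : ∀ i, vert i ∈ Γ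
  vert_injective : Function.Injective vert
  nondegenerate : ∀ K, AffineIndependent ℝ fun l => vert (tri K l)
  tri_injective : ∀ K K', range (tri K) = range (tri K') → K = K'
  conforming : ∀ K K',
    convexHull ℝ (range fun l => vert (tri K l)) ∩ convexHull ℝ (range fun l => vert (tri K' l)) =
      convexHull ℝ (vert '' (range (tri K) ∩ range (tri K')))
  proj_unique : ∀ K, ∀ x ∈ convexHull ℝ (range fun l => vert (tri K l)),
    ∃! y, y ∈ Γ ∧ dist x y = Metric.infDist x Γ
  proj_bijOn : BijOn (closestPoint Γ) (⋃ K, convexHull ℝ (range fun l => vert (tri K l))) Γ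

namespace Triangulation

variable {Γ : Set E3}

/-- The lattice point of order `k` with index `i` in the flat triangle `K`. -/
def latticePoint (M : Triangulation Γ) (k : ℕ) (K : Fin M.nK) (i : LatticeIndex k) : E3 :=
  ∑ l : Fin 3, ((i.1 l : ℝ) / k) • M.vert (M.tri K l)

/-- The global Lagrange nodes of order `k` (labelled by their position in the flat mesh). -/
abbrev Node (M : Triangulation Γ) (k : ℕ) :=
  {x : E3 // ∃ (K : Fin M.nK) (i : LatticeIndex k), x = M.latticePoint k K i}

/-- The node of order `k` with local index `i` in the triangle `K`. -/
def node (M : Triangulation Γ) (k : ℕ) (K : Fin M.nK) (i : LatticeIndex k) : M.Node k :=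
  ⟨M.latticePoint k K i, K, i, rfl⟩

/-- Lagrange finite element functions `z_h = ∑ⱼ zⱼ χⱼ(·,t)` of degree `k` on the discrete surface
at time `t`, given by their nodal values `zⱼ`. -/
abbrev FEFun (M : Triangulation Γ) (k : ℕ) (E : Type) (_t : ℝ) := M.Node k → E

/-- The representation on the reference triangle, `z_h ∘ F_K`, of a finite element function on
the element `K`. -/
def localRep (M : Triangulation Γ) {E : Type} [AddCommGroup E] [Module ℝ E] (k : ℕ)
    (z : M.Node k → E) (K : Fin M.nK) (x : R2) : E :=
  ∑ i : LatticeIndex k, shape k i.1 x • z (M.node k K i)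

/-- The time-lift: `∑ⱼ zⱼ χⱼ(·,s)` on the discrete surface at time `s` is sent to the function
`∑ⱼ zⱼ χⱼ(·,t)`, with the same nodal values, on the discrete surface at time `t`. -/
def timeLift (M : Triangulation Γ) {k : ℕ} {E : Type} {s : ℝ} (t : ℝ) (z : M.FEFun k E s) :
    M.FEFun k E t := z

end Triangulation

/-! ### Calculus on a parametrized surface piece `F` -/

/-- Coordinate tangent vectors. -/
def tangentVec (F : R2 → E3) (x : R2) (a : Fin 2) : E3 := fderiv ℝ F x (Pi.single a 1)

/-- First fundamental form. -/
def gram (F : R2 → E3) (x : R2) : Matrix (Fin 2) (Fin 2) ℝ :=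
  Matrix.of fun a b => inner ℝ (tangentVec F x a) (tangentVec F x b)

/-- The (non-normalized) normal `∂₀F × ∂₁F`, whose length is the area element. -/
def normalVec (F : R2 → E3) (x : R2) : E3 := cross3 (tangentVec F x 0) (tangentVec F x 1)

/-- Tangential gradient of the function whose pullback by `F` is `q`. -/
def surfGrad (F : R2 → E3) (q : R2 → ℝ) (x : R2) : E3 :=
  ∑ a, ∑ b, ((gram F x)⁻¹ a b * fderiv ℝ q x (Pi.single a 1)) • tangentVec F x b

/-- Tangential derivative of a vector field: row `i` is the tangential gradient of the `i`-th
component. -/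
def surfJacobian (F : R2 → E3) (w : R2 → E3) (x : R2) : Matrix (Fin 3) (Fin 3) ℝ :=
  Matrix.of fun i j => surfGrad F (fun y => w y i) x j

/-- The orthogonal projection `I - ν ⊗ ν` onto the tangent plane. -/
def tangentProj (F : R2 → E3) (x : R2) : Matrix (Fin 3) (Fin 3) ℝ :=
  1 - Matrix.vecMulVec (‖normalVec F x‖⁻¹ • normalVec F x).ofLp
    (‖normalVec F x‖⁻¹ • normalVec F x).ofLp

/-- Covariant derivative. -/
def covDeriv (F : R2 → E3) (w : R2 → E3) (x : R2) : Matrix (Fin 3) (Fin 3) ℝ :=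
  tangentProj F x * surfJacobian F w x

/-- The rate-of-strain tensor `E(w)`, the symmetric part of the covariant derivative. -/
def strain (F : R2 → E3) (w : R2 → E3) (x : R2) : Matrix (Fin 3) (Fin 3) ℝ :=
  (1 / 2 : ℝ) • (covDeriv F w x + (covDeriv F w x).transpose)

/-- Twice the area divided by the perimeter: the radius of the inscribed circle of the flat
triangle with vertices `a 0`, `a 1`, `a 2`. -/
def inradius (a : Fin 3 → E3) : ℝ :=
  ‖cross3 (a 1 - a 0) (a 2 - a 0)‖ / (dist (a 0) (a 1) + dist (a 1) (a 2) + dist (a 2) (a 0))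

/-! ### The evolving discrete surface of order `kg` and the discrete forms -/

namespace EvolvingSurface

variable (S : EvolvingSurface) (M : Triangulation (S.Γ 0)) (kg : ℕ)

/-- Position at time `t` of a geometric node: the node of the flat mesh is projected to `Γ(0)`
and then moves along `Γ(t)` with the normal flow. -/
def nodePos (t : ℝ) (a : M.Node kg) : E3 := S.Φ t (closestPoint (S.Γ 0) a.1)

/-- The reference map `F_K(·,t)`: the polynomial of degree `kg` that interpolates the nodes of
the element `K` at time `t`. -/
def elemMap (t : ℝ) (K : Fin M.nK) : R2 → E3 := M.localRep kg (S.nodePos M kg t) K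

/-- The element `K` of the discrete surface `Γ_h(t)`. -/
def elem (t : ℝ) (K : Fin M.nK) : Set E3 := S.elemMap M kg t K '' refTriangle

/-- `h` is the supremum over time of the maximal element diameter. -/
def IsMeshSize (h : ℝ) : Prop :=
  IsLUB {d | ∃ t ∈ Icc 0 S.T, ∃ K, d = Metric.diam (S.elem M kg t K)} h

/-- Uniform quasi-uniformity: at all times the inscribed circle of (the vertex triangle of) every
element has radius at least `ρ h`. -/
def IsQuasiUniform (ρ h : ℝ) : Prop :=
  ∀ t ∈ Icc 0 S.T, ∀ K, ρ * h ≤ inradius fun l => S.Φ t (M.vert (M.tri K l))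

/-- Integral over the discrete surface `Γ_h(t)` of the function with pullbacks `f K`. -/
def surfIntegral (t : ℝ) (f : Fin M.nK → R2 → ℝ) : ℝ :=
  ∑ K, ∫ x in refTriangle, f K x * ‖normalVec (S.elemMap M kg t K) x‖

/-- The elementwise outward unit normal `n_h` of `Γ_h(t)`: of the two unit normals of the element,
the one on the side of the outward normal of `Γ(t)` (at a vertex of the element). -/
def discNormal (t : ℝ) (K : Fin M.nK) (x : R2) : E3 :=
  (Real.sign (inner ℝ (normalVec (S.elemMap M kg t K) x)
      (S.normal t (S.Φ t (M.vert (M.tri K 0))))) * ‖normalVec (S.elemMap M kg t K) x‖⁻¹) •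
    normalVec (S.elemMap M kg t K) x

/-- `m_h(t; w, v) = ∫ w · v` for vector fields. -/
def mForm {k : ℕ} (t : ℝ) (w v : M.FEFun k E3 t) : ℝ :=
  S.surfIntegral M kg t fun K x => inner ℝ (M.localRep k w K x) (M.localRep k v K x)

/-- The `L²(Γ_h(t))` norm of a vector-valued finite element function. -/
def normL2 {k : ℕ} (t : ℝ) (w : M.FEFun k E3 t) : ℝ := Real.sqrt (S.mForm M kg t w w)

/-- The `L²(Γ_h(t))` norm of a scalar finite element function. -/
def scalarNormL2 {k : ℕ} (t : ℝ) (q : M.FEFun k ℝ t) : ℝ :=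
  Real.sqrt (S.surfIntegral M kg t fun K x => M.localRep k q K x ^ 2)

/-- The norm `(‖q‖² + ‖ξ‖²)^(1/2)` of a pair in `L²(Γ_h(t)) × L²(Γ_h(t))`. -/
def pairNormL2 {k k' : ℕ} (t : ℝ) (q : M.FEFun k ℝ t) (ξ : M.FEFun k' ℝ t) : ℝ :=
  Real.sqrt (S.scalarNormL2 M kg t q ^ 2 + S.scalarNormL2 M kg t ξ ^ 2)

/-- The `L²(Γ_h(t))` norm of the discrete rate-of-strain tensor `E_h(w)`. -/
def strainNormL2 {k : ℕ} (t : ℝ) (w : M.FEFun k E3 t) : ℝ :=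
  Real.sqrt (S.surfIntegral M kg t fun K x =>
    ∑ i, ∑ j, strain (S.elemMap M kg t K) (M.localRep k w K) x i j ^ 2)

/-- The energy norm `‖w‖_{a_h} = ‖E_h(w)‖ + ‖w‖`. -/
def energyNorm {k : ℕ} (t : ℝ) (w : M.FEFun k E3 t) : ℝ :=
  S.strainNormL2 M kg t w + S.normL2 M kg t w

/-- `b_h^L(t; w, {q, ξ}) = ∫ w · ∇_{Γ_h} q + ∫ ξ w · n_h`. -/
def bForm {ku kp kl : ℕ} (t : ℝ) (w : M.FEFun ku E3 t) (q : M.FEFun kp ℝ t)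
    (ξ : M.FEFun kl ℝ t) : ℝ :=
  S.surfIntegral M kg t (fun K x =>
      inner ℝ (M.localRep ku w K x) (surfGrad (S.elemMap M kg t K) (M.localRep kp q K) x)) +
    S.surfIntegral M kg t (fun K x =>
      M.localRep kl ξ K x * inner ℝ (M.localRep ku w K x) (S.discNormal M kg t K x))

/-- Zero mean over `Γ_h(t)`, the constraint in the pressure space `Q_h(t)`. -/
def MeanZero {k : ℕ} (t : ℝ) (q : M.FEFun k ℝ t) : Prop :=
  S.surfIntegral M kg t (fun K x => M.localRep k q K x) = 0

/-- `w` is discretely weakly tangential divergence-free, `w ∈ V_h^div(t)`. -/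
def IsWeaklyDivFree {ku : ℕ} (kp kl : ℕ) (t : ℝ) (w : M.FEFun ku E3 t) : Prop :=
  ∀ (q : M.FEFun kp ℝ t) (ξ : M.FEFun kl ℝ t), S.MeanZero M kg t q → S.bForm M kg t w q ξ = 0

/-- `(w', {p, l})` solves the defining system of the discrete Leray time-projection of `w` from
the surface at time `s` to the surface at time `t`. -/
def IsLerayProjection {ku kp kl : ℕ} (s t : ℝ) (w : M.FEFun ku E3 s)
    (w' : M.FEFun ku E3 t) (p : M.FEFun kp ℝ t) (l : M.FEFun kl ℝ t) : Prop :=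
  S.MeanZero M kg t p ∧
  (∀ v : M.FEFun ku E3 t,
    S.mForm M kg t w' v + S.bForm M kg t v p l = S.mForm M kg s w (M.timeLift s v)) ∧
  S.IsWeaklyDivFree M kg kp kl t w'

end EvolvingSurface

end

/-! ### Vector algebra in three-space -/

/-! The defining system is a saddle point problem in which the velocity is measured in L² and the
multipliers in ‖∇q‖ + ‖ξ‖. All estimates are made for nodal values: `meshNorm` is uniformly
equivalent to the L² norm and `jumpNorm` to the L² norm of the surface gradient; no power of h
appears in the latter because the Dirichlet energy is scale invariant in dimension two.

Let s, t be consecutive times, e = w - w' the difference of nodal values and {p, l} the multipliers.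
Then b_t(v,{p,l}) = m_t(e,v) - (m_t - m_s)(w,v) for every v, and three facts suffice. (i) The
time-lift keeps nodal values, while tangent vectors, area elements and weighted normals move by a
relative amount O(|t-s|); so m and b change by O(|t-s|) in these norms (`MeshGeom.abs_mForm_sub_le`,
`MeshGeom.abs_bForm_sub_le`). (ii) An inf-sup condition (`exists_infSup`) bounds ‖∇p‖ + ‖l‖ by C(‖e‖
+ |t-s|‖w‖). (iii) Since w is discretely divergence-free at s and w' at t, b_t(e,{p,l}) =
b_t(w,{p,l}) = (b_t - b_s)(w,{p,l}). Testing with v = e gives ‖e‖² ≤ C|t-s|‖w‖(‖e‖ + |t-s|‖w‖),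
hence ‖e‖ ≤ C|t-s|‖w‖ (`FormBounds.projection_bounds`), with only the L² norm on the right. For w =
0 the same bounds show that the square homogeneous system has only the zero solution, which yields
existence and uniqueness (`FormBounds.existsUnique`).

For the inf-sup condition the test field is h⁻² times an edge field plus a normal field. The edge
field sums, over the edges, bubble times edge derivative of q times edge vector. It is continuous
across elements, because on a common edge only the derivative along that edge survives, and its
degree 2 + (kp - 1) = ku puts it exactly into the velocity space. Paired with ∇q it yields a
weighted sum of squared edge derivatives. The interpolant of ξν, with ν the normal of the smooth
surface, yields ξ². The cross terms are of relative order h by the uniform geometry of the mesh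
(`exists_meshGeom`) and are absorbed for small h.

The L² bound for p needs a Poincaré inequality with a constant independent of the mesh
(`exists_poincare`). In a chart, two elements are joined by an axis-parallel path; the change of
nodal values along it is bounded by the oscillations on the elements of two thin strips, and
counting elements by area controls the strips. Connectedness and compactness of Γ(0) make the
inequality global.

Continuity of `normal` in time is not assumed, so discrete normals at s and t are compared only up
to one global sign; the sign is absorbed into ξ. -/

lemma E3_inner_eq (u v : E3) : inner ℝ u v = u 0 * v 0 + u 1 * v 1 + u 2 * v 2 := by
  simp [PiLp.inner_apply, Fin.sum_univ_three, mul_comm]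

lemma E3_norm_sq (u : E3) : ‖u‖ ^ 2 = u 0 ^ 2 + u 1 ^ 2 + u 2 ^ 2 := by
  rw [← real_inner_self_eq_norm_sq, E3_inner_eq]; ring

@[simp] lemma cross3_apply_zero (u v : E3) : cross3 u v 0 = u 1 * v 2 - u 2 * v 1 := by
  simp [cross3, cross_apply]

@[simp] lemma cross3_apply_one (u v : E3) : cross3 u v 1 = u 2 * v 0 - u 0 * v 2 := by
  simp [cross3, cross_apply]

@[simp] lemma cross3_apply_two (u v : E3) : cross3 u v 2 = u 0 * v 1 - u 1 * v 0 := by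
  simp [cross3, cross_apply]

lemma E3_ext {u v : E3} (h0 : u 0 = v 0) (h1 : u 1 = v 1) (h2 : u 2 = v 2) : u = v := by
  ext i; fin_cases i <;> assumption

lemma cross3_add_left (u v w : E3) : cross3 (u + v) w = cross3 u w + cross3 v w := by
  apply E3_ext <;> simp <;> ring

lemma cross3_add_right (u v w : E3) : cross3 u (v + w) = cross3 u v + cross3 u w := by
  apply E3_ext <;> simp <;> ring

lemma cross3_sub_left (u v w : E3) : cross3 (u - v) w = cross3 u w - cross3 v w := by
  apply E3_ext <;> simp <;> ring

lemma cross3_sub_right (u v w : E3) : cross3 u (v - w) = cross3 u v - cross3 u w := by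
  apply E3_ext <;> simp <;> ring

lemma cross3_smul_left (a : ℝ) (u v : E3) : cross3 (a • u) v = a • cross3 u v := by
  apply E3_ext <;> simp <;> ring

lemma cross3_smul_right (a : ℝ) (u v : E3) : cross3 u (a • v) = a • cross3 u v := by
  apply E3_ext <;> simp <;> ring

/-- Lagrange's identity, a polynomial identity in the six coordinates. -/
lemma norm_cross3_sq (u v : E3) :
    ‖cross3 u v‖ ^ 2 = ‖u‖ ^ 2 * ‖v‖ ^ 2 - inner ℝ u v ^ 2 := by
  rw [E3_norm_sq, E3_norm_sq, E3_norm_sq, E3_inner_eq]; simp; ring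

lemma norm_cross3_le (u v : E3) : ‖cross3 u v‖ ≤ ‖u‖ * ‖v‖ := by
  apply le_of_sq_le_sq _ (by positivity)
  rw [norm_cross3_sq, mul_pow]; nlinarith [sq_nonneg (inner ℝ u v)]

lemma inner_cross3_self_left (u v : E3) : inner ℝ u (cross3 u v) = 0 := by
  rw [E3_inner_eq]; simp; ring

lemma inner_cross3_self_right (u v : E3) : inner ℝ v (cross3 u v) = 0 := by
  rw [E3_inner_eq]; simp; ring

lemma inner_cross3_rotate (u v w : E3) : inner ℝ u (cross3 v w) = inner ℝ v (cross3 w u) := by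
  rw [E3_inner_eq, E3_inner_eq]; simp; ring

lemma cross3_cross3_right (u v : E3) :
    cross3 v (cross3 u v) = (inner ℝ v v) • u - (inner ℝ u v) • v := by
  apply E3_ext <;> simp only [E3_inner_eq, cross3_apply_zero, cross3_apply_one, cross3_apply_two,
    PiLp.sub_apply, PiLp.smul_apply, smul_eq_mul] <;> ring

lemma cross3_cross3_left (u v : E3) :
    cross3 (cross3 u v) u = (inner ℝ u u) • v - (inner ℝ u v) • u := by
  apply E3_ext <;> simp only [E3_inner_eq, cross3_apply_zero, cross3_apply_one, cross3_apply_two,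
    PiLp.sub_apply, PiLp.smul_apply, smul_eq_mul] <;> ring

lemma continuous_cross3 : Continuous fun p : E3 × E3 => cross3 p.1 p.2 := by
  have : (fun p : E3 × E3 => cross3 p.1 p.2) = fun p => WithLp.toLp 2
      ![p.1 1 * p.2 2 - p.1 2 * p.2 1, p.1 2 * p.2 0 - p.1 0 * p.2 2,
        p.1 0 * p.2 1 - p.1 1 * p.2 0] := by
    funext p; apply E3_ext <;> simp
  rw [this]
  refine (PiLp.continuous_toLp 2 _).comp (continuous_pi fun i => ?_)
  fin_cases i <;> simp <;> fun_prop

lemma Continuous.cross3 {X : Type*} [TopologicalSpace X] {f g : X → E3} (hf : Continuous f)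
    (hg : Continuous g) : Continuous fun x => cross3 (f x) (g x) :=
  continuous_cross3.comp (hf.prodMk hg)

lemma ContinuousOn.cross3 {X : Type*} [TopologicalSpace X] {f g : X → E3} {s : Set X}
    (hf : ContinuousOn f s) (hg : ContinuousOn g s) :
    ContinuousOn (fun x => cross3 (f x) (g x)) s :=
  continuous_cross3.comp_continuousOn (hf.prodMk hg)

lemma norm_cross3_sub_le (u v u' v' : E3) :
    ‖cross3 u v - cross3 u' v'‖ ≤ ‖u - u'‖ * ‖v‖ + ‖u'‖ * ‖v - v'‖ := by
  have : cross3 u v - cross3 u' v' = cross3 (u - u') v + cross3 u' (v - v') := by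
    rw [cross3_sub_left, cross3_sub_right]; abel
  rw [this]
  exact (norm_add_le _ _).trans (add_le_add (norm_cross3_le _ _) (norm_cross3_le _ _))

/-- Normalization of a vector. -/
noncomputable def unitize {E : Type*} [NormedAddCommGroup E] [NormedSpace ℝ E] (v : E) : E :=
  ‖v‖⁻¹ • v

lemma norm_unitize_le {E : Type*} [NormedAddCommGroup E] [NormedSpace ℝ E] (v : E) :
    ‖unitize v‖ ≤ 1 := by
  rw [unitize, norm_smul, norm_inv, norm_norm]; exact inv_mul_le_one

lemma norm_unitize {E : Type*} [NormedAddCommGroup E] [NormedSpace ℝ E] {v : E} (hv : v ≠ 0) :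
    ‖unitize v‖ = 1 := by
  rw [unitize, norm_smul, norm_inv, norm_norm, inv_mul_cancel₀ (norm_ne_zero_iff.2 hv)]

lemma norm_smul_unitize {E : Type*} [NormedAddCommGroup E] [NormedSpace ℝ E] (v : E) :
    ‖v‖ • unitize v = v := by
  rcases eq_or_ne v 0 with rfl | hv
  · simp
  · rw [unitize, smul_smul, mul_inv_cancel₀ (norm_ne_zero_iff.2 hv), one_smul]

/-- Multiply the difference of the unit vectors by ‖u‖: what remains is u - v plus (‖v‖ - ‖u‖) times
a vector of length at most one. Only one of the two vectors needs a lower bound. -/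
lemma norm_unitize_sub_le {E : Type*} [NormedAddCommGroup E] [NormedSpace ℝ E] {u : E} (v : E)
    {c : ℝ} (hc : 0 < c) (hu : c ≤ ‖u‖) : ‖unitize u - unitize v‖ ≤ 2 / c * ‖u - v‖ := by
  have hu0 : 0 < ‖u‖ := hc.trans_le hu
  have h1 : ‖u‖ • (unitize u - unitize v) = (u - v) + (‖v‖ - ‖u‖) • unitize v := by
    rw [smul_sub, norm_smul_unitize, sub_smul, norm_smul_unitize]; abel
  have h2 : ‖u‖ * ‖unitize u - unitize v‖ ≤ 2 * ‖u - v‖ := by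
    have h3 := congrArg norm h1
    rw [norm_smul, norm_norm] at h3
    rw [h3]
    refine (norm_add_le _ _).trans ?_
    rw [norm_smul, two_mul]
    gcongr
    refine (mul_le_of_le_one_right (norm_nonneg _) (norm_unitize_le v)).trans ?_
    rw [Real.norm_eq_abs, abs_sub_comm]; exact abs_norm_sub_norm_le u v
  rw [div_mul_eq_mul_div, le_div_iff₀ hc]
  nlinarith [norm_nonneg (unitize u - unitize v)]

/-! ### The tangential gradient -/

lemma gram_det (F : R2 → E3) (x : R2) : (gram F x).det = ‖normalVec F x‖ ^ 2 := by
  rw [normalVec, norm_cross3_sq, Matrix.det_fin_two]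
  simp only [gram, Matrix.of_apply, real_inner_self_eq_norm_sq]
  rw [real_inner_comm (tangentVec F x 0) (tangentVec F x 1)]; ring

/-- The adjugate of the Gram matrix is expressed by double vector products, so up to the factor ‖N‖²
the two vectors on the right are the basis dual to the tangent vectors. Nondegeneracy is not needed:
if N = 0, both inverses are zero by convention. -/
lemma surfGrad_eq (F : R2 → E3) (q : R2 → ℝ) (x : R2) :
    surfGrad F q x = (‖normalVec F x‖ ^ 2)⁻¹ •
      (fderiv ℝ q x (Pi.single 0 1) • cross3 (tangentVec F x 1) (normalVec F x) +
        fderiv ℝ q x (Pi.single 1 1) • cross3 (normalVec F x) (tangentVec F x 0)) := by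
  rw [normalVec, cross3_cross3_right, cross3_cross3_left, ← normalVec, surfGrad, Matrix.inv_def,
    gram_det, Matrix.adjugate_fin_two]
  simp only [Fin.sum_univ_two, gram, Matrix.of_apply, Matrix.smul_apply, Ring.inverse_eq_inv',
    Matrix.cons_val', Matrix.cons_val_zero, Matrix.cons_val_one, Matrix.cons_val_fin_one,
    smul_eq_mul]
  rw [real_inner_comm (tangentVec F x 0) (tangentVec F x 1)]
  module

/-- The surface gradient times the area element, as a linear function of the coordinate
derivatives `d` and a function of the tangent vectors. -/
noncomputable def fluxVec (g₀ g₁ : E3) (d : Fin 2 → ℝ) : E3 :=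
  d 0 • cross3 g₁ (unitize (cross3 g₀ g₁)) + d 1 • cross3 (unitize (cross3 g₀ g₁)) g₀

/-- The area element cancels all inverse powers of ‖N‖ except the one in the unit normal. The
weighted gradient is therefore homogeneous of degree one in the tangent vectors, which makes its
time increments easy to estimate. -/
lemma norm_smul_surfGrad (F : R2 → E3) (q : R2 → ℝ) (x : R2) :
    ‖normalVec F x‖ • surfGrad F q x = fluxVec (tangentVec F x 0) (tangentVec F x 1)
      (fun a => fderiv ℝ q x (Pi.single a 1)) := by
  rw [surfGrad_eq, fluxVec, ← normalVec, unitize, cross3_smul_left, cross3_smul_right]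
  rcases eq_or_ne (‖normalVec F x‖) 0 with h | h
  · simp [h]
  · simp only [smul_add, smul_smul]
    congr 2 <;> field_simp

lemma inner_tangentVec_zero_surfGrad {F : R2 → E3} (q : R2 → ℝ) {x : R2}
    (h : normalVec F x ≠ 0) :
    inner ℝ (tangentVec F x 0) (surfGrad F q x) = fderiv ℝ q x (Pi.single 0 1) := by
  have h' : ‖normalVec F x‖ ^ 2 ≠ 0 := by simpa using h
  rw [surfGrad_eq, inner_smul_right, inner_add_right, inner_smul_right, inner_smul_right,
    inner_cross3_self_right, inner_cross3_rotate, inner_cross3_rotate, ← normalVec,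
    real_inner_self_eq_norm_sq]
  field_simp; ring

lemma inner_tangentVec_one_surfGrad {F : R2 → E3} (q : R2 → ℝ) {x : R2}
    (h : normalVec F x ≠ 0) :
    inner ℝ (tangentVec F x 1) (surfGrad F q x) = fderiv ℝ q x (Pi.single 1 1) := by
  have h' : ‖normalVec F x‖ ^ 2 ≠ 0 := by simpa using h
  rw [surfGrad_eq, inner_smul_right, inner_add_right, inner_smul_right, inner_smul_right,
    inner_cross3_self_left, inner_cross3_rotate, ← normalVec,
    real_inner_self_eq_norm_sq]
  field_simp; ring

lemma norm_fluxVec_le (g₀ g₁ : E3) (d : Fin 2 → ℝ) :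
    ‖fluxVec g₀ g₁ d‖ ≤ |d 0| * ‖g₁‖ + |d 1| * ‖g₀‖ := by
  rw [fluxVec]
  refine (norm_add_le _ _).trans ?_
  rw [norm_smul, norm_smul, Real.norm_eq_abs, Real.norm_eq_abs]
  have h := norm_unitize_le (cross3 g₀ g₁)
  gcongr
  · exact (norm_cross3_le _ _).trans (mul_le_of_le_one_right (norm_nonneg _) h)
  · exact (norm_cross3_le _ _).trans (mul_le_of_le_one_left (norm_nonneg _) h)

/-- Used with a of order h, b of order h² and e of order h|t - s|; the quotient a²/b is then
bounded, so the bound loses nothing against e. -/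
lemma norm_fluxVec_sub_le {g₀ g₁ g₀' g₁' : E3} (d : Fin 2 → ℝ) {a b e : ℝ}
    (hb : 0 < b) (h0 : ‖g₀‖ ≤ a) (h1 : ‖g₁‖ ≤ a) (h0' : ‖g₀'‖ ≤ a) (h1' : ‖g₁'‖ ≤ a)
    (hN : b ≤ ‖cross3 g₀ g₁‖) (e0 : ‖g₀ - g₀'‖ ≤ e) (e1 : ‖g₁ - g₁'‖ ≤ e) :
    ‖fluxVec g₀ g₁ d - fluxVec g₀' g₁' d‖ ≤ (|d 0| + |d 1|) * (e + 4 * a ^ 2 / b * e) := by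
  have ha : 0 ≤ a := (norm_nonneg _).trans h0
  have he : 0 ≤ e := (norm_nonneg _).trans e0
  have hn := norm_unitize_le (cross3 g₀ g₁)
  have hd : ‖unitize (cross3 g₀ g₁) - unitize (cross3 g₀' g₁')‖ ≤ 4 * a / b * e := by
    refine (norm_unitize_sub_le _ hb hN).trans ?_
    have : ‖cross3 g₀ g₁ - cross3 g₀' g₁'‖ ≤ e * a + a * e :=
      (norm_cross3_sub_le _ _ _ _).trans (by gcongr)
    calc 2 / b * ‖cross3 g₀ g₁ - cross3 g₀' g₁'‖ ≤ 2 / b * (e * a + a * e) := by gcongr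
      _ = 4 * a / b * e := by ring
  have k1 : ‖cross3 g₁ (unitize (cross3 g₀ g₁)) - cross3 g₁' (unitize (cross3 g₀' g₁'))‖ ≤
      e + 4 * a ^ 2 / b * e := by
    refine (norm_cross3_sub_le _ _ _ _).trans ?_
    calc _ ≤ e * 1 + a * (4 * a / b * e) := by gcongr
      _ = _ := by ring
  have k2 : ‖cross3 (unitize (cross3 g₀ g₁)) g₀ - cross3 (unitize (cross3 g₀' g₁')) g₀'‖ ≤
      e + 4 * a ^ 2 / b * e := by
    have : cross3 (unitize (cross3 g₀ g₁)) g₀ - cross3 (unitize (cross3 g₀' g₁')) g₀' =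
        cross3 (unitize (cross3 g₀ g₁)) (g₀ - g₀') +
          cross3 (unitize (cross3 g₀ g₁) - unitize (cross3 g₀' g₁')) g₀' := by
      rw [cross3_sub_left, cross3_sub_right]; abel
    rw [this]
    refine (norm_add_le _ _).trans ((add_le_add (norm_cross3_le _ _) (norm_cross3_le _ _)).trans ?_)
    calc _ ≤ 1 * e + (4 * a / b * e) * a := by gcongr
      _ = _ := by ring
  have : fluxVec g₀ g₁ d - fluxVec g₀' g₁' d =
      d 0 • (cross3 g₁ (unitize (cross3 g₀ g₁)) - cross3 g₁' (unitize (cross3 g₀' g₁'))) +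
      d 1 • (cross3 (unitize (cross3 g₀ g₁)) g₀ - cross3 (unitize (cross3 g₀' g₁')) g₀') := by
    simp only [fluxVec]; module
  rw [this, add_mul]
  refine (norm_add_le _ _).trans ?_
  rw [norm_smul, norm_smul, Real.norm_eq_abs, Real.norm_eq_abs]
  gcongr

/-! ### Polynomials on the reference triangle and Lagrange interpolation -/

lemma bary_sum (x : R2) : ∑ l, bary x l = 1 := by
  simp [bary, Fin.sum_univ_three]; ring

lemma continuous_bary (l : Fin 3) : Continuous fun x => bary x l := by
  fin_cases l <;> simp [bary] <;> fun_prop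

lemma mem_refTriangle {x : R2} : x ∈ refTriangle ↔ ∀ l, 0 ≤ bary x l := by
  simp only [refTriangle, mem_ofPred_eq, Fin.forall_fin_succ, bary]
  simp
  constructor
  · rintro ⟨h0, h1, h2⟩; exact ⟨by linarith, h0, h1⟩
  · rintro ⟨h0, h1, h2⟩; exact ⟨h1, h2, by linarith⟩

/-- Polynomial functions of degree at most `d` in two variables. -/
def polyDeg (d : ℕ) : Submodule ℝ (R2 → ℝ) :=
  Submodule.span ℝ {f | ∃ a b : ℕ, a + b ≤ d ∧ f = fun x => x 0 ^ a * x 1 ^ b}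

lemma monomial_mem_polyDeg {a b d : ℕ} (h : a + b ≤ d) :
    (fun x : R2 => x 0 ^ a * x 1 ^ b) ∈ polyDeg d :=
  Submodule.subset_span ⟨a, b, h, rfl⟩

lemma polyDeg_mono {d e : ℕ} (h : d ≤ e) : polyDeg d ≤ polyDeg e :=
  Submodule.span_mono fun _ ⟨a, b, hab, hf⟩ => ⟨a, b, hab.trans h, hf⟩

lemma const_mem_polyDeg (c : ℝ) (d : ℕ) : (fun _ : R2 => c) ∈ polyDeg d := by
  have := (polyDeg d).smul_mem c (monomial_mem_polyDeg (a := 0) (b := 0) (Nat.zero_le d))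
  convert this using 1
  funext x; simp

lemma coord_mem_polyDeg (a : Fin 2) : (fun x : R2 => x a) ∈ polyDeg 1 := by
  fin_cases a
  · simpa using monomial_mem_polyDeg (a := 1) (b := 0) (le_refl 1)
  · simpa using monomial_mem_polyDeg (a := 0) (b := 1) (le_refl 1)

lemma bary_mem_polyDeg (l : Fin 3) : (fun x => bary x l) ∈ polyDeg 1 := by
  fin_cases l
  · exact (polyDeg 1).sub_mem ((polyDeg 1).sub_mem (const_mem_polyDeg 1 1) (coord_mem_polyDeg 0))
      (coord_mem_polyDeg 1)
  · exact coord_mem_polyDeg 0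
  · exact coord_mem_polyDeg 1

lemma mul_mem_polyDeg {d e : ℕ} {f g : R2 → ℝ} (hf : f ∈ polyDeg d) (hg : g ∈ polyDeg e) :
    (fun x => f x * g x) ∈ polyDeg (d + e) := by
  have h : f * g ∈ polyDeg d * polyDeg e := Submodule.mul_mem_mul hf hg
  rw [polyDeg, polyDeg, Submodule.span_mul_span] at h
  refine Submodule.span_le.2 ?_ h
  rintro _ ⟨_, ⟨a, b, hab, rfl⟩, _, ⟨a', b', hab', rfl⟩, rfl⟩
  have := monomial_mem_polyDeg (a := a + a') (b := b + b') (d := d + e) (by omega)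
  refine (congrArg (· ∈ polyDeg (d + e)) ?_).mpr this
  funext x; simp; ring

lemma prod_range_mem_polyDeg {f : ℕ → R2 → ℝ} (hf : ∀ m, f m ∈ polyDeg 1) (n : ℕ) :
    (fun x => ∏ m ∈ Finset.range n, f m x) ∈ polyDeg n := by
  induction n with
  | zero => simpa using const_mem_polyDeg 1 0
  | succ n ih => simp only [Finset.prod_range_succ]; exact mul_mem_polyDeg ih (hf n)

lemma polyDeg_contDiff {d : ℕ} {f : R2 → ℝ} (hf : f ∈ polyDeg d) {n : WithTop ℕ∞} :
    ContDiff ℝ n f := by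
  refine Submodule.span_induction (p := fun f _ => ContDiff ℝ n f) ?_ ?_ ?_ ?_ hf
  · rintro _ ⟨a, b, -, rfl⟩; fun_prop
  · exact contDiff_const
  · intro f g _ _ h1 h2; exact h1.add h2
  · intro c f _ h; exact contDiff_const.smul h

lemma fderiv_mem_polyDeg {d : ℕ} {f : R2 → ℝ} (hf : f ∈ polyDeg d) (v : R2) :
    (fun x => fderiv ℝ f x v) ∈ polyDeg (d - 1) := by
  have hdiff : ∀ g ∈ polyDeg d, Differentiable ℝ g := fun g hg =>
    (polyDeg_contDiff (n := 1) hg).differentiable one_ne_zero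
  refine Submodule.span_induction (p := fun f _ => (fun x => fderiv ℝ f x v) ∈ polyDeg (d - 1))
    ?_ ?_ ?_ ?_ hf
  · rintro _ ⟨a, b, hab, rfl⟩
    have h : ∀ x : R2, fderiv ℝ (fun x : R2 => x 0 ^ a * x 1 ^ b) x v =
        (a * v 0) * (x 0 ^ (a - 1) * x 1 ^ b) + (b * v 1) * (x 0 ^ a * x 1 ^ (b - 1)) := by
      intro x
      have h0 : HasFDerivAt (fun x : R2 => x 0) (ContinuousLinearMap.proj (R := ℝ) 0 : R2 →L[ℝ] ℝ) x :=
        (ContinuousLinearMap.proj (R := ℝ) 0 : R2 →L[ℝ] ℝ).hasFDerivAt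
      have h1 : HasFDerivAt (fun x : R2 => x 1) (ContinuousLinearMap.proj (R := ℝ) 1 : R2 →L[ℝ] ℝ) x :=
        (ContinuousLinearMap.proj (R := ℝ) 1 : R2 →L[ℝ] ℝ).hasFDerivAt
      have h2 : HasFDerivAt (fun x : R2 => x 0 ^ a * x 1 ^ b) _ x := (h0.pow a).mul (h1.pow b)
      rw [h2.fderiv]
      simp; ring
    simp only [h]
    refine (polyDeg _).add_mem ?_ ?_
    -- For a = 0 the truncated exponent a - 1 is harmless because the coefficient vanishes.
    · rcases Nat.eq_zero_or_pos a with rfl | ha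
      · simpa using const_mem_polyDeg 0 _
      · exact (polyDeg _).smul_mem (a * v 0)
          (monomial_mem_polyDeg (a := a - 1) (b := b) (d := d - 1) (by omega))
    · rcases Nat.eq_zero_or_pos b with rfl | hb
      · simpa using const_mem_polyDeg 0 _
      · exact (polyDeg _).smul_mem (b * v 1)
          (monomial_mem_polyDeg (a := a) (b := b - 1) (d := d - 1) (by omega))
  · simpa using const_mem_polyDeg 0 _
  · intro f g hf hg h1 h2
    have : (fun x => fderiv ℝ (f + g) x v) = (fun x => fderiv ℝ f x v) + fun x => fderiv ℝ g x v := by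
      funext x; rw [fderiv_add (hdiff f hf x) (hdiff g hg x)]; rfl
    rw [this]; exact (polyDeg _).add_mem h1 h2
  · intro c f hf h
    have : (fun x => fderiv ℝ (c • f) x v) = c • fun x => fderiv ℝ f x v := by
      funext x; rw [fderiv_const_smul (hdiff f hf x)]; rfl
    rw [this]; exact (polyDeg _).smul_mem c h

lemma shape_mem_polyDeg {k : ℕ} (i : LatticeIndex k) : shape k i.1 ∈ polyDeg k := by
  have hi : i.1 0 + i.1 1 + i.1 2 = k := by
    have := Finset.Nat.mem_antidiagonalTuple.1 i.2; rwa [Fin.sum_univ_three] at this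
  have h : ∀ l : Fin 3, (fun x => ∏ m ∈ Finset.range (i.1 l),
      ((k : ℝ) * bary x l - m) / ((i.1 l : ℝ) - m)) ∈ polyDeg (i.1 l) := by
    intro l
    refine prod_range_mem_polyDeg (f := fun m x => ((k : ℝ) * bary x l - m) / ((i.1 l : ℝ) - m))
      (fun m => ?_) _
    have := (polyDeg 1).smul_mem (((i.1 l : ℝ) - m)⁻¹) ((polyDeg 1).sub_mem
      ((polyDeg 1).smul_mem (k : ℝ) (bary_mem_polyDeg l)) (const_mem_polyDeg m 1))
    convert this using 1
    funext x; simp; ring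
  have h2 := mul_mem_polyDeg (mul_mem_polyDeg (h 0) (h 1)) (h 2)
  rw [hi] at h2
  convert h2 using 1
  funext x; simp only [shape, Fin.prod_univ_three]

lemma contDiff_shape {k : ℕ} (i : LatticeIndex k) {n : WithTop ℕ∞} : ContDiff ℝ n (shape k i.1) :=
  polyDeg_contDiff (shape_mem_polyDeg i)

/-- The lattice point of the reference triangle with index `i`. -/
noncomputable def latPt {k : ℕ} (i : LatticeIndex k) : R2 := ![(i.1 1 : ℝ) / k, (i.1 2 : ℝ) / k]

lemma bary_latPt {k : ℕ} (hk : 1 ≤ k) (i : LatticeIndex k) (l : Fin 3) :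
    bary (latPt i) l = (i.1 l : ℝ) / k := by
  have hi : i.1 0 + i.1 1 + i.1 2 = k := by
    have := Finset.Nat.mem_antidiagonalTuple.1 i.2; rwa [Fin.sum_univ_three] at this
  have hi' : (i.1 0 : ℝ) + i.1 1 + i.1 2 = k := by exact_mod_cast hi
  have hk' : (k : ℝ) ≠ 0 := by positivity
  fin_cases l <;> simp [bary, latPt]
  field_simp; linarith

lemma latPt_mem {k : ℕ} (hk : 1 ≤ k) (i : LatticeIndex k) : latPt i ∈ refTriangle :=
  mem_refTriangle.2 fun l => by rw [bary_latPt hk]; positivity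

/-- Two distinct indices have the same sum, so some component of j is strictly smaller than that of
i; the factor with m equal to this component vanishes at the lattice point j. -/
lemma shape_latPt {k : ℕ} (hk : 1 ≤ k) (i j : LatticeIndex k) :
    shape k i.1 (latPt j) = if i = j then 1 else 0 := by
  have hk' : (k : ℝ) ≠ 0 := by positivity
  have hsum : ∀ i : LatticeIndex k, ∑ l, i.1 l = k := fun i =>
    Finset.Nat.mem_antidiagonalTuple.1 i.2
  have hb : ∀ l, (k : ℝ) * bary (latPt j) l = j.1 l := fun l => by
    rw [bary_latPt hk]; field_simp
  simp only [shape, hb]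
  split_ifs with h
  · subst h
    refine Finset.prod_eq_one fun l _ => Finset.prod_eq_one fun m hm => div_self ?_
    have : (m : ℝ) < i.1 l := by exact_mod_cast Finset.mem_range.1 hm
    linarith
  · obtain ⟨l, hl⟩ : ∃ l, j.1 l < i.1 l := by
      by_contra! hcon
      refine h (Subtype.ext (funext fun l => ?_))
      have := (Finset.sum_eq_sum_iff_of_le fun l _ => hcon l).1 ((hsum i).trans (hsum j).symm)
      exact this l (Finset.mem_univ l)
    refine Finset.prod_eq_zero (Finset.mem_univ l)
      (Finset.prod_eq_zero (Finset.mem_range.2 hl) ?_)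
    simp

/-- The factor m = 0 is a multiple of the vanishing barycentric coordinate. This is the source of
continuity across elements: nodes off a face do not contribute on it. -/
lemma shape_eq_zero {k : ℕ} (i : LatticeIndex k) {x : R2} {l : Fin 3} (hx : bary x l = 0)
    (hi : i.1 l ≠ 0) : shape k i.1 x = 0 :=
  Finset.prod_eq_zero (Finset.mem_univ l)
    (Finset.prod_eq_zero (Finset.mem_range.2 (Nat.pos_of_ne_zero hi)) (by simp [hx]))

/-- Unnormalized Lagrange shape functions for the lattice of order `k`. -/
noncomputable def preShape (k : ℕ) (j : Fin 3 → ℕ) (x : R2) : ℝ :=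
  ∏ l : Fin 3, ∏ m ∈ Finset.range (j l), ((k : ℝ) * bary x l - m)

lemma preShape_update (k : ℕ) (j : Fin 3 → ℕ) (l : Fin 3) (x : R2) :
    preShape k (j + Pi.single l 1) x = preShape k j x * ((k : ℝ) * bary x l - j l) := by
  fin_cases l <;> simp [preShape, Fin.prod_univ_three, Finset.prod_range_succ] <;> ring

/-- The span of the unnormalized shape functions with indices of weight `d`. -/
noncomputable def preSpan (k d : ℕ) : Submodule ℝ (R2 → ℝ) :=
  Submodule.span ℝ {f | ∃ j : Fin 3 → ℕ, ∑ l, j l = d ∧ f = preShape k j}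

lemma preShape_succ_mem (k : ℕ) (j : Fin 3 → ℕ) (l : Fin 3) :
    preShape k (j + Pi.single l 1) ∈ preSpan k (∑ l, j l + 1) :=
  Submodule.subset_span ⟨_, by simp [Finset.sum_add_distrib], rfl⟩

/-- The three factors k λ_l - j_l add up to k - d, which is nonzero for d < k. Summing the updates
of j in the three directions therefore recovers a nonzero multiple of the product with index j. -/
lemma preSpan_le_succ {k d : ℕ} (hd : d < k) : preSpan k d ≤ preSpan k (d + 1) := by
  refine Submodule.span_le.2 ?_
  rintro _ ⟨j, rfl, rfl⟩
  have hne : (k : ℝ) - (∑ l, j l : ℕ) ≠ 0 := by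
    have : ((∑ l, j l : ℕ) : ℝ) < k := by exact_mod_cast hd
    linarith
  have h : preShape k j = ((k : ℝ) - (∑ l, j l : ℕ))⁻¹ •
      ∑ l, preShape k (j + Pi.single l 1) := by
    rw [eq_inv_smul_iff₀ hne]
    funext x
    have hs := bary_sum x
    simp only [Pi.smul_apply, Finset.sum_apply, preShape_update, ← Finset.mul_sum,
      Finset.sum_sub_distrib, hs, mul_one, smul_eq_mul]
    push_cast; ring
  rw [h]
  exact Submodule.smul_mem _ _ (Submodule.sum_mem _ fun l _ => preShape_succ_mem k j l)

/-- Multiplication by k λ_l equals the update in direction l plus j_l times the original product.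
Together with the inclusion of spans this gives all monomials by induction, without a dimension
count. -/
lemma bary_mul_mem_preSpan {k d : ℕ} (hd : d < k) (l : Fin 3) {f : R2 → ℝ}
    (hf : f ∈ preSpan k d) : (fun x => bary x l * f x) ∈ preSpan k (d + 1) := by
  have hk : (k : ℝ) ≠ 0 := by have : 0 < k := by omega
                              positivity
  refine Submodule.span_induction (p := fun f _ => (fun x => bary x l * f x) ∈ preSpan k (d + 1))
    ?_ ?_ ?_ ?_ hf
  · rintro _ ⟨j, rfl, rfl⟩
    have h : (fun x => bary x l * preShape k j x) = (k : ℝ)⁻¹ •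
        (preShape k (j + Pi.single l 1) + (j l : ℝ) • preShape k j) := by
      rw [eq_inv_smul_iff₀ hk]
      funext x
      simp only [Pi.smul_apply, Pi.add_apply, preShape_update, smul_eq_mul]; ring
    rw [h]
    exact Submodule.smul_mem _ _ (Submodule.add_mem _ (preShape_succ_mem k j l)
      (Submodule.smul_mem _ _ (preSpan_le_succ hd (Submodule.subset_span ⟨j, rfl, rfl⟩))))
  · simp only [Pi.zero_apply, mul_zero]
    exact (preSpan k (d + 1)).zero_mem
  · intro f g _ _ h1 h2
    simp only [Pi.add_apply, mul_add]
    exact Submodule.add_mem _ h1 h2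
  · intro c f _ h
    simp only [Pi.smul_apply, smul_eq_mul, mul_left_comm _ c]
    exact Submodule.smul_mem _ c h

lemma monomial_mem_preSpan {k a b : ℕ} (h : a + b ≤ k) :
    (fun x : R2 => x 0 ^ a * x 1 ^ b) ∈ preSpan k (a + b) := by
  induction a with
  | zero =>
    induction b with
    | zero => exact Submodule.subset_span ⟨0, by simp, by funext x; simp [preShape]⟩
    | succ b ih =>
      have := bary_mul_mem_preSpan (by omega) 2 (ih (by omega))
      rw [show 0 + (b + 1) = 0 + b + 1 by ring]
      convert this using 1
      funext x; simp [bary]; ring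
  | succ a ih =>
    have := bary_mul_mem_preSpan (by omega) 1 (ih (by omega))
    rw [show a + 1 + b = a + b + 1 by ring]
    convert this using 1
    funext x; simp [bary]; ring

lemma preSpan_mono {k d e : ℕ} (hde : d ≤ e) (he : e ≤ k) : preSpan k d ≤ preSpan k e := by
  induction e, hde using Nat.le_induction with
  | base => exact le_rfl
  | succ e _ ih => exact (ih (by omega)).trans (preSpan_le_succ (by omega))

lemma preShape_eq_smul_shape (k : ℕ) (j : Fin 3 → ℕ) :
    preShape k j = (∏ l : Fin 3, ∏ m ∈ Finset.range (j l), ((j l : ℝ) - m)) • shape k j := by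
  funext x
  simp only [preShape, shape, Pi.smul_apply, smul_eq_mul, ← Finset.prod_mul_distrib]
  refine Finset.prod_congr rfl fun l _ => Finset.prod_congr rfl fun m hm => ?_
  have : (m : ℝ) < j l := by exact_mod_cast Finset.mem_range.1 hm
  rw [mul_div_cancel₀ _ (by linarith)]

/-- Lagrange interpolation of degree `k` is exact for polynomials of degree at most `k`. -/
lemma interpolation_exact {k : ℕ} (hk : 1 ≤ k) {f : R2 → ℝ} (hf : f ∈ polyDeg k) (x : R2) :
    ∑ i : LatticeIndex k, shape k i.1 x * f (latPt i) = f x := by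
  -- After this inclusion exactness has to be checked only on multiples of shape functions, where it
  -- is the nodal property.
  have h1 : polyDeg k ≤ preSpan k k := by
    refine Submodule.span_le.2 ?_
    rintro _ ⟨a, b, hab, rfl⟩
    exact preSpan_mono hab le_rfl (monomial_mem_preSpan hab)
  refine Submodule.span_induction
    (p := fun f _ => ∑ i : LatticeIndex k, shape k i.1 x * f (latPt i) = f x) ?_ ?_ ?_ ?_ (h1 hf)
  · rintro _ ⟨j, hj, rfl⟩
    set i : LatticeIndex k := ⟨j, Finset.Nat.mem_antidiagonalTuple.2 hj⟩
    rw [preShape_eq_smul_shape]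
    simp only [Pi.smul_apply, smul_eq_mul]
    change ∑ i' : LatticeIndex k, shape k i'.1 x * (_ * shape k i.1 (latPt i')) = _ * shape k i.1 x
    simp only [shape_latPt hk]
    simp [mul_comm]
  · simp
  · intro f g _ _ h1 h2
    simp only [Pi.add_apply, mul_add, Finset.sum_add_distrib, h1, h2]
  · intro c f _ h
    simp only [Pi.smul_apply, smul_eq_mul, mul_left_comm _ c, ← Finset.mul_sum, h]

lemma shape_sum {k : ℕ} (hk : 1 ≤ k) (x : R2) : ∑ i : LatticeIndex k, shape k i.1 x = 1 := by
  simpa using interpolation_exact hk (const_mem_polyDeg 1 k) x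

/-! ### Finite-dimensional norm equivalences on the reference triangle -/

lemma isCompact_refTriangle : IsCompact refTriangle := by
  have h1 : IsClosed refTriangle := by
    have : refTriangle = ⋂ l, {x | 0 ≤ bary x l} := by ext x; simp [mem_refTriangle]
    rw [this]
    exact isClosed_iInter fun l => isClosed_le continuous_const (continuous_bary l)
  refine (isCompact_Icc (a := (0 : R2)) (b := 1)).of_isClosed_subset h1 ?_
  rintro x ⟨h0, h1, h2⟩
  refine ⟨fun i => ?_, fun i => ?_⟩ <;> fin_cases i <;> simp <;> linarith

lemma bary_combo (x y : R2) {a b : ℝ} (hab : a + b = 1) (l : Fin 3) :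
    bary (a • x + b • y) l = a * bary x l + b * bary y l := by
  obtain rfl : b = 1 - a := by linarith
  fin_cases l <;> simp [bary]; ring

lemma convex_refTriangle : Convex ℝ refTriangle := by
  intro x hx y hy a b ha hb hab
  rw [mem_refTriangle] at *
  intro l
  rw [bary_combo x y hab]
  have := hx l; have := hy l; positivity

lemma subset_interior_refTriangle : {x | ∀ l, 0 < bary x l} ⊆ interior refTriangle := by
  refine interior_maximal (fun x hx => mem_refTriangle.2 fun l => (hx l).le) ?_
  have : {x : R2 | ∀ l, 0 < bary x l} = ⋂ l, {x | 0 < bary x l} := by ext x; simp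
  rw [this]
  exact isOpen_iInter_of_finite fun l => isOpen_lt continuous_const (continuous_bary l)

lemma interior_refTriangle_nonempty : (interior refTriangle).Nonempty := by
  refine ⟨![1 / 3, 1 / 3], subset_interior_refTriangle fun l => ?_⟩
  fin_cases l <;> simp [bary]; norm_num

lemma refTriangle_subset_closure_pos : refTriangle ⊆ closure {x | ∀ l, 0 < bary x l} := by
  intro x hx
  set c : R2 := ![1 / 3, 1 / 3] with hc
  have hcb : ∀ l, bary c l = 1 / 3 := by
    intro l; fin_cases l <;> simp [bary, hc]; norm_num
  have hlim : Filter.Tendsto (fun s : ℝ => (1 - s) • x + s • c) (𝓝[>] 0) (𝓝 x) := by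
    have : Continuous fun s : ℝ => (1 - s) • x + s • c := by fun_prop
    have h := (this.tendsto 0).mono_left (nhdsWithin_le_nhds (s := Ioi 0))
    simpa using h
  refine mem_closure_of_tendsto hlim ?_
  filter_upwards [Ioo_mem_nhdsGT (zero_lt_one' ℝ)] with s hs
  intro l
  rw [bary_combo x c (by ring), hcb]
  have := mem_refTriangle.1 hx l
  have h1 : 0 < 1 - s := by linarith [hs.2]
  have h2 := hs.1
  positivity

lemma refTriangle_subset_closure_interior : refTriangle ⊆ closure (interior refTriangle) :=
  refTriangle_subset_closure_pos.trans (closure_mono subset_interior_refTriangle)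

lemma measurableSet_refTriangle : MeasurableSet refTriangle :=
  isCompact_refTriangle.measurableSet

lemma volume_refTriangle_lt_top : volume refTriangle < ⊤ := isCompact_refTriangle.measure_lt_top

lemma volume_real_refTriangle_pos : 0 < volume.real refTriangle := by
  refine ENNReal.toReal_pos ?_ volume_refTriangle_lt_top.ne
  exact (Measure.measure_pos_of_nonempty_interior _ interior_refTriangle_nonempty).ne'

lemma integrableOn_refTriangle {E : Type*} [NormedAddCommGroup E] {f : R2 → E}
    (hf : ContinuousOn f refTriangle) : IntegrableOn f refTriangle :=
  hf.integrableOn_compact isCompact_refTriangle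

/-- A vanishing integral gives zero almost everywhere; the triangle is contained in the closure of
its interior, so continuity gives zero at every point, including the boundary nodes. -/
lemma eq_zero_of_integral_refTriangle {f : R2 → ℝ} (hf : ContinuousOn f refTriangle)
    (h0 : ∀ x ∈ refTriangle, 0 ≤ f x) (hi : ∫ x in refTriangle, f x = 0) :
    ∀ x ∈ refTriangle, f x = 0 := by
  have h1 : f =ᵐ[volume.restrict refTriangle] 0 := by
    rwa [setIntegral_eq_zero_iff_of_nonneg_ae
      ((ae_restrict_iff' measurableSet_refTriangle).2 (Filter.Eventually.of_forall h0))
      (integrableOn_refTriangle hf)] at hi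
  exact Measure.eqOn_of_ae_eq h1 hf continuousOn_const refTriangle_subset_closure_interior

lemma norm_integral_refTriangle_le {E : Type*} [NormedAddCommGroup E] [NormedSpace ℝ E]
    {f : R2 → E} {C : ℝ}
    (h : ∀ x ∈ refTriangle, ‖f x‖ ≤ C) :
    ‖∫ x in refTriangle, f x‖ ≤ C * volume.real refTriangle :=
  norm_setIntegral_le_of_norm_le_const volume_refTriangle_lt_top h

/-- Minimize over the compact unit sphere and rescale; homogeneity of degree two is all that is
used, no bilinear structure. -/
lemma exists_quadratic_lower_bound {V : Type*} [NormedAddCommGroup V] [NormedSpace ℝ V]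
    [FiniteDimensional ℝ V] {Q : V → ℝ} (hQ : Continuous Q)
    (hs : ∀ (a : ℝ) v, Q (a • v) = a ^ 2 * Q v) (hp : ∀ v, v ≠ 0 → 0 < Q v) :
    ∃ c > 0, ∀ v, c * ‖v‖ ^ 2 ≤ Q v := by
  have : ProperSpace V := FiniteDimensional.proper ℝ V
  have hQ0 : Q 0 = 0 := by simpa using hs 0 0
  rcases (Metric.sphere (0 : V) 1).eq_empty_or_nonempty with he | hne
  · refine ⟨1, one_pos, fun v => ?_⟩
    rcases eq_or_ne v 0 with rfl | hv
    · simp [hQ0]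
    · exfalso
      have : ‖v‖⁻¹ • v ∈ Metric.sphere (0 : V) 1 := by simp [norm_smul, hv]
      rw [he] at this; exact this
  obtain ⟨v₀, hv₀, hmin⟩ := (isCompact_sphere (0 : V) 1).exists_isMinOn hne hQ.continuousOn
  have hv₀' : v₀ ≠ 0 := by rintro rfl; simp at hv₀
  refine ⟨Q v₀, hp v₀ hv₀', fun v => ?_⟩
  rcases eq_or_ne v 0 with rfl | hv
  · simp [hQ0]
  · have h1 : Q v₀ ≤ Q (‖v‖⁻¹ • v) := hmin (by simp [norm_smul, hv])
    rw [hs] at h1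
    have hn : 0 < ‖v‖ := norm_pos_iff.2 hv
    calc Q v₀ * ‖v‖ ^ 2 ≤ ((‖v‖⁻¹) ^ 2 * Q v) * ‖v‖ ^ 2 := by gcongr
      _ = Q v := by field_simp

section LocalFunctions

variable {E : Type*} [NormedAddCommGroup E]

/-- Euclidean norm of a vector of nodal values. -/
noncomputable def dofNorm {k : ℕ} (z : LatticeIndex k → E) : ℝ := √(∑ i, ‖z i‖ ^ 2)

/-- The lattice index of the vertex `l`. -/
def vtxIdx (k : ℕ) (l : Fin 3) : LatticeIndex k :=
  ⟨Pi.single l k, Finset.Nat.mem_antidiagonalTuple.2 (by simp)⟩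

/-- Oscillation of a vector of nodal values. -/
noncomputable def oscNorm {k : ℕ} (z : LatticeIndex k → E) : ℝ :=
  dofNorm fun i => z i - z (vtxIdx k 0)

/-- The vertices of the reference triangle. -/
noncomputable def refVtx : Fin 3 → R2 := ![![0, 0], ![1, 0], ![0, 1]]

lemma dofNorm_nonneg {k : ℕ} (z : LatticeIndex k → E) : 0 ≤ dofNorm z := Real.sqrt_nonneg _

lemma oscNorm_nonneg {k : ℕ} (z : LatticeIndex k → E) : 0 ≤ oscNorm z := Real.sqrt_nonneg _

lemma dofNorm_sq {k : ℕ} (z : LatticeIndex k → E) : dofNorm z ^ 2 = ∑ i, ‖z i‖ ^ 2 :=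
  Real.sq_sqrt (by positivity)

lemma norm_le_dofNorm {k : ℕ} (z : LatticeIndex k → E) (i : LatticeIndex k) :
    ‖z i‖ ≤ dofNorm z :=
  Real.le_sqrt_of_sq_le (Finset.single_le_sum (f := fun i => ‖z i‖ ^ 2)
    (fun _ _ => by positivity) (Finset.mem_univ i))

lemma norm_sub_le_oscNorm {k : ℕ} (z : LatticeIndex k → E) (i : LatticeIndex k) :
    ‖z i - z (vtxIdx k 0)‖ ≤ oscNorm z :=
  norm_le_dofNorm (fun i => z i - z (vtxIdx k 0)) i

lemma dofNorm_le {k : ℕ} {z : LatticeIndex k → E} {B : ℝ} (hB : 0 ≤ B) (h : ∀ i, ‖z i‖ ≤ B) :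
    dofNorm z ≤ √(Fintype.card (LatticeIndex k)) * B := by
  rw [dofNorm, ← Real.sqrt_sq hB, ← Real.sqrt_mul (by positivity)]
  refine Real.sqrt_le_sqrt ((Finset.sum_le_card_nsmul _ _ (B ^ 2) fun i _ => ?_).trans (by simp))
  exact pow_le_pow_left₀ (norm_nonneg _) (h i) 2

variable [NormedSpace ℝ E]

/-- The polynomial of degree `k` on the reference triangle with nodal values `z`. -/
noncomputable def locFun {k : ℕ} (z : LatticeIndex k → E) (x : R2) : E :=
  ∑ i, shape k i.1 x • z i

lemma contDiff_locFun {k : ℕ} (z : LatticeIndex k → E) {n : WithTop ℕ∞} :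
    ContDiff ℝ n (locFun z) :=
  ContDiff.sum fun i _ => (contDiff_shape i).smul contDiff_const

lemma continuous_locFun {k : ℕ} (z : LatticeIndex k → E) : Continuous (locFun z) :=
  (contDiff_locFun z (n := 0)).continuous

lemma differentiable_locFun {k : ℕ} (z : LatticeIndex k → E) : Differentiable ℝ (locFun z) :=
  (contDiff_locFun z (n := 1)).differentiable one_ne_zero

lemma fderiv_locFun {k : ℕ} (z : LatticeIndex k → E) (x v : R2) :
    fderiv ℝ (locFun z) x v = ∑ i, fderiv ℝ (shape k i.1) x v • z i := by
  have h : HasFDerivAt (locFun z) (∑ i, (fderiv ℝ (shape k i.1) x).smulRight (z i)) x := by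
    refine HasFDerivAt.fun_sum fun i _ => ?_
    exact (((contDiff_shape i (n := 1)).differentiable one_ne_zero x).hasFDerivAt).smul_const (z i)
  rw [h.fderiv]; simp

lemma continuous_fderiv_locFun {k : ℕ} (z : LatticeIndex k → E) (v : R2) :
    Continuous fun x => fderiv ℝ (locFun z) x v :=
  ((contDiff_locFun z (n := 1)).continuous_fderiv one_ne_zero).clm_apply continuous_const

lemma locFun_add {k : ℕ} (z w : LatticeIndex k → E) (x : R2) :
    locFun (fun i => z i + w i) x = locFun z x + locFun w x := by
  simp [locFun, Finset.sum_add_distrib]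

lemma locFun_sub {k : ℕ} (z w : LatticeIndex k → E) (x : R2) :
    locFun (fun i => z i - w i) x = locFun z x - locFun w x := by
  simp [locFun, smul_sub]

lemma locFun_smul {k : ℕ} (a : ℝ) (z : LatticeIndex k → E) (x : R2) :
    locFun (fun i => a • z i) x = a • locFun z x := by
  simp [locFun, Finset.smul_sum, smul_comm a]

lemma locFun_const {k : ℕ} (hk : 1 ≤ k) (c : E) (x : R2) :
    locFun (fun _ : LatticeIndex k => c) x = c := by
  rw [locFun, ← Finset.sum_smul, shape_sum hk, one_smul]

lemma locFun_latPt {k : ℕ} (hk : 1 ≤ k) (z : LatticeIndex k → E) (j : LatticeIndex k) :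
    locFun z (latPt j) = z j := by
  simp [locFun, shape_latPt hk, ite_smul]

lemma fderiv_locFun_sub_const {k : ℕ} (hk : 1 ≤ k) (z : LatticeIndex k → E) (c : E) (x : R2) :
    fderiv ℝ (locFun fun i => z i - c) x = fderiv ℝ (locFun z) x := by
  have : (locFun fun i => z i - c) = fun x => locFun z x - c := by
    funext x; rw [locFun_sub z (fun _ => c), locFun_const hk]
  rw [this, fderiv_sub_const]

lemma locFun_mem_polyDeg {k : ℕ} (z : LatticeIndex k → ℝ) : locFun z ∈ polyDeg k := by
  have : locFun z = ∑ i, z i • shape k i.1 := by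
    funext x; simp [locFun, mul_comm]
  rw [this]
  exact Submodule.sum_mem _ fun i _ => Submodule.smul_mem _ _ (shape_mem_polyDeg i)

variable (E) in
lemma exists_locFun_bound (k : ℕ) : ∃ C > 0, ∀ z : LatticeIndex k → E, ∀ x ∈ refTriangle,
    ‖locFun z x‖ ≤ C * dofNorm z := by
  have h1 : ∀ i : LatticeIndex k, ∃ C, ∀ x ∈ refTriangle, ‖shape k i.1 x‖ ≤ C := fun i =>
    isCompact_refTriangle.exists_bound_of_continuousOn
      (contDiff_shape i (n := 0)).continuous.continuousOn
  choose C hC using h1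
  refine ⟨∑ i, |C i| + 1, by positivity, fun z x hx => ?_⟩
  refine (norm_sum_le _ _).trans ?_
  rw [add_mul, Finset.sum_mul]
  refine (Finset.sum_le_sum fun i _ => ?_).trans
    (le_add_of_nonneg_right (by have := dofNorm_nonneg z; positivity))
  rw [norm_smul]
  exact mul_le_mul ((hC i x hx).trans (le_abs_self _)) (norm_le_dofNorm z i) (norm_nonneg _)
    (abs_nonneg _)

variable (E) in
-- The derivative does not see constants, so the value at the vertex 0 may be subtracted before
-- estimating; this is why the oscillation, and not the full norm, bounds it.
lemma exists_fderiv_locFun_bound {k : ℕ} (hk : 1 ≤ k) :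
    ∃ C > 0, ∀ z : LatticeIndex k → E, ∀ x ∈ refTriangle,
      ‖fderiv ℝ (locFun z) x‖ ≤ C * oscNorm z := by
  have h1 : ∀ i : LatticeIndex k, ∃ C, ∀ x ∈ refTriangle, ‖fderiv ℝ (shape k i.1) x‖ ≤ C :=
    fun i => isCompact_refTriangle.exists_bound_of_continuousOn
      ((contDiff_shape i (n := 1)).continuous_fderiv one_ne_zero).continuousOn
  choose C hC using h1
  refine ⟨∑ i, |C i| + 1, by positivity, fun z x hx => ?_⟩
  have hosc := oscNorm_nonneg z
  refine ContinuousLinearMap.opNorm_le_bound _ (by positivity) fun v => ?_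
  rw [← fderiv_locFun_sub_const hk z (z (vtxIdx k 0)), fderiv_locFun]
  refine (norm_sum_le _ _).trans ?_
  rw [add_mul, add_mul, Finset.sum_mul, Finset.sum_mul]
  refine (Finset.sum_le_sum fun i _ => ?_).trans (le_add_of_nonneg_right (by positivity))
  rw [norm_smul, mul_right_comm]
  refine mul_le_mul ?_ (norm_sub_le_oscNorm z i) (norm_nonneg _) (by positivity)
  refine (ContinuousLinearMap.le_opNorm _ _).trans ?_
  gcongr
  exact (hC i x hx).trans (le_abs_self _)

end LocalFunctions

lemma dofNorm_sq_le_card {k : ℕ} (z : LatticeIndex k → ℝ) :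
    dofNorm z ^ 2 ≤ Fintype.card (LatticeIndex k) * ‖z‖ ^ 2 := by
  rw [dofNorm_sq]
  refine (Finset.sum_le_card_nsmul _ _ (‖z‖ ^ 2) fun i _ => ?_).trans (by simp)
  exact pow_le_pow_left₀ (norm_nonneg _) (norm_le_pi_norm z i) 2

lemma continuous_uncurry_locFun (k : ℕ) :
    Continuous fun p : (LatticeIndex k → ℝ) × R2 => locFun p.1 p.2 := by
  refine continuous_finsetSum _ fun i _ => ?_
  exact ((contDiff_shape i (n := 0)).continuous.comp continuous_snd).smul
    ((continuous_apply i).comp continuous_fst)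

lemma continuous_uncurry_fderiv_locFun (k : ℕ) (v : R2) :
    Continuous fun p : (LatticeIndex k → ℝ) × R2 => fderiv ℝ (locFun p.1) p.2 v := by
  simp only [fderiv_locFun]
  refine continuous_finsetSum _ fun i _ => ?_
  exact (((((contDiff_shape i (n := 1)).continuous_fderiv one_ne_zero).clm_apply
    continuous_const).comp continuous_snd)).smul ((continuous_apply i).comp continuous_fst)

/-- On polynomials of degree `k`, the `L²` norm controls the nodal values. -/
lemma exists_dofNorm_le_integral {k : ℕ} (hk : 1 ≤ k) : ∃ c > 0, ∀ z : LatticeIndex k → ℝ,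
    c * dofNorm z ^ 2 ≤ ∫ x in refTriangle, locFun z x ^ 2 := by
  have hQc : Continuous fun z : LatticeIndex k → ℝ => ∫ x in refTriangle, locFun z x ^ 2 :=
    continuous_parametric_integral_of_continuous
      (f := fun (z : LatticeIndex k → ℝ) x => locFun z x ^ 2)
      ((continuous_pow 2).comp (continuous_uncurry_locFun k)) isCompact_refTriangle
  obtain ⟨c, hc, h⟩ := exists_quadratic_lower_bound hQc (fun a z => by
      rw [← integral_const_mul]
      congr 1; funext x
      rw [show a • z = fun i => a • z i from rfl, locFun_smul, smul_eq_mul, mul_pow]) (fun z hz => by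
      refine lt_of_le_of_ne (integral_nonneg fun x => by positivity) fun h0 => hz ?_
      have := eq_zero_of_integral_refTriangle ((continuous_locFun z).pow 2).continuousOn
        (fun x _ => sq_nonneg _) h0.symm
      funext j
      have h2 := this _ (latPt_mem hk j)
      rw [Pi.pow_apply, locFun_latPt hk] at h2
      simpa using h2)
  have hcard : 0 < (Fintype.card (LatticeIndex k) : ℝ) := by
    have : Nonempty (LatticeIndex k) := ⟨vtxIdx k 0⟩
    exact_mod_cast Fintype.card_pos
  -- The form bounds the sup norm of the nodal values; passing to the Euclidean norm costs the
  -- number of nodes.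
  refine ⟨c / Fintype.card (LatticeIndex k), by positivity, fun z => le_trans ?_ (h z)⟩
  rw [div_mul_eq_mul_div, div_le_iff₀ hcard]
  nlinarith [dofNorm_sq_le_card z]

/-- The sum over ordered pairs of vertices of the squared edge derivatives, weighted by edge
bubbles. -/
noncomputable def edgeForm (q : R2 → ℝ) (x : R2) : ℝ :=
  ∑ l, ∑ m, bary x l * bary x m * fderiv ℝ q x (refVtx m - refVtx l) ^ 2

lemma continuous_edgeForm {k : ℕ} (z : LatticeIndex k → ℝ) :
    Continuous (edgeForm (locFun z)) := by
  refine continuous_finsetSum _ fun l _ => continuous_finsetSum _ fun m _ => ?_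
  exact ((continuous_bary l).mul (continuous_bary m)).mul ((continuous_fderiv_locFun z _).pow 2)

lemma edgeForm_nonneg (q : R2 → ℝ) {x : R2} (hx : x ∈ refTriangle) : 0 ≤ edgeForm q x := by
  rw [mem_refTriangle] at hx
  exact Finset.sum_nonneg fun l _ => Finset.sum_nonneg fun m _ => by
    have := hx l; have := hx m; positivity

/-- At interior points all bubble weights are positive, so the derivatives along two independent
edges vanish there; continuity extends this to the closed triangle, which is convex. -/
lemma locFun_const_of_edgeForm {k : ℕ} (z : LatticeIndex k → ℝ)
    (h : ∀ x ∈ refTriangle, edgeForm (locFun z) x = 0) :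
    ∀ x ∈ refTriangle, ∀ y ∈ refTriangle, locFun z x = locFun z y := by
  have h1 : ∀ x, (∀ l, 0 < bary x l) → fderiv ℝ (locFun z) x = 0 := by
    intro x hx
    have hx' : x ∈ refTriangle := mem_refTriangle.2 fun l => (hx l).le
    have h2 := h x hx'
    have key : ∀ m, fderiv ℝ (locFun z) x (refVtx m - refVtx 0) = 0 := by
      intro m
      have h3 := (Finset.sum_eq_zero_iff_of_nonneg (fun l _ => Finset.sum_nonneg fun m _ => by
        have := (hx l).le; have := (hx m).le; positivity)).1 h2 0 (Finset.mem_univ _)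
      have h4 := (Finset.sum_eq_zero_iff_of_nonneg (fun m _ => by
        have := (hx 0).le; have := (hx m).le; positivity)).1 h3 m (Finset.mem_univ _)
      have := (hx 0).ne'; have := (hx m).ne'
      simpa [*] using h4
    ext v
    have hv : v = v 0 • (refVtx 1 - refVtx 0) + v 1 • (refVtx 2 - refVtx 0) := by
      funext a; fin_cases a <;> simp [refVtx]
    rw [hv, map_add, map_smul, map_smul, key, key]; simp
  have h2 : ∀ x ∈ refTriangle, fderiv ℝ (locFun z) x = 0 := by
    intro x hx
    have hclosed : IsClosed {x | fderiv ℝ (locFun z) x = 0} :=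
      isClosed_eq ((contDiff_locFun z (n := 1)).continuous_fderiv one_ne_zero) continuous_const
    exact closure_minimal (fun x hx => h1 x hx) hclosed (refTriangle_subset_closure_pos hx)
  intro x hx y hy
  have := convex_refTriangle.norm_image_sub_le_of_norm_fderiv_le (𝕜 := ℝ) (f := locFun z)
    (fun x _ => differentiable_locFun z x) (C := 0) (fun x hx => by rw [h2 x hx, norm_zero]) hx hy
  rw [zero_mul, norm_le_zero_iff, sub_eq_zero] at this
  exact this.symm

/-- On polynomials of degree `k`, the weighted edge derivatives control the oscillation. -/
lemma exists_oscNorm_le_integral {k : ℕ} (hk : 1 ≤ k) : ∃ c > 0, ∀ z : LatticeIndex k → ℝ,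
    c * oscNorm z ^ 2 ≤ ∫ x in refTriangle, edgeForm (locFun z) x := by
  set i₀ := vtxIdx k 0
  -- The edge form alone vanishes on constants. Adding the square of one nodal value makes it
  -- definite; the extra term disappears again when the form is applied to z - z i₀.
  have hQc : Continuous fun z : LatticeIndex k → ℝ =>
      (∫ x in refTriangle, edgeForm (locFun z) x) + z i₀ ^ 2 := by
    have hc : Continuous fun z : LatticeIndex k → ℝ => z i₀ ^ 2 := by fun_prop
    refine Continuous.add (continuous_parametric_integral_of_continuous (μ := volume)
      (f := fun (z : LatticeIndex k → ℝ) x => edgeForm (locFun z) x) ?_ isCompact_refTriangle) hc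
    change Continuous fun p : (LatticeIndex k → ℝ) × R2 => ∑ l, ∑ m,
      bary p.2 l * bary p.2 m * fderiv ℝ (locFun p.1) p.2 (refVtx m - refVtx l) ^ 2
    refine continuous_finsetSum _ fun l _ => continuous_finsetSum _ fun m _ => ?_
    exact (((continuous_bary l).comp continuous_snd).mul
      ((continuous_bary m).comp continuous_snd)).mul
        ((continuous_pow 2).comp (continuous_uncurry_fderiv_locFun k _))
  obtain ⟨c, hc, h⟩ := exists_quadratic_lower_bound hQc (fun a z => by
      rw [mul_add, ← integral_const_mul, Pi.smul_apply, smul_eq_mul, mul_pow]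
      congr 2; funext x
      have hf : ∀ v, fderiv ℝ (locFun (a • z)) x v = a * fderiv ℝ (locFun z) x v := by
        intro v; simp [fderiv_locFun, Finset.mul_sum, mul_left_comm]
      simp only [edgeForm, Finset.mul_sum, hf]
      refine Finset.sum_congr rfl fun l _ => Finset.sum_congr rfl fun m _ => by ring) (fun z hz => by
      have hnn : 0 ≤ ∫ x in refTriangle, edgeForm (locFun z) x :=
        setIntegral_nonneg measurableSet_refTriangle fun x hx => edgeForm_nonneg _ hx
      refine lt_of_le_of_ne (by positivity) fun h0 => hz ?_
      have h1 : ∫ x in refTriangle, edgeForm (locFun z) x = 0 := by nlinarith [sq_nonneg (z i₀)]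
      have h2 : z i₀ = 0 := by
        have : z i₀ ^ 2 = 0 := by nlinarith [sq_nonneg (z i₀)]
        simpa using this
      have h3 := eq_zero_of_integral_refTriangle (continuous_edgeForm z).continuousOn
        (fun x hx => edgeForm_nonneg _ hx) h1
      funext j
      have h4 := locFun_const_of_edgeForm z h3 _ (latPt_mem hk j) _ (latPt_mem hk i₀)
      rw [locFun_latPt hk, locFun_latPt hk, h2] at h4
      exact h4)
  have hcard : 0 < (Fintype.card (LatticeIndex k) : ℝ) := by
    have : Nonempty (LatticeIndex k) := ⟨vtxIdx k 0⟩
    exact_mod_cast Fintype.card_pos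
  refine ⟨c / Fintype.card (LatticeIndex k), by positivity, fun z => ?_⟩
  have h1 := h fun i => z i - z i₀
  have h2 : ∀ x, edgeForm (locFun fun i => z i - z i₀) x = edgeForm (locFun z) x := fun x => by
    simp only [edgeForm, fderiv_locFun_sub_const hk]
  simp only [h2, sub_self, ne_eq, OfNat.ofNat_ne_zero, not_false_eq_true, zero_pow, add_zero] at h1
  refine le_trans ?_ h1
  rw [div_mul_eq_mul_div, div_le_iff₀ hcard]
  have := dofNorm_sq_le_card fun i => z i - z i₀
  change c * dofNorm (fun i => z i - z i₀) ^ 2 ≤ _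
  nlinarith

/-! ### Conformity of triangulations -/

lemma bary_refVtx (l j : Fin 3) : bary (refVtx l) j = if j = l then 1 else 0 := by
  fin_cases l <;> fin_cases j <;> simp [bary, refVtx]

lemma bary_add_smul_sub (x y z : R2) (s : ℝ) (j : Fin 3) :
    bary (x + s • (y - z)) j = bary x j + s * (bary y j - bary z j) := by
  fin_cases j <;> simp [bary]; ring

lemma eq_of_bary_eq {x y : R2} (h : ∀ l, bary x l = bary y l) : x = y := by
  funext a
  fin_cases a
  · exact h 1
  · exact h 2

/-- Permutation of the vertices acting on lattice indices. -/
def permIdx {k : ℕ} (σ : Equiv.Perm (Fin 3)) : LatticeIndex k ≃ LatticeIndex k where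
  toFun i := ⟨i.1 ∘ σ.symm, Finset.Nat.mem_antidiagonalTuple.2 (by
    have := Finset.Nat.mem_antidiagonalTuple.1 i.2
    exact (Equiv.sum_comp σ.symm i.1).trans this)⟩
  invFun i := ⟨i.1 ∘ σ, Finset.Nat.mem_antidiagonalTuple.2 (by
    have := Finset.Nat.mem_antidiagonalTuple.1 i.2
    exact (Equiv.sum_comp σ i.1).trans this)⟩
  left_inv i := Subtype.ext (by funext l; simp)
  right_inv i := Subtype.ext (by funext l; simp)

lemma shape_permIdx {k : ℕ} (σ : Equiv.Perm (Fin 3)) (i : LatticeIndex k) {x x' : R2}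
    (h : ∀ l, bary x' (σ l) = bary x l) : shape k (permIdx σ i).1 x' = shape k i.1 x := by
  rw [shape, ← Equiv.prod_comp σ]
  refine Finset.prod_congr rfl fun l _ => ?_
  simp [permIdx, h]

namespace Triangulation

variable {Γ : Set E3} (M : Triangulation Γ)

/-- The affine parametrization of the flat triangle `K`. -/
noncomputable def pt (K : Fin M.nK) (x : R2) : E3 := ∑ l, bary x l • M.vert (M.tri K l)

lemma pt_latPt {k : ℕ} (hk : 1 ≤ k) (K : Fin M.nK) (i : LatticeIndex k) :
    M.pt K (latPt i) = M.latticePoint k K i := by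
  simp only [pt, latticePoint, bary_latPt hk]

lemma pt_refVtx (K : Fin M.nK) (l : Fin 3) : M.pt K (refVtx l) = M.vert (M.tri K l) := by
  simp [pt, bary_refVtx]

lemma refVtx_mem (l : Fin 3) : refVtx l ∈ refTriangle :=
  mem_refTriangle.2 fun j => by rw [bary_refVtx]; split_ifs <;> norm_num

lemma pt_mem_convexHull (K : Fin M.nK) {x : R2} (hx : x ∈ refTriangle) :
    M.pt K x ∈ convexHull ℝ (range fun l => M.vert (M.tri K l)) :=
  (convex_convexHull ℝ _).sum_mem (fun l _ => mem_refTriangle.1 hx l) (bary_sum x)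
    fun l _ => subset_convexHull ℝ _ ⟨l, rfl⟩

lemma weights_unique (K : Fin M.nK) {a b : Fin 3 → ℝ} (ha : ∑ l, a l = 1) (hb : ∑ l, b l = 1)
    (h : ∑ l, a l • M.vert (M.tri K l) = ∑ l, b l • M.vert (M.tri K l)) : a = b := by
  have := affineIndependent_iff.1 (M.nondegenerate K) Finset.univ (fun l => a l - b l)
    (by rw [Finset.sum_sub_distrib, ha, hb, sub_self])
    (by simp only [sub_smul, Finset.sum_sub_distrib]; rw [h, sub_self])
  funext l
  exact sub_eq_zero.1 (this l (Finset.mem_univ l))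

lemma tri_injective' (K : Fin M.nK) : Function.Injective (M.tri K) := fun _ _ h =>
  (M.nondegenerate K).injective (congrArg M.vert h)

/-- The matching of common vertices is injective, as triangles have distinct vertices, and a partial
injection of three elements extends to a permutation. Its values off the common vertices are
arbitrary. -/
lemma exists_perm (K K' : Fin M.nK) : ∃ σ : Equiv.Perm (Fin 3), ∀ l,
    M.tri K l ∈ range (M.tri K') → M.tri K' (σ l) = M.tri K l := by
  classical
  have h : ∀ l, ∃ l', M.tri K l ∈ range (M.tri K') → M.tri K' l' = M.tri K l := by
    intro l
    by_cases hl : M.tri K l ∈ range (M.tri K')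
    · obtain ⟨l', hl'⟩ := hl; exact ⟨l', fun _ => hl'⟩
    · exact ⟨0, fun h => absurd h hl⟩
  choose f hf using h
  obtain ⟨g, hg⟩ := Set.MapsTo.exists_equiv_extend_of_card_eq (α := Fin 3) (β := Fin 3)
    (t := Finset.univ) (by simp) (s := {l | M.tri K l ∈ range (M.tri K')}) (f := f)
    (fun _ _ => by simp) (fun l hl m hm hlm => M.tri_injective' K (by
      rw [← hf l hl, ← hf m hm, hlm]))
  refine ⟨g.trans (Equiv.subtypeUnivEquiv Finset.mem_univ), fun l hl => ?_⟩
  have : (g.trans (Equiv.subtypeUnivEquiv Finset.mem_univ)) l = f l := hg l hl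
  rw [this, hf l hl]

/-- Two representations of a point of the flat mesh differ by a permutation of the vertices that
matches the vertices carrying the point. -/
lemma exists_perm_of_pt_eq {K K' : Fin M.nK} {x x' : R2} (hx : x ∈ refTriangle)
    (hx' : x' ∈ refTriangle) (h : M.pt K x = M.pt K' x') :
    ∃ σ : Equiv.Perm (Fin 3), (∀ l, bary x' (σ l) = bary x l) ∧
      ∀ l, bary x l ≠ 0 → M.tri K' (σ l) = M.tri K l := by
  obtain ⟨σ, hσ⟩ := M.exists_perm K K'
  -- The affine combinations of vertices of K in which only common vertices carry weight. By
  -- conformity the point lies in the hull of the common vertices, hence in C, and uniqueness of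
  -- barycentric coordinates transfers the weights to both triangles.
  set C : Set E3 := {p | ∃ w : Fin 3 → ℝ, ∑ l, w l = 1 ∧
    (∀ l, M.tri K l ∉ range (M.tri K') → w l = 0) ∧ p = ∑ l, w l • M.vert (M.tri K l)} with hC
  have hconv : Convex ℝ C := by
    rintro _ ⟨w, hw1, hw2, rfl⟩ _ ⟨w', hw1', hw2', rfl⟩ a b - - hab
    refine ⟨fun l => a * w l + b * w' l, ?_, fun l hl => by simp [hw2 l hl, hw2' l hl], ?_⟩
    · rw [Finset.sum_add_distrib, ← Finset.mul_sum, ← Finset.mul_sum, hw1, hw1']; linarith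
    · simp only [add_smul, mul_smul, Finset.sum_add_distrib, Finset.smul_sum]
  have hp : M.pt K x ∈ C := by
    have h1 : M.pt K x ∈ convexHull ℝ (M.vert '' (range (M.tri K) ∩ range (M.tri K'))) := by
      rw [← M.conforming]
      exact ⟨M.pt_mem_convexHull K hx, h ▸ M.pt_mem_convexHull K' hx'⟩
    refine convexHull_min ?_ hconv h1
    rintro _ ⟨_, ⟨⟨l, rfl⟩, hl⟩, rfl⟩
    refine ⟨Pi.single l 1, by simp, fun m hm => ?_, by simp [Pi.single_apply]⟩
    rcases eq_or_ne m l with rfl | hml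
    · exact absurd hl hm
    · simp [hml]
  obtain ⟨w, hw1, hw2, hw3⟩ := hp
  have hx1 : (fun l => bary x l) = w := M.weights_unique K (bary_sum x) hw1 hw3
  have hw4 : ∀ l, w l ≠ 0 → M.tri K' (σ l) = M.tri K l := fun l hl =>
    hσ l (by_contra fun hcon => hl (hw2 l hcon))
  have hx2 : (fun l => bary x' l) = fun m => w (σ.symm m) := by
    refine M.weights_unique K' (bary_sum x') ?_ ?_
    · rw [← hw1]; exact Equiv.sum_comp σ.symm w
    · change M.pt K' x' = _
      rw [← h, hw3, ← Equiv.sum_comp σ fun m => w (σ.symm m) • M.vert (M.tri K' m)]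
      refine Finset.sum_congr rfl fun l _ => ?_
      rw [Equiv.symm_apply_apply]
      rcases eq_or_ne (w l) 0 with h0 | h0
      · simp [h0]
      · rw [hw4 l h0]
  refine ⟨σ, fun l => ?_, fun l hl => hw4 l ?_⟩
  · rw [congrFun hx2 (σ l), Equiv.symm_apply_apply, ← congrFun hx1 l]
  · rwa [← congrFun hx1 l]

lemma exists_common_vertex {K K' : Fin M.nK} {x x' : R2} (hx : x ∈ refTriangle)
    (hx' : x' ∈ refTriangle) (h : M.pt K x = M.pt K' x') :
    ∃ l l', M.tri K l = M.tri K' l' := by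
  obtain ⟨σ, -, h2⟩ := M.exists_perm_of_pt_eq hx hx' h
  obtain ⟨l, hl⟩ : ∃ l, bary x l ≠ 0 := by
    by_contra! hcon
    have := bary_sum x
    simp [hcon] at this
  exact ⟨l, σ l, (h2 l hl).symm⟩

/-- All three vertices carry the point, so all of them are common and the two triangles have the
same vertex set. -/
lemma eq_of_pt_eq_of_pos {K K' : Fin M.nK} {x x' : R2} (hx : ∀ l, 0 < bary x l)
    (hx' : x' ∈ refTriangle) (h : M.pt K x = M.pt K' x') : K = K' := by
  obtain ⟨σ, -, h2⟩ := M.exists_perm_of_pt_eq (mem_refTriangle.2 fun l => (hx l).le) hx' h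
  refine M.tri_injective K K' ?_
  have : M.tri K = M.tri K' ∘ σ := funext fun l => (h2 l (hx l).ne').symm
  rw [this, EquivLike.range_comp]

/-- The nodal values on the element `K`. -/
noncomputable def dof {E : Type} {k : ℕ} (z : M.Node k → E) (K : Fin M.nK) (i : LatticeIndex k) : E :=
  z (M.node k K i)

lemma localRep_eq {E : Type} [NormedAddCommGroup E] [NormedSpace ℝ E] {k : ℕ} (z : M.Node k → E)
    (K : Fin M.nK) : M.localRep k z K = locFun (M.dof z K) := rfl

instance (k : ℕ) : Finite (M.Node k) :=
  Finite.of_surjective (fun p : Fin M.nK × LatticeIndex k => M.node k p.1 p.2) fun ⟨_, K, i, hx⟩ =>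
    ⟨(K, i), Subtype.ext hx.symm⟩

/-- A family of functions on the elements that agree on common points of the flat mesh. -/
def Compatible {E : Type} (f : Fin M.nK → R2 → E) : Prop :=
  ∀ K K' x x', x ∈ refTriangle → x' ∈ refTriangle → M.pt K x = M.pt K' x' → f K x = f K' x'

/-- Nodal interpolation of a compatible family. -/
noncomputable def interp {E : Type} (k : ℕ) (f : Fin M.nK → R2 → E) (a : M.Node k) : E :=
  f a.2.choose (latPt a.2.choose_spec.choose)

/-- `interp` evaluates on an arbitrarily chosen element containing the node; compatibility makes the
choice irrelevant. -/
lemma dof_interp {E : Type} {k : ℕ} (hk : 1 ≤ k) {f : Fin M.nK → R2 → E} (hf : M.Compatible f)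
    (K : Fin M.nK) : M.dof (M.interp k f) K = fun i => f K (latPt i) := by
  funext i
  refine hf _ _ _ _ (latPt_mem hk _) (latPt_mem hk i) ?_
  rw [pt_latPt M hk, pt_latPt M hk]
  exact (M.node k K i).2.choose_spec.choose_spec.symm

lemma node_permIdx {k : ℕ} {K K' : Fin M.nK} (σ : Equiv.Perm (Fin 3)) (i : LatticeIndex k)
    (h : ∀ l, i.1 l ≠ 0 → M.tri K' (σ l) = M.tri K l) :
    M.node k K' (permIdx σ i) = M.node k K i := by
  refine Subtype.ext ?_
  change M.latticePoint k K' _ = M.latticePoint k K i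
  rw [latticePoint, latticePoint, ← Equiv.sum_comp σ]
  refine Finset.sum_congr rfl fun l _ => ?_
  have : (permIdx σ i).1 (σ l) = i.1 l := by simp [permIdx]
  rw [this]
  rcases eq_or_ne (i.1 l) 0 with h0 | h0
  · simp [h0]
  · rw [h l h0]

/-- Finite element functions are continuous across elements. -/
lemma compatible_locFun {E : Type} [NormedAddCommGroup E] [NormedSpace ℝ E] {k : ℕ}
    (z : M.Node k → E) : M.Compatible fun K => locFun (M.dof z K) := by
  intro K K' x x' hx hx' h
  obtain ⟨σ, h1, h2⟩ := M.exists_perm_of_pt_eq hx hx' h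
  simp only [locFun]
  rw [← Equiv.sum_comp (permIdx σ) fun i => shape k i.1 x' • M.dof z K' i]
  refine Finset.sum_congr rfl fun i _ => ?_
  rw [shape_permIdx σ i h1]
  -- Either the node is spanned by vertices that carry the point, and the node is common to both
  -- triangles, or its shape function vanishes at the point.
  by_cases hi : ∀ l, i.1 l ≠ 0 → bary x l ≠ 0
  · rw [dof, dof, M.node_permIdx σ i fun l hl => h2 l (hi l hl)]
  · push Not at hi
    obtain ⟨l, hl, hl'⟩ := hi
    simp [shape_eq_zero i hl' hl]

/-- The sum over the edges of the edge derivative of `q`, times the edge bubble, times the edge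
vector of the mesh with vertices `a`. -/
noncomputable def edgeField {k : ℕ} (q : M.Node k → ℝ) (a : Fin M.nV → E3) (K : Fin M.nK)
    (x : R2) : E3 :=
  ∑ l, ∑ m, (bary x l * bary x m *
    fderiv ℝ (locFun (M.dof q K)) x (refVtx m - refVtx l)) • (a (M.tri K m) - a (M.tri K l))

lemma pt_add_smul (K : Fin M.nK) (x : R2) (l m : Fin 3) (s : ℝ) :
    M.pt K (x + s • (refVtx m - refVtx l)) =
      M.pt K x + s • (M.vert (M.tri K m) - M.vert (M.tri K l)) := by
  simp only [pt, bary_add_smul_sub, add_smul, Finset.sum_add_distrib, mul_smul, sub_smul,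
    ← Finset.smul_sum, Finset.sum_sub_distrib]
  simp [bary_refVtx]

/-- If both endpoints of an edge carry the point, a short line in the edge direction stays in both
elements. There the two local functions agree, so their directional derivatives do. -/
lemma fderiv_edge_eq {k : ℕ} (q : M.Node k → ℝ) {K K' : Fin M.nK} {x x' : R2}
    (hx : x ∈ refTriangle) (hx' : x' ∈ refTriangle) (h : M.pt K x = M.pt K' x')
    {l m l' m' : Fin 3} (hl : bary x l ≠ 0) (hm : bary x m ≠ 0) (hl' : bary x' l' ≠ 0)
    (hm' : bary x' m' ≠ 0) (el : M.tri K' l' = M.tri K l) (em : M.tri K' m' = M.tri K m) :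
    fderiv ℝ (locFun (M.dof q K)) x (refVtx m - refVtx l) =
      fderiv ℝ (locFun (M.dof q K')) x' (refVtx m' - refVtx l') := by
  have hmem : ∀ (x : R2) (l m : Fin 3), x ∈ refTriangle → bary x l ≠ 0 → bary x m ≠ 0 →
      ∀ᶠ s : ℝ in 𝓝 0, x + s • (refVtx m - refVtx l) ∈ refTriangle := by
    intro x l m hx hl hm
    have hj : ∀ j, ∀ᶠ s : ℝ in 𝓝 0, 0 ≤ bary (x + s • (refVtx m - refVtx l)) j := by
      intro j
      have hc : Continuous fun s : ℝ => bary (x + s • (refVtx m - refVtx l)) j :=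
        (continuous_bary j).comp (by fun_prop)
      rcases (mem_refTriangle.1 hx j).lt_or_eq with h0 | h0
      · have := hc.tendsto 0
        rw [zero_smul, add_zero] at this
        exact (this.eventually (lt_mem_nhds h0)).mono fun _ h => le_of_lt h
      -- A coordinate that vanishes at x belongs to neither endpoint, so it remains zero along the
      -- edge direction.
      · refine Filter.Eventually.of_forall fun s => ?_
        have h1 : j ≠ l := by rintro rfl; exact hl h0.symm
        have h2 : j ≠ m := by rintro rfl; exact hm h0.symm
        rw [bary_add_smul_sub, bary_refVtx, bary_refVtx, ← h0]; simp [h1, h2]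
    filter_upwards [Filter.eventually_all.2 hj] with s hs
    exact mem_refTriangle.2 hs
  rw [← (differentiable_locFun _ x).lineDeriv_eq_fderiv,
    ← (differentiable_locFun _ x').lineDeriv_eq_fderiv, lineDeriv, lineDeriv]
  refine Filter.EventuallyEq.deriv_eq ?_
  filter_upwards [hmem x l m hx hl hm, hmem x' l' m' hx' hl' hm'] with s h1 h2
  refine M.compatible_locFun q K K' _ _ h1 h2 ?_
  rw [pt_add_smul, pt_add_smul, h, el, em]

/-- The edge derivative of q may jump between elements, but the bubble removes every term except
those of edges both of whose endpoints carry the point, and these terms agree. -/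
lemma compatible_edgeField {k : ℕ} (q : M.Node k → ℝ) (a : Fin M.nV → E3) :
    M.Compatible (M.edgeField q a) := by
  intro K K' x x' hx hx' h
  obtain ⟨σ, h1, h2⟩ := M.exists_perm_of_pt_eq hx hx' h
  simp only [edgeField]
  rw [← Equiv.sum_comp σ fun l => ∑ m, (bary x' l * bary x' m *
    fderiv ℝ (locFun (M.dof q K')) x' (refVtx m - refVtx l)) • (a (M.tri K' m) - a (M.tri K' l))]
  refine Finset.sum_congr rfl fun l _ => ?_
  rw [← Equiv.sum_comp σ fun m => (bary x' (σ l) * bary x' m *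
    fderiv ℝ (locFun (M.dof q K')) x' (refVtx m - refVtx (σ l))) •
      (a (M.tri K' m) - a (M.tri K' (σ l)))]
  refine Finset.sum_congr rfl fun m _ => ?_
  rw [h1, h1]
  by_cases hl : bary x l = 0
  · simp [hl]
  by_cases hm : bary x m = 0
  · simp [hm]
  rw [M.fderiv_edge_eq q hx hx' h hl hm (by rwa [h1]) (by rwa [h1]) (h2 l hl) (h2 m hm),
    h2 l hl, h2 m hm]

end Triangulation

/-! ### Geometry of a bounded domain of class `C^m` -/

/-- A compactness principle for constants: local constants of a property monotone in the constant
are combined by taking the maximum over a finite cover. -/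
lemma IsCompact.exists_uniform {X : Type*} [TopologicalSpace X] {K : Set X} (hK : IsCompact K)
    {P : X → ℝ → Prop} (hmono : ∀ x C C', 0 < C → C ≤ C' → P x C → P x C')
    (hloc : ∀ x ∈ K, ∃ C > 0, ∀ᶠ y in 𝓝[K] x, P y C) : ∃ C > 0, ∀ x ∈ K, P x C := by
  refine hK.induction_on (p := fun s => ∃ C > 0, ∀ x ∈ s, P x C) ⟨1, one_pos, by simp⟩ ?_ ?_ ?_
  · rintro s t hst ⟨C, hC, h⟩; exact ⟨C, hC, fun x hx => h x (hst hx)⟩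
  · rintro s t ⟨C, hC, h⟩ ⟨C', hC', h'⟩
    refine ⟨max C C', lt_max_of_lt_left hC, ?_⟩
    rintro x (hx | hx)
    · exact hmono _ _ _ hC (le_max_left _ _) (h x hx)
    · exact hmono _ _ _ hC' (le_max_right _ _) (h' x hx)
  · intro x hx
    obtain ⟨C, hC, h⟩ := hloc x hx
    exact ⟨_, h, C, hC, fun y hy => hy⟩

lemma inner_gradient (φ : E3 → ℝ) (x v : E3) : inner ℝ (gradient φ x) v = fderiv ℝ φ x v :=
  InnerProductSpace.toDual_symm_apply

lemma contDiff_gradient {φ : E3 → ℝ} {m n : WithTop ℕ∞} (h : ContDiff ℝ m φ) (hn : n + 1 ≤ m) :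
    ContDiff ℝ n (gradient φ) :=
  (InnerProductSpace.toDual ℝ E3).symm.contDiff.comp (h.fderiv_right hn)

lemma hasDerivAt_line {φ : E3 → ℝ} (h : Differentiable ℝ φ) (x v : E3) (s : ℝ) :
    HasDerivAt (fun s : ℝ => φ (x + s • v)) (inner ℝ (gradient φ (x + s • v)) v) s := by
  rw [inner_gradient]
  have h1 : HasDerivAt (fun s : ℝ => x + s • v) v s := by
    simpa using ((hasDerivAt_id s).smul_const v).const_add x
  exact (h (x + s • v)).hasFDerivAt.comp_hasDerivAt s h1

lemma eventually_neg_of_inner_neg {φ : E3 → ℝ} (h : Differentiable ℝ φ) {x v : E3} (hx : φ x = 0)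
    (hv : inner ℝ (gradient φ x) v < 0) : ∀ᶠ s : ℝ in 𝓝[>] 0, φ (x + s • v) < 0 := by
  have h1 := hasDerivAt_line h x v 0
  rw [zero_smul, add_zero] at h1
  have h2 := (hasDerivAt_iff_tendsto_slope.1 h1).eventually (gt_mem_nhds hv)
  have h3 : ∀ᶠ s in 𝓝[>] (0 : ℝ), slope (fun s : ℝ => φ (x + s • v)) 0 s < 0 :=
    h2.filter_mono (nhdsWithin_mono _ fun s hs => ne_of_gt hs)
  filter_upwards [h3, self_mem_nhdsWithin] with s hs hs0
  rw [slope_def_field, zero_smul, add_zero, hx, sub_zero, sub_zero] at hs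
  exact (div_neg_iff.1 hs).elim (fun h => absurd h.2 (not_lt.2 (le_of_lt hs0))) fun h => h.1

/-- The gradient is of class C¹, hence locally Lipschitz; the mean value inequality on the segment
between the two points turns this into the quadratic remainder. -/
lemma exists_taylor_bound {φ : E3 → ℝ} (h : ContDiff ℝ 2 φ) (z : E3) : ∃ C > 0, ∃ δ > 0,
    (∀ x ∈ Metric.ball z δ, ∀ y ∈ Metric.ball z δ,
      ‖gradient φ x - gradient φ y‖ ≤ C * ‖x - y‖) ∧
    ∀ x ∈ Metric.ball z δ, ∀ y ∈ Metric.ball z δ,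
      |φ y - φ x - inner ℝ (gradient φ x) (y - x)| ≤ C * ‖y - x‖ ^ 2 := by
  have hg : ContDiff ℝ 1 (gradient φ) := contDiff_gradient h (by norm_num)
  obtain ⟨K, t, ht, hL⟩ := hg.contDiffAt.exists_lipschitzOnWith (x := z)
  obtain ⟨δ, hδ, hb⟩ := Metric.mem_nhds_iff.1 ht
  have hd : Differentiable ℝ φ := h.differentiable (by norm_num)
  have h1 : ∀ x ∈ Metric.ball z δ, ∀ y ∈ Metric.ball z δ,
      ‖gradient φ x - gradient φ y‖ ≤ (K + 1 : ℝ) * ‖x - y‖ := fun x hx y hy => by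
    have := hL.norm_sub_le (hb hx) (hb hy)
    nlinarith [norm_nonneg (x - y)]
  refine ⟨K + 1, by positivity, δ, hδ, h1, fun x hx y hy => ?_⟩
  have hseg : segment ℝ x y ⊆ Metric.ball z δ := (convex_ball z δ).segment_subset hx hy
  have := (convex_segment x y).norm_image_sub_le_of_norm_hasFDerivWithin_le' (𝕜 := ℝ) (f := φ)
    (f' := fderiv ℝ φ) (φ := fderiv ℝ φ x) (C := (K + 1) * ‖y - x‖)
    (fun w _ => (hd w).hasFDerivAt.hasFDerivWithinAt) (fun w hw => ?_)
    (left_mem_segment ℝ x y) (right_mem_segment ℝ x y)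
  · rw [inner_gradient, ← Real.norm_eq_abs]
    refine this.trans (le_of_eq (by ring))
  · have h2 := h1 w (hseg hw) x hx
    have h3 : ‖fderiv ℝ φ w - fderiv ℝ φ x‖ = ‖gradient φ w - gradient φ x‖ := by
      rw [gradient, gradient, ← map_sub, LinearIsometryEquiv.norm_map]
    rw [h3]
    refine h2.trans ?_
    gcongr
    exact norm_sub_le_of_mem_segment hw

section Domain

variable {m : ℕ} {Ω : Set E3}

lemma IsBoundedCmDomain.isCompact_frontier (h : IsBoundedCmDomain m Ω) :
    IsCompact (frontier Ω) :=
  Metric.isCompact_of_isClosed_isBounded isClosed_frontier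
    (h.2.2.1.closure.subset frontier_subset_closure)

lemma IsLocalDefiningFunction.eventually_self {x : E3} {φ : E3 → ℝ} (hm : 1 ≤ m)
    (h : IsLocalDefiningFunction m Ω x φ) :
    ∀ᶠ y in 𝓝 x, IsLocalDefiningFunction m Ω y φ := by
  have hc : Continuous (gradient φ) :=
    (contDiff_gradient (n := 0) h.1 (by simpa using hm)).continuous
  filter_upwards [h.2.2.eventually_nhds, hc.continuousAt.eventually_ne h.2.1] with y h1 h2
  exact ⟨h.1, h2, h1⟩

lemma IsLocalDefiningFunction.mem_frontier_iff {x : E3} {φ : E3 → ℝ} (hΩ : IsOpen Ω) (hm : 1 ≤ m)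
    (h : IsLocalDefiningFunction m Ω x φ) : x ∈ frontier Ω ↔ φ x = 0 := by
  have hd : Differentiable ℝ φ := h.1.differentiable (by simp; omega)
  rw [hΩ.frontier_eq]
  constructor
  · rintro ⟨hcl, hx⟩
    rw [h.2.2.self_of_nhds, not_lt] at hx
    refine le_antisymm ?_ hx
    by_contra! hpos
    have h1 : ∀ᶠ y in 𝓝 x, 0 < φ y := hd.continuous.continuousAt.eventually (lt_mem_nhds hpos)
    have h2 : ∀ᶠ y in 𝓝 x, y ∉ Ω := by
      filter_upwards [h1, h.2.2] with y hy hy'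
      rw [hy']; exact not_lt.2 hy.le
    exact (mem_closure_iff_frequently.1 hcl) h2
  · intro h0
    refine ⟨?_, fun hx => ?_⟩
    · have hneg : inner ℝ (gradient φ x) (-gradient φ x) < 0 := by
        rw [inner_neg_right, real_inner_self_eq_norm_sq]
        have := norm_pos_iff.2 h.2.1
        have : 0 < ‖gradient φ x‖ ^ 2 := by positivity
        linarith
      have h1 := eventually_neg_of_inner_neg hd h0 hneg
      have hlim : Filter.Tendsto (fun s : ℝ => x + s • (-gradient φ x)) (𝓝[>] 0) (𝓝 x) := by
        have : Continuous fun s : ℝ => x + s • (-gradient φ x) := by fun_prop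
        have h := (this.tendsto 0).mono_left (nhdsWithin_le_nhds (s := Ioi 0))
        simpa using h
      refine mem_closure_of_tendsto hlim ?_
      filter_upwards [h1, hlim.eventually h.2.2] with s hs hs'
      exact hs'.2 hs
    · rw [h.2.2.self_of_nhds, h0] at hx
      exact lt_irrefl _ hx

/-- If the unit gradients a and b differed, then along b - a the function φ would decrease and ψ
increase. Nearby points on this ray would lie in Ω by φ and outside by ψ. -/
lemma IsLocalDefiningFunction.unitize_gradient_eq {x : E3} {φ ψ : E3 → ℝ} (hΩ : IsOpen Ω)
    (hx : x ∈ frontier Ω) (h : IsLocalDefiningFunction 1 Ω x φ)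
    (h' : IsLocalDefiningFunction 1 Ω x ψ) :
    unitize (gradient φ x) = unitize (gradient ψ x) := by
  by_contra hne
  set a := unitize (gradient φ x) with ha
  set b := unitize (gradient ψ x) with hb
  have ha1 : ‖a‖ = 1 := norm_unitize h.2.1
  have hb1 : ‖b‖ = 1 := norm_unitize h'.2.1
  have hab : inner ℝ a b < 1 := inner_lt_one_iff_real_of_norm_eq_one ha1 hb1 |>.2 hne
  have d1 : inner ℝ (gradient φ x) (b - a) < 0 := by
    rw [← norm_smul_unitize (gradient φ x), ← ha, real_inner_smul_left, inner_sub_right,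
      real_inner_self_eq_norm_sq, ha1]
    have := norm_pos_iff.2 h.2.1
    nlinarith
  have d2 : inner ℝ (gradient (fun y => -ψ y) x) (b - a) < 0 := by
    have hg : gradient (fun y => -ψ y) x = - gradient ψ x := by
      rw [gradient, gradient, fderiv_fun_neg, map_neg]
    rw [hg, ← norm_smul_unitize (gradient ψ x), ← hb, inner_neg_left, real_inner_smul_left,
      inner_sub_right, real_inner_self_eq_norm_sq, hb1, real_inner_comm]
    have := norm_pos_iff.2 h'.2.1
    nlinarith
  have e1 := eventually_neg_of_inner_neg (h.1.differentiable (by norm_num))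
    ((h.mem_frontier_iff hΩ le_rfl).1 hx) d1
  have e2 := eventually_neg_of_inner_neg (φ := fun y => -ψ y)
    (h'.1.differentiable (by norm_num)).fun_neg
    (by rw [(h'.mem_frontier_iff hΩ le_rfl).1 hx, neg_zero]) d2
  have hlim : Filter.Tendsto (fun s : ℝ => x + s • (b - a)) (𝓝[>] 0) (𝓝 x) := by
    have : Continuous fun s : ℝ => x + s • (b - a) := by fun_prop
    have h := (this.tendsto 0).mono_left (nhdsWithin_le_nhds (s := Ioi 0))
    simpa using h
  obtain ⟨s, h1, h2, h3, h4⟩ := (e1.and (e2.and ((hlim.eventually h.2.2).and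
    (hlim.eventually h'.2.2)))).exists
  have := h4.1 (h3.2 h1)
  linarith

variable {ν : E3 → E3}

lemma IsLocalDefiningFunction.mono {m n : ℕ} (h : n ≤ m) {x : E3} {φ : E3 → ℝ}
    (hφ : IsLocalDefiningFunction m Ω x φ) : IsLocalDefiningFunction n Ω x φ :=
  ⟨hφ.1.of_le (by exact_mod_cast h), hφ.2⟩

lemma norm_outwardNormal (hν : ∀ x ∈ frontier Ω, IsOutwardUnitNormal Ω x (ν x)) {x : E3}
    (hx : x ∈ frontier Ω) : ‖ν x‖ = 1 := by
  obtain ⟨φ, hφ, h⟩ := hν x hx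
  rw [h]; exact norm_unitize hφ.2.1

lemma outwardNormal_eq (hΩ : IsOpen Ω) (hν : ∀ x ∈ frontier Ω, IsOutwardUnitNormal Ω x (ν x))
    (hm : 1 ≤ m) {x : E3} (hx : x ∈ frontier Ω) {φ : E3 → ℝ}
    (hφ : IsLocalDefiningFunction m Ω x φ) : ν x = unitize (gradient φ x) := by
  obtain ⟨ψ, hψ, h⟩ := hν x hx
  rw [h]; exact hψ.unitize_gradient_eq hΩ hx (hφ.mono hm)

/-- Local behaviour of the outward normal. -/
lemma exists_local_normal_bounds (hΩ : IsBoundedCmDomain m Ω) (hm : 2 ≤ m)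
    (hν : ∀ x ∈ frontier Ω, IsOutwardUnitNormal Ω x (ν x)) {z : E3} (hz : z ∈ frontier Ω) :
    ∃ C > 0, ∃ δ > 0, ∀ x ∈ frontier Ω ∩ Metric.ball z δ, ∀ y ∈ frontier Ω ∩ Metric.ball z δ,
      ‖ν x - ν y‖ ≤ C * ‖x - y‖ ∧ |inner ℝ (y - x) (ν x)| ≤ C * ‖y - x‖ ^ 2 := by
  obtain ⟨φ, hφ⟩ := hΩ.2.2.2 z hz
  obtain ⟨C, hC, δ, hδ, h1, h2⟩ := exists_taylor_bound (hφ.1.of_le (by exact_mod_cast hm)) z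
  have hg0 : 0 < ‖gradient φ z‖ := norm_pos_iff.2 hφ.2.1
  have hgc : Continuous (gradient φ) :=
    (contDiff_gradient (n := 0) hφ.1 (by simp; omega)).continuous
  have hev : ∀ᶠ y in 𝓝 z, IsLocalDefiningFunction m Ω y φ ∧ ‖gradient φ z‖ / 2 < ‖gradient φ y‖ :=
    (hφ.eventually_self (by omega)).and
      (hgc.norm.continuousAt.eventually (lt_mem_nhds (half_lt_self hg0)))
  obtain ⟨δ', hδ', hb⟩ := Metric.mem_nhds_iff.1 hev
  set c := ‖gradient φ z‖ / 2 with hc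
  have hc0 : 0 < c := by positivity
  refine ⟨2 / c * C, by positivity, min δ δ', lt_min hδ hδ', ?_⟩
  rintro x ⟨hx, hxb⟩ y ⟨hy, hyb⟩
  have hx1 := Metric.ball_subset_ball (min_le_left δ δ') hxb
  have hy1 := Metric.ball_subset_ball (min_le_left δ δ') hyb
  obtain ⟨hx2, hx3⟩ := hb (Metric.ball_subset_ball (min_le_right δ δ') hxb)
  obtain ⟨hy2, hy3⟩ := hb (Metric.ball_subset_ball (min_le_right δ δ') hyb)
  rw [outwardNormal_eq hΩ.1 hν (by omega) hx hx2, outwardNormal_eq hΩ.1 hν (by omega) hy hy2]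
  constructor
  · refine (norm_unitize_sub_le _ hc0 hx3.le).trans ?_
    rw [mul_assoc]
    exact mul_le_mul_of_nonneg_left (h1 x hx1 y hy1) (by positivity)
  · have h3 := h2 x hx1 y hy1
    rw [(hx2.mem_frontier_iff hΩ.1 (by omega)).1 hx, (hy2.mem_frontier_iff hΩ.1 (by omega)).1 hy,
      sub_zero, zero_sub, abs_neg, real_inner_comm] at h3
    rw [unitize, inner_smul_right, abs_mul, abs_inv, abs_norm]
    have h4 : ‖gradient φ x‖⁻¹ ≤ c⁻¹ := inv_anti₀ hc0 hx3.le
    calc ‖gradient φ x‖⁻¹ * |inner ℝ (y - x) (gradient φ x)| ≤ c⁻¹ * (C * ‖y - x‖ ^ 2) := by gcongr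
      _ ≤ 2 / c * C * ‖y - x‖ ^ 2 := by
        rw [div_eq_mul_inv]
        have : 0 ≤ c⁻¹ * C * ‖y - x‖ ^ 2 := by positivity
        nlinarith

/-- The outward normal is Lipschitz, and the surface is quadratically close to its tangent
planes. -/
lemma exists_normal_bounds (hΩ : IsBoundedCmDomain m Ω) (hm : 2 ≤ m)
    (hν : ∀ x ∈ frontier Ω, IsOutwardUnitNormal Ω x (ν x)) :
    ∃ C > 0, ∀ x ∈ frontier Ω, ∀ y ∈ frontier Ω,
      ‖ν x - ν y‖ ≤ C * ‖x - y‖ ∧ |inner ℝ (y - x) (ν x)| ≤ C * ‖y - x‖ ^ 2 := by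
  have hK := hΩ.isCompact_frontier
  refine ((hK.prod hK).exists_uniform (P := fun p C =>
      ‖ν p.1 - ν p.2‖ ≤ C * ‖p.1 - p.2‖ ∧ |inner ℝ (p.2 - p.1) (ν p.1)| ≤ C * ‖p.2 - p.1‖ ^ 2)
    (fun p C C' _ hCC h => ⟨h.1.trans (by gcongr), h.2.trans (by gcongr)⟩) ?_).imp
      fun C ⟨hC, h⟩ => ⟨hC, fun x hx y hy => h (x, y) ⟨hx, hy⟩⟩
  rintro ⟨x, y⟩ ⟨hx, hy⟩
  -- Near the diagonal the local bounds apply; away from it the distance is bounded below by d, and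
  -- the constant 2/d beats the trivial bounds for unit vectors.
  rcases eq_or_ne x y with rfl | hxy
  · obtain ⟨C, hC, δ, hδ, h⟩ := exists_local_normal_bounds hΩ hm hν hx
    refine ⟨C, hC, ?_⟩
    have : Metric.ball x δ ×ˢ Metric.ball x δ ∈ 𝓝 (x, x) :=
      prod_mem_nhds (Metric.ball_mem_nhds _ hδ) (Metric.ball_mem_nhds _ hδ)
    filter_upwards [mem_nhdsWithin_of_mem_nhds this, self_mem_nhdsWithin] with p hp hp'
    exact h p.1 ⟨hp'.1, hp.1⟩ p.2 ⟨hp'.2, hp.2⟩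
  · set d := ‖x - y‖ / 2 with hd
    have hd0 : 0 < d := by have := norm_pos_iff.2 (sub_ne_zero.2 hxy); positivity
    refine ⟨2 / d, by positivity, ?_⟩
    have hc : Continuous fun p : E3 × E3 => ‖p.1 - p.2‖ := by fun_prop
    have hev : ∀ᶠ p in 𝓝 (x, y), d < ‖p.1 - p.2‖ :=
      hc.continuousAt.eventually (lt_mem_nhds (by simp only [hd]; linarith))
    filter_upwards [mem_nhdsWithin_of_mem_nhds hev, self_mem_nhdsWithin] with p hp hp'
    have n1 := norm_outwardNormal hν hp'.1
    have n2 := norm_outwardNormal hν hp'.2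
    constructor
    · have := norm_sub_le (ν p.1) (ν p.2)
      rw [n1, n2] at this
      rw [div_mul_eq_mul_div, le_div_iff₀ hd0]
      nlinarith
    · have := abs_real_inner_le_norm (p.2 - p.1) (ν p.1)
      rw [n1, mul_one] at this
      refine this.trans ?_
      rw [norm_sub_rev] at hp
      rw [div_mul_eq_mul_div, le_div_iff₀ hd0]
      nlinarith [norm_nonneg (p.2 - p.1)]

/-- Near a boundary point `z`, the boundary is reached from any point along the normal at `z`
within a distance controlled by the defining function. -/
lemma exists_normal_shift (hΩ : IsBoundedCmDomain m Ω) (hm : 1 ≤ m)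
    (hν : ∀ x ∈ frontier Ω, IsOutwardUnitNormal Ω x (ν x)) {z : E3} (hz : z ∈ frontier Ω)
    {φ : E3 → ℝ} (hφ : IsLocalDefiningFunction m Ω z φ) :
    ∃ C > 0, ∃ δ > 0, ∀ x ∈ Metric.ball z δ, ∃ s : ℝ, |s| ≤ C * |φ x| ∧
      x + s • ν z ∈ frontier Ω := by
  have hd : Differentiable ℝ φ := hφ.1.differentiable (by simp; omega)
  have hgc : Continuous (gradient φ) :=
    (contDiff_gradient (n := 0) hφ.1 (by simpa using hm)).continuous
  have hg0 : 0 < ‖gradient φ z‖ := norm_pos_iff.2 hφ.2.1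
  set c := ‖gradient φ z‖ / 2 with hc
  have hc0 : 0 < c := by positivity
  have hin : inner ℝ (gradient φ z) (ν z) = ‖gradient φ z‖ := by
    rw [outwardNormal_eq hΩ.1 hν hm hz hφ, unitize, inner_smul_right, real_inner_self_eq_norm_sq]
    field_simp
  have hev : ∀ᶠ y in 𝓝 z, IsLocalDefiningFunction m Ω y φ ∧ c < inner ℝ (gradient φ y) (ν z) := by
    refine (hφ.eventually_self hm).and ?_
    have : Continuous fun y => inner ℝ (gradient φ y) (ν z) := by fun_prop
    exact this.continuousAt.eventually (lt_mem_nhds (by simp only [hin]; exact half_lt_self hg0))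
  obtain ⟨δ₀, hδ₀, hb⟩ := Metric.mem_nhds_iff.1 hev
  have hφz : φ z = 0 := (hφ.mem_frontier_iff hΩ.1 hm).1 hz
  have hev2 : ∀ᶠ y in 𝓝 z, |φ y| < c * (δ₀ / 2) := by
    have : Continuous fun y => |φ y| := hd.continuous.abs
    exact this.continuousAt.eventually (gt_mem_nhds (by simp only [hφz, abs_zero]; positivity))
  obtain ⟨δ₁, hδ₁, hb1⟩ := Metric.mem_nhds_iff.1 hev2
  refine ⟨c⁻¹, by positivity, min δ₁ (δ₀ / 2), by positivity, fun x hx => ?_⟩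
  have hx1 : |φ x| < c * (δ₀ / 2) := hb1 (Metric.ball_subset_ball (min_le_left _ _) hx)
  have hx2 : dist x z < δ₀ / 2 := lt_of_lt_of_le hx (min_le_right _ _)
  set R := c⁻¹ * |φ x| with hR
  have hR0 : 0 ≤ R := by positivity
  have hR1 : R < δ₀ / 2 := by rw [hR, inv_mul_lt_iff₀ hc0]; exact hx1
  have hcR : c * R = |φ x| := by rw [hR, ← mul_assoc, mul_inv_cancel₀ hc0.ne', one_mul]
  have hball : ∀ s ∈ Icc (-R) R, x + s • ν z ∈ Metric.ball z δ₀ := by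
    intro s hs
    rw [Metric.mem_ball, dist_eq_norm]
    have : ‖s • ν z‖ ≤ R := by
      rw [norm_smul, norm_outwardNormal hν hz, mul_one]; exact abs_le.2 hs
    rw [dist_eq_norm] at hx2
    calc ‖x + s • ν z - z‖ = ‖(x - z) + s • ν z‖ := by congr 1; abel
      _ ≤ ‖x - z‖ + ‖s • ν z‖ := norm_add_le _ _
      _ < δ₀ := by linarith
  have hder := fun s => hasDerivAt_line hd x (ν z) s
  have hcont : Continuous fun s : ℝ => φ (x + s • ν z) :=
    continuous_iff_continuousAt.2 fun s => (hder s).continuousAt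
  -- Along the normal at z the function φ has slope at least c, so it changes sign within distance R
  -- = c⁻¹|φ x|; the intermediate value theorem gives the boundary point.
  have hmv := (convex_Icc (-R) R).mul_sub_le_image_sub_of_le_deriv (C := c)
    (f := fun s : ℝ => φ (x + s • ν z)) hcont.continuousOn
    (fun s _ => (hder s).differentiableAt.differentiableWithinAt)
    (fun s hs => by rw [(hder s).deriv]; exact (hb (hball s (interior_subset hs))).2.le)
  have h1 := hmv 0 ⟨by linarith, hR0⟩ R ⟨by linarith, le_rfl⟩ hR0
  have h2 := hmv (-R) ⟨le_rfl, by linarith⟩ 0 ⟨by linarith, hR0⟩ (by linarith)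
  simp only [zero_smul, add_zero] at h1 h2
  have h3 := neg_abs_le (φ x)
  have h4 := le_abs_self (φ x)
  obtain ⟨s, hs, hs0⟩ := intermediate_value_Icc (by linarith : -R ≤ R) hcont.continuousOn
    (show (0 : ℝ) ∈ Icc (φ (x + (-R) • ν z)) (φ (x + R • ν z)) from
      ⟨by linarith, by linarith⟩)
  exact ⟨s, abs_le.2 hs, ((hb (hball s hs)).1.mem_frontier_iff hΩ.1 hm).2 hs0⟩

/-- The boundary contains curves in all tangent directions. -/
lemma exists_tangent_curve (hΩ : IsBoundedCmDomain m Ω) (hm : 2 ≤ m)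
    (hν : ∀ x ∈ frontier Ω, IsOutwardUnitNormal Ω x (ν x)) {z : E3} (hz : z ∈ frontier Ω)
    {e : E3} (he : inner ℝ e (ν z) = 0) :
    ∃ C > 0, ∀ᶠ s : ℝ in 𝓝 0, ∃ y ∈ frontier Ω, ‖y - (z + s • e)‖ ≤ C * s ^ 2 := by
  obtain ⟨φ, hφ⟩ := hΩ.2.2.2 z hz
  obtain ⟨C, hC, δ, hδ, h⟩ := exists_normal_shift hΩ (by omega) hν hz hφ
  obtain ⟨C', hC', δ', hδ', -, h'⟩ := exists_taylor_bound (hφ.1.of_le (by exact_mod_cast hm)) z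
  -- As e is tangential, Taylor's formula leaves φ(z + s e) = O(s²), and the normal shift onto the
  -- surface has this size.
  have hge : inner ℝ (gradient φ z) e = 0 := by
    rw [← norm_smul_unitize (gradient φ z), ← outwardNormal_eq hΩ.1 hν (by omega) hz hφ,
      real_inner_smul_left, real_inner_comm, he, mul_zero]
  have hφz : φ z = 0 := (hφ.mem_frontier_iff hΩ.1 (by omega)).1 hz
  refine ⟨C * (C' * ‖e‖ ^ 2) + 1, by positivity, ?_⟩
  have hlim : Filter.Tendsto (fun s : ℝ => z + s • e) (𝓝 0) (𝓝 z) := by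
    have : Continuous fun s : ℝ => z + s • e := by fun_prop
    simpa using this.tendsto 0
  filter_upwards [hlim.eventually (Metric.ball_mem_nhds z hδ),
    hlim.eventually (Metric.ball_mem_nhds z hδ')] with s hs hs'
  obtain ⟨r, hr, hr'⟩ := h _ hs
  refine ⟨_, hr', ?_⟩
  have h1 := h' z (Metric.mem_ball_self hδ') _ hs'
  rw [hφz, sub_zero, add_sub_cancel_left, inner_smul_right, hge, mul_zero, sub_zero, norm_smul,
    mul_pow, Real.norm_eq_abs, sq_abs] at h1
  rw [add_sub_cancel_left, norm_smul, norm_outwardNormal hν hz, mul_one, Real.norm_eq_abs]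
  calc |r| ≤ C * |φ (z + s • e)| := hr
    _ ≤ C * (C' * (s ^ 2 * ‖e‖ ^ 2)) := by gcongr
    _ ≤ _ := by nlinarith [sq_nonneg s]

/-- The segment from a point to a closest boundary point is normal to the boundary. -/
lemma inner_sub_closest_eq_zero (hΩ : IsBoundedCmDomain m Ω) (hm : 2 ≤ m)
    (hν : ∀ x ∈ frontier Ω, IsOutwardUnitNormal Ω x (ν x)) {x y : E3} (hy : y ∈ frontier Ω)
    (hmin : ∀ w ∈ frontier Ω, dist x y ≤ dist x w) {e : E3} (he : inner ℝ e (ν y) = 0) :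
    inner ℝ (x - y) e = 0 := by
  -- One inequality is enough, since -e is tangential as well. If the product were positive, moving
  -- from y along the surface in direction e would shorten the squared distance to x to first order
  -- in s, against errors of second order.
  have key : ∀ e : E3, inner ℝ e (ν y) = 0 → inner ℝ (x - y) e ≤ 0 := by
    intro e he
    by_contra! hpos
    obtain ⟨C, hC, h⟩ := exists_tangent_curve hΩ hm hν hy he
    set a := inner ℝ (x - y) e with ha
    have hlim : Filter.Tendsto (fun s : ℝ => 2 * s * (C * ‖x - y‖) + s * (‖e‖ + C * s) ^ 2)
        (𝓝[>] 0) (𝓝 0) := by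
      have : Continuous fun s : ℝ => 2 * s * (C * ‖x - y‖) + s * (‖e‖ + C * s) ^ 2 := by fun_prop
      have h := (this.tendsto 0).mono_left (nhdsWithin_le_nhds (s := Ioi 0))
      simpa using h
    have hpos' : ∀ᶠ s : ℝ in 𝓝[>] 0, 0 < s := self_mem_nhdsWithin
    obtain ⟨s, ⟨w, hw, hw'⟩, hs0', hs⟩ := ((h.filter_mono nhdsWithin_le_nhds).and
      (hpos'.and (hlim.eventually (gt_mem_nhds (show 0 < 2 * a by linarith))))).exists
    have h1 := hmin w hw
    rw [dist_eq_norm, dist_eq_norm] at h1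
    set r := w - (y + s • e) with hr
    have hxw : x - w = (x - y) - (s • e + r) := by rw [hr]; abel
    have h2 : ‖x - y‖ ^ 2 ≤ ‖x - w‖ ^ 2 := pow_le_pow_left₀ (norm_nonneg _) h1 2
    rw [hxw, norm_sub_sq_real (x - y), inner_add_right, inner_smul_right, ← ha] at h2
    have h3 : ‖s • e + r‖ ≤ s * (‖e‖ + C * s) := by
      refine (norm_add_le _ _).trans ?_
      rw [norm_smul, Real.norm_eq_abs, abs_of_pos hs0']
      nlinarith
    have h4 : ‖s • e + r‖ ^ 2 ≤ (s * (‖e‖ + C * s)) ^ 2 := pow_le_pow_left₀ (norm_nonneg _) h3 2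
    have h5 : -inner ℝ (x - y) r ≤ ‖x - y‖ * (C * s ^ 2) := by
      have := neg_le_of_abs_le (abs_real_inner_le_norm (x - y) r)
      have : ‖x - y‖ * ‖r‖ ≤ ‖x - y‖ * (C * s ^ 2) := by gcongr
      linarith
    have h6 : 2 * (s * a) ≤ s * (2 * s * (C * ‖x - y‖) + s * (‖e‖ + C * s) ^ 2) := by nlinarith
    have h7 : s * (2 * s * (C * ‖x - y‖) + s * (‖e‖ + C * s) ^ 2) < s * (2 * a) :=
      mul_lt_mul_of_pos_left hs hs0'
    linarith
  refine le_antisymm (key e he) ?_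
  have := key (-e) (by rw [inner_neg_left, he, neg_zero])
  rw [inner_neg_right] at this; linarith

/-- Points of a flat triangle with vertices on the boundary are quadratically close to it. -/
lemma exists_flat_triangle_dist (hΩ : IsBoundedCmDomain m Ω) (hm : 2 ≤ m)
    (hν : ∀ x ∈ frontier Ω, IsOutwardUnitNormal Ω x (ν x)) :
    ∃ C > 0, ∀ (v : Fin 3 → E3) (w : Fin 3 → ℝ) (h : ℝ), (∀ l, v l ∈ frontier Ω) →
      (∀ l, 0 ≤ w l) → ∑ l, w l = 1 → (∀ l m, ‖v l - v m‖ ≤ h) → C * h ≤ 1 →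
      ∃ y ∈ frontier Ω, ‖∑ l, w l • v l - y‖ ≤ C * h ^ 2 := by
  refine (hΩ.isCompact_frontier.exists_uniform (P := fun y C =>
    ∀ (v : Fin 3 → E3) (w : Fin 3 → ℝ) (h : ℝ), v 0 = y → (∀ l, v l ∈ frontier Ω) →
      (∀ l, 0 ≤ w l) → ∑ l, w l = 1 → (∀ l m, ‖v l - v m‖ ≤ h) → C * h ≤ 1 →
      ∃ y ∈ frontier Ω, ‖∑ l, w l • v l - y‖ ≤ C * h ^ 2) ?_ ?_).imp
      fun C ⟨hC, h⟩ => ⟨hC, fun v w r hv hw hw1 hr hr1 =>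
        h (v 0) (hv 0) v w r rfl hv hw hw1 hr hr1⟩
  · intro y C C' hC hCC h v w r hv0 hv hw hw1 hr hr1
    have hr0 : 0 ≤ r := (norm_nonneg _).trans (hr 0 0)
    obtain ⟨y, hy, hy'⟩ := h v w r hv0 hv hw hw1 hr
      ((mul_le_mul_of_nonneg_right hCC hr0).trans hr1)
    exact ⟨y, hy, hy'.trans (by gcongr)⟩
  · intro z hz
    obtain ⟨φ, hφ⟩ := hΩ.2.2.2 z hz
    obtain ⟨C, hC, δ, hδ, h⟩ := exists_normal_shift hΩ (by omega) hν hz hφ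
    obtain ⟨C', hC', δ', hδ', -, h'⟩ := exists_taylor_bound (hφ.1.of_le (by exact_mod_cast hm)) z
    obtain ⟨δ'', hδ'', hb⟩ := Metric.mem_nhds_iff.1 (hφ.eventually_self (by omega : 1 ≤ m))
    set η := min δ (min δ' δ'') with hη
    have hη0 : 0 < η := by positivity
    -- The entry 4/η turns the smallness assumption on h into h ≤ η/4, which keeps the whole
    -- triangle in the ball where φ describes Ω.
    refine ⟨max (C * C') (4 / η), by positivity, ?_⟩
    filter_upwards [mem_nhdsWithin_of_mem_nhds (Metric.ball_mem_nhds z (half_pos hη0))]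
      with y hy v w r hv0 hv hw hw1 hr hr1
    have hr0 : 0 ≤ r := (norm_nonneg _).trans (hr 0 0)
    have hrη : r ≤ η / 4 := by
      have : 4 / η * r ≤ 1 := (mul_le_mul_of_nonneg_right (le_max_right _ _) hr0).trans hr1
      rw [div_mul_eq_mul_div, div_le_one hη0] at this
      linarith
    have hvb : ∀ l, v l ∈ Metric.ball z η := by
      intro l
      have h1 := hr l 0
      rw [hv0, ← dist_eq_norm] at h1
      have h2 : dist y z < η / 2 := hy
      have := dist_triangle (v l) y z
      rw [Metric.mem_ball]; linarith
    set x := ∑ l, w l • v l with hx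
    have hxb : x ∈ Metric.ball z η :=
      (convex_ball z η).sum_mem (fun l _ => hw l) hw1 fun l _ => hvb l
    obtain ⟨s, hs, hs'⟩ := h x (Metric.ball_subset_ball (min_le_left _ _) hxb)
    refine ⟨_, hs', ?_⟩
    rw [sub_add_cancel_left, norm_neg, norm_smul, norm_outwardNormal hν hz, mul_one,
      Real.norm_eq_abs]
    have hb' : η ≤ δ' := (min_le_right _ _).trans (min_le_left _ _)
    have hb'' : η ≤ δ'' := (min_le_right _ _).trans (min_le_right _ _)
    have hvx : ∀ l, ‖v l - x‖ ≤ r := by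
      intro l
      have : v l - x = ∑ j, w j • (v l - v j) := by
        simp only [smul_sub, Finset.sum_sub_distrib, ← Finset.sum_smul, hw1, one_smul, hx]
      rw [this]
      refine (norm_sum_le _ _).trans ?_
      calc ∑ j, ‖w j • (v l - v j)‖ ≤ ∑ j, w j * r := Finset.sum_le_sum fun j _ => by
            rw [norm_smul, Real.norm_eq_abs, abs_of_nonneg (hw j)]
            exact mul_le_mul_of_nonneg_left (hr l j) (hw j)
        _ = r := by rw [← Finset.sum_mul, hw1, one_mul]
    -- The first-order Taylor terms at x cancel in the barycentric combination, and φ vanishes at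
    -- the vertices; so φ x is a combination of quadratic remainders.
    have hzero : ∑ l, w l * inner ℝ (gradient φ x) (v l - x) = 0 := by
      simp only [← inner_smul_right]
      rw [← inner_sum]
      simp only [smul_sub, Finset.sum_sub_distrib, ← Finset.sum_smul, hw1, one_smul]
      rw [← hx, sub_self, inner_zero_right]
    have hφx : φ x = -∑ l, w l * (φ (v l) - φ x - inner ℝ (gradient φ x) (v l - x)) := by
      have hv0 : ∀ l, φ (v l) = 0 := fun l =>
        ((show IsLocalDefiningFunction m Ω (v l) φ from
          hb (Metric.ball_subset_ball hb'' (hvb l))).mem_frontier_iff hΩ.1 (by omega)).1 (hv l)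
      simp only [hv0, mul_sub, Finset.sum_sub_distrib, hzero, mul_zero, ← Finset.sum_mul, hw1]
      simp
    have hφb : |φ x| ≤ C' * r ^ 2 := by
      rw [hφx, abs_neg]
      refine (Finset.abs_sum_le_sum_abs _ _).trans ?_
      calc _ ≤ ∑ l, w l * (C' * r ^ 2) := Finset.sum_le_sum fun l _ => by
            rw [abs_mul, abs_of_nonneg (hw l)]
            refine mul_le_mul_of_nonneg_left ?_ (hw l)
            refine (h' x (Metric.ball_subset_ball hb' hxb) (v l)
              (Metric.ball_subset_ball hb' (hvb l))).trans ?_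
            have := hvx l
            gcongr
        _ = C' * r ^ 2 := by rw [← Finset.sum_mul, hw1, one_mul]
    calc |s| ≤ C * (C' * r ^ 2) := hs.trans (by gcongr)
      _ = (C * C') * r ^ 2 := by ring
      _ ≤ _ := by gcongr; exact le_max_left _ _

end Domain

/-! ### Frames and cofactors -/

lemma cross3_cross3_eq (u v w : E3) :
    cross3 u (cross3 v w) = (inner ℝ u w) • v - (inner ℝ u v) • w := by
  apply E3_ext <;> simp only [E3_inner_eq, cross3_apply_zero, cross3_apply_one, cross3_apply_two,
    PiLp.sub_apply, PiLp.smul_apply, smul_eq_mul] <;> ring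

lemma eq_zero_of_cross3_eq_zero {u v : E3} (hv : v ≠ 0) (h1 : cross3 u v = 0)
    (h2 : inner ℝ u v = 0) : u = 0 := by
  have := norm_cross3_sq u v
  rw [h1, h2, norm_zero] at this
  have hv' : ‖v‖ ^ 2 ≠ 0 := by simpa using hv
  have h3 : ‖u‖ ^ 2 = 0 := by
    have : ‖u‖ ^ 2 * ‖v‖ ^ 2 = 0 := by linarith
    exact (mul_eq_zero.1 this).resolve_right hv'
  simpa using h3

/-- A positively oriented orthonormal frame. -/
structure IsFrame (a b n : E3) : Prop where
  norm_a : ‖a‖ = 1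
  norm_b : ‖b‖ = 1
  norm_n : ‖n‖ = 1
  inner_ab : inner ℝ a b = 0
  inner_an : inner ℝ a n = 0
  inner_bn : inner ℝ b n = 0
  cross_ab : cross3 a b = n

lemma exists_isFrame {n : E3} (hn : ‖n‖ = 1) : ∃ a b, IsFrame a b n := by
  obtain ⟨e, he⟩ : ∃ e, cross3 n e ≠ 0 := by
    by_contra! h
    have h0 := h (EuclideanSpace.single 0 1)
    have h1 := h (EuclideanSpace.single 1 1)
    have e1 := congrArg (fun v : E3 => v 1) h0
    have e2 := congrArg (fun v : E3 => v 2) h0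
    have e3 := congrArg (fun v : E3 => v 2) h1
    simp at e1 e2 e3
    have : n = 0 := E3_ext (by simpa using e3) (by simpa using e2) (by simpa using e1)
    rw [this, norm_zero] at hn
    exact zero_ne_one hn
  have ha : ‖unitize (cross3 n e)‖ = 1 := norm_unitize he
  have han : inner ℝ (unitize (cross3 n e)) n = 0 := by
    rw [unitize, real_inner_smul_left, real_inner_comm, inner_cross3_self_left, mul_zero]
  set a := unitize (cross3 n e)
  have hb : ‖cross3 n a‖ = 1 := by
    have := norm_cross3_sq n a
    rw [hn, ha, real_inner_comm, han] at this
    have h2 : ‖cross3 n a‖ ^ 2 = 1 := by rw [this]; norm_num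
    exact (pow_eq_one_iff_of_nonneg (norm_nonneg _) two_ne_zero).1 h2
  refine ⟨a, cross3 n a, ha, hb, hn, inner_cross3_self_right _ _, han, ?_, ?_⟩
  · rw [real_inner_comm]; exact inner_cross3_self_left _ _
  · have hna : inner ℝ n a = 0 := by rw [real_inner_comm]; exact han
    rw [cross3_cross3_right, hna, real_inner_self_eq_norm_sq, ha]
    simp

lemma IsFrame.decomp {a b n : E3} (h : IsFrame a b n) (v : E3) :
    v = inner ℝ v a • a + inner ℝ v b • b + inner ℝ v n • n := by
  set w := v - (inner ℝ v a • a + inner ℝ v b • b + inner ℝ v n • n) with hw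
  have haa : inner ℝ a a = (1 : ℝ) := by rw [real_inner_self_eq_norm_sq, h.norm_a]; norm_num
  have hbb : inner ℝ b b = (1 : ℝ) := by rw [real_inner_self_eq_norm_sq, h.norm_b]; norm_num
  have hnn : inner ℝ n n = (1 : ℝ) := by rw [real_inner_self_eq_norm_sq, h.norm_n]; norm_num
  have hba : inner ℝ b a = 0 := by rw [real_inner_comm]; exact h.inner_ab
  have hna : inner ℝ n a = 0 := by rw [real_inner_comm]; exact h.inner_an
  have hnb : inner ℝ n b = 0 := by rw [real_inner_comm]; exact h.inner_bn
  have wa : inner ℝ w a = 0 := by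
    simp only [hw, inner_sub_left, inner_add_left, real_inner_smul_left, haa, hba, hna]; ring
  have wb : inner ℝ w b = 0 := by
    simp only [hw, inner_sub_left, inner_add_left, real_inner_smul_left, hbb, h.inner_ab, hnb]; ring
  have wn : inner ℝ w n = 0 := by
    simp only [hw, inner_sub_left, inner_add_left, real_inner_smul_left, h.inner_an, h.inner_bn,
      hnn]; ring
  have hn0 : n ≠ 0 := by rintro rfl; simpa using h.norm_n
  have hc : cross3 w n = 0 := by rw [← h.cross_ab, cross3_cross3_eq, wa, wb]; simp
  exact sub_eq_zero.1 (eq_zero_of_cross3_eq_zero hn0 hc wn)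

lemma IsFrame.norm_sq {a b n : E3} (h : IsFrame a b n) (v : E3) :
    ‖v‖ ^ 2 = inner ℝ v a ^ 2 + inner ℝ v b ^ 2 + inner ℝ v n ^ 2 := by
  conv_lhs => rw [← real_inner_self_eq_norm_sq, h.decomp v, inner_add_right, inner_add_right,
    inner_smul_right, inner_smul_right, inner_smul_right, ← h.decomp v]
  ring

/-- The cofactor of a linear map, applied to a vector. -/
noncomputable def cofac (D : E3 →L[ℝ] E3) (n : E3) : E3 :=
  n 0 • cross3 (D (EuclideanSpace.single 1 1)) (D (EuclideanSpace.single 2 1)) +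
  n 1 • cross3 (D (EuclideanSpace.single 2 1)) (D (EuclideanSpace.single 0 1)) +
  n 2 • cross3 (D (EuclideanSpace.single 0 1)) (D (EuclideanSpace.single 1 1))

lemma E3_decomp (v : E3) : v = v 0 • EuclideanSpace.single 0 (1 : ℝ) +
    v 1 • EuclideanSpace.single 1 (1 : ℝ) + v 2 • EuclideanSpace.single 2 (1 : ℝ) := by
  apply E3_ext <;> simp

lemma clm_E3_apply (D : E3 →L[ℝ] E3) (v : E3) : D v = v 0 • D (EuclideanSpace.single 0 1) +
    v 1 • D (EuclideanSpace.single 1 1) + v 2 • D (EuclideanSpace.single 2 1) := by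
  conv_lhs => rw [E3_decomp v]
  simp

/-- The cofactor is what transports normals: applied to the vector product of two tangent vectors it
gives the vector product of their images. -/
lemma cofac_cross3 (D : E3 →L[ℝ] E3) (a b : E3) :
    cofac D (cross3 a b) = cross3 (D a) (D b) := by
  rw [clm_E3_apply D a, clm_E3_apply D b, cofac]
  apply E3_ext <;> simp <;> ring

/-- The scalar factor is the determinant of D, written as the triple product of its columns. It
allows tangency estimates at time zero to be carried to time t. -/
lemma inner_cofac (D : E3 →L[ℝ] E3) (v n : E3) : inner ℝ (D v) (cofac D n) =
    inner ℝ (D (EuclideanSpace.single 0 1)) (cross3 (D (EuclideanSpace.single 1 1))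
      (D (EuclideanSpace.single 2 1))) * inner ℝ v n := by
  rw [clm_E3_apply D v, cofac]
  simp only [E3_inner_eq]; simp; ring

lemma norm_cofac_le (D : E3 →L[ℝ] E3) (n : E3) : ‖cofac D n‖ ≤ 3 * ‖D‖ ^ 2 * ‖n‖ := by
  have h1 : ∀ i : Fin 3, ‖D (EuclideanSpace.single i 1)‖ ≤ ‖D‖ := fun i => by
    simpa using D.le_opNorm (EuclideanSpace.single i 1)
  have h2 : ∀ i j : Fin 3, ‖cross3 (D (EuclideanSpace.single i 1))
      (D (EuclideanSpace.single j 1))‖ ≤ ‖D‖ ^ 2 := fun i j => by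
    refine (norm_cross3_le _ _).trans ?_
    rw [sq]; exact mul_le_mul (h1 i) (h1 j) (norm_nonneg _) (norm_nonneg _)
  have h3 : ∀ i : Fin 3, ‖n i‖ ≤ ‖n‖ := fun i => PiLp.norm_apply_le n i
  have h4 : ∀ i j k : Fin 3, ‖n i • cross3 (D (EuclideanSpace.single j 1))
      (D (EuclideanSpace.single k 1))‖ ≤ ‖n‖ * ‖D‖ ^ 2 := fun i j k => by
    rw [norm_smul]; exact mul_le_mul (h3 i) (h2 j k) (norm_nonneg _) (norm_nonneg _)
  rw [cofac]
  refine (norm_add₃_le).trans ?_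
  have := h4 0 1 2; have := h4 1 2 0; have := h4 2 0 1
  linarith

lemma norm_cofac_sub_le (D D' : E3 →L[ℝ] E3) (n : E3) :
    ‖cofac D n - cofac D' n‖ ≤ 3 * (‖D‖ + ‖D'‖) * ‖D - D'‖ * ‖n‖ := by
  have h1 : ∀ (A : E3 →L[ℝ] E3) (i : Fin 3), ‖A (EuclideanSpace.single i 1)‖ ≤ ‖A‖ := fun A i => by
    simpa using A.le_opNorm (EuclideanSpace.single i 1)
  have h2 : ∀ i j : Fin 3, ‖cross3 (D (EuclideanSpace.single i 1)) (D (EuclideanSpace.single j 1)) -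
      cross3 (D' (EuclideanSpace.single i 1)) (D' (EuclideanSpace.single j 1))‖ ≤
      (‖D‖ + ‖D'‖) * ‖D - D'‖ := fun i j => by
    refine (norm_cross3_sub_le _ _ _ _).trans ?_
    have e1 := h1 (D - D') i
    have e2 := h1 (D - D') j
    rw [sub_apply] at e1 e2
    calc _ ≤ ‖D - D'‖ * ‖D‖ + ‖D'‖ * ‖D - D'‖ := by gcongr <;> apply h1
      _ = _ := by ring
  have h3 : ∀ i : Fin 3, ‖n i‖ ≤ ‖n‖ := fun i => PiLp.norm_apply_le n i
  have h4 : ∀ i j k : Fin 3, ‖n i • (cross3 (D (EuclideanSpace.single j 1))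
      (D (EuclideanSpace.single k 1)) - cross3 (D' (EuclideanSpace.single j 1))
      (D' (EuclideanSpace.single k 1)))‖ ≤ ‖n‖ * ((‖D‖ + ‖D'‖) * ‖D - D'‖) := fun i j k => by
    rw [norm_smul]; exact mul_le_mul (h3 i) (h2 j k) (norm_nonneg _) (norm_nonneg _)
  have h5 : cofac D n - cofac D' n =
    n 0 • (cross3 (D (EuclideanSpace.single 1 1)) (D (EuclideanSpace.single 2 1)) -
      cross3 (D' (EuclideanSpace.single 1 1)) (D' (EuclideanSpace.single 2 1))) +
    n 1 • (cross3 (D (EuclideanSpace.single 2 1)) (D (EuclideanSpace.single 0 1)) -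
      cross3 (D' (EuclideanSpace.single 2 1)) (D' (EuclideanSpace.single 0 1))) +
    n 2 • (cross3 (D (EuclideanSpace.single 0 1)) (D (EuclideanSpace.single 1 1)) -
      cross3 (D' (EuclideanSpace.single 0 1)) (D' (EuclideanSpace.single 1 1))) := by
    simp only [cofac, smul_sub]; abel
  rw [h5]
  refine (norm_add₃_le).trans ?_
  have := h4 0 1 2; have := h4 1 2 0; have := h4 2 0 1
  linarith

lemma cofac_sub (D : E3 →L[ℝ] E3) (n n' : E3) : cofac D n - cofac D n' = cofac D (n - n') := by
  simp only [cofac, PiLp.sub_apply]; module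

/-- Only injectivity on the tangent plane enters: a vanishing product of D a and D b would put a
nontrivial tangential combination into the kernel. The ambient extension of the flow need not be
invertible in the normal direction. -/
lemma cofac_ne_zero {D : E3 →L[ℝ] E3} {a b n : E3} (hf : IsFrame a b n)
    (hD : ∀ v, inner ℝ v n = 0 → D v = 0 → v = 0) : cofac D n ≠ 0 := by
  rw [← hf.cross_ab, cofac_cross3]
  intro h
  have h1 := cross3_cross3_eq (D a) (D a) (D b)
  rw [h] at h1
  have h2 : cross3 (D a) 0 = 0 := by apply E3_ext <;> simp
  rw [h2] at h1
  have h3 : D (inner ℝ (D a) (D b) • a - inner ℝ (D a) (D a) • b) = 0 := by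
    rw [map_sub, map_smul, map_smul, ← h1]
  have h4 := hD _ (by
    rw [inner_sub_left, real_inner_smul_left, real_inner_smul_left, hf.inner_an, hf.inner_bn]
    ring) h3
  have h5 : inner ℝ (inner ℝ (D a) (D b) • a - inner ℝ (D a) (D a) • b) b = (0 : ℝ) := by
    rw [h4, inner_zero_left]
  rw [inner_sub_left, real_inner_smul_left, real_inner_smul_left, hf.inner_ab,
    real_inner_self_eq_norm_sq b, hf.norm_b] at h5
  have h6 : D a = 0 := by
    rw [← inner_self_eq_zero (𝕜 := ℝ)]; linarith
  have := hD a hf.inner_an h6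
  rw [← norm_eq_zero, hf.norm_a] at this
  exact one_ne_zero this

/-! ### Uniform bounds for flows -/

lemma IsContinuousInC3.continuousOn_fderiv {T : ℝ} {f : ℝ → E3 → E3} (hf : IsContinuousInC3 T f)
    (v : E3) : ContinuousOn (fun p : ℝ × E3 => fderiv ℝ (f p.1) p.2 v) (Icc 0 T ×ˢ univ) := by
  have h := hf.2 1 (by norm_num)
  have h2 : ∀ p : ℝ × E3, fderiv ℝ (f p.1) p.2 v =
      iteratedFDeriv ℝ 1 (f p.1) p.2 (fun _ => v) := fun p => by
    rw [iteratedFDeriv_one_apply]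
  simp only [h2]
  exact (ContinuousMultilinearMap.apply ℝ (fun _ : Fin 1 => E3) E3 fun _ => v).continuous.comp_continuousOn h

/-- Bounds for the first and second spatial derivatives on a ball, uniform in time. -/
lemma IsContinuousInC3.exists_bounds {T : ℝ} {f : ℝ → E3 → E3} (hf : IsContinuousInC3 T f) (R : ℝ) :
    ∃ L > 0, ∀ t ∈ Icc 0 T, ∀ x ∈ Metric.closedBall (0 : E3) R, ∀ y ∈ Metric.closedBall (0 : E3) R,
      ‖fderiv ℝ (f t) x‖ ≤ L ∧ ‖fderiv ℝ (f t) x - fderiv ℝ (f t) y‖ ≤ L * ‖x - y‖ ∧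
      ‖f t x - f t y‖ ≤ L * ‖x - y‖ ∧
      ‖f t y - f t x - fderiv ℝ (f t) x (y - x)‖ ≤ L * ‖y - x‖ ^ 2 := by
  have hK : IsCompact (Icc 0 T ×ˢ Metric.closedBall (0 : E3) R) :=
    isCompact_Icc.prod (isCompact_closedBall 0 R)
  have hsub : Icc 0 T ×ˢ Metric.closedBall (0 : E3) R ⊆ Icc 0 T ×ˢ univ :=
    prod_mono le_rfl (subset_univ _)
  obtain ⟨C1, hC1⟩ := hK.exists_bound_of_continuousOn ((hf.2 1 (by norm_num)).mono hsub)
  obtain ⟨C2, hC2⟩ := hK.exists_bound_of_continuousOn ((hf.2 2 (by norm_num)).mono hsub)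
  set L := max (max C1 C2) 1 with hL
  have hL0 : 0 < L := by positivity
  have b1 : ∀ t ∈ Icc 0 T, ∀ x ∈ Metric.closedBall (0 : E3) R, ‖fderiv ℝ (f t) x‖ ≤ L := by
    intro t ht x hx
    have := hC1 (t, x) ⟨ht, hx⟩
    rw [norm_iteratedFDeriv_one] at this
    exact this.trans ((le_max_left _ _).trans (le_max_left _ _))
  have b2 : ∀ t ∈ Icc 0 T, ∀ x ∈ Metric.closedBall (0 : E3) R,
      ‖fderiv ℝ (fderiv ℝ (f t)) x‖ ≤ L := by
    intro t ht x hx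
    have := hC2 (t, x) ⟨ht, hx⟩
    rw [← norm_iteratedFDeriv_fderiv, norm_iteratedFDeriv_one] at this
    exact this.trans ((le_max_right _ _).trans (le_max_left _ _))
  have hd : ∀ t ∈ Icc 0 T, Differentiable ℝ (f t) := fun t ht =>
    (hf.1 t ht).differentiable (by norm_num)
  have hd2 : ∀ t ∈ Icc 0 T, Differentiable ℝ (fderiv ℝ (f t)) := fun t ht =>
    ((hf.1 t ht).fderiv_right (m := 1) (by norm_num)).differentiable (by norm_num)
  have hcv := convex_closedBall (0 : E3) R
  have b3 : ∀ t ∈ Icc 0 T, ∀ x ∈ Metric.closedBall (0 : E3) R,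
      ∀ y ∈ Metric.closedBall (0 : E3) R,
      ‖fderiv ℝ (f t) x - fderiv ℝ (f t) y‖ ≤ L * ‖x - y‖ := fun t ht x hx y hy =>
    hcv.norm_image_sub_le_of_norm_fderiv_le (𝕜 := ℝ) (fun w _ => hd2 t ht w)
      (fun w hw => b2 t ht w hw) hy hx
  refine ⟨L, hL0, fun t ht x hx y hy => ⟨b1 t ht x hx, b3 t ht x hx y hy, ?_, ?_⟩⟩
  · exact hcv.norm_image_sub_le_of_norm_fderiv_le (𝕜 := ℝ) (fun w _ => hd t ht w)
      (fun w hw => b1 t ht w hw) hy hx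
  · have hseg : segment ℝ x y ⊆ Metric.closedBall 0 R := hcv.segment_subset hx hy
    have := (convex_segment x y).norm_image_sub_le_of_norm_hasFDerivWithin_le' (𝕜 := ℝ) (f := f t)
      (f' := fderiv ℝ (f t)) (φ := fderiv ℝ (f t) x) (C := L * ‖y - x‖)
      (fun w _ => (hd t ht w).hasFDerivAt.hasFDerivWithinAt) (fun w hw => ?_)
      (left_mem_segment ℝ x y) (right_mem_segment ℝ x y)
    · exact this.trans (le_of_eq (by ring))
    · refine (b3 t ht w (hseg hw) x hx).trans ?_
      gcongr
      exact norm_sub_le_of_mem_segment hw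

namespace EvolvingSurface

variable (S : EvolvingSurface)

lemma zero_mem : (0 : ℝ) ∈ Icc 0 S.T := ⟨le_rfl, S.T_pos.le⟩

lemma isCompact_Γ : IsCompact (S.Γ 0) := (S.domain 0 S.zero_mem).isCompact_frontier

lemma Φ_mem {t : ℝ} (ht : t ∈ Icc 0 S.T) {z : E3} (hz : z ∈ S.Γ 0) : S.Φ t z ∈ frontier (S.Ω t) := by
  rw [← S.flow_image t ht]; exact mem_image_of_mem _ hz

/-- The increments of the flow in time are Lipschitz in space. -/
lemma exists_increment_bound (R : ℝ) : ∃ L > 0, ∀ t ∈ Icc 0 S.T, ∀ s ∈ Icc 0 S.T,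
    ∀ x ∈ Metric.closedBall (0 : E3) R, ∀ y ∈ Metric.closedBall (0 : E3) R,
      ‖(S.Φ t x - S.Φ t y) - (S.Φ s x - S.Φ s y)‖ ≤ L * |t - s| * ‖x - y‖ := by
  obtain ⟨L, hL, h⟩ := S.dflow_regular.exists_bounds R
  refine ⟨L, hL, fun t ht s hs x hx y hy => ?_⟩
  have := (convex_Icc 0 S.T).norm_image_sub_le_of_norm_hasDerivWithin_le
    (f := fun t => S.Φ t x - S.Φ t y) (f' := fun t => S.dΦ t x - S.dΦ t y) (C := L * ‖x - y‖)
    (fun r hr => (S.flow_deriv r hr x).sub (S.flow_deriv r hr y))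
    (fun r hr => (h r hr x hx y hy).2.2.1) hs ht
  rw [Real.norm_eq_abs] at this
  refine this.trans (le_of_eq (by ring))

/-- The derivative of the flow is injective on tangent spaces. -/
lemma fderiv_flow_injective {t : ℝ} (ht : t ∈ Icc 0 S.T) {z : E3} (hz : z ∈ S.Γ 0) {v : E3}
    (hv : inner ℝ v (S.normal 0 z) = 0) (h0 : fderiv ℝ (S.Φ t) z v = 0) : v = 0 := by
  by_contra hne
  have hv0 : 0 < ‖v‖ := norm_pos_iff.2 hne
  -- If the derivative annihilated v, then along a surface curve y(s) = z + s v + O(s²) the flow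
  -- would move by O(s²). The locally Lipschitz inverse would give ‖y(s) - z‖ = O(s²), which
  -- contradicts s‖v‖ for small s.
  obtain ⟨Ψ, hΨ, hinv⟩ := S.flow_diffeo t ht
  obtain ⟨K, U, hU, hLip⟩ := (hΨ.of_le (by norm_num : (1 : WithTop ℕ∞) ≤ 3)).contDiffAt
    |>.exists_lipschitzOnWith (x := S.Φ t z)
  obtain ⟨C, hC, hcurve⟩ := exists_tangent_curve (S.domain 0 S.zero_mem) (by norm_num)
    (S.normal_spec 0 S.zero_mem) hz hv
  obtain ⟨R, hR⟩ := S.isCompact_Γ.isBounded.subset_closedBall (0 : E3)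
  obtain ⟨L, hL, hb⟩ := S.flow_regular.exists_bounds R
  have hcont : Continuous (S.Φ t) := (S.flow_regular.1 t ht).continuous
  obtain ⟨δ, hδ, hδb⟩ := Metric.mem_nhds_iff.1 (hcont.continuousAt hU)
  set A := ‖v‖ + C with hA
  have hlim : Filter.Tendsto (fun s : ℝ => (C + K * (L * A ^ 2 + L * C)) * s) (𝓝[>] 0) (𝓝 0) := by
    have : Continuous fun s : ℝ => (C + K * (L * A ^ 2 + L * C)) * s := by fun_prop
    have h := (this.tendsto 0).mono_left (nhdsWithin_le_nhds (s := Ioi 0))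
    simpa using h
  have hpos' : ∀ᶠ s : ℝ in 𝓝[>] 0, 0 < s := self_mem_nhdsWithin
  have hsmall : ∀ᶠ s : ℝ in 𝓝[>] 0, s < min 1 (δ / A) :=
    (gt_mem_nhds (by positivity)).filter_mono nhdsWithin_le_nhds
  obtain ⟨s, ⟨y, hy, hy'⟩, hs0, hs1, hs2⟩ := ((hcurve.filter_mono nhdsWithin_le_nhds).and
      (hpos'.and (hsmall.and (hlim.eventually (gt_mem_nhds hv0))))).exists
  have hs3 : s < 1 := hs1.trans_le (min_le_left _ _)
  have hs4 : s * A < δ := by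
    have := hs1.trans_le (min_le_right _ _)
    rwa [lt_div_iff₀ (by positivity)] at this
  set r := y - (z + s • v) with hr
  have hyz : y - z = s • v + r := by rw [hr]; abel
  have hyz1 : ‖y - z‖ ≤ s * A := by
    rw [hyz]
    refine (norm_add_le _ _).trans ?_
    rw [norm_smul, Real.norm_eq_abs, abs_of_pos hs0, hA]
    have hss : s ^ 2 ≤ s := by nlinarith
    have := mul_le_mul_of_nonneg_left hss hC.le
    linarith
  have hΦ : ‖S.Φ t y - S.Φ t z‖ ≤ (L * A ^ 2 + L * C) * s ^ 2 := by
    have h1 := (hb t ht z (hR hz) y (hR hy)).2.2.2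
    have h2 : fderiv ℝ (S.Φ t) z (y - z) = fderiv ℝ (S.Φ t) z r := by
      rw [hyz, map_add, map_smul, h0, smul_zero, zero_add]
    have h3 : ‖fderiv ℝ (S.Φ t) z r‖ ≤ L * (C * s ^ 2) :=
      (ContinuousLinearMap.le_opNorm _ _).trans
        (mul_le_mul (hb t ht z (hR hz) y (hR hy)).1 hy' (norm_nonneg _) hL.le)
    rw [h2] at h1
    have h4 : ‖y - z‖ ^ 2 ≤ (s * A) ^ 2 := pow_le_pow_left₀ (norm_nonneg _) hyz1 2
    have h5 := norm_le_norm_sub_add (S.Φ t y - S.Φ t z) (fderiv ℝ (S.Φ t) z r)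
    nlinarith
  have hlip := hLip.norm_sub_le (hδb (show y ∈ Metric.ball z δ by
    rw [Metric.mem_ball, dist_eq_norm]; linarith)) (mem_of_mem_nhds hU)
  rw [hinv y hy, hinv z hz] at hlip
  have h6 : s * ‖v‖ ≤ ‖y - z‖ + ‖r‖ := by
    have : s • v = (y - z) - r := by rw [hyz]; abel
    rw [← abs_of_pos hs0, ← Real.norm_eq_abs, ← norm_smul, this]
    exact norm_sub_le _ _
  have h7 : (K : ℝ) * ‖S.Φ t y - S.Φ t z‖ ≤ K * ((L * A ^ 2 + L * C) * s ^ 2) := by gcongr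
  have h8 : s * ‖v‖ ≤ s * ((C + K * (L * A ^ 2 + L * C)) * s) := by nlinarith
  have h9 := le_of_mul_le_mul_left h8 hs0
  linarith

/-- The normal of the evolving surface transported from time zero, not normalized. -/
noncomputable def flowNormal (t : ℝ) (z : E3) : E3 :=
  cofac (fderiv ℝ (S.Φ t) z) (S.normal 0 z)

/-- The unit normal of the evolving surface transported from time zero. -/
noncomputable def flowUnitNormal (t : ℝ) (z : E3) : E3 := unitize (S.flowNormal t z)

lemma flowNormal_ne_zero {t : ℝ} (ht : t ∈ Icc 0 S.T) {z : E3} (hz : z ∈ S.Γ 0) :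
    S.flowNormal t z ≠ 0 := by
  obtain ⟨a, b, hf⟩ := exists_isFrame (norm_outwardNormal (S.normal_spec 0 S.zero_mem) hz)
  exact cofac_ne_zero hf fun v hv h0 => S.fderiv_flow_injective ht hz hv h0

lemma continuousOn_normal {t : ℝ} (ht : t ∈ Icc 0 S.T) :
    ContinuousOn (S.normal t) (frontier (S.Ω t)) := by
  obtain ⟨C, hC, h⟩ := exists_normal_bounds (S.domain t ht) (by norm_num) (S.normal_spec t ht)
  have : LipschitzOnWith (Real.toNNReal C) (S.normal t) (frontier (S.Ω t)) :=
    LipschitzOnWith.of_dist_le_mul fun x hx y hy => by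
      rw [dist_eq_norm, dist_eq_norm, Real.coe_toNNReal _ hC.le]; exact (h x hx y hy).1
  exact this.continuousOn

/-- The field `normal` carries no continuity in time. The transported normal is jointly continuous
by construction and replaces it in all arguments uniform in time. -/
lemma continuousOn_flowNormal :
    ContinuousOn (fun p : ℝ × E3 => S.flowNormal p.1 p.2) (Icc 0 S.T ×ˢ S.Γ 0) := by
  have hsub : Icc 0 S.T ×ˢ S.Γ 0 ⊆ Icc 0 S.T ×ˢ univ := prod_mono le_rfl (subset_univ _)
  have hD := fun i : Fin 3 => (S.flow_regular.continuousOn_fderiv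
    (EuclideanSpace.single i 1)).mono hsub
  have hn : ∀ i : Fin 3, ContinuousOn (fun p : ℝ × E3 => S.normal 0 p.2 i) (Icc 0 S.T ×ˢ S.Γ 0) :=
    fun i => ((PiLp.continuous_apply 2 _ i).comp_continuousOn
      (S.continuousOn_normal S.zero_mem)).comp continuousOn_snd fun p hp => hp.2
  exact ((((hn 0).smul ((hD 1).cross3 (hD 2))).add ((hn 1).smul ((hD 2).cross3 (hD 0))))).add
    ((hn 2).smul ((hD 0).cross3 (hD 1)))

lemma exists_flowNormal_lower_bound : ∃ c > 0, ∀ t ∈ Icc 0 S.T, ∀ z ∈ S.Γ 0,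
    c ≤ ‖S.flowNormal t z‖ := by
  have hK : IsCompact (Icc 0 S.T ×ˢ S.Γ 0) := isCompact_Icc.prod S.isCompact_Γ
  have hne : (Icc 0 S.T ×ˢ S.Γ 0).Nonempty := by
    obtain ⟨z, hz⟩ := S.connected.nonempty
    exact ⟨(0, z), S.zero_mem, hz⟩
  obtain ⟨p, hp, hmin⟩ := hK.exists_isMinOn hne S.continuousOn_flowNormal.norm
  refine ⟨‖S.flowNormal p.1 p.2‖, norm_pos_iff.2 (S.flowNormal_ne_zero hp.1 hp.2),
    fun t ht z hz => ?_⟩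
  exact isMinOn_iff.1 hmin (t, z) (mk_mem_prod ht hz)

lemma continuousOn_flowUnitNormal :
    ContinuousOn (fun p : ℝ × E3 => S.flowUnitNormal p.1 p.2) (Icc 0 S.T ×ˢ S.Γ 0) := by
  have h := S.continuousOn_flowNormal
  exact (h.norm.inv₀ fun p hp => norm_ne_zero_iff.2 (S.flowNormal_ne_zero hp.1 hp.2)).smul h

/-- The outward normal is orthogonal to the transported tangent vectors. -/
lemma inner_fderiv_flow_normal {t : ℝ} (ht : t ∈ Icc 0 S.T) {z : E3} (hz : z ∈ S.Γ 0) {v : E3}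
    (hv : inner ℝ v (S.normal 0 z) = 0) :
    inner ℝ (fderiv ℝ (S.Φ t) z v) (S.normal t (S.Φ t z)) = 0 := by
  obtain ⟨B, hB, hn⟩ := exists_normal_bounds (S.domain t ht) (by norm_num) (S.normal_spec t ht)
  obtain ⟨C, hC, hcurve⟩ := exists_tangent_curve (S.domain 0 S.zero_mem) (by norm_num)
    (S.normal_spec 0 S.zero_mem) hz hv
  obtain ⟨R, hR⟩ := S.isCompact_Γ.isBounded.subset_closedBall (0 : E3)
  obtain ⟨L, hL, hb⟩ := S.flow_regular.exists_bounds R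
  set ν := S.normal t (S.Φ t z) with hν
  have hν1 : ‖ν‖ = 1 := norm_outwardNormal (S.normal_spec t ht) (S.Φ_mem ht hz)
  set a := inner ℝ (fderiv ℝ (S.Φ t) z v) ν with ha
  set A := ‖v‖ + C with hA
  set M := B * (L * A) ^ 2 + L * A ^ 2 + L * C with hM
  by_contra hne
  have hlim : Filter.Tendsto (fun s : ℝ => M * s) (𝓝[>] 0) (𝓝 0) := by
    have : Continuous fun s : ℝ => M * s := by fun_prop
    have h := (this.tendsto 0).mono_left (nhdsWithin_le_nhds (s := Ioi 0))
    simpa using h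
  have hpos' : ∀ᶠ s : ℝ in 𝓝[>] 0, 0 < s := self_mem_nhdsWithin
  have hsmall : ∀ᶠ s : ℝ in 𝓝[>] 0, s < 1 :=
    (gt_mem_nhds one_pos).filter_mono nhdsWithin_le_nhds
  obtain ⟨s, ⟨y, hy, hy'⟩, hs0, hs1, hs2⟩ := ((hcurve.filter_mono nhdsWithin_le_nhds).and
      (hpos'.and (hsmall.and (hlim.eventually (gt_mem_nhds (abs_pos.2 hne)))))).exists
  set r := y - (z + s • v) with hr
  have hyz : y - z = s • v + r := by rw [hr]; abel
  have hyz1 : ‖y - z‖ ≤ s * A := by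
    rw [hyz]
    refine (norm_add_le _ _).trans ?_
    rw [norm_smul, Real.norm_eq_abs, abs_of_pos hs0, hA]
    have hss : s ^ 2 ≤ s := by nlinarith
    have := mul_le_mul_of_nonneg_left hss hC.le
    linarith
  have hyz2 : ‖y - z‖ ^ 2 ≤ (s * A) ^ 2 := pow_le_pow_left₀ (norm_nonneg _) hyz1 2
  have e1 := (hb t ht z (hR hz) y (hR hy)).2.2.2
  have e2 := (hb t ht y (hR hy) z (hR hz)).2.2.1
  have e3 := (hn _ (S.Φ_mem ht hz) _ (S.Φ_mem ht hy)).2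
  have e4 : ‖fderiv ℝ (S.Φ t) z r‖ ≤ L * (C * s ^ 2) :=
    (ContinuousLinearMap.le_opNorm _ _).trans
      (mul_le_mul (hb t ht z (hR hz) y (hR hy)).1 hy' (norm_nonneg _) hL.le)
  have e5 : ‖S.Φ t y - S.Φ t z‖ ^ 2 ≤ (L * (s * A)) ^ 2 :=
    pow_le_pow_left₀ (norm_nonneg _) (e2.trans (by gcongr)) 2
  -- Each term on the right is O(s²): a chord of Γ(t) against its normal, the Taylor remainder of
  -- the flow, and the image of the quadratic deviation of the curve from its tangent.
  have key : s * a = inner ℝ (S.Φ t y - S.Φ t z) ν -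
      inner ℝ (S.Φ t y - S.Φ t z - fderiv ℝ (S.Φ t) z (y - z)) ν -
      inner ℝ (fderiv ℝ (S.Φ t) z r) ν := by
    rw [hyz, map_add, map_smul, inner_sub_left _ (_ + _), inner_add_left, real_inner_smul_left]
    ring
  have h1 : |s * a| ≤ B * (L * (s * A)) ^ 2 + L * (s * A) ^ 2 + L * (C * s ^ 2) := by
    rw [key]
    refine (abs_sub _ _).trans (add_le_add ((abs_sub _ _).trans (add_le_add ?_ ?_)) ?_)
    · exact e3.trans (by gcongr)
    · refine (abs_real_inner_le_norm _ _).trans ?_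
      rw [hν1, mul_one]; exact e1.trans (by gcongr)
    · refine (abs_real_inner_le_norm _ _).trans ?_
      rw [hν1, mul_one]; exact e4
  rw [abs_mul, abs_of_pos hs0] at h1
  have h2 : s * |a| ≤ s * (M * s) := by rw [hM]; linarith
  have := le_of_mul_le_mul_left h2 hs0
  linarith

/-- Up to one global sign, the outward normal is the transported normal. -/
lemma exists_sign_normal {t : ℝ} (ht : t ∈ Icc 0 S.T) : ∃ σ : ℝ, (σ = 1 ∨ σ = -1) ∧
    ∀ z ∈ S.Γ 0, S.normal t (S.Φ t z) = σ • S.flowUnitNormal t z := by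
  have hpar : ∀ z ∈ S.Γ 0, S.normal t (S.Φ t z) =
      inner ℝ (S.normal t (S.Φ t z)) (S.flowUnitNormal t z) • S.flowUnitNormal t z := by
    intro z hz
    obtain ⟨a, b, hf⟩ := exists_isFrame (norm_outwardNormal (S.normal_spec 0 S.zero_mem) hz)
    have h1 : cross3 (S.normal t (S.Φ t z)) (S.flowNormal t z) = 0 := by
      rw [flowNormal, ← hf.cross_ab, cofac_cross3, cross3_cross3_eq,
        real_inner_comm, S.inner_fderiv_flow_normal ht hz hf.inner_bn,
        real_inner_comm, S.inner_fderiv_flow_normal ht hz hf.inner_an]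
      simp
    have hN := S.flowNormal_ne_zero ht hz
    have hu : ‖S.flowUnitNormal t z‖ = 1 := norm_unitize hN
    rw [← sub_eq_zero]
    refine eq_zero_of_cross3_eq_zero (v := S.flowUnitNormal t z) ?_ ?_ ?_
    · intro h; rw [h, norm_zero] at hu; exact zero_ne_one hu
    · have h2 : cross3 (S.flowUnitNormal t z) (S.flowUnitNormal t z) = 0 := by
        apply E3_ext <;> simp <;> ring
      rw [cross3_sub_left, cross3_smul_left, h2, smul_zero, sub_zero, flowUnitNormal, unitize,
        cross3_smul_right, h1, smul_zero]
    · rw [inner_sub_left, real_inner_smul_left, real_inner_self_eq_norm_sq, hu]; ring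
  have hcont : ContinuousOn (fun z => inner ℝ (S.normal t (S.Φ t z)) (S.flowUnitNormal t z))
      (S.Γ 0) := by
    refine ContinuousOn.inner ?_ ?_
    · exact (S.continuousOn_normal ht).comp (S.flow_regular.1 t ht).continuous.continuousOn
        fun z hz => S.Φ_mem ht hz
    · exact ContinuousOn.comp (g := fun p : ℝ × E3 => S.flowUnitNormal p.1 p.2)
        (f := fun z => (t, z)) S.continuousOn_flowUnitNormal
        (Continuous.prodMk_right t).continuousOn fun z hz => mk_mem_prod ht hz
  -- The two unit normals are parallel, so their product is a continuous function with square one on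
  -- the connected surface Γ(0), hence constant.
  have hsq : EqOn ((fun z => inner ℝ (S.normal t (S.Φ t z)) (S.flowUnitNormal t z)) ^ 2) 1
      (S.Γ 0) := by
    intro z hz
    have h1 := congrArg norm (hpar z hz)
    rw [norm_smul, norm_outwardNormal (S.normal_spec t ht) (S.Φ_mem ht hz), flowUnitNormal,
      norm_unitize (S.flowNormal_ne_zero ht hz), mul_one, Real.norm_eq_abs] at h1
    simp only [Pi.pow_apply, Pi.one_apply]
    rw [← sq_abs]; rw [flowUnitNormal, ← h1]; norm_num
  rcases S.connected.isPreconnected.eq_one_or_eq_neg_one_of_sq_eq hcont hsq with h | h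
  · exact ⟨1, Or.inl rfl, fun z hz => (hpar z hz).trans
      (congrArg (· • S.flowUnitNormal t z) (h hz))⟩
  · exact ⟨-1, Or.inr rfl, fun z hz => (hpar z hz).trans
      (congrArg (· • S.flowUnitNormal t z) (h hz))⟩

/-- Lipschitz bound for the transported normal and tangency, uniform in time. -/
lemma exists_flowUnitNormal_bounds : ∃ L > 0, ∀ t ∈ Icc 0 S.T, ∀ z ∈ S.Γ 0, ∀ y ∈ S.Γ 0,
    ‖S.flowUnitNormal t z - S.flowUnitNormal t y‖ ≤ L * ‖z - y‖ ∧
    |inner ℝ (S.Φ t y - S.Φ t z) (S.flowUnitNormal t z)| ≤ L * ‖y - z‖ ^ 2 := by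
  obtain ⟨R, hR⟩ := S.isCompact_Γ.isBounded.subset_closedBall (0 : E3)
  obtain ⟨L, hL, hb⟩ := S.flow_regular.exists_bounds R
  obtain ⟨c, hc, hlow⟩ := S.exists_flowNormal_lower_bound
  obtain ⟨B, hB, hn⟩ := exists_normal_bounds (S.domain 0 S.zero_mem) (by norm_num)
    (S.normal_spec 0 S.zero_mem)
  have hn1 : ∀ z ∈ S.Γ 0, ‖S.normal 0 z‖ = 1 := fun z hz =>
    norm_outwardNormal (S.normal_spec 0 S.zero_mem) hz
  refine ⟨2 / c * (3 * (L + L) * L + 3 * L ^ 2 * B) + (L + c⁻¹ * (L ^ 3 * B)), by positivity,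
    fun t ht z hz y hy => ⟨?_, ?_⟩⟩
  · have h1 : ‖S.flowNormal t z - S.flowNormal t y‖ ≤
        (3 * (L + L) * L + 3 * L ^ 2 * B) * ‖z - y‖ := by
      have e : S.flowNormal t z - S.flowNormal t y =
          (cofac (fderiv ℝ (S.Φ t) z) (S.normal 0 z) - cofac (fderiv ℝ (S.Φ t) y) (S.normal 0 z)) +
          cofac (fderiv ℝ (S.Φ t) y) (S.normal 0 z - S.normal 0 y) := by
        rw [← cofac_sub, flowNormal, flowNormal]; abel
      rw [e]
      refine (norm_add_le _ _).trans ((add_le_add (norm_cofac_sub_le _ _ _)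
        (norm_cofac_le _ _)).trans ?_)
      rw [hn1 z hz, mul_one]
      have e1 := (hb t ht z (hR hz) y (hR hy)).1
      have e2 := (hb t ht y (hR hy) z (hR hz)).1
      have e3 := (hb t ht z (hR hz) y (hR hy)).2.1
      have e4 := (hn z hz y hy).1
      calc _ ≤ 3 * (L + L) * (L * ‖z - y‖) + 3 * L ^ 2 * (B * ‖z - y‖) := by gcongr
        _ = _ := by ring
    refine (norm_unitize_sub_le _ hc (hlow t ht z hz)).trans ?_
    calc _ ≤ 2 / c * ((3 * (L + L) * L + 3 * L ^ 2 * B) * ‖z - y‖) := by gcongr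
      _ = 2 / c * (3 * (L + L) * L + 3 * L ^ 2 * B) * ‖z - y‖ := by ring
      _ ≤ _ := by
        refine mul_le_mul_of_nonneg_right ?_ (norm_nonneg _)
        have : 0 ≤ L + c⁻¹ * (L ^ 3 * B) := by positivity
        linarith
  · have hu := norm_unitize_le (S.flowNormal t z)
    have hd := (hb t ht z (hR hz) y (hR hy)).1
    -- The cofactor identity reduces the linear part to the determinant times the product of y - z
    -- with the normal at time zero, which is quadratic in the distance.
    have e1 : |inner ℝ (fderiv ℝ (S.Φ t) z (y - z)) (S.flowUnitNormal t z)| ≤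
        c⁻¹ * (L ^ 3 * B) * ‖y - z‖ ^ 2 := by
      rw [flowUnitNormal, unitize, inner_smul_right, flowNormal, inner_cofac, abs_mul, abs_mul,
        abs_inv, abs_norm]
      have d1 : ∀ i : Fin 3, ‖fderiv ℝ (S.Φ t) z (EuclideanSpace.single i 1)‖ ≤ L := fun i =>
        (by simpa using (fderiv ℝ (S.Φ t) z).le_opNorm (EuclideanSpace.single i 1) :
          ‖fderiv ℝ (S.Φ t) z (EuclideanSpace.single i 1)‖ ≤ ‖fderiv ℝ (S.Φ t) z‖).trans hd
      have d2 : |inner ℝ (fderiv ℝ (S.Φ t) z (EuclideanSpace.single 0 1))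
          (cross3 (fderiv ℝ (S.Φ t) z (EuclideanSpace.single 1 1))
            (fderiv ℝ (S.Φ t) z (EuclideanSpace.single 2 1)))| ≤ L ^ 3 := by
        refine (abs_real_inner_le_norm _ _).trans ?_
        calc _ ≤ L * (L * L) := mul_le_mul (d1 0) ((norm_cross3_le _ _).trans
              (mul_le_mul (d1 1) (d1 2) (norm_nonneg _) hL.le)) (norm_nonneg _) hL.le
          _ = L ^ 3 := by ring
      have d3 : ‖cofac (fderiv ℝ (S.Φ t) z) (S.normal 0 z)‖⁻¹ ≤ c⁻¹ :=
        inv_anti₀ hc (hlow t ht z hz)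
      calc _ ≤ c⁻¹ * (L ^ 3 * (B * ‖y - z‖ ^ 2)) := by
            have := (hn z hz y hy).2
            gcongr
        _ = _ := by ring
    have e2 : |inner ℝ (S.Φ t y - S.Φ t z - fderiv ℝ (S.Φ t) z (y - z)) (S.flowUnitNormal t z)| ≤
        L * ‖y - z‖ ^ 2 := by
      refine (abs_real_inner_le_norm _ _).trans ?_
      exact (mul_le_of_le_one_right (norm_nonneg _) hu).trans
        (hb t ht z (hR hz) y (hR hy)).2.2.2
    have e3 : inner ℝ (S.Φ t y - S.Φ t z) (S.flowUnitNormal t z) =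
        inner ℝ (S.Φ t y - S.Φ t z - fderiv ℝ (S.Φ t) z (y - z)) (S.flowUnitNormal t z) +
        inner ℝ (fderiv ℝ (S.Φ t) z (y - z)) (S.flowUnitNormal t z) := by
      rw [← inner_add_left]; congr 1; abel
    rw [e3]
    refine (abs_add_le _ _).trans ((add_le_add e2 e1).trans ?_)
    rw [← add_mul]
    refine mul_le_mul_of_nonneg_right ?_ (by positivity)
    have : 0 ≤ 2 / c * (3 * (L + L) * L + 3 * L ^ 2 * B) := by positivity
    linarith

end EvolvingSurface

/-! ### Geometry of the elements of the discrete surface -/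

namespace Triangulation

variable {Γ : Set E3} (M : Triangulation Γ)

/-- Projection of the flat element `K` to the surface. -/
noncomputable def proj (K : Fin M.nK) (x : R2) : E3 := closestPoint Γ (M.pt K x)

lemma proj_spec (K : Fin M.nK) {x : R2} (hx : x ∈ refTriangle) :
    M.proj K x ∈ Γ ∧ dist (M.pt K x) (M.proj K x) = Metric.infDist (M.pt K x) Γ :=
  Classical.epsilon_spec (p := fun y => y ∈ Γ ∧ dist (M.pt K x) y = Metric.infDist (M.pt K x) Γ)
    (M.proj_unique K _ (M.pt_mem_convexHull K hx)).exists

lemma proj_refVtx (K : Fin M.nK) (l : Fin 3) : M.proj K (refVtx l) = M.vert (M.tri K l) := by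
  have h := (M.proj_spec K (refVtx_mem l)).2
  rw [pt_refVtx, Metric.infDist_zero_of_mem (M.vert_mem _), dist_eq_zero] at h
  exact h.symm

lemma dist_proj_le (K : Fin M.nK) {x : R2} (hx : x ∈ refTriangle) {y : E3} (hy : y ∈ Γ) :
    ‖M.pt K x - M.proj K x‖ ≤ ‖M.pt K x - y‖ := by
  rw [← dist_eq_norm, ← dist_eq_norm, (M.proj_spec K hx).2]
  exact Metric.infDist_le_dist_of_mem hy

lemma pt_sub_vert_le {h : ℝ} (K : Fin M.nK)
    (hh : ∀ l m, ‖M.vert (M.tri K l) - M.vert (M.tri K m)‖ ≤ h) {x : R2} (hx : x ∈ refTriangle)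
    (l : Fin 3) : ‖M.vert (M.tri K l) - M.pt K x‖ ≤ h := by
  have : M.vert (M.tri K l) - M.pt K x =
      ∑ j, bary x j • (M.vert (M.tri K l) - M.vert (M.tri K j)) := by
    simp only [smul_sub, Finset.sum_sub_distrib, ← Finset.sum_smul, bary_sum, one_smul, pt]
  rw [this]
  refine (norm_sum_le _ _).trans ?_
  calc _ ≤ ∑ j, bary x j * h := Finset.sum_le_sum fun j _ => by
        rw [norm_smul, Real.norm_eq_abs, abs_of_nonneg (mem_refTriangle.1 hx j)]
        exact mul_le_mul_of_nonneg_left (hh l j) (mem_refTriangle.1 hx j)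
    _ = h := by rw [← Finset.sum_mul, bary_sum, one_mul]

end Triangulation

lemma latPt_vtxIdx {k : ℕ} (hk : 1 ≤ k) (l : Fin 3) : latPt (vtxIdx k l) = refVtx l := by
  have hk' : (k : ℝ) ≠ 0 := by positivity
  refine eq_of_bary_eq fun j => ?_
  rw [bary_latPt hk, bary_refVtx]
  rcases eq_or_ne j l with rfl | h
  · simp [vtxIdx, hk']
  · simp [vtxIdx, h]

lemma locFun_affine {k : ℕ} (hk : 1 ≤ k) (a : Fin 3 → E3) (x : R2) :
    locFun (fun i : LatticeIndex k => ∑ l, bary (latPt i) l • a l) x = ∑ l, bary x l • a l := by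
  simp only [locFun, Finset.smul_sum]
  rw [Finset.sum_comm]
  refine Finset.sum_congr rfl fun l _ => ?_
  simp only [smul_smul, ← Finset.sum_smul]
  rw [interpolation_exact hk (polyDeg_mono hk (bary_mem_polyDeg l))]

lemma fderiv_affine (a : Fin 3 → E3) (x v : R2) :
    fderiv ℝ (fun x => ∑ l, bary x l • a l) x v = v 0 • (a 1 - a 0) + v 1 • (a 2 - a 0) := by
  have h0 : HasFDerivAt (fun x : R2 => x 0) (ContinuousLinearMap.proj (R := ℝ) 0 : R2 →L[ℝ] ℝ) x :=
    (ContinuousLinearMap.proj (R := ℝ) 0 : R2 →L[ℝ] ℝ).hasFDerivAt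
  have h1 : HasFDerivAt (fun x : R2 => x 1) (ContinuousLinearMap.proj (R := ℝ) 1 : R2 →L[ℝ] ℝ) x :=
    (ContinuousLinearMap.proj (R := ℝ) 1 : R2 →L[ℝ] ℝ).hasFDerivAt
  have h : HasFDerivAt (fun x : R2 => a 0 + (x 0 • (a 1 - a 0) + x 1 • (a 2 - a 0))) _ x :=
    ((h0.smul_const (a 1 - a 0)).add (h1.smul_const (a 2 - a 0))).const_add (a 0)
  have e : (fun x : R2 => ∑ l, bary x l • a l) =
      fun x : R2 => a 0 + (x 0 • (a 1 - a 0) + x 1 • (a 2 - a 0)) := by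
    funext x
    simp only [Fin.sum_univ_three, bary, Matrix.cons_val_zero, Matrix.cons_val_one,
      Matrix.cons_val]
    module
  rw [e, h.fderiv]; simp

/-- Chords of the triangle with vertices `a` that correspond to the coordinate directions. -/
def chord (a : Fin 3 → E3) (b : Fin 2) : E3 := a b.succ - a 0

/-- Twice the area N is at most the product of any two of the sides paired here, so N ≥ rP forces
every side to be at least r. Then the perimeter P is at least 3r, and N ≥ rP ≥ 3r². -/
lemma inradius_bound {a : Fin 3 → E3} {r : ℝ} (hr : 0 < r) (h : r ≤ inradius a) :
    3 * r ^ 2 ≤ ‖cross3 (chord a 0) (chord a 1)‖ := by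
  have e0 : chord a 0 = a 1 - a 0 := rfl
  have e1 : chord a 1 = a 2 - a 0 := rfl
  rw [e0, e1]
  set N := ‖cross3 (a 1 - a 0) (a 2 - a 0)‖ with hN
  set P := dist (a 0) (a 1) + dist (a 1) (a 2) + dist (a 2) (a 0) with hP
  have hin : inradius a = N / P := rfl
  have hP0 : 0 < P := by
    refine lt_of_le_of_ne (by positivity) fun h0 => ?_
    rw [hin, ← h0, div_zero] at h; linarith
  rw [hin, le_div_iff₀ hP0] at h
  have n1 : N ≤ dist (a 0) (a 1) * dist (a 2) (a 0) := by
    rw [dist_comm (a 0), dist_eq_norm, dist_eq_norm]; exact norm_cross3_le _ _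
  have n2 : N ≤ dist (a 1) (a 2) * dist (a 2) (a 0) := by
    have : cross3 (a 1 - a 0) (a 2 - a 0) = cross3 (a 1 - a 2) (a 2 - a 0) := by
      apply E3_ext <;> simp <;> ring
    rw [hN, this, dist_eq_norm, dist_eq_norm]; exact norm_cross3_le _ _
  have d0 : 0 ≤ dist (a 0) (a 1) := dist_nonneg
  have d1 : 0 ≤ dist (a 1) (a 2) := dist_nonneg
  have d2 : 0 ≤ dist (a 2) (a 0) := dist_nonneg
  have k0 : r ≤ dist (a 0) (a 1) := by
    refine le_of_mul_le_mul_right (?_ : r * P ≤ _ * P) hP0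
    nlinarith
  have k1 : r ≤ dist (a 1) (a 2) := by
    refine le_of_mul_le_mul_right (?_ : r * P ≤ _ * P) hP0
    nlinarith
  have k2 : r ≤ dist (a 2) (a 0) := by
    refine le_of_mul_le_mul_right (?_ : r * P ≤ _ * P) hP0
    nlinarith
  nlinarith

namespace EvolvingSurface

variable (S : EvolvingSurface) (M : Triangulation (S.Γ 0)) (kg : ℕ)

lemma elemMap_eq (t : ℝ) (K : Fin M.nK) :
    S.elemMap M kg t K = locFun (M.dof (S.nodePos M kg t) K) := rfl

variable {kg}

lemma dof_nodePos (hkg : 1 ≤ kg) (t : ℝ) (K : Fin M.nK) (i : LatticeIndex kg) :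
    M.dof (S.nodePos M kg t) K i = S.Φ t (M.proj K (latPt i)) := by
  rw [Triangulation.proj, Triangulation.pt_latPt M hkg]; rfl

lemma elemMap_refVtx (hkg : 1 ≤ kg) (t : ℝ) (K : Fin M.nK) (l : Fin 3) :
    S.elemMap M kg t K (refVtx l) = S.Φ t (M.vert (M.tri K l)) := by
  rw [elemMap_eq, ← latPt_vtxIdx hkg, locFun_latPt hkg, S.dof_nodePos M hkg, latPt_vtxIdx hkg,
    Triangulation.proj_refVtx]

/-- The vertices of the element `K` at time `t`. -/
def vtx (t : ℝ) (K : Fin M.nK) (l : Fin 3) : E3 := S.Φ t (M.vert (M.tri K l))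

variable {M}

lemma vtx_sub_le (hkg : 1 ≤ kg) {h : ℝ} (hh : S.IsMeshSize M kg h) {t : ℝ} (ht : t ∈ Icc 0 S.T)
    (K : Fin M.nK) (l m : Fin 3) : ‖S.vtx M t K l - S.vtx M t K m‖ ≤ h := by
  have hb : Bornology.IsBounded (S.elem M kg t K) := by
    refine (isCompact_refTriangle.image ?_).isBounded
    rw [elemMap_eq]; exact continuous_locFun _
  have h1 : dist (S.vtx M t K l) (S.vtx M t K m) ≤ Metric.diam (S.elem M kg t K) :=
    Metric.dist_le_diam_of_mem hb
      ⟨refVtx l, Triangulation.refVtx_mem l, S.elemMap_refVtx M hkg t K l⟩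
      ⟨refVtx m, Triangulation.refVtx_mem m, S.elemMap_refVtx M hkg t K m⟩
  rw [← dist_eq_norm]
  exact h1.trans (hh.1 ⟨t, ht, K, rfl⟩)

lemma flow_zero_vert (j : Fin M.nV) : S.Φ 0 (M.vert j) = M.vert j := S.flow_zero _ (M.vert_mem j)

lemma vert_sub_le (hkg : 1 ≤ kg) {h : ℝ} (hh : S.IsMeshSize M kg h)
    (K : Fin M.nK) (l m : Fin 3) : ‖M.vert (M.tri K l) - M.vert (M.tri K m)‖ ≤ h := by
  have := S.vtx_sub_le hkg hh S.zero_mem K l m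
  rwa [vtx, vtx, flow_zero_vert, flow_zero_vert] at this

/-- Without elements the set of diameters is empty and every real number is an upper bound, so no
least one exists. -/
lemma nK_pos {h : ℝ} (hh : S.IsMeshSize M kg h) : 0 < M.nK := by
  rcases Nat.eq_zero_or_pos M.nK with h0 | h0
  · exfalso
    have : IsEmpty (Fin M.nK) := by rw [h0]; infer_instance
    have hlub : h ≤ h - 1 := hh.2 (by rintro _ ⟨t, -, K, -⟩; exact isEmptyElim K)
    linarith
  · exact h0

lemma meshSize_pos (hkg : 1 ≤ kg) {h : ℝ} (hh : S.IsMeshSize M kg h) : 0 < h := by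
  have K : Fin M.nK := ⟨0, S.nK_pos hh⟩
  refine lt_of_lt_of_le (norm_pos_iff.2 ?_) (S.vert_sub_le hkg hh K 0 1)
  rw [sub_ne_zero]
  intro h
  exact absurd ((M.nondegenerate K).injective h) (by decide)

lemma area_bound (hkg : 1 ≤ kg) {ρ h : ℝ} (hρ : 0 < ρ) (hh : S.IsMeshSize M kg h)
    (hq : S.IsQuasiUniform M ρ h) {t : ℝ} (ht : t ∈ Icc 0 S.T) (K : Fin M.nK) :
    3 * (ρ * h) ^ 2 ≤ ‖cross3 (chord (S.vtx M t K) 0) (chord (S.vtx M t K) 1)‖ :=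
  inradius_bound (mul_pos hρ (S.meshSize_pos hkg hh)) (hq t ht K)

/-- Distance of the flat mesh from the surface. -/
lemma exists_proj_dist : ∃ C > 0, ∀ (M : Triangulation (S.Γ 0)) (h : ℝ),
    (∀ K l m, ‖M.vert (M.tri K l) - M.vert (M.tri K m)‖ ≤ h) → C * h ≤ 1 →
    ∀ K, ∀ x ∈ refTriangle, ‖M.pt K x - M.proj K x‖ ≤ C * h ^ 2 := by
  obtain ⟨C, hC, h⟩ := exists_flat_triangle_dist (S.domain 0 S.zero_mem) (by norm_num)
    (S.normal_spec 0 S.zero_mem)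
  refine ⟨C, hC, fun M r hr hr1 K x hx => ?_⟩
  obtain ⟨y, hy, hy'⟩ := h (fun l => M.vert (M.tri K l)) (bary x) r (fun l => M.vert_mem _)
    (mem_refTriangle.1 hx) (bary_sum x) (hr K) hr1
  exact (M.dist_proj_le K hx hy).trans hy'

/-- Deviation of the geometric nodes from the affine interpolant of the vertices. -/
lemma exists_node_deviation : ∃ C > 0, ∀ (M : Triangulation (S.Γ 0)) (h : ℝ),
    (∀ K l m, ‖M.vert (M.tri K l) - M.vert (M.tri K m)‖ ≤ h) → C * h ≤ 1 →
    ∀ K, ∀ x ∈ refTriangle, ‖M.proj K x - M.vert (M.tri K 0)‖ ≤ 2 * h ∧ ∀ t ∈ Icc 0 S.T,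
      ‖S.Φ t (M.proj K x) - ∑ l, bary x l • S.vtx M t K l‖ ≤ C * h ^ 2 := by
  obtain ⟨C, hC, hpd⟩ := S.exists_proj_dist
  obtain ⟨R, hR⟩ := S.isCompact_Γ.isBounded.subset_closedBall (0 : E3)
  obtain ⟨L, hL, hb⟩ := S.flow_regular.exists_bounds R
  refine ⟨C + L * C + L, by positivity, fun M h hh hh1 K x hx => ?_⟩
  have hh0 : 0 ≤ h := (norm_nonneg _).trans (hh K 0 0)
  have hCh : C * h ≤ 1 := by
    have : 0 ≤ (L * C + L) * h := by positivity
    linarith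
  have hp := hpd M h hh hCh K x hx
  have hv := fun l => M.pt_sub_vert_le K (hh K) hx l
  constructor
  · have e : M.proj K x - M.vert (M.tri K 0) =
        -(M.pt K x - M.proj K x) - (M.vert (M.tri K 0) - M.pt K x) := by abel
    rw [e]
    refine (norm_sub_le _ _).trans ?_
    rw [norm_neg]
    have := hv 0
    nlinarith
  · intro t ht
    set p := M.pt K x with hpdef
    have hvR : ∀ l, M.vert (M.tri K l) ∈ Metric.closedBall (0 : E3) R := fun l => hR (M.vert_mem _)
    -- The flat point p is off the surface in general; the convex ball contains it and is where the
    -- derivative bounds of the ambient flow hold.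
    have hpR : p ∈ Metric.closedBall (0 : E3) R :=
      (convex_closedBall (0 : E3) R).sum_mem (fun l _ => mem_refTriangle.1 hx l) (bary_sum x)
        fun l _ => hvR l
    have e1 : ‖S.Φ t (M.proj K x) - S.Φ t p‖ ≤ L * (C * h ^ 2) := by
      refine ((hb t ht _ (hR (M.proj_spec K hx).1) _ hpR).2.2.1).trans ?_
      rw [norm_sub_rev]; gcongr
    -- The linear Taylor terms at p cancel in the barycentric combination, leaving a deviation of
    -- second order.
    have e2 : S.Φ t p - ∑ l, bary x l • S.vtx M t K l = -∑ l, bary x l •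
        (S.Φ t (M.vert (M.tri K l)) - S.Φ t p - fderiv ℝ (S.Φ t) p (M.vert (M.tri K l) - p)) := by
      have hz : ∑ l, bary x l • fderiv ℝ (S.Φ t) p (M.vert (M.tri K l) - p) = 0 := by
        simp only [← map_smul]
        rw [← map_sum]
        simp only [smul_sub, Finset.sum_sub_distrib, ← Finset.sum_smul, bary_sum, one_smul]
        rw [show ∑ l, bary x l • M.vert (M.tri K l) = p from rfl, sub_self, map_zero]
      simp only [smul_sub (bary x _) (_ - _), Finset.sum_sub_distrib, hz, sub_zero]
      simp only [smul_sub, Finset.sum_sub_distrib, ← Finset.sum_smul, bary_sum, one_smul, neg_sub]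
      rfl
    have e3 : ‖S.Φ t p - ∑ l, bary x l • S.vtx M t K l‖ ≤ L * h ^ 2 := by
      rw [e2, norm_neg]
      refine (norm_sum_le _ _).trans ?_
      calc _ ≤ ∑ l, bary x l * (L * h ^ 2) := Finset.sum_le_sum fun l _ => by
            rw [norm_smul, Real.norm_eq_abs, abs_of_nonneg (mem_refTriangle.1 hx l)]
            refine mul_le_mul_of_nonneg_left ?_ (mem_refTriangle.1 hx l)
            refine (hb t ht p hpR _ (hvR l)).2.2.2.trans ?_
            have := hv l
            gcongr
        _ = L * h ^ 2 := by rw [← Finset.sum_mul, bary_sum, one_mul]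
    have e4 := norm_sub_le_norm_sub_add_norm_sub (S.Φ t (M.proj K x)) (S.Φ t p)
      (∑ l, bary x l • S.vtx M t K l)
    have : 0 ≤ C * h ^ 2 := by positivity
    linarith

lemma tangentVec_elemMap (M : Triangulation (S.Γ 0)) (t : ℝ) (K : Fin M.nK) (x : R2) (b : Fin 2) :
    tangentVec (S.elemMap M kg t K) x b =
      ∑ i, fderiv ℝ (shape kg i.1) x (Pi.single b 1) • M.dof (S.nodePos M kg t) K i := by
  rw [tangentVec, elemMap_eq, fderiv_locFun]

/-- Tangent vectors of the elements, their difference from the chords and their time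
increments. -/
lemma exists_tangentVec_bounds (hkg : 1 ≤ kg) : ∃ C > 0, ∀ (M : Triangulation (S.Γ 0)) (h : ℝ),
    S.IsMeshSize M kg h → C * h ≤ 1 → ∀ K, ∀ x ∈ refTriangle, ∀ b, ∀ t ∈ Icc 0 S.T,
      ‖tangentVec (S.elemMap M kg t K) x b - chord (S.vtx M t K) b‖ ≤ C * h ^ 2 ∧
      ∀ s ∈ Icc 0 S.T, ‖tangentVec (S.elemMap M kg t K) x b -
        tangentVec (S.elemMap M kg s K) x b‖ ≤ C * |t - s| * h := by
  obtain ⟨C, hC, hdev⟩ := S.exists_node_deviation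
  obtain ⟨D, hD, hfd⟩ := exists_fderiv_locFun_bound E3 hkg
  obtain ⟨R, hR⟩ := S.isCompact_Γ.isBounded.subset_closedBall (0 : E3)
  obtain ⟨L, hL, hinc⟩ := S.exists_increment_bound R
  set q := √(Fintype.card (LatticeIndex kg)) with hq
  have hq0 : 0 ≤ q := Real.sqrt_nonneg _
  refine ⟨C + D * (q * (2 * C)) + D * (q * (2 * L)), by positivity, fun M h hh hh1 K x hx b t ht => ?_⟩
  have hh0 : 0 < h := S.meshSize_pos hkg hh
  have hCh : C * h ≤ 1 := by
    have : 0 ≤ (D * (q * (2 * C)) + D * (q * (2 * L))) * h := by positivity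
    nlinarith
  have hdv := hdev M h (fun K l m => S.vert_sub_le hkg hh K l m) hCh K
  have hs1 : ‖(Pi.single b 1 : R2)‖ ≤ 1 := by
    rw [Pi.norm_single]; simp
  constructor
  · set w : LatticeIndex kg → E3 := fun i => ∑ l, bary (latPt i) l • S.vtx M t K l with hw
    set z := M.dof (S.nodePos M kg t) K with hz
    -- The chords are the derivatives of the affine interpolant of the vertices, which Lagrange
    -- interpolation reproduces; the difference is the derivative of a polynomial with nodal values
    -- O(h²).
    have e1 : tangentVec (S.elemMap M kg t K) x b - chord (S.vtx M t K) b =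
        fderiv ℝ (locFun fun i => z i - w i) x (Pi.single b 1) := by
      have h1 : chord (S.vtx M t K) b = fderiv ℝ (locFun w) x (Pi.single b 1) := by
        have : locFun w = fun x => ∑ l, bary x l • S.vtx M t K l := by
          funext y; exact locFun_affine hkg _ y
        rw [this, fderiv_affine]
        fin_cases b <;> simp [chord]
      rw [h1, tangentVec, elemMap_eq, ← hz, fderiv_locFun, fderiv_locFun, fderiv_locFun,
        ← Finset.sum_sub_distrib]
      simp only [smul_sub]
    rw [e1]
    refine (ContinuousLinearMap.le_opNorm _ _).trans ((mul_le_of_le_one_right (norm_nonneg _)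
      hs1).trans ((hfd _ x hx).trans ?_))
    have hb : ∀ i, ‖z i - w i‖ ≤ C * h ^ 2 := fun i => by
      rw [hz, S.dof_nodePos M hkg]; exact (hdv _ (latPt_mem hkg i)).2 t ht
    have hosc : oscNorm (fun i => z i - w i) ≤ q * (2 * C * h ^ 2) := by
      refine dofNorm_le (by positivity) fun i => (norm_sub_le _ _).trans ?_
      have := hb i; have := hb (vtxIdx kg 0); linarith
    calc D * oscNorm (fun i => z i - w i) ≤ D * (q * (2 * C * h ^ 2)) := by gcongr
      _ = D * (q * (2 * C)) * h ^ 2 := by ring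
      _ ≤ _ := by
        refine mul_le_mul_of_nonneg_right ?_ (by positivity)
        have : 0 ≤ D * (q * (2 * L)) := by positivity
        linarith
  · intro s hs
    set z := M.dof (S.nodePos M kg t) K with hz
    set w := M.dof (S.nodePos M kg s) K with hw
    have e1 : tangentVec (S.elemMap M kg t K) x b - tangentVec (S.elemMap M kg s K) x b =
        fderiv ℝ (locFun fun i => z i - w i) x (Pi.single b 1) := by
      rw [tangentVec_elemMap, tangentVec_elemMap, fderiv_locFun, ← Finset.sum_sub_distrib]
      simp only [smul_sub, hz, hw]
    rw [e1]
    refine (ContinuousLinearMap.le_opNorm _ _).trans ((mul_le_of_le_one_right (norm_nonneg _)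
      hs1).trans ((hfd _ x hx).trans ?_))
    -- The oscillation compares each node with a vertex of the same element. Increments of the flow
    -- are Lipschitz in space with constant L|t - s|, so both factors |t - s| and h are gained.
    have hosc : oscNorm (fun i => z i - w i) ≤ q * (2 * L * |t - s| * h) := by
      refine dofNorm_le (by positivity) fun i => ?_
      have h1 := (hdv _ (latPt_mem hkg i)).1
      have h2 := hinc t ht s hs _ (hR (M.proj_spec K (latPt_mem hkg i)).1) _
        (hR (M.vert_mem (M.tri K 0)))
      simp only [hz, hw, S.dof_nodePos M hkg, latPt_vtxIdx hkg, Triangulation.proj_refVtx]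
      calc _ = ‖(S.Φ t (M.proj K (latPt i)) - S.Φ t (M.vert (M.tri K 0))) -
            (S.Φ s (M.proj K (latPt i)) - S.Φ s (M.vert (M.tri K 0)))‖ := by congr 1; abel
        _ ≤ L * |t - s| * (2 * h) := h2.trans (by gcongr)
        _ = _ := by ring
    calc D * oscNorm (fun i => z i - w i) ≤ D * (q * (2 * L * |t - s| * h)) := by gcongr
      _ = D * (q * (2 * L)) * (|t - s| * h) := by ring
      _ ≤ _ := by
        rw [mul_assoc _ |t - s| h]
        refine mul_le_mul_of_nonneg_right ?_ (by positivity)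
        have : 0 ≤ D * (q * (2 * C)) := by positivity
        linarith

end EvolvingSurface

/-- The vector product is the sine of the angle, so the cosine c is nonzero. With the sign that
makes the angle acute the squared distance is 2 - 2|c| ≤ 2(1 - c²), twice the squared sine. -/
lemma norm_sign_unitize_sub_le {N ν : E3} {δ : ℝ} (hν : ‖ν‖ = 1) (hN : N ≠ 0)
    (h : ‖cross3 ν (unitize N)‖ ≤ δ) (hδ : δ ≤ 1 / 2) :
    inner ℝ N ν ≠ 0 ∧ ‖Real.sign (inner ℝ N ν) • unitize N - ν‖ ≤ 2 * δ := by
  have hu : ‖unitize N‖ = 1 := norm_unitize hN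
  have hN0 : 0 < ‖N‖ := norm_pos_iff.2 hN
  have hδ0 : 0 ≤ δ := (norm_nonneg _).trans h
  set c := inner ℝ ν (unitize N) with hc
  have h1 : c ^ 2 = 1 - ‖cross3 ν (unitize N)‖ ^ 2 := by
    rw [norm_cross3_sq, hν, hu]; ring
  have h2 : ‖cross3 ν (unitize N)‖ ^ 2 ≤ δ ^ 2 := pow_le_pow_left₀ (norm_nonneg _) h 2
  have h3 : inner ℝ N ν = ‖N‖ * c := by
    conv_lhs => rw [← norm_smul_unitize N]
    rw [real_inner_smul_left, real_inner_comm]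
  have hc0 : c ≠ 0 := by
    intro h0
    rw [h0] at h1
    nlinarith
  have hc1 : |c| ≤ 1 := by
    have := abs_real_inner_le_norm ν (unitize N)
    rwa [hν, hu, one_mul] at this
  refine ⟨by rw [h3]; exact mul_ne_zero hN0.ne' hc0, ?_⟩
  have hs : ∀ s : ℝ, s ^ 2 = 1 → s * c = |c| → ‖s • unitize N - ν‖ ≤ 2 * δ := by
    intro s hs1 hs2
    refine le_of_sq_le_sq ?_ (by positivity)
    rw [norm_sub_sq_real, norm_smul, hu, mul_one, Real.norm_eq_abs, sq_abs, hs1, hν,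
      real_inner_smul_left, real_inner_comm, ← hc, hs2]
    have := sq_abs c
    nlinarith [abs_nonneg c]
  rcases lt_or_gt_of_ne hc0 with hneg | hpos
  · rw [h3, Real.sign_of_neg (mul_neg_of_pos_of_neg hN0 hneg)]
    exact hs _ (by norm_num) (by rw [abs_of_neg hneg]; ring)
  · rw [h3, Real.sign_of_pos (mul_pos hN0 hpos)]
    exact hs _ (by norm_num) (by rw [abs_of_pos hpos]; ring)

lemma IsPreconnected.sign_eq {X : Type*} [TopologicalSpace X] {s : Set X} (hs : IsPreconnected s)
    {f : X → ℝ} (hf : ContinuousOn f s) (h0 : ∀ x ∈ s, f x ≠ 0) {x y : X} (hx : x ∈ s)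
    (hy : y ∈ s) : Real.sign (f x) = Real.sign (f y) := by
  have key : ∀ a ∈ s, ∀ b ∈ s, f a < 0 → ¬ 0 < f b := by
    intro a ha b hb h1 h2
    obtain ⟨c, hc, hc0⟩ := hs.intermediate_value ha hb hf ⟨h1.le, h2.le⟩
    exact h0 c hc hc0
  rcases lt_or_gt_of_ne (h0 x hx) with h1 | h1 <;> rcases lt_or_gt_of_ne (h0 y hy) with h2 | h2
  · rw [Real.sign_of_neg h1, Real.sign_of_neg h2]
  · exact absurd h2 (key x hx y hy h1)
  · exact absurd h1 (key y hy x hx h2)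
  · rw [Real.sign_of_pos h1, Real.sign_of_pos h2]

namespace EvolvingSurface

variable (S : EvolvingSurface) (M : Triangulation (S.Γ 0)) (kg : ℕ)

/-- The uniform geometric properties of the discrete evolving surface. -/
structure MeshGeom (h C : ℝ) : Prop where
  C_pos : 0 < C
  h_pos : 0 < h
  tang_le : ∀ t ∈ Icc 0 S.T, ∀ K, ∀ x ∈ refTriangle, ∀ b,
    ‖tangentVec (S.elemMap M kg t K) x b‖ ≤ C * h
  normal_ge : ∀ t ∈ Icc 0 S.T, ∀ K, ∀ x ∈ refTriangle,
    C⁻¹ * h ^ 2 ≤ ‖normalVec (S.elemMap M kg t K) x‖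
  tang_diff : ∀ t ∈ Icc 0 S.T, ∀ s ∈ Icc 0 S.T, ∀ K, ∀ x ∈ refTriangle, ∀ b,
    ‖tangentVec (S.elemMap M kg t K) x b - tangentVec (S.elemMap M kg s K) x b‖ ≤ C * |t - s| * h
  tang_chord : ∀ t ∈ Icc 0 S.T, ∀ K, ∀ x ∈ refTriangle, ∀ b,
    ‖tangentVec (S.elemMap M kg t K) x b - chord (S.vtx M t K) b‖ ≤ C * h ^ 2
  vtx_le : ∀ t ∈ Icc 0 S.T, ∀ K l m, ‖S.vtx M t K l - S.vtx M t K m‖ ≤ h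
  vtx_orth : ∀ t ∈ Icc 0 S.T, ∀ K l,
    |inner ℝ (S.vtx M t K l - S.vtx M t K 0) (S.normal t (S.vtx M t K 0))| ≤ C * h ^ 2
  norm_normal : ∀ t ∈ Icc 0 S.T, ∀ z ∈ S.Γ 0, ‖S.normal t (S.Φ t z)‖ = 1
  node_normal : ∀ t ∈ Icc 0 S.T, ∀ K, ∀ x ∈ refTriangle,
    ‖S.normal t (S.Φ t (M.proj K x)) - S.normal t (S.vtx M t K 0)‖ ≤ C * h
  disc_normal : ∀ t ∈ Icc 0 S.T, ∀ K, ∀ x ∈ refTriangle,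
    ‖S.discNormal M kg t K x - S.normal t (S.vtx M t K 0)‖ ≤ C * h
  -- The orientation of the parametrization of K relative to the normal is constant on the element,
  -- and its dependence on time is one global sign σ; ε does not depend on time.
  sign : ∃ ε : Fin M.nK → ℝ, (∀ K, |ε K| ≤ 1) ∧ ∀ t ∈ Icc 0 S.T, ∃ σ : ℝ, (σ = 1 ∨ σ = -1) ∧
    ∀ K, ∀ x ∈ refTriangle, Real.sign (inner ℝ (normalVec (S.elemMap M kg t K) x)
      (S.normal t (S.vtx M t K 0))) = σ * ε K

variable {kg}

lemma continuousOn_flow_time (z : E3) : ContinuousOn (fun t => S.Φ t z) (Icc 0 S.T) :=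
  fun t ht => (S.flow_deriv t ht z).continuousWithinAt

lemma continuousOn_tangentVec (K : Fin M.nK) (b : Fin 2) :
    ContinuousOn (fun p : ℝ × R2 => tangentVec (S.elemMap M kg p.1 K) p.2 b)
      (Icc 0 S.T ×ˢ refTriangle) := by
  simp only [tangentVec_elemMap]
  refine continuousOn_finsetSum _ fun i _ => ?_
  have h1 : ContinuousOn (fun p : ℝ × R2 => fderiv ℝ (shape kg i.1) p.2 (Pi.single b 1))
      (Icc 0 S.T ×ˢ refTriangle) :=
    (((contDiff_shape i (n := 1)).continuous_fderiv one_ne_zero).clm_apply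
      continuous_const |>.comp continuous_snd).continuousOn
  have h2 : ContinuousOn (fun p : ℝ × R2 => M.dof (S.nodePos M kg p.1) K i)
      (Icc 0 S.T ×ˢ refTriangle) :=
    ContinuousOn.comp (g := fun t => S.Φ t (closestPoint (S.Γ 0) (M.node kg K i).1))
      (S.continuousOn_flow_time _) continuousOn_fst fun p hp => hp.1
  exact h1.smul h2

lemma exists_meshGeom (hkg : 1 ≤ kg) {ρ : ℝ} (hρ : 0 < ρ) : ∃ C > 0, ∃ h₀ > 0,
    ∀ (M : Triangulation (S.Γ 0)) (h : ℝ), S.IsMeshSize M kg h → S.IsQuasiUniform M ρ h →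
      h < h₀ → S.MeshGeom M kg h C := by
  obtain ⟨C₁, hC₁, htv⟩ := S.exists_tangentVec_bounds hkg
  obtain ⟨L, hL, hun⟩ := S.exists_flowUnitNormal_bounds
  obtain ⟨C₀, hC₀, hdev⟩ := S.exists_node_deviation
  set C₂ := C₁ + L with hC₂
  set C₃ := 4 * C₂ / ρ ^ 2 with hC₃
  have hC₂0 : 0 < C₂ := by positivity
  have hC₃0 : 0 < C₃ := by positivity
  set C := 2 + (ρ ^ 2)⁻¹ + C₁ + L + 2 * L + 2 * C₃ with hC
  have hC0 : 0 < C := by positivity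
  set B := C₁ + C₀ + 3 * C₁ / (2 * ρ ^ 2) + 2 * C₃ with hB
  have hB0 : 0 < B := by positivity
  -- The bound B h ≤ 1 contains the conditions `s1` to `s4`: applicability of the two node
  -- estimates, a loss of at most two thirds of the flat area, and a normal deviation of at most one
  -- half.
  refine ⟨C, hC0, B⁻¹, by positivity, fun M h hh hq hlt => ?_⟩
  have hh0 : 0 < h := S.meshSize_pos hkg hh
  have hBh : B * h ≤ 1 := by
    rw [lt_inv_comm₀ hh0 hB0] at hlt
    calc B * h ≤ h⁻¹ * h := by gcongr
      _ = 1 := inv_mul_cancel₀ hh0.ne'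
  have p1 : 0 < C₁ * h := by positivity
  have p2 : 0 < C₀ * h := by positivity
  have p3 : 0 < 3 * C₁ / (2 * ρ ^ 2) * h := by positivity
  have p4 : 0 < C₃ * h := by positivity
  have hsplit : C₁ * h + C₀ * h + 3 * C₁ / (2 * ρ ^ 2) * h + 2 * (C₃ * h) ≤ 1 := by
    rw [hB] at hBh; linarith
  have s1 : C₁ * h ≤ 1 := by linarith
  have s2 : C₀ * h ≤ 1 := by linarith
  have s3 : 3 * C₁ * h ≤ 2 * ρ ^ 2 := by
    have : 3 * C₁ / (2 * ρ ^ 2) * h ≤ 1 := by linarith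
    rw [div_mul_eq_mul_div, div_le_one (by positivity)] at this; exact this
  have s4 : C₃ * h ≤ 1 / 2 := by linarith
  have htv' := htv M h hh s1
  have hvl : ∀ t ∈ Icc 0 S.T, ∀ K l m, ‖S.vtx M t K l - S.vtx M t K m‖ ≤ h :=
    fun t ht K l m => S.vtx_sub_le hkg hh ht K l m
  have hch : ∀ t ∈ Icc 0 S.T, ∀ K b, ‖chord (S.vtx M t K) b‖ ≤ h := fun t ht K b => hvl t ht K _ _
  have htl : ∀ t ∈ Icc 0 S.T, ∀ K, ∀ x ∈ refTriangle, ∀ b,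
      ‖tangentVec (S.elemMap M kg t K) x b‖ ≤ 2 * h := by
    intro t ht K x hx b
    have e1 := (htv' K x hx b t ht).1
    have e2 := hch t ht K b
    have e3 := norm_le_norm_sub_add (tangentVec (S.elemMap M kg t K) x b) (chord (S.vtx M t K) b)
    nlinarith
  have hng : ∀ t ∈ Icc 0 S.T, ∀ K, ∀ x ∈ refTriangle,
      ρ ^ 2 * h ^ 2 ≤ ‖normalVec (S.elemMap M kg t K) x‖ := by
    intro t ht K x hx
    have e1 := S.area_bound hkg hρ hh hq ht K
    have e2 := norm_cross3_sub_le (tangentVec (S.elemMap M kg t K) x 0)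
      (tangentVec (S.elemMap M kg t K) x 1) (chord (S.vtx M t K) 0) (chord (S.vtx M t K) 1)
    have e3 := norm_sub_norm_le (cross3 (chord (S.vtx M t K) 0) (chord (S.vtx M t K) 1))
      (normalVec (S.elemMap M kg t K) x)
    rw [norm_sub_rev, normalVec] at e3
    have e4 : ‖tangentVec (S.elemMap M kg t K) x 0 - chord (S.vtx M t K) 0‖ *
        ‖tangentVec (S.elemMap M kg t K) x 1‖ ≤ C₁ * h ^ 2 * (2 * h) :=
      mul_le_mul (htv' K x hx 0 t ht).1 (htl t ht K x hx 1) (norm_nonneg _) (by positivity)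
    have e5 : ‖chord (S.vtx M t K) 0‖ * ‖tangentVec (S.elemMap M kg t K) x 1 -
        chord (S.vtx M t K) 1‖ ≤ h * (C₁ * h ^ 2) :=
      mul_le_mul (hch t ht K 0) (htv' K x hx 1 t ht).1 (norm_nonneg _) hh0.le
    -- The flat area 3ρ²h² loses at most 3C₁h³ ≤ 2ρ²h² when chords are replaced by tangent vectors.
    have e6 : 3 * C₁ * h * h ^ 2 ≤ 2 * ρ ^ 2 * h ^ 2 := by gcongr
    rw [normalVec]
    nlinarith
  have hn1 : ∀ t ∈ Icc 0 S.T, ∀ z ∈ S.Γ 0, ‖S.normal t (S.Φ t z)‖ = 1 := fun t ht z hz =>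
    norm_outwardNormal (S.normal_spec t ht) (S.Φ_mem ht hz)
  have hvo : ∀ t ∈ Icc 0 S.T, ∀ K l,
      |inner ℝ (S.vtx M t K l - S.vtx M t K 0) (S.normal t (S.vtx M t K 0))| ≤ L * h ^ 2 := by
    intro t ht K l
    obtain ⟨σ, hσ, hσn⟩ := S.exists_sign_normal ht
    have hσ1 : |σ| = 1 := by rcases hσ with rfl | rfl <;> simp
    have e1 := (hun t ht _ (M.vert_mem (M.tri K 0)) _ (M.vert_mem (M.tri K l))).2
    have e2 := S.vert_sub_le hkg hh K l 0
    rw [vtx, vtx, hσn _ (M.vert_mem _), inner_smul_right, abs_mul, hσ1, one_mul]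
    exact e1.trans (by gcongr)
  have hto : ∀ t ∈ Icc 0 S.T, ∀ K, ∀ x ∈ refTriangle, ∀ b,
      |inner ℝ (tangentVec (S.elemMap M kg t K) x b) (S.normal t (S.vtx M t K 0))| ≤
        C₂ * h ^ 2 := by
    intro t ht K x hx b
    have e1 : inner ℝ (tangentVec (S.elemMap M kg t K) x b) (S.normal t (S.vtx M t K 0)) =
      inner ℝ (tangentVec (S.elemMap M kg t K) x b - chord (S.vtx M t K) b)
        (S.normal t (S.vtx M t K 0)) +
      inner ℝ (chord (S.vtx M t K) b) (S.normal t (S.vtx M t K 0)) := by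
      rw [← inner_add_left, sub_add_cancel]
    rw [e1, hC₂, add_mul]
    refine (abs_add_le _ _).trans (add_le_add ?_ (hvo t ht K b.succ))
    refine (abs_real_inner_le_norm _ _).trans ?_
    rw [vtx, hn1 t ht _ (M.vert_mem _), mul_one]
    exact (htv' K x hx b t ht).1
  have hN0 : ∀ t ∈ Icc 0 S.T, ∀ K, ∀ x ∈ refTriangle, normalVec (S.elemMap M kg t K) x ≠ 0 := by
    intro t ht K x hx h0
    have := hng t ht K x hx
    rw [h0, norm_zero] at this
    have : 0 < ρ ^ 2 * h ^ 2 := by positivity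
    linarith
  have hdn : ∀ t ∈ Icc 0 S.T, ∀ K, ∀ x ∈ refTriangle,
      inner ℝ (normalVec (S.elemMap M kg t K) x) (S.normal t (S.vtx M t K 0)) ≠ 0 ∧
      ‖Real.sign (inner ℝ (normalVec (S.elemMap M kg t K) x) (S.normal t (S.vtx M t K 0))) •
        unitize (normalVec (S.elemMap M kg t K) x) - S.normal t (S.vtx M t K 0)‖ ≤
        2 * (C₃ * h) := by
    intro t ht K x hx
    refine norm_sign_unitize_sub_le (hn1 t ht _ (M.vert_mem _)) (hN0 t ht K x hx) ?_ s4
    have e1 : ‖cross3 (S.normal t (S.vtx M t K 0)) (normalVec (S.elemMap M kg t K) x)‖ ≤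
        4 * C₂ * h ^ 3 := by
      rw [normalVec, cross3_cross3_eq]
      refine (norm_sub_le _ _).trans ?_
      rw [norm_smul, norm_smul, Real.norm_eq_abs, Real.norm_eq_abs, real_inner_comm,
        real_inner_comm (tangentVec (S.elemMap M kg t K) x 0)]
      calc _ ≤ C₂ * h ^ 2 * (2 * h) + C₂ * h ^ 2 * (2 * h) :=
            add_le_add (mul_le_mul (hto t ht K x hx 1) (htl t ht K x hx 0) (norm_nonneg _)
              (by positivity)) (mul_le_mul (hto t ht K x hx 0) (htl t ht K x hx 1) (norm_nonneg _)
              (by positivity))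
        _ = _ := by ring
    rw [unitize, cross3_smul_right, norm_smul, norm_inv, norm_norm, inv_mul_le_iff₀
      (norm_pos_iff.2 (hN0 t ht K x hx))]
    refine e1.trans ?_
    calc 4 * C₂ * h ^ 3 = ρ ^ 2 * h ^ 2 * (C₃ * h) := by rw [hC₃]; field_simp
      _ ≤ _ := mul_le_mul_of_nonneg_right (hng t ht K x hx) (by positivity)
  have hCi : C⁻¹ ≤ ρ ^ 2 := by
    rw [inv_le_comm₀ hC0 (by positivity)]
    rw [hC]
    have : 0 < 2 + C₁ + L + 2 * L + 2 * C₃ := by positivity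
    linarith
  have hCpos : 0 < (ρ ^ 2)⁻¹ := by positivity
  refine ⟨hC0, hh0, ?_, ?_, ?_, ?_, hvl, ?_, hn1, ?_, ?_, ?_⟩
  · intro t ht K x hx b
    refine (htl t ht K x hx b).trans (mul_le_mul_of_nonneg_right ?_ hh0.le)
    rw [hC]; linarith
  · intro t ht K x hx
    exact (mul_le_mul_of_nonneg_right hCi (by positivity)).trans (hng t ht K x hx)
  · intro t ht s hs K x hx b
    refine ((htv' K x hx b t ht).2 s hs).trans ?_
    refine mul_le_mul_of_nonneg_right (mul_le_mul_of_nonneg_right ?_ (abs_nonneg _)) hh0.le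
    rw [hC]; linarith
  · intro t ht K x hx b
    refine (htv' K x hx b t ht).1.trans (mul_le_mul_of_nonneg_right ?_ (by positivity))
    rw [hC]; linarith
  · intro t ht K l
    refine (hvo t ht K l).trans (mul_le_mul_of_nonneg_right ?_ (by positivity))
    rw [hC]; linarith
  · intro t ht K x hx
    obtain ⟨σ, hσ, hσn⟩ := S.exists_sign_normal ht
    have hσ1 : |σ| = 1 := by rcases hσ with rfl | rfl <;> simp
    have hp := (M.proj_spec K hx).1
    have e1 := (hun t ht _ hp _ (M.vert_mem (M.tri K 0))).1
    have e2 := (hdev M h (fun K l m => S.vert_sub_le hkg hh K l m) s2 K x hx).1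
    rw [vtx, hσn _ hp, hσn _ (M.vert_mem _), ← smul_sub, norm_smul, Real.norm_eq_abs, hσ1, one_mul]
    calc _ ≤ L * (2 * h) := e1.trans (by gcongr)
      _ = 2 * L * h := by ring
      _ ≤ _ := by
        refine mul_le_mul_of_nonneg_right ?_ hh0.le
        rw [hC]; linarith
  · intro t ht K x hx
    have e1 := (hdn t ht K x hx).2
    rw [unitize, smul_smul] at e1
    refine le_trans e1 ?_
    rw [← mul_assoc]
    refine mul_le_mul_of_nonneg_right ?_ hh0.le
    rw [hC]; linarith
  -- Against the transported normal, which is continuous in time, the product never vanishes on the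
  -- connected set of times and points. Its sign is thus the value at time zero and one vertex, and
  -- only the global sign of `normal t` depends on t.
  · have hne : ∀ K, ∀ p ∈ Icc 0 S.T ×ˢ refTriangle,
        inner ℝ (normalVec (S.elemMap M kg p.1 K) p.2)
          (S.flowUnitNormal p.1 (M.vert (M.tri K 0))) ≠ 0 := by
      rintro K ⟨t, x⟩ ⟨ht, hx⟩ h0
      obtain ⟨σ, hσ, hσn⟩ := S.exists_sign_normal ht
      refine (hdn t ht K x hx).1 ?_
      rw [vtx, hσn _ (M.vert_mem _), inner_smul_right, h0, mul_zero]
    have hcont : ∀ K, ContinuousOn (fun p : ℝ × R2 => inner ℝ (normalVec (S.elemMap M kg p.1 K) p.2)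
          (S.flowUnitNormal p.1 (M.vert (M.tri K 0)))) (Icc 0 S.T ×ˢ refTriangle) := by
      intro K
      refine ContinuousOn.inner ?_ ?_
      · exact (S.continuousOn_tangentVec M K 0).cross3 (S.continuousOn_tangentVec M K 1)
      · exact ContinuousOn.comp (g := fun p : ℝ × E3 => S.flowUnitNormal p.1 p.2)
          (f := fun p : ℝ × R2 => (p.1, M.vert (M.tri K 0))) S.continuousOn_flowUnitNormal
          (by fun_prop) fun p hp => mk_mem_prod hp.1 (M.vert_mem _)
    have hpre : IsPreconnected (Icc 0 S.T ×ˢ refTriangle) :=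
      isPreconnected_Icc.prod convex_refTriangle.isPreconnected
    refine ⟨fun K => Real.sign (inner ℝ (normalVec (S.elemMap M kg 0 K) (refVtx 0))
      (S.flowUnitNormal 0 (M.vert (M.tri K 0)))), fun K => ?_, fun t ht => ?_⟩
    · simp only
      rcases Real.sign_apply_eq (inner ℝ (normalVec (S.elemMap M kg 0 K) (refVtx 0))
        (S.flowUnitNormal 0 (M.vert (M.tri K 0)))) with h | h | h <;> rw [h] <;> simp
    · obtain ⟨σ, hσ, hσn⟩ := S.exists_sign_normal ht
      refine ⟨σ, hσ, fun K x hx => ?_⟩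
      have e1 := hpre.sign_eq (hcont K) (hne K) (mk_mem_prod ht hx)
        (mk_mem_prod S.zero_mem (Triangulation.refVtx_mem 0))
      simp only at e1
      beta_reduce
      rw [vtx, hσn _ (M.vert_mem _), inner_smul_right, ← e1]
      rcases hσ with rfl | rfl
      · simp
      · rw [neg_one_mul, Real.sign_neg, neg_one_mul]

end EvolvingSurface

/-! ### Discrete norms of nodal values -/

lemma abs_sum_le_of_forall_le {ι : Type*} [Fintype ι] {f a b : ι → ℝ} {B : ℝ} (hB : 0 ≤ B)
    (h : ∀ i, |f i| ≤ B * (a i * b i)) :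
    |∑ i, f i| ≤ B * (√(∑ i, a i ^ 2) * √(∑ i, b i ^ 2)) := by
  refine (Finset.abs_sum_le_sum_abs _ _).trans ((Finset.sum_le_sum fun i _ => h i).trans ?_)
  rw [← Finset.mul_sum]
  exact mul_le_mul_of_nonneg_left (Real.sum_mul_le_sqrt_mul_sqrt _ _ _) hB

lemma exists_dofNorm_le_integral_E3 {k : ℕ} (hk : 1 ≤ k) : ∃ c > 0, ∀ z : LatticeIndex k → E3,
    c * dofNorm z ^ 2 ≤ ∫ x in refTriangle, ‖locFun z x‖ ^ 2 := by
  obtain ⟨c, hc, h⟩ := exists_dofNorm_le_integral hk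
  refine ⟨c, hc, fun z => ?_⟩
  have e1 : dofNorm z ^ 2 = ∑ j : Fin 3, dofNorm (fun i => z i j) ^ 2 := by
    simp only [dofNorm_sq, E3_norm_sq, Real.norm_eq_abs, sq_abs]
    rw [Finset.sum_comm]
    exact Finset.sum_congr rfl fun i _ => by rw [Fin.sum_univ_three]
  have e2 : ∀ x, ‖locFun z x‖ ^ 2 = ∑ j : Fin 3, locFun (fun i => z i j) x ^ 2 := by
    intro x
    have : ∀ j, locFun z x j = locFun (fun i => z i j) x := by
      intro j; simp [locFun]
    rw [E3_norm_sq, Fin.sum_univ_three]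
    simp only [this]
  simp only [e2]
  rw [e1, Finset.mul_sum, integral_finsetSum]
  · exact Finset.sum_le_sum fun j _ => h _
  · intro j _
    exact integrableOn_refTriangle ((continuous_locFun _).pow 2).continuousOn

lemma abs_integral_refTriangle_le {f : R2 → ℝ} {B : ℝ} (h : ∀ x ∈ refTriangle, |f x| ≤ B) :
    |∫ x in refTriangle, f x| ≤ B * volume.real refTriangle :=
  norm_integral_refTriangle_le (E := ℝ) (f := f) h

lemma integral_refTriangle_mono {f g : R2 → ℝ} (hf : ContinuousOn f refTriangle)
    (hg : ContinuousOn g refTriangle) (h : ∀ x ∈ refTriangle, f x ≤ g x) :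
    ∫ x in refTriangle, f x ≤ ∫ x in refTriangle, g x :=
  setIntegral_mono_on (integrableOn_refTriangle hf) (integrableOn_refTriangle hg)
    measurableSet_refTriangle h

namespace Triangulation

variable {Γ : Set E3} (M : Triangulation Γ) {E : Type} [NormedAddCommGroup E] {k : ℕ}

/-- The scaled Euclidean norm of nodal values, equivalent to the `L²` norm on a mesh of
size `h`. -/
noncomputable def meshNorm (h : ℝ) (z : M.Node k → E) : ℝ := h * √(∑ K, dofNorm (M.dof z K) ^ 2)

/-- The norm of nodal differences, equivalent to the mesh-scaled norm of the gradient. -/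
noncomputable def jumpNorm (z : M.Node k → E) : ℝ := √(∑ K, oscNorm (M.dof z K) ^ 2)

variable {M}

lemma meshNorm_nonneg {h : ℝ} (hh : 0 ≤ h) (z : M.Node k → E) : 0 ≤ M.meshNorm h z :=
  mul_nonneg hh (Real.sqrt_nonneg _)

lemma jumpNorm_nonneg (z : M.Node k → E) : 0 ≤ M.jumpNorm z := Real.sqrt_nonneg _

lemma meshNorm_sq (h : ℝ) (z : M.Node k → E) :
    M.meshNorm h z ^ 2 = h ^ 2 * ∑ K, dofNorm (M.dof z K) ^ 2 := by
  rw [meshNorm, mul_pow, Real.sq_sqrt (Finset.sum_nonneg fun _ _ => sq_nonneg _)]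

lemma jumpNorm_sq (z : M.Node k → E) : M.jumpNorm z ^ 2 = ∑ K, oscNorm (M.dof z K) ^ 2 :=
  Real.sq_sqrt (Finset.sum_nonneg fun _ _ => sq_nonneg _)

lemma meshNorm_le_of_forall {h B : ℝ} (hh : 0 ≤ h)
    (hB : 0 ≤ B) {z : M.Node k → E} {a : Fin M.nK → ℝ}
    (H : ∀ K, dofNorm (M.dof z K) ≤ B * a K) :
    M.meshNorm h z ≤ h * (B * √(∑ K, a K ^ 2)) := by
  rw [meshNorm]
  refine mul_le_mul_of_nonneg_left ?_ hh
  rw [← Real.sqrt_sq hB, ← Real.sqrt_mul (sq_nonneg B), Finset.mul_sum]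
  refine Real.sqrt_le_sqrt (Finset.sum_le_sum fun K _ => ?_)
  rw [← mul_pow]
  exact pow_le_pow_left₀ (dofNorm_nonneg _) (H K) 2

/-- Writing the quantity as a genuine norm on a nested Euclidean product gives the triangle
inequality, homogeneity and definiteness for free. -/
lemma meshNorm_eq_norm (h : ℝ) (z : M.Node k → E) :
    M.meshNorm h z = h * ‖WithLp.toLp 2 fun K => WithLp.toLp 2 (M.dof z K)‖ := by
  simp only [meshNorm, PiLp.norm_eq_of_L2, dofNorm]

lemma meshNorm_add_le {h : ℝ} (hh : 0 ≤ h) (z z' : M.Node k → E) :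
    M.meshNorm h (z + z') ≤ M.meshNorm h z + M.meshNorm h z' := by
  simp only [meshNorm_eq_norm]
  rw [← mul_add]
  exact mul_le_mul_of_nonneg_left (norm_add_le (WithLp.toLp 2 fun K => WithLp.toLp 2 (M.dof z K))
    (WithLp.toLp 2 fun K => WithLp.toLp 2 (M.dof z' K))) hh

lemma meshNorm_smul [NormedSpace ℝ E] (h a : ℝ) (z : M.Node k → E) :
    M.meshNorm h (a • z) = |a| * M.meshNorm h z := by
  simp only [meshNorm_eq_norm]
  rw [mul_left_comm, ← Real.norm_eq_abs]
  congr 1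
  exact norm_smul a (WithLp.toLp 2 fun K => WithLp.toLp 2 (M.dof z K))

lemma eq_zero_of_meshNorm_eq_zero {h : ℝ} (hh : h ≠ 0) {z : M.Node k → E}
    (hz : M.meshNorm h z = 0) : z = 0 := by
  rw [meshNorm_eq_norm, mul_eq_zero, or_iff_right hh, norm_eq_zero] at hz
  funext ⟨x, K, i, hx⟩
  subst hx
  have h1 := congrArg (fun f => (f K) i) hz
  exact h1

end Triangulation

/-! ### The bilinear forms and their change in time -/

namespace EvolvingSurface

variable {S : EvolvingSurface} {M : Triangulation (S.Γ 0)} {kg : ℕ}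

variable (S M) in
lemma continuous_tangentVec (t : ℝ) (K : Fin M.nK) (b : Fin 2) :
    Continuous fun x => tangentVec (S.elemMap M kg t K) x b :=
  continuous_fderiv_locFun (M.dof (S.nodePos M kg t) K) _

variable (S M) in
lemma continuous_normalVec (t : ℝ) (K : Fin M.nK) :
    Continuous fun x => normalVec (S.elemMap M kg t K) x :=
  (S.continuous_tangentVec M t K 0).cross3 (S.continuous_tangentVec M t K 1)

section Bounds

variable {h C : ℝ} (G : S.MeshGeom M kg h C)
include G

lemma MeshGeom.normal_le {t : ℝ} (ht : t ∈ Icc 0 S.T) (K : Fin M.nK) {x : R2}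
    (hx : x ∈ refTriangle) : ‖normalVec (S.elemMap M kg t K) x‖ ≤ C ^ 2 * h ^ 2 := by
  have h1 := G.C_pos
  have h2 := G.h_pos
  refine (norm_cross3_le _ _).trans ?_
  calc _ ≤ C * h * (C * h) := mul_le_mul (G.tang_le t ht K x hx 0) (G.tang_le t ht K x hx 1)
        (norm_nonneg _) (by positivity)
    _ = _ := by ring

lemma MeshGeom.normal_ne_zero {t : ℝ} (ht : t ∈ Icc 0 S.T) (K : Fin M.nK) {x : R2}
    (hx : x ∈ refTriangle) : normalVec (S.elemMap M kg t K) x ≠ 0 := by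
  have h1 := G.C_pos
  have h2 := G.h_pos
  have h3 := G.normal_ge t ht K x hx
  have : 0 < C⁻¹ * h ^ 2 := by positivity
  exact norm_pos_iff.1 (by linarith)

lemma MeshGeom.normal_diff {t s : ℝ} (ht : t ∈ Icc 0 S.T) (hs : s ∈ Icc 0 S.T) (K : Fin M.nK)
    {x : R2} (hx : x ∈ refTriangle) :
    ‖normalVec (S.elemMap M kg t K) x - normalVec (S.elemMap M kg s K) x‖ ≤
      2 * C ^ 2 * |t - s| * h ^ 2 := by
  have h1 := G.C_pos
  have h2 := G.h_pos
  refine (norm_cross3_sub_le _ _ _ _).trans ?_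
  calc _ ≤ C * |t - s| * h * (C * h) + C * h * (C * |t - s| * h) :=
        add_le_add (mul_le_mul (G.tang_diff t ht s hs K x hx 0) (G.tang_le t ht K x hx 1)
          (norm_nonneg _) (by positivity)) (mul_le_mul (G.tang_le s hs K x hx 0)
          (G.tang_diff t ht s hs K x hx 1) (norm_nonneg _) (by positivity))
    _ = _ := by ring

lemma MeshGeom.sqNorm_lower {E : Type} [NormedAddCommGroup E] [NormedSpace ℝ E] {k : ℕ} {c : ℝ}
    (hE : ∀ z : LatticeIndex k → E, c * dofNorm z ^ 2 ≤ ∫ x in refTriangle, ‖locFun z x‖ ^ 2)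
    {t : ℝ} (ht : t ∈ Icc 0 S.T) (z : M.Node k → E) :
    C⁻¹ * c * M.meshNorm h z ^ 2 ≤ S.surfIntegral M kg t fun K x => ‖M.localRep k z K x‖ ^ 2 := by
  have h1 := G.C_pos
  have h2 := G.h_pos
  rw [Triangulation.meshNorm_sq, ← mul_assoc, Finset.mul_sum, surfIntegral]
  refine Finset.sum_le_sum fun K _ => ?_
  rw [M.localRep_eq]
  calc C⁻¹ * c * h ^ 2 * dofNorm (M.dof z K) ^ 2 = C⁻¹ * h ^ 2 * (c * dofNorm (M.dof z K) ^ 2) := by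
        ring
    _ ≤ C⁻¹ * h ^ 2 * ∫ x in refTriangle, ‖locFun (M.dof z K) x‖ ^ 2 :=
        mul_le_mul_of_nonneg_left (hE _) (by positivity)
    _ = ∫ x in refTriangle, C⁻¹ * h ^ 2 * ‖locFun (M.dof z K) x‖ ^ 2 :=
        (integral_const_mul _ _).symm
    _ ≤ _ := by
        have hc := (continuous_locFun (M.dof z K)).norm.pow 2
        refine integral_refTriangle_mono (continuous_const.mul hc).continuousOn
          (hc.mul (S.continuous_normalVec M t K).norm).continuousOn fun x hx => ?_
        rw [mul_comm]
        exact mul_le_mul_of_nonneg_left (G.normal_ge t ht K x hx) (by positivity)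

lemma MeshGeom.sqNorm_upper {E : Type} [NormedAddCommGroup E] [NormedSpace ℝ E] {k : ℕ} {c : ℝ}
    (hE : ∀ z : LatticeIndex k → E, ∀ x ∈ refTriangle, ‖locFun z x‖ ≤ c * dofNorm z)
    {t : ℝ} (ht : t ∈ Icc 0 S.T) (z : M.Node k → E) :
    S.surfIntegral M kg t (fun K x => ‖M.localRep k z K x‖ ^ 2) ≤
      c ^ 2 * C ^ 2 * volume.real refTriangle * M.meshNorm h z ^ 2 := by
  have h1 := G.C_pos
  have h2 := G.h_pos
  rw [Triangulation.meshNorm_sq, ← mul_assoc, Finset.mul_sum, surfIntegral]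
  refine Finset.sum_le_sum fun K _ => ?_
  rw [M.localRep_eq]
  have := norm_integral_refTriangle_le (f := fun x => ‖locFun (M.dof z K) x‖ ^ 2 *
    ‖normalVec (S.elemMap M kg t K) x‖) (C := (c * dofNorm (M.dof z K)) ^ 2 * (C ^ 2 * h ^ 2)) ?_
  · refine (le_abs_self _).trans (this.trans (le_of_eq (by ring)))
  · intro x hx
    rw [Real.norm_of_nonneg (by positivity)]
    exact mul_le_mul (pow_le_pow_left₀ (norm_nonneg _) (hE _ x hx) 2) (G.normal_le ht K hx)
      (norm_nonneg _) (by positivity)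

lemma MeshGeom.abs_mForm_le {k : ℕ} {c : ℝ} (hc : 0 ≤ c)
    (hE : ∀ z : LatticeIndex k → E3, ∀ x ∈ refTriangle, ‖locFun z x‖ ≤ c * dofNorm z)
    {t : ℝ} (ht : t ∈ Icc 0 S.T) (w v : M.Node k → E3) :
    |S.mForm M kg t w v| ≤
      c ^ 2 * C ^ 2 * volume.real refTriangle * (M.meshNorm h w * M.meshNorm h v) := by
  have h1 := G.C_pos
  have h2 := G.h_pos
  have := abs_sum_le_of_forall_le (f := fun K => ∫ x in refTriangle,
    inner ℝ (M.localRep k w K x) (M.localRep k v K x) * ‖normalVec (S.elemMap M kg t K) x‖)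
    (a := fun K => dofNorm (M.dof w K)) (b := fun K => dofNorm (M.dof v K))
    (B := c ^ 2 * C ^ 2 * volume.real refTriangle * h ^ 2) (by positivity) ?_
  · refine this.trans (le_of_eq ?_)
    rw [Triangulation.meshNorm, Triangulation.meshNorm]; ring
  · intro K
    refine le_trans (b := c * dofNorm (M.dof w K) * (c * dofNorm (M.dof v K)) *
      (C ^ 2 * h ^ 2) * volume.real refTriangle)
      (abs_integral_refTriangle_le fun x hx => ?_) (le_of_eq (by ring))
    have d1 := dofNorm_nonneg (M.dof w K)
    have d2 := dofNorm_nonneg (M.dof v K)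
    rw [abs_mul, abs_norm]
    refine mul_le_mul ((abs_real_inner_le_norm _ _).trans ?_) (G.normal_le ht K hx)
      (norm_nonneg _) (by positivity)
    rw [M.localRep_eq, M.localRep_eq]
    exact mul_le_mul (hE _ x hx) (hE _ x hx) (norm_nonneg _) (by positivity)

/-- On the reference triangle the two integrands have the same nodal values; only the area elements
differ, by O(|t - s| h²). -/
lemma MeshGeom.abs_mForm_sub_le {k : ℕ} {c : ℝ} (hc : 0 ≤ c)
    (hE : ∀ z : LatticeIndex k → E3, ∀ x ∈ refTriangle, ‖locFun z x‖ ≤ c * dofNorm z)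
    {t s : ℝ} (ht : t ∈ Icc 0 S.T) (hs : s ∈ Icc 0 S.T) (w v : M.Node k → E3) :
    |S.mForm M kg t w v - S.mForm M kg s w v| ≤
      c ^ 2 * (2 * C ^ 2) * volume.real refTriangle * |t - s| *
        (M.meshNorm h w * M.meshNorm h v) := by
  have h1 := G.C_pos
  have h2 := G.h_pos
  have hint : ∀ t K, IntegrableOn (fun x => inner ℝ (M.localRep k w K x) (M.localRep k v K x) *
      ‖normalVec (S.elemMap M kg t K) x‖) refTriangle := by
    intro t K
    rw [M.localRep_eq, M.localRep_eq]
    exact integrableOn_refTriangle (((continuous_locFun _).inner (continuous_locFun _)).mul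
      (S.continuous_normalVec M t K).norm).continuousOn
  rw [mForm, mForm, surfIntegral, surfIntegral, ← Finset.sum_sub_distrib]
  have := abs_sum_le_of_forall_le (f := fun K => (∫ x in refTriangle,
    inner ℝ (M.localRep k w K x) (M.localRep k v K x) * ‖normalVec (S.elemMap M kg t K) x‖) -
    ∫ x in refTriangle,
    inner ℝ (M.localRep k w K x) (M.localRep k v K x) * ‖normalVec (S.elemMap M kg s K) x‖)
    (a := fun K => dofNorm (M.dof w K)) (b := fun K => dofNorm (M.dof v K))
    (B := c ^ 2 * (2 * C ^ 2) * volume.real refTriangle * |t - s| * h ^ 2) (by positivity) ?_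
  · refine this.trans (le_of_eq ?_)
    rw [Triangulation.meshNorm, Triangulation.meshNorm]; ring
  · intro K
    rw [← integral_sub (hint t K) (hint s K)]
    refine le_trans (b := c * dofNorm (M.dof w K) * (c * dofNorm (M.dof v K)) *
      (2 * C ^ 2 * |t - s| * h ^ 2) * volume.real refTriangle)
      (abs_integral_refTriangle_le fun x hx => ?_) (le_of_eq (by ring))
    have d1 := dofNorm_nonneg (M.dof w K)
    have d2 := dofNorm_nonneg (M.dof v K)
    rw [← mul_sub, abs_mul]
    refine mul_le_mul ((abs_real_inner_le_norm _ _).trans ?_)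
      ((abs_norm_sub_norm_le _ _).trans (G.normal_diff ht hs K hx)) (abs_nonneg _) (by positivity)
    rw [M.localRep_eq, M.localRep_eq]
    exact mul_le_mul (hE _ x hx) (hE _ x hx) (norm_nonneg _) (by positivity)

end Bounds

/-- The flux of a scalar function across the discrete surface element, `‖N‖ ∇q`. -/
noncomputable def elemFlux (S : EvolvingSurface) (M : Triangulation (S.Γ 0)) (kg : ℕ) {k : ℕ} (t : ℝ)
    (q : M.Node k → ℝ) (K : Fin M.nK) (x : R2) : E3 :=
  fluxVec (tangentVec (S.elemMap M kg t K) x 0) (tangentVec (S.elemMap M kg t K) x 1)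
    fun a => fderiv ℝ (locFun (M.dof q K)) x (Pi.single a 1)

/-- The integrand of the form `b` on the reference triangle. -/
noncomputable def bDensity (S : EvolvingSurface) (M : Triangulation (S.Γ 0)) (kg : ℕ) {ku kp kl : ℕ} (t : ℝ)
    (w : M.Node ku → E3) (q : M.Node kp → ℝ) (ξ : M.Node kl → ℝ) (K : Fin M.nK) (x : R2) : ℝ :=
  inner ℝ (locFun (M.dof w K) x) (S.elemFlux M kg t q K x) +
    Real.sign (inner ℝ (normalVec (S.elemMap M kg t K) x) (S.normal t (S.vtx M t K 0))) *
      (locFun (M.dof ξ K) x * inner ℝ (locFun (M.dof w K) x) (normalVec (S.elemMap M kg t K) x))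

section BForm

variable {h C : ℝ} (G : S.MeshGeom M kg h C) {ku kp kl : ℕ}
include G

lemma MeshGeom.continuousOn_elemFlux {t : ℝ} (ht : t ∈ Icc 0 S.T) (q : M.Node kp → ℝ)
    (K : Fin M.nK) : ContinuousOn (S.elemFlux M kg t q K) refTriangle := by
  have hN : ContinuousOn (fun x => unitize (cross3 (tangentVec (S.elemMap M kg t K) x 0)
      (tangentVec (S.elemMap M kg t K) x 1))) refTriangle :=
    ((S.continuous_normalVec M t K).norm.continuousOn.inv₀ fun x hx =>
      norm_ne_zero_iff.2 (G.normal_ne_zero ht K hx)).smul (S.continuous_normalVec M t K).continuousOn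
  have h0 : ContinuousOn (fun x => fderiv ℝ (locFun (M.dof q K)) x (Pi.single 0 1)) refTriangle :=
    (continuous_fderiv_locFun _ _).continuousOn
  have h1 : ContinuousOn (fun x => fderiv ℝ (locFun (M.dof q K)) x (Pi.single 1 1)) refTriangle :=
    (continuous_fderiv_locFun _ _).continuousOn
  exact (h0.smul ((S.continuous_tangentVec M t K 1).continuousOn.cross3 hN)).add
    (h1.smul (hN.cross3 (S.continuous_tangentVec M t K 0).continuousOn))

/-- The sign in the density is constant on each element, so the discontinuity of the sign function
plays no role; nonvanishing of N makes the unit normal continuous. -/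
lemma MeshGeom.continuousOn_bDensity {t : ℝ} (ht : t ∈ Icc 0 S.T) (w : M.Node ku → E3)
    (q : M.Node kp → ℝ) (ξ : M.Node kl → ℝ) (K : Fin M.nK) :
    ContinuousOn (S.bDensity M kg t w q ξ K) refTriangle := by
  obtain ⟨ε, -, hε⟩ := G.sign
  obtain ⟨σ, -, hσ⟩ := hε t ht
  have : ContinuousOn (fun x => inner ℝ (locFun (M.dof w K) x) (S.elemFlux M kg t q K x) +
      σ * ε K * (locFun (M.dof ξ K) x *
        inner ℝ (locFun (M.dof w K) x) (normalVec (S.elemMap M kg t K) x))) refTriangle :=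
    ((continuous_locFun _).continuousOn.inner (G.continuousOn_elemFlux ht q K)).add
      (continuous_const.mul ((continuous_locFun _).mul
        ((continuous_locFun _).inner (S.continuous_normalVec M t K)))).continuousOn
  refine this.congr fun x hx => ?_
  rw [bDensity, hσ K x hx]

lemma MeshGeom.bForm_eq {t : ℝ} (ht : t ∈ Icc 0 S.T) (w : M.Node ku → E3)
    (q : M.Node kp → ℝ) (ξ : M.Node kl → ℝ) :
    S.bForm M kg t w q ξ = ∑ K, ∫ x in refTriangle, S.bDensity M kg t w q ξ K x := by
  rw [bForm, surfIntegral, surfIntegral, ← Finset.sum_add_distrib]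
  refine Finset.sum_congr rfl fun K _ => ?_
  have e1 : ∀ x, inner ℝ (M.localRep ku w K x) (surfGrad (S.elemMap M kg t K) (M.localRep kp q K) x) *
      ‖normalVec (S.elemMap M kg t K) x‖ =
      inner ℝ (locFun (M.dof w K) x) (S.elemFlux M kg t q K x) := by
    intro x
    rw [M.localRep_eq, M.localRep_eq, elemFlux, ← norm_smul_surfGrad, inner_smul_right, mul_comm]
  have e2 : ∀ x ∈ refTriangle, M.localRep kl ξ K x * inner ℝ (M.localRep ku w K x)
      (S.discNormal M kg t K x) * ‖normalVec (S.elemMap M kg t K) x‖ =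
      S.bDensity M kg t w q ξ K x - inner ℝ (locFun (M.dof w K) x) (S.elemFlux M kg t q K x) := by
    intro x hx
    have := norm_ne_zero_iff.2 (G.normal_ne_zero ht K hx)
    rw [M.localRep_eq, M.localRep_eq, bDensity, discNormal, inner_smul_right, ← vtx]
    field_simp
    ring
  have hc : ContinuousOn (fun x => inner ℝ (locFun (M.dof w K) x) (S.elemFlux M kg t q K x))
      refTriangle :=
    (continuous_locFun (M.dof w K)).continuousOn.inner (G.continuousOn_elemFlux ht q K)
  rw [setIntegral_congr_fun measurableSet_refTriangle e2]
  simp only [e1]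
  rw [integral_sub (integrableOn_refTriangle (G.continuousOn_bDensity ht w q ξ K))
    (integrableOn_refTriangle hc)]
  ring

lemma MeshGeom.bForm_add_left {t : ℝ} (ht : t ∈ Icc 0 S.T) (w w' : M.Node ku → E3)
    (q : M.Node kp → ℝ) (ξ : M.Node kl → ℝ) :
    S.bForm M kg t (w + w') q ξ = S.bForm M kg t w q ξ + S.bForm M kg t w' q ξ := by
  simp only [G.bForm_eq ht]
  rw [← Finset.sum_add_distrib]
  refine Finset.sum_congr rfl fun K _ => ?_
  rw [← integral_add (integrableOn_refTriangle (G.continuousOn_bDensity ht w q ξ K))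
    (integrableOn_refTriangle (G.continuousOn_bDensity ht w' q ξ K))]
  refine integral_congr_ae (.of_forall fun x => ?_)
  have : locFun (M.dof (w + w') K) x = locFun (M.dof w K) x + locFun (M.dof w' K) x :=
    locFun_add _ _ x
  simp only [bDensity, this, inner_add_left]
  ring

lemma MeshGeom.bForm_smul_left {t : ℝ} (ht : t ∈ Icc 0 S.T) (a : ℝ) (w : M.Node ku → E3)
    (q : M.Node kp → ℝ) (ξ : M.Node kl → ℝ) :
    S.bForm M kg t (a • w) q ξ = a * S.bForm M kg t w q ξ := by
  simp only [G.bForm_eq ht]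
  rw [Finset.mul_sum]
  refine Finset.sum_congr rfl fun K _ => ?_
  rw [← integral_const_mul]
  refine integral_congr_ae (.of_forall fun x => ?_)
  have : locFun (M.dof (a • w) K) x = a • locFun (M.dof w K) x := locFun_smul _ _ x
  simp only [bDensity, this, real_inner_smul_left]
  ring

lemma MeshGeom.bForm_add_right {t : ℝ} (ht : t ∈ Icc 0 S.T) (w : M.Node ku → E3)
    (q q' : M.Node kp → ℝ) (ξ ξ' : M.Node kl → ℝ) :
    S.bForm M kg t w (q + q') (ξ + ξ') = S.bForm M kg t w q ξ + S.bForm M kg t w q' ξ' := by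
  simp only [G.bForm_eq ht]
  rw [← Finset.sum_add_distrib]
  refine Finset.sum_congr rfl fun K _ => ?_
  rw [← integral_add (integrableOn_refTriangle (G.continuousOn_bDensity ht w q ξ K))
    (integrableOn_refTriangle (G.continuousOn_bDensity ht w q' ξ' K))]
  refine integral_congr_ae (.of_forall fun x => ?_)
  have e1 : locFun (M.dof (ξ + ξ') K) x = locFun (M.dof ξ K) x + locFun (M.dof ξ' K) x :=
    locFun_add _ _ x
  have e2 : locFun (M.dof (q + q') K) = locFun (M.dof q K) + locFun (M.dof q' K) :=
    funext fun x => locFun_add _ _ x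
  have e3 : fderiv ℝ (locFun (M.dof (q + q') K)) x =
      fderiv ℝ (locFun (M.dof q K)) x + fderiv ℝ (locFun (M.dof q' K)) x := by
    rw [e2, fderiv_add (differentiable_locFun _ x) (differentiable_locFun _ x)]
  simp only [bDensity, elemFlux, fluxVec, e1, e3, inner_add_right, add_apply, add_smul]
  ring

lemma MeshGeom.bForm_smul_right {t : ℝ} (ht : t ∈ Icc 0 S.T) (a : ℝ) (w : M.Node ku → E3)
    (q : M.Node kp → ℝ) (ξ : M.Node kl → ℝ) :
    S.bForm M kg t w (a • q) (a • ξ) = a * S.bForm M kg t w q ξ := by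
  simp only [G.bForm_eq ht]
  rw [Finset.mul_sum]
  refine Finset.sum_congr rfl fun K _ => ?_
  rw [← integral_const_mul]
  refine integral_congr_ae (.of_forall fun x => ?_)
  have e1 : locFun (M.dof (a • ξ) K) x = a • locFun (M.dof ξ K) x := locFun_smul _ _ x
  have e2 : locFun (M.dof (a • q) K) = a • locFun (M.dof q K) := funext fun x => locFun_smul _ _ x
  have e3 : fderiv ℝ (locFun (M.dof (a • q) K)) x = a • fderiv ℝ (locFun (M.dof q K)) x := by
    rw [e2, fderiv_const_smul (differentiable_locFun _ x)]
  simp only [bDensity, elemFlux, fluxVec, e1, e3, inner_add_right, smul_apply,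
    inner_smul_right, smul_eq_mul]
  ring

omit G in
-- Only the gradient of q enters. This permits a pressure with mean zero at time t to be used as a
-- test function at time s after subtracting a constant.
lemma bForm_sub_const (hkp : 1 ≤ kp) (t : ℝ) (w : M.Node ku → E3) (q : M.Node kp → ℝ) (a : ℝ)
    (ξ : M.Node kl → ℝ) :
    S.bForm M kg t w (fun i => q i - a) ξ = S.bForm M kg t w q ξ := by
  have e1 : ∀ K x, fderiv ℝ (M.localRep kp (fun i => q i - a) K) x =
      fderiv ℝ (M.localRep kp q K) x := fun K x => fderiv_locFun_sub_const hkp (M.dof q K) a x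
  simp only [bForm, surfGrad, e1]

lemma MeshGeom.abs_bForm_sub_le {cu cp cl : ℝ} (hcu : 0 ≤ cu) (hcp : 0 ≤ cp) (hcl : 0 ≤ cl)
    (hU : ∀ z : LatticeIndex ku → E3, ∀ x ∈ refTriangle, ‖locFun z x‖ ≤ cu * dofNorm z)
    (hP : ∀ z : LatticeIndex kp → ℝ, ∀ x ∈ refTriangle, ‖fderiv ℝ (locFun z) x‖ ≤ cp * oscNorm z)
    (hL : ∀ z : LatticeIndex kl → ℝ, ∀ x ∈ refTriangle, ‖locFun z x‖ ≤ cl * dofNorm z)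
    {t s : ℝ} (ht : t ∈ Icc 0 S.T) (hs : s ∈ Icc 0 S.T) :
    ∃ σ : ℝ, ∀ (w : M.Node ku → E3) (q : M.Node kp → ℝ) (ξ : M.Node kl → ℝ),
      |S.bForm M kg t w q ξ - S.bForm M kg s w q (σ • ξ)| ≤
        volume.real refTriangle * cu * (2 * cp * (C + 4 * C ^ 4) + cl * (2 * C ^ 2)) * |t - s| *
          (M.meshNorm h w * (M.jumpNorm q + M.meshNorm h ξ)) := by
  have h1 := G.C_pos
  have h2 := G.h_pos
  obtain ⟨ε, hε1, hε⟩ := G.sign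
  obtain ⟨σ, hσ1, hσ⟩ := hε t ht
  obtain ⟨σ', hσ1', hσ'⟩ := hε s hs
  have hσσ : σ' * (σ' * σ) = σ := by rcases hσ1' with rfl | rfl <;> ring
  have hσa : |σ| = 1 := by rcases hσ1 with rfl | rfl <;> simp
  -- The discrete normals at the two times are compared up to this relative global sign. With ξ
  -- multiplied by it, the normal terms carry equal signs and differ only through the normal
  -- vectors.
  refine ⟨σ' * σ, fun w q ξ => ?_⟩
  set V := volume.real refTriangle with hV
  have hV0 : 0 < V := volume_real_refTriangle_pos
  set D₁ := 2 * cp * (C + 4 * C ^ 4) with hD₁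
  set D₂ := cl * (2 * C ^ 2) with hD₂
  have hD₁0 : 0 ≤ D₁ := by positivity
  have hD₂0 : 0 ≤ D₂ := by positivity
  have key : ∀ K, ∀ x ∈ refTriangle, ‖S.bDensity M kg t w q ξ K x -
      S.bDensity M kg s w q ((σ' * σ) • ξ) K x‖ ≤ cu * |t - s| * (dofNorm (M.dof w K) *
        (D₁ * h * oscNorm (M.dof q K) + D₂ * h ^ 2 * dofNorm (M.dof ξ K))) := by
    intro K x hx
    have d1 := dofNorm_nonneg (M.dof w K)
    have d2 := oscNorm_nonneg (M.dof q K)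
    have d3 := dofNorm_nonneg (M.dof ξ K)
    have e1 : locFun (M.dof ((σ' * σ) • ξ) K) x = (σ' * σ) * locFun (M.dof ξ K) x :=
      locFun_smul _ _ x
    have e2 : S.bDensity M kg t w q ξ K x - S.bDensity M kg s w q ((σ' * σ) • ξ) K x =
        inner ℝ (locFun (M.dof w K) x) (S.elemFlux M kg t q K x - S.elemFlux M kg s q K x) +
        σ * ε K * (locFun (M.dof ξ K) x * inner ℝ (locFun (M.dof w K) x)
          (normalVec (S.elemMap M kg t K) x - normalVec (S.elemMap M kg s K) x)) := by
      rw [bDensity, bDensity, hσ K x hx, hσ' K x hx, e1, inner_sub_right, inner_sub_right]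
      linear_combination (-ε K * locFun (M.dof ξ K) x * inner ℝ (locFun (M.dof w K) x)
          (normalVec (S.elemMap M kg s K) x)) * hσσ
    have hd : ∀ a, |fderiv ℝ (locFun (M.dof q K)) x (Pi.single a 1)| ≤ cp * oscNorm (M.dof q K) := by
      intro a
      refine ((fderiv ℝ (locFun (M.dof q K)) x).le_opNorm _).trans ?_
      have : ‖(Pi.single a 1 : R2)‖ = 1 := by rw [Pi.norm_single, norm_one]
      rw [this, mul_one]
      exact hP _ x hx
    -- The quotient (C h)²/(C⁻¹h²) is C³, which explains the term 4 C⁴ in D₁ and shows that no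
    -- negative power of h remains.
    have e3 : ‖S.elemFlux M kg t q K x - S.elemFlux M kg s q K x‖ ≤
        D₁ * |t - s| * h * oscNorm (M.dof q K) := by
      refine (norm_fluxVec_sub_le _ (a := C * h) (b := C⁻¹ * h ^ 2) (e := C * |t - s| * h)
        (by positivity) (G.tang_le t ht K x hx 0) (G.tang_le t ht K x hx 1) (G.tang_le s hs K x hx 0)
        (G.tang_le s hs K x hx 1) (G.normal_ge t ht K x hx) (G.tang_diff t ht s hs K x hx 0)
        (G.tang_diff t ht s hs K x hx 1)).trans ?_
      calc _ ≤ (cp * oscNorm (M.dof q K) + cp * oscNorm (M.dof q K)) * (C * |t - s| * h +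
            4 * (C * h) ^ 2 / (C⁻¹ * h ^ 2) * (C * |t - s| * h)) := by
            refine mul_le_mul_of_nonneg_right (add_le_add (hd 0) (hd 1)) (by positivity)
        _ = _ := by rw [hD₁]; field_simp; ring
    have e4 := G.normal_diff ht hs K hx
    have e5 := hU (M.dof w K) x hx
    have e6 := hL (M.dof ξ K) x hx
    rw [e2, Real.norm_eq_abs]
    refine (abs_add_le _ _).trans ?_
    have e7 : |inner ℝ (locFun (M.dof w K) x) (S.elemFlux M kg t q K x - S.elemFlux M kg s q K x)| ≤
        cu * dofNorm (M.dof w K) * (D₁ * |t - s| * h * oscNorm (M.dof q K)) :=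
      (abs_real_inner_le_norm _ _).trans (mul_le_mul e5 e3 (norm_nonneg _) (by positivity))
    have e8 : |inner ℝ (locFun (M.dof w K) x)
        (normalVec (S.elemMap M kg t K) x - normalVec (S.elemMap M kg s K) x)| ≤
        cu * dofNorm (M.dof w K) * (2 * C ^ 2 * |t - s| * h ^ 2) :=
      (abs_real_inner_le_norm _ _).trans (mul_le_mul e5 e4 (norm_nonneg _) (by positivity))
    have e9 : |σ * ε K * (locFun (M.dof ξ K) x * inner ℝ (locFun (M.dof w K) x)
          (normalVec (S.elemMap M kg t K) x - normalVec (S.elemMap M kg s K) x))| ≤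
        1 * (cl * dofNorm (M.dof ξ K) *
          (cu * dofNorm (M.dof w K) * (2 * C ^ 2 * |t - s| * h ^ 2))) := by
      rw [abs_mul, abs_mul, abs_mul (locFun _ _), hσa, one_mul]
      exact mul_le_mul (hε1 K) (mul_le_mul e6 e8 (abs_nonneg _) (by positivity)) (by positivity)
        zero_le_one
    refine (add_le_add e7 e9).trans (le_of_eq ?_)
    rw [hD₂]; ring
  have hK : ∀ K, |(∫ x in refTriangle, S.bDensity M kg t w q ξ K x) -
      ∫ x in refTriangle, S.bDensity M kg s w q ((σ' * σ) • ξ) K x| ≤ V * cu * |t - s| * h *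
        (dofNorm (M.dof w K) *
        (D₁ * oscNorm (M.dof q K) + D₂ * h * dofNorm (M.dof ξ K))) := by
    intro K
    rw [← integral_sub (integrableOn_refTriangle (G.continuousOn_bDensity ht w q ξ K))
      (integrableOn_refTriangle (G.continuousOn_bDensity hs w q _ K))]
    exact (norm_integral_refTriangle_le (key K)).trans (le_of_eq (by ring))
  rw [G.bForm_eq ht, G.bForm_eq hs, ← Finset.sum_sub_distrib]
  refine (Finset.abs_sum_le_sum_abs _ _).trans ((Finset.sum_le_sum fun K _ => hK K).trans ?_)
  rw [← Finset.mul_sum]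
  have c1 := Real.sum_mul_le_sqrt_mul_sqrt Finset.univ (fun K => dofNorm (M.dof w K))
    (fun K => oscNorm (M.dof q K))
  have c2 := Real.sum_mul_le_sqrt_mul_sqrt Finset.univ (fun K => dofNorm (M.dof w K))
    (fun K => dofNorm (M.dof ξ K))
  have c3 : ∑ K, dofNorm (M.dof w K) * (D₁ * oscNorm (M.dof q K) + D₂ * h * dofNorm (M.dof ξ K)) =
      D₁ * (∑ K, dofNorm (M.dof w K) * oscNorm (M.dof q K)) +
      D₂ * h * ∑ K, dofNorm (M.dof w K) * dofNorm (M.dof ξ K) := by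
    rw [Finset.mul_sum, Finset.mul_sum, ← Finset.sum_add_distrib]
    exact Finset.sum_congr rfl fun K _ => by ring
  rw [c3]
  have n1 := M.meshNorm_nonneg h2.le w
  have n2 := M.jumpNorm_nonneg q
  have n3 := M.meshNorm_nonneg h2.le ξ
  calc _ ≤ V * cu * |t - s| * h * (D₁ * (√(∑ K, dofNorm (M.dof w K) ^ 2) *
        √(∑ K, oscNorm (M.dof q K) ^ 2)) + D₂ * h * (√(∑ K, dofNorm (M.dof w K) ^ 2) *
        √(∑ K, dofNorm (M.dof ξ K) ^ 2))) := by gcongr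
    _ = V * cu * |t - s| * M.meshNorm h w * (D₁ * M.jumpNorm q + D₂ * M.meshNorm h ξ) := by
        rw [Triangulation.meshNorm, Triangulation.meshNorm, Triangulation.jumpNorm]; ring
    _ ≤ V * cu * |t - s| * M.meshNorm h w * ((D₁ + D₂) * (M.jumpNorm q + M.meshNorm h ξ)) := by
        refine mul_le_mul_of_nonneg_left ?_ (by positivity)
        nlinarith [mul_nonneg hD₁0 n3, mul_nonneg hD₂0 n2]
    _ = _ := by ring

end BForm

end EvolvingSurface

/-! ### The inf-sup condition -/

lemma inner_cross3_unitize_cross3 (g₀ g₁ : E3) (d : Fin 2 → ℝ) :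
    inner ℝ (cross3 g₀ g₁) (fluxVec g₀ g₁ d) = 0 := by
  rw [fluxVec, unitize, cross3_smul_right, cross3_smul_left, inner_add_right]
  simp only [inner_smul_right, inner_cross3_self_left, inner_cross3_self_right, mul_zero, add_zero]

lemma norm_refVtx_sub_le (l m : Fin 3) : ‖refVtx m - refVtx l‖ ≤ 1 := by
  rw [pi_norm_le_iff_of_nonneg zero_le_one]
  intro i
  fin_cases l <;> fin_cases m <;> fin_cases i <;> simp [refVtx]

lemma sum_bary_mul_bary (x : R2) : ∑ l, ∑ m, bary x l * bary x m = 1 := by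
  simp_rw [← Finset.mul_sum, bary_sum, mul_one, bary_sum]

/-- The products λ_l λ_m are nonnegative on the triangle and add up to one, so the double sum is an
average. -/
lemma norm_sum_bary_smul_le {E : Type*} [NormedAddCommGroup E] [NormedSpace ℝ E] {x : R2}
    (hx : x ∈ refTriangle) {f : Fin 3 → Fin 3 → E} {B : ℝ} (h : ∀ l m, ‖f l m‖ ≤ B) :
    ‖∑ l, ∑ m, (bary x l * bary x m) • f l m‖ ≤ B := by
  have h0 := mem_refTriangle.1 hx
  calc _ ≤ ∑ l, ∑ m, bary x l * bary x m * B := by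
        refine (norm_sum_le _ _).trans (Finset.sum_le_sum fun l _ => (norm_sum_le _ _).trans
          (Finset.sum_le_sum fun m _ => ?_))
        rw [norm_smul, Real.norm_of_nonneg (mul_nonneg (h0 l) (h0 m))]
        exact mul_le_mul_of_nonneg_left (h l m) (mul_nonneg (h0 l) (h0 m))
    _ = B := by simp_rw [← Finset.sum_mul, sum_bary_mul_bary, one_mul]

namespace Triangulation

variable {Γ : Set E3} (M : Triangulation Γ)

/-- Two barycentric factors and one derivative of q have total degree 2 + (kp - 1) = ku, so
interpolation in the velocity space is exact. This is where the relation between the two degrees is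
used. -/
lemma locFun_interp_edgeField {ku kp : ℕ} (hku : 2 ≤ ku) (hkp : kp + 1 = ku) (q : M.Node kp → ℝ)
    (a : Fin M.nV → E3) (K : Fin M.nK) (x : R2) :
    locFun (M.dof (M.interp ku (M.edgeField q a)) K) x = M.edgeField q a K x := by
  have hk : 1 ≤ ku := by omega
  have hpoly : ∀ l m, (fun y => bary y l * bary y m *
      fderiv ℝ (locFun (M.dof q K)) y (refVtx m - refVtx l)) ∈ polyDeg ku := by
    intro l m
    have := mul_mem_polyDeg (mul_mem_polyDeg (bary_mem_polyDeg l) (bary_mem_polyDeg m))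
      (fderiv_mem_polyDeg (locFun_mem_polyDeg (M.dof q K)) (refVtx m - refVtx l))
    have e : 1 + 1 + (kp - 1) = ku := by omega
    rw [e] at this
    exact this
  rw [M.dof_interp hk (M.compatible_edgeField q a) K]
  simp only [locFun, edgeField]
  simp_rw [Finset.smul_sum]
  rw [Finset.sum_comm]
  refine Finset.sum_congr rfl fun l _ => ?_
  rw [Finset.sum_comm]
  refine Finset.sum_congr rfl fun m _ => ?_
  simp_rw [smul_smul]
  rw [← Finset.sum_smul]
  exact congrArg (· • _) (interpolation_exact hk (hpoly l m) x)

end Triangulation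

namespace EvolvingSurface

variable {S : EvolvingSurface} {M : Triangulation (S.Γ 0)} {kg : ℕ} {h C : ℝ}

section Pointwise

variable (G : S.MeshGeom M kg h C) {ku kp kl : ℕ} {t : ℝ} (ht : t ∈ Icc 0 S.T) (K : Fin M.nK)
  {x : R2} (hx : x ∈ refTriangle)

lemma norm_discNormal_le (t : ℝ) (K : Fin M.nK) (x : R2) : ‖S.discNormal M kg t K x‖ ≤ 1 := by
  rw [discNormal, mul_smul, norm_smul]
  have h1 : ‖Real.sign (inner ℝ (normalVec (S.elemMap M kg t K) x)
      (S.normal t (S.Φ t (M.vert (M.tri K 0)))))‖ ≤ 1 := by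
    rcases Real.sign_apply_eq (inner ℝ (normalVec (S.elemMap M kg t K) x)
      (S.normal t (S.Φ t (M.vert (M.tri K 0))))) with h | h | h <;> rw [h] <;> simp
  exact mul_le_one₀ h1 (norm_nonneg _) (norm_unitize_le _)

include G ht hx

lemma MeshGeom.bDensity_eq (w : M.Node ku → E3) (q : M.Node kp → ℝ) (ξ : M.Node kl → ℝ) :
    S.bDensity M kg t w q ξ K x = inner ℝ (locFun (M.dof w K) x) (S.elemFlux M kg t q K x) +
      ‖normalVec (S.elemMap M kg t K) x‖ * (locFun (M.dof ξ K) x *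
        inner ℝ (locFun (M.dof w K) x) (S.discNormal M kg t K x)) := by
  have := norm_ne_zero_iff.2 (G.normal_ne_zero ht K hx)
  rw [bDensity, discNormal, inner_smul_right, ← vtx]
  field_simp

/-- Edges are chords of the smooth surface and hence tangential up to O(h²); replacing the smooth by
the discrete normal costs O(h) on a vector of length at most h. -/
lemma MeshGeom.abs_inner_edge_discNormal_le (l m : Fin 3) :
    |inner ℝ (S.vtx M t K m - S.vtx M t K l) (S.discNormal M kg t K x)| ≤ 3 * C * h ^ 2 := by
  have h0 := G.h_pos
  have e1 : inner ℝ (S.vtx M t K m - S.vtx M t K l) (S.discNormal M kg t K x) =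
      inner ℝ (S.vtx M t K m - S.vtx M t K 0) (S.normal t (S.vtx M t K 0)) -
      inner ℝ (S.vtx M t K l - S.vtx M t K 0) (S.normal t (S.vtx M t K 0)) +
      inner ℝ (S.vtx M t K m - S.vtx M t K l)
        (S.discNormal M kg t K x - S.normal t (S.vtx M t K 0)) := by
    rw [← inner_sub_left, sub_sub_sub_cancel_right, ← inner_add_right, add_sub_cancel]
  have e2 := (abs_real_inner_le_norm (S.vtx M t K m - S.vtx M t K l)
    (S.discNormal M kg t K x - S.normal t (S.vtx M t K 0))).trans
    (mul_le_mul (G.vtx_le t ht K m l) (G.disc_normal t ht K x hx) (norm_nonneg _) h0.le)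
  rw [e1]
  refine (abs_add_le _ _).trans ((add_le_add (abs_sub _ _) e2).trans ?_)
  linarith [G.vtx_orth t ht K m, G.vtx_orth t ht K l]

omit G ht hx in
lemma inner_discNormal_elemFlux (q : M.Node kp → ℝ) :
    inner ℝ (S.discNormal M kg t K x) (S.elemFlux M kg t q K x) = 0 := by
  rw [discNormal, real_inner_smul_left, elemFlux, normalVec, inner_cross3_unitize_cross3, mul_zero]

section Pressure

variable {cp : ℝ} (hcp : 0 ≤ cp)
  (hP : ∀ z : LatticeIndex kp → ℝ, ∀ x ∈ refTriangle, ‖fderiv ℝ (locFun z) x‖ ≤ cp * oscNorm z)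
include hcp hP

lemma MeshGeom.norm_elemFlux_le (q : M.Node kp → ℝ) :
    ‖S.elemFlux M kg t q K x‖ ≤ 2 * cp * C * h * oscNorm (M.dof q K) := by
  have d := oscNorm_nonneg (M.dof q K)
  have hd : ∀ a, |fderiv ℝ (locFun (M.dof q K)) x (Pi.single a 1)| ≤ cp * oscNorm (M.dof q K) := by
    intro a
    refine ((fderiv ℝ (locFun (M.dof q K)) x).le_opNorm _).trans ?_
    have : ‖(Pi.single a 1 : R2)‖ = 1 := by rw [Pi.norm_single, norm_one]
    rw [this, mul_one]
    exact hP _ x hx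
  refine (norm_fluxVec_le _ _ _).trans ?_
  calc _ ≤ cp * oscNorm (M.dof q K) * (C * h) + cp * oscNorm (M.dof q K) * (C * h) :=
        add_le_add (mul_le_mul (hd 0) (G.tang_le t ht K x hx 1) (norm_nonneg _) (by positivity))
          (mul_le_mul (hd 1) (G.tang_le t ht K x hx 0) (norm_nonneg _) (by positivity))
    _ = _ := by ring

omit G ht in
lemma abs_fderiv_edge_le (q : M.Node kp → ℝ) (l m : Fin 3) :
    |fderiv ℝ (locFun (M.dof q K)) x (refVtx m - refVtx l)| ≤ cp * oscNorm (M.dof q K) := by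
  refine ((fderiv ℝ (locFun (M.dof q K)) x).le_opNorm _).trans ?_
  exact (mul_le_mul (hP _ x hx) (norm_refVtx_sub_le l m) (norm_nonneg _)
    (mul_nonneg hcp (oscNorm_nonneg _))).trans (mul_one _).le

/-- For differences of exact tangent vectors in place of the edge vector the expression would
vanish, because the gradient is dual to the tangent vectors. Edge vectors differ from these by
O(h²), and the flux has size h times the oscillation. -/
lemma MeshGeom.abs_inner_edge_elemFlux_sub_le (q : M.Node kp → ℝ) (l m : Fin 3) :
    |inner ℝ (S.vtx M t K m - S.vtx M t K l) (S.elemFlux M kg t q K x) -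
      ‖normalVec (S.elemMap M kg t K) x‖ *
        fderiv ℝ (locFun (M.dof q K)) x (refVtx m - refVtx l)| ≤
      4 * C ^ 2 * cp * h ^ 3 * oscNorm (M.dof q K) := by
  have h0 := G.h_pos
  have h1 := G.C_pos
  have hN := G.normal_ne_zero ht K hx
  set T : Fin 3 → E3 := ![0, tangentVec (S.elemMap M kg t K) x 0,
    tangentVec (S.elemMap M kg t K) x 1] with hT
  have hflux : ∀ l, inner ℝ (T l) (S.elemFlux M kg t q K x) =
      ‖normalVec (S.elemMap M kg t K) x‖ * fderiv ℝ (locFun (M.dof q K)) x (refVtx l) := by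
    intro l
    rw [elemFlux, ← norm_smul_surfGrad, inner_smul_right]
    congr 1
    have r0 : refVtx 0 = 0 := by ext i; fin_cases i <;> rfl
    have r1 : refVtx 1 = Pi.single 0 1 := by ext i; fin_cases i <;> simp [refVtx]
    have r2 : refVtx 2 = Pi.single 1 1 := by ext i; fin_cases i <;> simp [refVtx]
    fin_cases l
    · change inner ℝ (0 : E3) _ = fderiv ℝ (locFun (M.dof q K)) x (refVtx 0)
      rw [r0, inner_zero_left, map_zero]
    · change inner ℝ (tangentVec (S.elemMap M kg t K) x 0) _ =
        fderiv ℝ (locFun (M.dof q K)) x (refVtx 1)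
      rw [r1, inner_tangentVec_zero_surfGrad _ hN]
    · change inner ℝ (tangentVec (S.elemMap M kg t K) x 1) _ =
        fderiv ℝ (locFun (M.dof q K)) x (refVtx 2)
      rw [r2, inner_tangentVec_one_surfGrad _ hN]
  have hTd : ∀ l, ‖S.vtx M t K l - S.vtx M t K 0 - T l‖ ≤ C * h ^ 2 := by
    intro l
    rw [norm_sub_rev]
    fin_cases l
    · change ‖(0 : E3) - (S.vtx M t K 0 - S.vtx M t K 0)‖ ≤ _
      rw [sub_self, sub_zero, norm_zero]
      positivity
    · exact G.tang_chord t ht K x hx 0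
    · exact G.tang_chord t ht K x hx 1
  have e1 : inner ℝ (S.vtx M t K m - S.vtx M t K l) (S.elemFlux M kg t q K x) -
      ‖normalVec (S.elemMap M kg t K) x‖ *
        fderiv ℝ (locFun (M.dof q K)) x (refVtx m - refVtx l) =
      inner ℝ ((S.vtx M t K m - S.vtx M t K 0 - T m) - (S.vtx M t K l - S.vtx M t K 0 - T l))
        (S.elemFlux M kg t q K x) := by
    rw [map_sub, mul_sub, ← hflux, ← hflux]
    simp only [inner_sub_left]
    ring
  rw [e1]
  have e2 := (norm_sub_le (S.vtx M t K m - S.vtx M t K 0 - T m)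
    (S.vtx M t K l - S.vtx M t K 0 - T l)).trans (add_le_add (hTd m) (hTd l))
  refine (abs_real_inner_le_norm _ _).trans ((mul_le_mul e2
    (G.norm_elemFlux_le ht K hx hcp hP q) (norm_nonneg _) (by positivity)).trans (le_of_eq ?_))
  ring

/-- The third bound is the coercive one: an edge vector paired with the flux gives the area element
times the edge derivative, and the field supplies the edge derivative a second time, so squares
arise. -/
lemma MeshGeom.edgeField_bounds (q : M.Node kp → ℝ) :
    ‖M.edgeField q (fun i => S.Φ t (M.vert i)) K x‖ ≤ cp * h * oscNorm (M.dof q K) ∧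
    |inner ℝ (M.edgeField q (fun i => S.Φ t (M.vert i)) K x) (S.discNormal M kg t K x)| ≤
      3 * C * cp * h ^ 2 * oscNorm (M.dof q K) ∧
    ‖normalVec (S.elemMap M kg t K) x‖ * edgeForm (locFun (M.dof q K)) x -
        4 * C ^ 2 * cp ^ 2 * h ^ 3 * oscNorm (M.dof q K) ^ 2 ≤
      inner ℝ (M.edgeField q (fun i => S.Φ t (M.vert i)) K x) (S.elemFlux M kg t q K x) := by
  have h0 := G.h_pos
  have h1 := G.C_pos
  have d := oscNorm_nonneg (M.dof q K)
  have hD := abs_fderiv_edge_le K hx hcp hP q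
  set D : Fin 3 → Fin 3 → ℝ := fun l m => fderiv ℝ (locFun (M.dof q K)) x (refVtx m - refVtx l)
    with hDdef
  have hE : M.edgeField q (fun i => S.Φ t (M.vert i)) K x =
      ∑ l, ∑ m, (bary x l * bary x m) • (D l m • (S.vtx M t K m - S.vtx M t K l)) := by
    simp only [Triangulation.edgeField, smul_smul, hDdef, vtx]
  have hI : ∀ y : E3, inner ℝ (M.edgeField q (fun i => S.Φ t (M.vert i)) K x) y =
      ∑ l, ∑ m, (bary x l * bary x m) • (D l m * inner ℝ (S.vtx M t K m - S.vtx M t K l) y) := by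
    intro y
    simp only [hE, sum_inner, real_inner_smul_left, smul_eq_mul]
  refine ⟨?_, ?_, ?_⟩
  · rw [hE]
    refine norm_sum_bary_smul_le hx fun l m => ?_
    rw [norm_smul]
    calc _ ≤ cp * oscNorm (M.dof q K) * h :=
          mul_le_mul (hD l m) (G.vtx_le t ht K m l) (norm_nonneg _) (by positivity)
      _ = _ := by ring
  · rw [hI, ← Real.norm_eq_abs]
    refine norm_sum_bary_smul_le hx fun l m => ?_
    rw [norm_mul]
    calc _ ≤ cp * oscNorm (M.dof q K) * (3 * C * h ^ 2) :=
          mul_le_mul (hD l m) (G.abs_inner_edge_discNormal_le ht K hx l m) (abs_nonneg _)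
            (by positivity)
      _ = _ := by ring
  · have e1 : ‖normalVec (S.elemMap M kg t K) x‖ * edgeForm (locFun (M.dof q K)) x =
        ∑ l, ∑ m, (bary x l * bary x m) • (D l m * (‖normalVec (S.elemMap M kg t K) x‖ * D l m)) := by
      rw [edgeForm, Finset.mul_sum]
      refine Finset.sum_congr rfl fun l _ => ?_
      rw [Finset.mul_sum]
      refine Finset.sum_congr rfl fun m _ => ?_
      simp only [smul_eq_mul, hDdef]
      ring
    rw [sub_le_comm, e1, hI, ← Finset.sum_sub_distrib]
    simp_rw [← Finset.sum_sub_distrib, ← smul_sub, ← mul_sub]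
    refine (le_abs_self _).trans ?_
    rw [← Real.norm_eq_abs]
    refine norm_sum_bary_smul_le hx fun l m => ?_
    rw [norm_mul, ← norm_neg (_ - _), neg_sub]
    calc _ ≤ cp * oscNorm (M.dof q K) * (4 * C ^ 2 * cp * h ^ 3 * oscNorm (M.dof q K)) :=
          mul_le_mul (hD l m) (G.abs_inner_edge_elemFlux_sub_le ht K hx hcp hP q l m)
            (abs_nonneg _) (by positivity)
      _ = _ := by ring

end Pressure

end Pointwise

end EvolvingSurface

namespace EvolvingSurface

variable {S : EvolvingSurface} {M : Triangulation (S.Γ 0)} {kg : ℕ} {h C : ℝ}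

/-- The vector field that has on every element the scalar coefficients `ξ` in the direction of the
normal of the smooth surface. -/
noncomputable def normalField (S : EvolvingSurface) (M : Triangulation (S.Γ 0)) {kl : ℕ} (t : ℝ)
    (ξ : M.Node kl → ℝ) (K : Fin M.nK) (x : R2) : E3 :=
  locFun (M.dof ξ K) x • S.normal t (S.Φ t (M.proj K x))

/-- The projected point depends only on the point of the flat mesh, so the normal of the smooth
surface is single-valued across elements. The elementwise discrete normal would not be. -/
lemma compatible_normalField {kl : ℕ} (t : ℝ) (ξ : M.Node kl → ℝ) :
    M.Compatible (S.normalField M t ξ) := by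
  intro K K' x x' hx hx' hpt
  have e : locFun (M.dof ξ K) x = locFun (M.dof ξ K') x' :=
    M.compatible_locFun ξ K K' x x' hx hx' hpt
  rw [normalField, normalField, Triangulation.proj, Triangulation.proj, hpt, e]

section InfSup

variable (G : S.MeshGeom M kg h C) {ku kp kl : ℕ} {t : ℝ} (ht : t ∈ Icc 0 S.T) (K : Fin M.nK)

variable {cu cl : ℝ} (hcl : 0 ≤ cl)
    (hU : ∀ z : LatticeIndex ku → E3, ∀ x ∈ refTriangle, ‖locFun z x‖ ≤ cu * dofNorm z)
    (hL : ∀ z : LatticeIndex kl → ℝ, ∀ x ∈ refTriangle, ‖locFun z x‖ ≤ cl * dofNorm z)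
    (hku : 1 ≤ ku) (hkl : kl ≤ ku)

include G ht hcl hL hku in
lemma MeshGeom.dofNorm_interp_normalField_le (ξ : M.Node kl → ℝ) :
    dofNorm (M.dof (M.interp ku (S.normalField M t ξ)) K) ≤
      √(Fintype.card (LatticeIndex ku)) * cl * dofNorm (M.dof ξ K) := by
  have d := dofNorm_nonneg (M.dof ξ K)
  rw [M.dof_interp hku (compatible_normalField t ξ) K, mul_assoc]
  refine dofNorm_le (by positivity) fun i => ?_
  rw [normalField, norm_smul, G.norm_normal t ht _ (M.proj_spec K (latPt_mem hku i)).1, mul_one]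
  exact hL _ _ (latPt_mem hku i)

include G ht hcl hL hku hU hkl in
-- Because kl ≤ ku, interpolation reproduces ξ times a fixed vector. Only the variation of the
-- smooth normal over one element, of order h, remains.
lemma MeshGeom.norm_interp_normalField_sub_le (hcu : 0 ≤ cu) (ξ : M.Node kl → ℝ) {x : R2}
    (hx : x ∈ refTriangle) :
    ‖locFun (M.dof (M.interp ku (S.normalField M t ξ)) K) x -
      locFun (M.dof ξ K) x • S.normal t (S.vtx M t K 0)‖ ≤
      cu * √(Fintype.card (LatticeIndex ku)) * cl * C * (h * dofNorm (M.dof ξ K)) := by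
  have d := dofNorm_nonneg (M.dof ξ K)
  have h0 := G.h_pos
  have h1 := G.C_pos
  have e1 : locFun (M.dof ξ K) x • S.normal t (S.vtx M t K 0) =
      locFun (fun i : LatticeIndex ku => locFun (M.dof ξ K) (latPt i) •
        S.normal t (S.vtx M t K 0)) x := by
    conv_lhs => rw [← interpolation_exact hku (polyDeg_mono hkl (locFun_mem_polyDeg (M.dof ξ K))) x]
    rw [locFun, Finset.sum_smul]
    exact Finset.sum_congr rfl fun i _ => by rw [smul_smul]
  rw [e1, M.dof_interp hku (compatible_normalField t ξ) K, ← locFun_sub]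
  refine (hU _ x hx).trans ?_
  calc _ ≤ cu * (√(Fintype.card (LatticeIndex ku)) * (cl * dofNorm (M.dof ξ K) * (C * h))) := by
        refine mul_le_mul_of_nonneg_left (dofNorm_le (by positivity) fun i => ?_) hcu
        rw [normalField, ← smul_sub, norm_smul]
        exact mul_le_mul (hL _ _ (latPt_mem hku i)) (G.node_normal t ht K _ (latPt_mem hku i))
          (norm_nonneg _) (by positivity)
    _ = _ := by ring

end InfSup

/-- The pointwise lower bound behind the inf-sup condition: `e` is the tangential and `u` the
normal part of the test field, `f` the flux, `n` the discrete and `ν` the smooth normal. -/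
lemma infSup_pointwise {e u f n ν : E3} {ξ N Q A X h C p U c : ℝ} (hh : 0 < h) (hC : 0 < C)
    (hp : 0 ≤ p) (hU : 0 ≤ U) (hc : 0 ≤ c) (hA : 0 ≤ A) (hX : 0 ≤ X) (hN : 0 ≤ N)
    (hNC : N ≤ C ^ 2 * h ^ 2) (hν : ‖ν‖ = 1) (hn : ‖n‖ ≤ 1) (hnν : ‖n - ν‖ ≤ C * h)
    (hnf : inner ℝ n f = 0) (hf : ‖f‖ ≤ 2 * p * C * h * A)
    (hen : |inner ℝ e n| ≤ 3 * C * p * h ^ 2 * A)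
    (hef : N * Q - 4 * C ^ 2 * p ^ 2 * h ^ 3 * A ^ 2 ≤ inner ℝ e f)
    (hu : ‖u - ξ • ν‖ ≤ U * (h * X)) (hξ : |ξ| ≤ c * X) :
    N * ((h ^ 2)⁻¹ * Q + ξ ^ 2) - (4 * C ^ 2 * p ^ 2 + 2 * (U + c * C) * p * C +
        3 * C ^ 3 * c * p + C ^ 2 * (c * U + c ^ 2 * C)) * h * (A ^ 2 + (h * X) ^ 2) ≤
      inner ℝ ((h ^ 2)⁻¹ • e + u) f + N * (ξ * inner ℝ ((h ^ 2)⁻¹ • e + u) n) := by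
  have a1 : -(U * (h * X) * (2 * p * C * h * A)) ≤ inner ℝ (u - ξ • ν) f :=
    neg_le_of_abs_le ((abs_real_inner_le_norm _ _).trans
      (mul_le_mul hu hf (norm_nonneg _) (by positivity)))
  have a2 : |ξ * inner ℝ (n - ν) f| ≤ c * X * (C * h * (2 * p * C * h * A)) := by
    rw [abs_mul]
    exact mul_le_mul hξ ((abs_real_inner_le_norm _ _).trans
      (mul_le_mul hnν hf (norm_nonneg _) (by positivity))) (abs_nonneg _) (by positivity)
  -- The flux is orthogonal to the discrete normal, so the main part ξν of u pairs with it only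
  -- through ν - n, of order h.
  have b1 : inner ℝ u f = inner ℝ (u - ξ • ν) f - ξ * inner ℝ (n - ν) f := by
    rw [inner_sub_left, inner_sub_left, hnf, real_inner_smul_left]; ring
  have a3 : |ξ * inner ℝ e n| ≤ c * X * (3 * C * p * h ^ 2 * A) := by
    rw [abs_mul]
    exact mul_le_mul hξ hen (abs_nonneg _) (by positivity)
  have a4 : |ξ * inner ℝ (u - ξ • ν) n| ≤ c * X * (U * (h * X) * 1) := by
    rw [abs_mul]
    exact mul_le_mul hξ ((abs_real_inner_le_norm _ _).trans
      (mul_le_mul hu hn (norm_nonneg _) (by positivity))) (abs_nonneg _) (by positivity)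
  have a5 : |ξ ^ 2 * inner ℝ ν (n - ν)| ≤ (c * X) ^ 2 * (1 * (C * h)) := by
    rw [abs_mul, abs_pow]
    refine mul_le_mul (pow_le_pow_left₀ (abs_nonneg _) hξ 2) ((abs_real_inner_le_norm _ _).trans ?_)
      (abs_nonneg _) (by positivity)
    rw [hν]
    exact mul_le_mul_of_nonneg_left hnν zero_le_one
  -- The normal part contributes ξ² up to the interpolation error and the deviation of the two
  -- normals.
  have b2 : ξ * inner ℝ u n = ξ * inner ℝ (u - ξ • ν) n + ξ ^ 2 * inner ℝ ν (n - ν) + ξ ^ 2 := by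
    rw [inner_sub_left, inner_sub_right, real_inner_self_eq_norm_sq, hν, real_inner_smul_left]; ring
  have a2' := le_of_abs_le a2
  have a3' := neg_le_of_abs_le a3
  have a4' := neg_le_of_abs_le a4
  have a5' := neg_le_of_abs_le a5
  have c1 : -(C ^ 2 * h ^ 2 * ((h ^ 2)⁻¹ * (c * X * (3 * C * p * h ^ 2 * A)) +
      c * X * (U * (h * X) * 1) + (c * X) ^ 2 * (1 * (C * h)))) ≤
      N * ((h ^ 2)⁻¹ * (ξ * inner ℝ e n) + ξ * inner ℝ (u - ξ • ν) n +
        ξ ^ 2 * inner ℝ ν (n - ν)) := by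
    have hi : 0 ≤ (h ^ 2)⁻¹ := by positivity
    have g1 : -((h ^ 2)⁻¹ * (c * X * (3 * C * p * h ^ 2 * A)) +
      c * X * (U * (h * X) * 1) + (c * X) ^ 2 * (1 * (C * h))) ≤
      (h ^ 2)⁻¹ * (ξ * inner ℝ e n) + ξ * inner ℝ (u - ξ • ν) n + ξ ^ 2 * inner ℝ ν (n - ν) := by
      have := mul_le_mul_of_nonneg_left a3' hi
      linarith only [this, a4', a5']
    have g2 : 0 ≤ (h ^ 2)⁻¹ * (c * X * (3 * C * p * h ^ 2 * A)) +
      c * X * (U * (h * X) * 1) + (c * X) ^ 2 * (1 * (C * h)) := by positivity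
    refine le_trans ?_ (mul_le_mul_of_nonneg_left g1 hN)
    rw [mul_neg]
    exact neg_le_neg (mul_le_mul_of_nonneg_right hNC g2)
  have c2 : C ^ 2 * h ^ 2 * ((h ^ 2)⁻¹ * (c * X * (3 * C * p * h ^ 2 * A)) +
      c * X * (U * (h * X) * 1) + (c * X) ^ 2 * (1 * (C * h))) =
      3 * C ^ 3 * c * p * h * ((h * X) * A) + C ^ 2 * (c * U + c ^ 2 * C) * h * (h * X) ^ 2 := by
    field_simp
    ring
  have c3 : N * Q * (h ^ 2)⁻¹ - 4 * C ^ 2 * p ^ 2 * h * A ^ 2 ≤ (h ^ 2)⁻¹ * inner ℝ e f := by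
    have := mul_le_mul_of_nonneg_left hef (by positivity : 0 ≤ (h ^ 2)⁻¹)
    refine le_trans (le_of_eq ?_) this
    field_simp
  have e1 : inner ℝ ((h ^ 2)⁻¹ • e + u) f + N * (ξ * inner ℝ ((h ^ 2)⁻¹ • e + u) n) =
      (h ^ 2)⁻¹ * inner ℝ e f + inner ℝ u f +
      N * ((h ^ 2)⁻¹ * (ξ * inner ℝ e n) + ξ * inner ℝ u n) := by
    rw [inner_add_left, inner_add_left, real_inner_smul_left, real_inner_smul_left]; ring
  rw [e1, b1, b2]
  have hXA : (h * X) * A ≤ A ^ 2 + (h * X) ^ 2 := by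
    linarith only [sq_nonneg (h * X - A), sq_nonneg A, sq_nonneg (h * X)]
  have k1 : (2 * (U + c * C) * p * C) * h * ((h * X) * A) ≤
      (2 * (U + c * C) * p * C) * h * (A ^ 2 + (h * X) ^ 2) :=
    mul_le_mul_of_nonneg_left hXA (by positivity)
  have k2 : 3 * C ^ 3 * c * p * h * ((h * X) * A) ≤ 3 * C ^ 3 * c * p * h * (A ^ 2 + (h * X) ^ 2) :=
    mul_le_mul_of_nonneg_left hXA (by positivity)
  have k3 : 0 ≤ 4 * C ^ 2 * p ^ 2 * h * (h * X) ^ 2 := by positivity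
  have k4 : 0 ≤ C ^ 2 * (c * U + c ^ 2 * C) * h * A ^ 2 := by positivity
  linarith only [a1, a2', c1, c2, c3, k1, k2, k3, k4]

/-- The test field is h⁻² times the edge field plus the interpolated normal field. Edge derivative
times edge vector has the size of h²∇q, which explains the factor. All constants are fixed before
the surface and the mesh; they depend on these only through the geometric constant C. -/
lemma exists_infSup {kp ku kl : ℕ} (hku : 2 ≤ ku) (hkp : kp + 1 = ku) (hkl : 1 ≤ kl)
    (hkl' : kl ≤ ku) {C : ℝ} (hC : 0 < C) : ∃ β > 0, ∃ B > 0, ∃ h₀ > 0,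
    ∀ (S : EvolvingSurface) (M : Triangulation (S.Γ 0)) (kg : ℕ) (h : ℝ), S.MeshGeom M kg h C →
      h < h₀ → ∀ t ∈ Icc 0 S.T, ∀ (q : M.Node kp → ℝ) (ξ : M.Node kl → ℝ), ∃ v : M.Node ku → E3,
        β * (M.jumpNorm q ^ 2 + M.meshNorm h ξ ^ 2) ≤ S.bForm M kg t v q ξ ∧
        M.meshNorm h v ≤ B * (M.jumpNorm q + M.meshNorm h ξ) := by
  have hku1 : 1 ≤ ku := by omega
  have hkp1 : 1 ≤ kp := by omega
  obtain ⟨cu, hcu, hU⟩ := exists_locFun_bound E3 ku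
  obtain ⟨cl, hcl, hL⟩ := exists_locFun_bound ℝ kl
  obtain ⟨p, hp, hP⟩ := exists_fderiv_locFun_bound ℝ hkp1
  obtain ⟨ce, hce, hE⟩ := exists_oscNorm_le_integral hkp1
  obtain ⟨cd, hcd, hD⟩ := exists_dofNorm_le_integral hkl
  set V := volume.real refTriangle with hV
  have hV0 : 0 < V := volume_real_refTriangle_pos
  set κ := √(Fintype.card (LatticeIndex ku) : ℝ) with hκ
  have hκ0 : 0 ≤ κ := Real.sqrt_nonneg _
  set U := cu * κ * cl * C with hUdef
  have hU0 : 0 ≤ U := by positivity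
  set D := 4 * C ^ 2 * p ^ 2 + 2 * (U + cl * C) * p * C +
        3 * C ^ 3 * cl * p + C ^ 2 * (cl * U + cl ^ 2 * C) with hDdef
  have hD0 : 0 < D := by positivity
  set m := min ce cd with hm
  have hm0 : 0 < m := lt_min hce hcd
  refine ⟨C⁻¹ * m / 2, by positivity, κ * p + κ * cl + 1, by positivity,
    C⁻¹ * m / (2 * V * D), by positivity, fun S M kg h G hlt t ht q ξ => ?_⟩
  have h0 := G.h_pos
  rw [lt_div_iff₀ (by positivity)] at hlt
  set a : Fin M.nV → E3 := fun i => S.Φ t (M.vert i) with ha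
  set v₁ := M.interp ku (M.edgeField q a) with hv₁
  set v₂ := M.interp ku (S.normalField M t ξ) with hv₂
  refine ⟨(h ^ 2)⁻¹ • v₁ + v₂, ?_, ?_⟩
  · rw [G.bForm_eq ht, Triangulation.jumpNorm_sq, Triangulation.meshNorm_sq, Finset.mul_sum,
      ← Finset.sum_add_distrib, Finset.mul_sum]
    refine Finset.sum_le_sum fun K _ => ?_
    set A := oscNorm (M.dof q K) with hA
    set X := dofNorm (M.dof ξ K) with hX
    have hA0 : 0 ≤ A := oscNorm_nonneg _
    have hX0 : 0 ≤ X := dofNorm_nonneg _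
    have hloc : ∀ x, locFun (M.dof ((h ^ 2)⁻¹ • v₁ + v₂) K) x =
        (h ^ 2)⁻¹ • M.edgeField q a K x + locFun (M.dof v₂ K) x := by
      intro x
      rw [← M.locFun_interp_edgeField hku hkp q a K x, ← locFun_smul, ← locFun_add]
      rfl
    have hpt : ∀ x ∈ refTriangle, C⁻¹ * h ^ 2 * ((h ^ 2)⁻¹ * edgeForm (locFun (M.dof q K)) x +
        locFun (M.dof ξ K) x ^ 2) - D * h * (A ^ 2 + (h * X) ^ 2) ≤
        S.bDensity M kg t ((h ^ 2)⁻¹ • v₁ + v₂) q ξ K x := by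
      intro x hx
      obtain ⟨-, hen, hef⟩ := G.edgeField_bounds ht K hx hp.le hP q
      have := infSup_pointwise h0 hC hp.le hU0 hcl.le hA0 hX0 (norm_nonneg _)
        (G.normal_le ht K hx) (G.norm_normal t ht _ (M.vert_mem (M.tri K 0)))
        (norm_discNormal_le t K x) (G.disc_normal t ht K x hx)
        (inner_discNormal_elemFlux K q) (G.norm_elemFlux_le ht K hx hp.le hP q) hen hef
        (G.norm_interp_normalField_sub_le ht K hcl.le hU hL hku1 hkl' hcu.le ξ hx)
        (hL (M.dof ξ K) x hx)
      rw [G.bDensity_eq ht K hx, hloc]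
      refine le_trans (sub_le_sub_right (mul_le_mul_of_nonneg_right (G.normal_ge t ht K x hx) ?_) _)
        this
      have := edgeForm_nonneg (locFun (M.dof q K)) hx
      positivity
    have hc1 := continuous_edgeForm (M.dof q K)
    have hc2 : Continuous fun x => locFun (M.dof ξ K) x ^ 2 := (continuous_locFun (M.dof ξ K)).pow 2
    have hc4 : Continuous fun x => (h ^ 2)⁻¹ * edgeForm (locFun (M.dof q K)) x :=
      continuous_const.mul hc1
    have hc3 : Continuous fun x => C⁻¹ * h ^ 2 * ((h ^ 2)⁻¹ * edgeForm (locFun (M.dof q K)) x +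
        locFun (M.dof ξ K) x ^ 2) := continuous_const.mul ((continuous_const.mul hc1).add hc2)
    refine le_trans ?_ (integral_refTriangle_mono (f := fun x => C⁻¹ * h ^ 2 * ((h ^ 2)⁻¹ *
      edgeForm (locFun (M.dof q K)) x + locFun (M.dof ξ K) x ^ 2) - D * h * (A ^ 2 + (h * X) ^ 2))
      (hc3.sub continuous_const).continuousOn
      (G.continuousOn_bDensity ht _ q ξ K) hpt)
    rw [integral_sub (integrableOn_refTriangle hc3.continuousOn)
      (integrableOn_refTriangle continuousOn_const), integral_const_mul,
      integral_add (integrableOn_refTriangle hc4.continuousOn)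
      (integrableOn_refTriangle hc2.continuousOn), integral_const_mul, setIntegral_const, smul_eq_mul]
    have i1 : m * A ^ 2 ≤ ∫ x in refTriangle, edgeForm (locFun (M.dof q K)) x :=
      (mul_le_mul_of_nonneg_right (min_le_left _ _) (sq_nonneg _)).trans (hE _)
    have i2 : m * X ^ 2 ≤ ∫ x in refTriangle, locFun (M.dof ξ K) x ^ 2 :=
      (mul_le_mul_of_nonneg_right (min_le_right _ _) (sq_nonneg _)).trans (hD _)
    have i3 : C⁻¹ * m * (A ^ 2 + h ^ 2 * X ^ 2) ≤ C⁻¹ * h ^ 2 * ((h ^ 2)⁻¹ *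
        (∫ x in refTriangle, edgeForm (locFun (M.dof q K)) x) +
        ∫ x in refTriangle, locFun (M.dof ξ K) x ^ 2) := by
      calc _ = C⁻¹ * h ^ 2 * ((h ^ 2)⁻¹ * (m * A ^ 2) + m * X ^ 2) := by field_simp
        _ ≤ _ := by gcongr
    -- The threshold on h is chosen so that the cross terms consume half of the coercive term; this
    -- is the factor 1/2 in the inf-sup constant.
    have i4 : V * (D * h * (A ^ 2 + (h * X) ^ 2)) ≤ C⁻¹ * m / 2 * (A ^ 2 + h ^ 2 * X ^ 2) := by
      calc _ = h * (2 * V * D) / 2 * (A ^ 2 + h ^ 2 * X ^ 2) := by ring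
        _ ≤ _ := by gcongr
    linarith
  · have n1 := M.jumpNorm_nonneg q
    have n2 := M.meshNorm_nonneg h0.le ξ
    have e1 : M.meshNorm h v₁ ≤ h * (κ * p * h * M.jumpNorm q) := by
      refine Triangulation.meshNorm_le_of_forall h0.le (by positivity) fun K => ?_
      have d := oscNorm_nonneg (M.dof q K)
      rw [hv₁, M.dof_interp hku1 (M.compatible_edgeField q a) K, mul_assoc, mul_assoc]
      refine dofNorm_le (by positivity) fun i => ?_
      rw [← mul_assoc]
      exact (G.edgeField_bounds ht K (latPt_mem hku1 i) hp.le hP q).1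
    have e2 : M.meshNorm h v₂ ≤ h * (κ * cl * √(∑ K, dofNorm (M.dof ξ K) ^ 2)) :=
      Triangulation.meshNorm_le_of_forall h0.le (by positivity) fun K =>
        G.dofNorm_interp_normalField_le ht K hcl.le hL hku1 ξ
    have e3 := M.meshNorm_add_le h0.le ((h ^ 2)⁻¹ • v₁) v₂
    rw [M.meshNorm_smul, abs_of_pos (by positivity)] at e3
    have e4 : (h ^ 2)⁻¹ * M.meshNorm h v₁ ≤ κ * p * M.jumpNorm q := by
      calc _ ≤ (h ^ 2)⁻¹ * (h * (κ * p * h * M.jumpNorm q)) := by gcongr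
        _ = _ := by field_simp
    have e5 : M.meshNorm h v₂ ≤ κ * cl * M.meshNorm h ξ :=
      e2.trans_eq (by rw [Triangulation.meshNorm]; ring)
    have e6 : 0 ≤ κ * p * M.meshNorm h ξ := by positivity
    have e7 : 0 ≤ κ * cl * M.jumpNorm q := by positivity
    linarith

end EvolvingSurface

/-! ### Charts of the surface and bi-Lipschitz projection of the elements -/

lemma cross3_self (v : E3) : cross3 v v = 0 := by
  rw [← norm_eq_zero, ← sq_eq_zero_iff, norm_cross3_sq, real_inner_self_eq_norm_sq]
  ring

namespace Triangulation

variable {Γ : Set E3} (M : Triangulation Γ)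

/-- All edges are at most `h` and all triangles have at least the area `κ h² / 2`. -/
structure IsShapeRegular (h κ : ℝ) : Prop where
  h_pos : 0 < h
  edge_le : ∀ K l m, ‖M.vert (M.tri K l) - M.vert (M.tri K m)‖ ≤ h
  area_ge : ∀ K, κ * h ^ 2 ≤ ‖cross3 (chord (fun l => M.vert (M.tri K l)) 0)
    (chord (fun l => M.vert (M.tri K l)) 1)‖

variable {M}

lemma pt_sub_pt (K : Fin M.nK) (x y : R2) :
    M.pt K x - M.pt K y = (x 0 - y 0) • chord (fun l => M.vert (M.tri K l)) 0 +
      (x 1 - y 1) • chord (fun l => M.vert (M.tri K l)) 1 := by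
  simp only [pt, Fin.sum_univ_three, bary, chord]
  simp only [Matrix.cons_val_zero, Matrix.cons_val_one, Matrix.cons_val]
  rw [show Fin.succ (0 : Fin 2) = (1 : Fin 3) from rfl,
    show Fin.succ (1 : Fin 2) = (2 : Fin 3) from rfl]
  module

lemma IsShapeRegular.norm_pt_sub_le {h κ : ℝ} (H : M.IsShapeRegular h κ) (K : Fin M.nK) (x y : R2) :
    ‖M.pt K x - M.pt K y‖ ≤ 2 * h * ‖x - y‖ := by
  have h0 := norm_le_pi_norm (x - y) 0
  have h1 := norm_le_pi_norm (x - y) 1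
  rw [pt_sub_pt]
  refine (norm_add_le _ _).trans ?_
  rw [norm_smul, norm_smul]
  calc _ ≤ ‖x - y‖ * h + ‖x - y‖ * h := add_le_add
        (mul_le_mul h0 (H.edge_le K 1 0) (norm_nonneg _) (norm_nonneg _))
        (mul_le_mul h1 (H.edge_le K 2 0) (norm_nonneg _) (norm_nonneg _))
    _ = _ := by ring

/-- Cramer's rule: the vector product with one edge isolates one coordinate of x - y, multiplied by
the area vector, which the shape regularity bounds below. -/
lemma IsShapeRegular.le_norm_pt_sub {h κ : ℝ} (H : M.IsShapeRegular h κ) (K : Fin M.nK) (x y : R2) :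
    κ * h * ‖x - y‖ ≤ ‖M.pt K x - M.pt K y‖ := by
  have h0 := H.h_pos
  set E := chord (fun l => M.vert (M.tri K l)) with hE
  have hE0 : ‖E 0‖ ≤ h := H.edge_le K 1 0
  have hE1 : ‖E 1‖ ≤ h := H.edge_le K 2 0
  rcases le_or_gt κ 0 with hκ | hκ
  · refine le_trans ?_ (norm_nonneg _)
    exact mul_nonpos_of_nonpos_of_nonneg (mul_nonpos_of_nonpos_of_nonneg hκ h0.le) (norm_nonneg _)
  have key : ∀ a, κ * h * |x a - y a| ≤ ‖M.pt K x - M.pt K y‖ := by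
    have c0 : (x 0 - y 0) • cross3 (E 0) (E 1) = cross3 (M.pt K x - M.pt K y) (E 1) := by
      rw [pt_sub_pt, cross3_add_left, cross3_smul_left, cross3_smul_left, cross3_self, smul_zero,
        add_zero]
    have c1 : (x 1 - y 1) • cross3 (E 0) (E 1) = cross3 (E 0) (M.pt K x - M.pt K y) := by
      rw [pt_sub_pt, cross3_add_right, cross3_smul_right, cross3_smul_right, cross3_self, smul_zero,
        zero_add]
    have hA := H.area_ge K
    have e0 : |x 0 - y 0| * (κ * h ^ 2) ≤ ‖M.pt K x - M.pt K y‖ * h := by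
      have := congrArg norm c0
      rw [norm_smul, Real.norm_eq_abs] at this
      calc _ ≤ |x 0 - y 0| * ‖cross3 (E 0) (E 1)‖ := by gcongr
        _ = _ := this
        _ ≤ ‖M.pt K x - M.pt K y‖ * ‖E 1‖ := norm_cross3_le _ _
        _ ≤ _ := by gcongr
    have e1 : |x 1 - y 1| * (κ * h ^ 2) ≤ ‖M.pt K x - M.pt K y‖ * h := by
      have := congrArg norm c1
      rw [norm_smul, Real.norm_eq_abs] at this
      calc _ ≤ |x 1 - y 1| * ‖cross3 (E 0) (E 1)‖ := by gcongr
        _ = _ := this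
        _ ≤ ‖E 0‖ * ‖M.pt K x - M.pt K y‖ := norm_cross3_le _ _
        _ ≤ h * ‖M.pt K x - M.pt K y‖ := by gcongr
        _ = _ := mul_comm _ _
    have e : ∀ a, |x a - y a| * (κ * h ^ 2) ≤ ‖M.pt K x - M.pt K y‖ * h :=
      Fin.forall_fin_two.2 ⟨e0, e1⟩
    intro a
    refine le_of_mul_le_mul_right ?_ h0
    calc _ = |x a - y a| * (κ * h ^ 2) := by ring
      _ ≤ _ := e a
  have hk : 0 < κ * h := by positivity
  rw [← le_div_iff₀' hk, pi_norm_le_iff_of_nonneg (by positivity)]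
  intro a
  rw [le_div_iff₀' hk]
  exact key a

end Triangulation

namespace EvolvingSurface

variable (S : EvolvingSurface)

/-- A flat point differs from its projection by a multiple σ of the normal there. Flat displacements
and surface chords are both nearly tangential, so the multiples change little between two points,
and the projection distorts distances only by small relative errors. -/
lemma exists_proj_bilipschitz {κ : ℝ} (hκ : 0 < κ) : ∃ h₀ > 0, ∀ (M : Triangulation (S.Γ 0)) (h : ℝ),
    M.IsShapeRegular h κ → h < h₀ → ∀ K, (∀ x ∈ refTriangle, ‖M.proj K x - M.vert (M.tri K 0)‖ ≤ 2 * h) ∧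
      ∀ x ∈ refTriangle, ∀ y ∈ refTriangle, κ / 4 * h * ‖x - y‖ ≤ ‖M.proj K x - M.proj K y‖ ∧
        ‖M.proj K x - M.proj K y‖ ≤ 6 * h * ‖x - y‖ := by
  obtain ⟨L, hL, hnb⟩ := exists_normal_bounds (S.domain 0 S.zero_mem) (by norm_num)
    (S.normal_spec 0 S.zero_mem)
  obtain ⟨C₁, hC₁, hpd⟩ := S.exists_proj_dist
  obtain ⟨C₂, hC₂, hdev⟩ := S.exists_node_deviation
  set B := C₁ + C₂ + 12 * L + 12 * L / κ + 2 * (4 * L + 2 * C₁ * L) + 1 with hB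
  have hB0 : 0 < B := by positivity
  refine ⟨B⁻¹, by positivity, fun M h H hlt K => ?_⟩
  have hh := H.h_pos
  have hBh : B * h ≤ 1 := by
    rw [lt_inv_comm₀ hh hB0] at hlt
    calc B * h ≤ h⁻¹ * h := by gcongr
      _ = 1 := inv_mul_cancel₀ hh.ne'
  have p1 : 0 < C₁ * h := by positivity
  have p2 : 0 < C₂ * h := by positivity
  have p3 : 0 < 12 * L * h := by positivity
  have p4 : 0 < 12 * L / κ * h := by positivity
  have p5 : 0 < (4 * L + 2 * C₁ * L) * h := by positivity
  have hsum : C₁ * h + C₂ * h + 12 * L * h + 12 * L / κ * h + 2 * ((4 * L + 2 * C₁ * L) * h) + h ≤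
      1 := by rw [hB] at hBh; linarith
  have q4 : 12 * L * h ≤ κ := by
    have : 12 * L / κ * h ≤ 1 := by linarith
    rwa [div_mul_eq_mul_div, div_le_one hκ] at this
  have hV : ∀ x ∈ refTriangle, ‖M.proj K x - M.vert (M.tri K 0)‖ ≤ 2 * h := fun x hx =>
    (hdev M h H.edge_le (by linarith) K x hx).1
  refine ⟨hV, fun x hx y hy => ?_⟩
  have hpx := M.proj_spec K hx
  have hpy := M.proj_spec K hy
  have hn1 : ∀ p ∈ S.Γ 0, ‖S.normal 0 p‖ = 1 := fun p hp =>
    norm_outwardNormal (S.normal_spec 0 S.zero_mem) hp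
  -- The displacement to a closest point has no tangential component, so it is a multiple of the
  -- normal.
  have hrep : ∀ x ∈ refTriangle, ∃ σ : ℝ, |σ| ≤ C₁ * h ^ 2 ∧
      M.pt K x - M.proj K x = σ • S.normal 0 (M.proj K x) := by
    intro x hx
    have hp := (M.proj_spec K hx).1
    set n := S.normal 0 (M.proj K x)
    set s := M.pt K x - M.proj K x
    have hnn : ‖n‖ = 1 := hn1 _ hp
    refine ⟨inner ℝ s n, ?_, ?_⟩
    · refine (abs_real_inner_le_norm _ _).trans ?_
      rw [hnn, mul_one]
      exact hpd M h H.edge_le (by linarith) K x hx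
    · have ho : inner ℝ (s - inner ℝ s n • n) n = 0 := by
        rw [inner_sub_left, real_inner_smul_left, real_inner_self_eq_norm_sq, hnn]; ring
      have h2 := inner_sub_closest_eq_zero (S.domain 0 S.zero_mem) (by norm_num)
        (S.normal_spec 0 S.zero_mem) hp (x := M.pt K x) (fun w hw => by
          rw [dist_eq_norm, dist_eq_norm]; exact M.dist_proj_le K hx hw) ho
      have h3 : inner ℝ (s - inner ℝ s n • n) (s - inner ℝ s n • n) = 0 := by
        conv_lhs => rw [inner_sub_left, real_inner_smul_left, real_inner_comm _ n, ho, mul_zero,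
          sub_zero]
        exact h2
      exact sub_eq_zero.1 (inner_self_eq_zero.1 h3)
  obtain ⟨σ, hσ, hσe⟩ := hrep x hx
  obtain ⟨σ', hσ', hσe'⟩ := hrep y hy
  set p := M.proj K x with hp
  set p' := M.proj K y with hp'
  set n := S.normal 0 p with hn
  set n' := S.normal 0 p' with hn'
  have hnn : ‖n‖ = 1 := hn1 _ hpx.1
  set D := M.pt K x - M.pt K y with hD
  set d := ‖x - y‖ with hd
  have hd0 : 0 ≤ d := norm_nonneg _
  set δ := ‖p - p'‖ with hδ
  have hδ0 : 0 ≤ δ := norm_nonneg _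
  have hδh : δ ≤ 4 * h := by
    have := norm_sub_le_norm_sub_add_norm_sub p (M.vert (M.tri K 0)) p'
    have h1 := hV x hx
    have h2 := hV y hy
    rw [norm_sub_rev] at h2
    linarith
  have hν : ‖n' - n‖ ≤ L * δ := by
    rw [hδ, norm_sub_rev p]
    exact (hnb p' hpy.1 p hpx.1).1
  have hΔn : |inner ℝ (p - p') n| ≤ 4 * L * h * δ := by
    have := (hnb p hpx.1 p' hpy.1).2
    rw [← neg_sub p p', inner_neg_left, abs_neg, norm_neg, ← hδ] at this
    refine this.trans ?_
    nlinarith [mul_nonneg hL.le hδ0]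
  have hEn : ∀ l, |inner ℝ (M.vert (M.tri K l) - M.vert (M.tri K 0)) n| ≤ 3 * L * h ^ 2 := by
    intro l
    have e1 := (hnb _ (M.vert_mem (M.tri K 0)) _ (M.vert_mem (M.tri K l))).2
    have e2 := (hnb p hpx.1 _ (M.vert_mem (M.tri K 0))).1
    have e3 := H.edge_le K l 0
    have e4 : inner ℝ (M.vert (M.tri K l) - M.vert (M.tri K 0)) n =
        inner ℝ (M.vert (M.tri K l) - M.vert (M.tri K 0)) (S.normal 0 (M.vert (M.tri K 0))) +
        inner ℝ (M.vert (M.tri K l) - M.vert (M.tri K 0))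
          (n - S.normal 0 (M.vert (M.tri K 0))) := by
      rw [← inner_add_right, add_sub_cancel]
    rw [e4]
    refine (abs_add_le _ _).trans ?_
    have e5 : |inner ℝ (M.vert (M.tri K l) - M.vert (M.tri K 0))
          (n - S.normal 0 (M.vert (M.tri K 0)))| ≤ h * (L * (2 * h)) :=
      (abs_real_inner_le_norm _ _).trans (mul_le_mul e3 (e2.trans
        (mul_le_mul_of_nonneg_left (hV x hx) hL.le)) (norm_nonneg _) hh.le)
    have e6 : L * ‖M.vert (M.tri K l) - M.vert (M.tri K 0)‖ ^ 2 ≤ L * h ^ 2 := by gcongr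
    linarith
  have hDn : |inner ℝ D n| ≤ 6 * L * h ^ 2 * d := by
    have h0 : |x 0 - y 0| ≤ d := norm_le_pi_norm (x - y) 0
    have h1 : |x 1 - y 1| ≤ d := norm_le_pi_norm (x - y) 1
    rw [hD, M.pt_sub_pt, inner_add_left, real_inner_smul_left, real_inner_smul_left]
    refine (abs_add_le _ _).trans ?_
    rw [abs_mul, abs_mul]
    calc _ ≤ d * (3 * L * h ^ 2) + d * (3 * L * h ^ 2) := add_le_add
          (mul_le_mul h0 (hEn 1) (abs_nonneg _) hd0) (mul_le_mul h1 (hEn 2) (abs_nonneg _) hd0)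
      _ = _ := by ring
  have hDe : D = (p - p') + (σ - σ') • n - σ' • (n' - n) := by
    have e1 : D = (M.pt K x - p) - (M.pt K y - p') + (p - p') := by rw [hD]; abel
    rw [e1, hσe, hσe']
    module
  have hσn : ‖σ' • (n' - n)‖ ≤ C₁ * L * h ^ 2 * δ := by
    rw [norm_smul, Real.norm_eq_abs]
    calc _ ≤ C₁ * h ^ 2 * (L * δ) := mul_le_mul hσ' hν (norm_nonneg _) (by positivity)
      _ = _ := by ring
  -- Take the normal component of `hDe` at p; the components of D and of p - p' are small, and the
  -- change of the normal is damped by σ' = O(h²).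
  have hτ : |σ - σ'| ≤ 6 * L * h ^ 2 * d + 4 * L * h * δ + C₁ * L * h ^ 2 * δ := by
    have e1 : σ - σ' = inner ℝ D n - inner ℝ (p - p') n + inner ℝ (σ' • (n' - n)) n := by
      rw [hDe, inner_sub_left, inner_add_left, real_inner_smul_left n, real_inner_self_eq_norm_sq,
        hnn]
      ring
    rw [e1]
    have e2 : |inner ℝ (σ' • (n' - n)) n| ≤ C₁ * L * h ^ 2 * δ := by
      refine (abs_real_inner_le_norm _ _).trans ?_
      rw [hnn, mul_one]
      exact hσn
    exact (abs_add_le _ _).trans (add_le_add ((abs_sub _ _).trans (add_le_add hDn hΔn)) e2)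
  have hτn : ‖(σ - σ') • n‖ = |σ - σ'| := by rw [norm_smul, hnn, mul_one, Real.norm_eq_abs]
  have hbig : 4 * L * h * δ + 2 * (C₁ * L * h ^ 2 * δ) ≤ 1 / 2 * δ := by
    have e1 : (4 * L + 2 * C₁ * L) * h ≤ 1 / 2 := by linarith
    have e2 : h ≤ 1 := by linarith
    calc 4 * L * h * δ + 2 * (C₁ * L * h ^ 2 * δ) = (4 * L * h + 2 * (C₁ * L) * (h * h)) * δ := by
          ring
      _ ≤ (4 * L * h + 2 * (C₁ * L) * (1 * h)) * δ := by gcongr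
      _ = (4 * L + 2 * C₁ * L) * h * δ := by ring
      _ ≤ _ := by gcongr
  have hDlo := H.le_norm_pt_sub K x y
  have hDhi := H.norm_pt_sub_le K x y
  constructor
  · have e1 : ‖D‖ ≤ δ + |σ - σ'| + C₁ * L * h ^ 2 * δ := by
      rw [hDe]
      refine (norm_sub_le _ _).trans (add_le_add ((norm_add_le _ _).trans ?_) hσn)
      rw [hτn]
    have e2 : 6 * L * h ^ 2 * d ≤ κ / 2 * h * d := by
      calc 6 * L * h ^ 2 * d = 12 * L * h / 2 * h * d := by ring
        _ ≤ _ := by gcongr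
    linarith
  · have e1 : δ ≤ ‖D‖ + |σ - σ'| + C₁ * L * h ^ 2 * δ := by
      have e : p - p' = D - (σ - σ') • n + σ' • (n' - n) := by rw [hDe]; abel
      rw [hδ, e]
      refine (norm_add_le _ _).trans (add_le_add ((norm_sub_le _ _).trans ?_) ?_)
      · rw [hτn]
      · rw [← e]; exact hσn
    have e2 : 6 * L * h ^ 2 * d ≤ 1 * h * d := by
      have : 6 * L * h ≤ 1 := by linarith
      calc 6 * L * h ^ 2 * d = 6 * L * h * h * d := by ring
        _ ≤ _ := by gcongr
    linarith

/-- Near a point the surface is a Lipschitz graph over a square in its tangent plane. -/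
lemma exists_patch {z : E3} (hz : z ∈ S.Γ 0) : ∃ κ : E3 → R2, ∃ r > 0, ∃ η > 0,
    (∀ y y', ‖κ y - κ y'‖ ≤ ‖y - y'‖) ∧ κ z = 0 ∧
    (∀ y ∈ S.Γ 0 ∩ Metric.ball z r, ∀ y' ∈ S.Γ 0 ∩ Metric.ball z r,
      ‖y - y'‖ ≤ 2 * ‖κ y - κ y'‖) ∧
    ∀ p : R2, ‖p‖ ≤ η → ∃ y ∈ S.Γ 0 ∩ Metric.ball z (r / 2), κ y = p := by
  obtain ⟨L, hL, hnb⟩ := exists_normal_bounds (S.domain 0 S.zero_mem) (by norm_num)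
    (S.normal_spec 0 S.zero_mem)
  have hnz : ‖S.normal 0 z‖ = 1 := norm_outwardNormal (S.normal_spec 0 S.zero_mem) hz
  obtain ⟨a, b, F⟩ := exists_isFrame hnz
  obtain ⟨φ, hφ⟩ := (S.domain 0 S.zero_mem).2.2.2 z hz
  obtain ⟨C, hC, δ, hδ, hshift⟩ := exists_normal_shift (S.domain 0 S.zero_mem) (by norm_num)
    (S.normal_spec 0 S.zero_mem) hz hφ
  have hφz : φ z = 0 :=
    (IsLocalDefiningFunction.mem_frontier_iff (S.domain 0 S.zero_mem).1 (by norm_num) hφ).1 hz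
  -- With L r = 1/6, a chord in the ball has normal component at most 2Lr + Lr = 1/2 of its length;
  -- its tangential coordinates then control the chord up to the factor 2.
  set r := (6 * L)⁻¹ with hr
  have hr0 : 0 < r := by positivity
  have hLr : L * r = 1 / 6 := by rw [hr]; field_simp
  obtain ⟨ε, hε, hεφ⟩ := Metric.continuousAt_iff.1 (hφ.1.continuous.continuousAt (x := z))
    (r / (4 * C)) (by positivity)
  -- The tangential displacement is at most 2η ≤ r/8 and the normal shift at most r/4, so the lifted
  -- point stays in the ball of radius r/2.
  set η := min (min (δ / 3) (ε / 3)) (r / 16) with hη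
  have hη0 : 0 < η := by positivity
  set κ : E3 → R2 := fun y => ![inner ℝ (y - z) a, inner ℝ (y - z) b] with hκ
  have hκsub : ∀ y y', κ y - κ y' = ![inner ℝ (y - y') a, inner ℝ (y - y') b] := by
    intro y y'
    ext i
    fin_cases i
    · simp only [hκ, Fin.zero_eta, Pi.sub_apply, Matrix.cons_val_zero]
      rw [← inner_sub_left, sub_sub_sub_cancel_right]
    · simp only [hκ, Fin.mk_one, Pi.sub_apply, Matrix.cons_val_one, Matrix.cons_val_zero]
      rw [← inner_sub_left, sub_sub_sub_cancel_right]
  refine ⟨κ, r, hr0, η, hη0, ?_, ?_, ?_, ?_⟩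
  · intro y y'
    rw [hκsub, pi_norm_le_iff_of_nonneg (norm_nonneg _)]
    intro i
    fin_cases i
    · exact (abs_real_inner_le_norm _ _).trans (by rw [F.norm_a, mul_one])
    · exact (abs_real_inner_le_norm _ _).trans (by rw [F.norm_b, mul_one])
  · ext i
    fin_cases i <;> simp [hκ]
  · rintro y ⟨hy, hyr⟩ y' ⟨hy', hyr'⟩
    set v := y - y' with hv
    have hk0 : |inner ℝ v a| ≤ ‖κ y - κ y'‖ := by
      rw [hκsub]; exact norm_le_pi_norm ![inner ℝ (y - y') a, inner ℝ (y - y') b] 0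
    have hk1 : |inner ℝ v b| ≤ ‖κ y - κ y'‖ := by
      rw [hκsub]; exact norm_le_pi_norm ![inner ℝ (y - y') a, inner ℝ (y - y') b] 1
    rw [mem_ball_iff_norm] at hyr hyr'
    have hvr : ‖v‖ ≤ 2 * r := by
      have := norm_sub_le_norm_sub_add_norm_sub y z y'
      rw [norm_sub_rev z] at this
      linarith
    have hvn : |inner ℝ v (S.normal 0 z)| ≤ 1 / 2 * ‖v‖ := by
      have e1 := (hnb y' hy' y hy).2
      have e2 := (hnb z hz y' hy').1
      have e3 : inner ℝ v (S.normal 0 z) = inner ℝ v (S.normal 0 y') +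
          inner ℝ v (S.normal 0 z - S.normal 0 y') := by
        rw [← inner_add_right, add_sub_cancel]
      rw [e3]
      refine (abs_add_le _ _).trans ?_
      have e4 : |inner ℝ v (S.normal 0 z - S.normal 0 y')| ≤ ‖v‖ * (L * r) :=
        (abs_real_inner_le_norm _ _).trans (mul_le_mul_of_nonneg_left (e2.trans
          (mul_le_mul_of_nonneg_left (by rw [norm_sub_rev]; exact hyr'.le) hL.le)) (norm_nonneg _))
      have e5 : L * ‖v‖ ^ 2 ≤ 2 * (L * r) * ‖v‖ := by
        calc L * ‖v‖ ^ 2 = L * ‖v‖ * ‖v‖ := by ring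
          _ ≤ L * (2 * r) * ‖v‖ := by gcongr
          _ = _ := by ring
      rw [hLr] at e4 e5
      linarith
    have hsq := F.norm_sq v
    have s0 := pow_le_pow_left₀ (abs_nonneg _) hk0 2
    have s1 := pow_le_pow_left₀ (abs_nonneg _) hk1 2
    have s2 := pow_le_pow_left₀ (abs_nonneg _) hvn 2
    rw [sq_abs] at s0 s1 s2
    refine le_of_sq_le_sq ?_ (by positivity)
    nlinarith [sq_nonneg ‖v‖, sq_nonneg ‖κ y - κ y'‖]
  · intro p hp
    have hp0 : |p 0| ≤ η := (norm_le_pi_norm p 0).trans hp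
    have hp1 : |p 1| ≤ η := (norm_le_pi_norm p 1).trans hp
    set x := z + (p 0 • a + p 1 • b) with hx
    have hxz : ‖x - z‖ ≤ 2 * η := by
      rw [hx, add_sub_cancel_left]
      refine (norm_add_le _ _).trans ?_
      rw [norm_smul, norm_smul, F.norm_a, F.norm_b, Real.norm_eq_abs, Real.norm_eq_abs]
      linarith
    have hη1 : η ≤ δ / 3 := (min_le_left _ _).trans (min_le_left _ _)
    have hη2 : η ≤ ε / 3 := (min_le_left _ _).trans (min_le_right _ _)
    have hη3 : η ≤ r / 16 := min_le_right _ _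
    obtain ⟨s, hs, hsΓ⟩ := hshift x (by rw [mem_ball_iff_norm]; linarith)
    have hφx := hεφ (x := x) (by rw [dist_eq_norm]; linarith)
    rw [hφz, Real.dist_eq, sub_zero] at hφx
    have hsr : |s| ≤ r / 4 := by
      calc |s| ≤ C * |φ x| := hs
        _ ≤ C * (r / (4 * C)) := by gcongr
        _ = r / 4 := by field_simp
    refine ⟨x + s • S.normal 0 z, ⟨hsΓ, ?_⟩, ?_⟩
    · rw [mem_ball_iff_norm, add_sub_right_comm]
      refine (norm_add_le _ _).trans_lt ?_
      rw [norm_smul, hnz, mul_one, Real.norm_eq_abs]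
      linarith
    · have e : x + s • S.normal 0 z - z = p 0 • a + p 1 • b + s • S.normal 0 z := by rw [hx]; abel
      have hba : inner ℝ b a = 0 := by rw [real_inner_comm]; exact F.inner_ab
      have hna : inner ℝ (S.normal 0 z) a = 0 := by rw [real_inner_comm]; exact F.inner_an
      have hnb' : inner ℝ (S.normal 0 z) b = 0 := by rw [real_inner_comm]; exact F.inner_bn
      ext i
      fin_cases i
      · simp only [hκ, Fin.zero_eta, Matrix.cons_val_zero]
        rw [e, inner_add_left, inner_add_left, real_inner_smul_left, real_inner_smul_left,
          real_inner_smul_left, real_inner_self_eq_norm_sq, F.norm_a, hba, hna]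
        ring
      · simp only [hκ, Fin.mk_one, Matrix.cons_val_one, Matrix.cons_val_zero]
        rw [e, inner_add_left, inner_add_left, real_inner_smul_left, real_inner_smul_left,
          real_inner_smul_left, real_inner_self_eq_norm_sq, F.norm_b, F.inner_ab, hnb']
        ring

end EvolvingSurface

/-! ### The discrete Poincaré inequality -/

/-- If a preconnected set is covered by finitely many closed sets carrying numbers `u i` with
tolerance `o i` such that numbers on intersecting sets agree up to tolerance, then the numbers
along the preconnected set vary at most by twice the sum of the tolerances. -/
lemma IsPreconnected.abs_sub_le_two_mul_sum {X ι : Type*} [TopologicalSpace X] [Finite ι]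
    {P : Set X} (hP : IsPreconnected P) {A : ι → Set X} (hA : ∀ i, IsClosed (A i))
    (hcov : P ⊆ ⋃ i, A i) {u o : ι → ℝ} (ho : ∀ i, 0 ≤ o i)
    (hint : ∀ i j, (A i ∩ A j).Nonempty → |u i - u j| ≤ o i + o j) {J : Finset ι}
    (hJ : ∀ i, (P ∩ A i).Nonempty → i ∈ J) {i j : ι} (hi : (P ∩ A i).Nonempty)
    (hj : (P ∩ A j).Nonempty) : |u i - u j| ≤ 2 * ∑ l ∈ J, o l := by
  wlog hij : u i ≤ u j generalizing i j
  · rw [abs_sub_comm]; exact this hj hi (le_of_not_ge hij)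
  -- A value s missed by all intervals would split the pieces meeting P into those below and those
  -- above s. Two closed sets would cover the preconnected P, and a common point would violate the
  -- tolerance between intersecting pieces. Comparing lengths then gives the claim.
  have hsub : Icc (u i) (u j) ⊆ ⋃ l ∈ J, Icc (u l - o l) (u l + o l) := by
    intro s hs
    by_contra hcon
    simp only [mem_iUnion, not_exists] at hcon
    have hout : ∀ l, (P ∩ A l).Nonempty → u l + o l < s ∨ s < u l - o l := by
      intro l hl
      have := hcon l (hJ l hl)
      rw [mem_Icc, not_and_or, not_le, not_le] at this
      exact this.symm
    have hi1 : u i + o i < s := (hout i hi).resolve_right fun h => by linarith [ho i, hs.1]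
    have hj1 : s < u j - o j := (hout j hj).resolve_left fun h => by linarith [ho j, hs.2]
    have hclosed : ∀ Q : ι → Prop, IsClosed (⋃ l ∈ {l | Q l}, A l) := fun Q =>
      (Set.toFinite {l | Q l}).isClosed_biUnion fun l _ => hA l
    have k1 : P ⊆ (⋃ l ∈ {l | u l + o l < s}, A l) ∪ ⋃ l ∈ {l | s < u l - o l}, A l := by
      intro x hx
      obtain ⟨l, hl⟩ := mem_iUnion.1 (hcov hx)
      rcases hout l ⟨x, hx, hl⟩ with h | h
      · exact Or.inl (mem_biUnion (show l ∈ {l | u l + o l < s} from h) hl)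
      · exact Or.inr (mem_biUnion (show l ∈ {l | s < u l - o l} from h) hl)
    have k2 : (P ∩ ⋃ l ∈ {l | u l + o l < s}, A l).Nonempty := by
      obtain ⟨x, hx, hxi⟩ := hi
      exact ⟨x, hx, mem_biUnion (show i ∈ {l | u l + o l < s} from hi1) hxi⟩
    have k3 : (P ∩ ⋃ l ∈ {l | s < u l - o l}, A l).Nonempty := by
      obtain ⟨x, hx, hxj⟩ := hj
      exact ⟨x, hx, mem_biUnion (show j ∈ {l | s < u l - o l} from hj1) hxj⟩
    obtain ⟨x, hxP, hx1, hx2⟩ := isPreconnected_closed_iff.1 hP _ _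
      (hclosed fun l => u l + o l < s) (hclosed fun l => s < u l - o l) k1 k2 k3
    simp only [mem_iUnion] at hx1 hx2
    obtain ⟨l, hl, hxl⟩ := hx1
    obtain ⟨m, hm, hxm⟩ := hx2
    have hl' : u l + o l < s := hl
    have hm' : s < u m - o m := hm
    have := (abs_le.1 (hint l m ⟨x, hxl, hxm⟩)).1
    linarith
  have hvol := (measure_mono (μ := volume) hsub).trans (measure_biUnion_finset_le J _)
  simp only [Real.volume_Icc] at hvol
  rw [← ENNReal.ofReal_sum_of_nonneg fun l _ => by linarith [ho l],
    ENNReal.ofReal_le_ofReal_iff (Finset.sum_nonneg fun l _ => by linarith [ho l])] at hvol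
  rw [abs_sub_comm, abs_of_nonneg (by linarith), Finset.mul_sum]
  refine hvol.trans (le_of_eq (Finset.sum_congr rfl fun l _ => by ring))

/-- A triangle in the interior of the reference triangle. -/
def innerTriangle : Set R2 := {x | ∀ l, 1 / 6 ≤ bary x l}

lemma innerTriangle_subset : innerTriangle ⊆ refTriangle := fun x hx =>
  mem_refTriangle.2 fun l => le_trans (by norm_num) (hx l)

lemma isCompact_innerTriangle : IsCompact innerTriangle := by
  refine isCompact_refTriangle.of_isClosed_subset ?_ innerTriangle_subset
  have : innerTriangle = ⋂ l, {x | 1 / 6 ≤ bary x l} := by ext x; simp [innerTriangle]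
  rw [this]
  exact isClosed_iInter fun l => isClosed_le continuous_const (continuous_bary l)

lemma volume_innerTriangle_lt_top : volume innerTriangle < ⊤ := isCompact_innerTriangle.measure_lt_top

lemma volume_real_innerTriangle_pos : 0 < volume.real innerTriangle := by
  rw [measureReal_def, ENNReal.toReal_pos_iff]
  refine ⟨?_, volume_innerTriangle_lt_top⟩
  have ho : IsOpen {x : R2 | ∀ l, 1 / 6 < bary x l} := by
    have : {x : R2 | ∀ l, 1 / 6 < bary x l} = ⋂ l, {x | 1 / 6 < bary x l} := by ext x; simp
    rw [this]
    exact isOpen_iInter_of_finite fun l => isOpen_lt continuous_const (continuous_bary l)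
  have hne : {x : R2 | ∀ l, 1 / 6 < bary x l}.Nonempty := by
    refine ⟨![1 / 3, 1 / 3], fun l => ?_⟩
    fin_cases l <;> norm_num [bary]
  exact (ho.measure_pos volume hne).trans_le (measure_mono fun x hx l => (hx l).le)

/-- The area of the image of a planar set under an expanding map. -/
lemma volume_le_of_expanding {f : R2 → R2} {s : Set R2} {a : ℝ} (ha : 0 < a)
    (hf : ∀ x ∈ s, ∀ y ∈ s, a * ‖x - y‖ ≤ ‖f x - f y‖) :
    volume s ≤ ENNReal.ofReal (a⁻¹ ^ 2) * volume (f '' s) := by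
  have hinj : InjOn f s := by
    intro x hx y hy hxy
    have := hf x hx y hy
    rw [hxy, sub_self, norm_zero] at this
    have h0 : ‖x - y‖ ≤ 0 := by
      by_contra hcon
      push Not at hcon
      have := mul_pos ha hcon
      linarith
    exact sub_eq_zero.1 (norm_le_zero_iff.1 h0)
  have hg : LipschitzOnWith (Real.toNNReal a⁻¹) (Function.invFunOn f s) (f '' s) := by
    refine LipschitzOnWith.of_dist_le_mul ?_
    rintro _ ⟨x, hx, rfl⟩ _ ⟨y, hy, rfl⟩
    rw [hinj.leftInvOn_invFunOn hx, hinj.leftInvOn_invFunOn hy, dist_eq_norm, dist_eq_norm,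
      Real.coe_toNNReal _ (by positivity), inv_mul_eq_div, le_div_iff₀' ha]
    exact hf x hx y hy
  -- For the sup norm on the plane, two-dimensional Hausdorff measure is Lebesgue measure, so the
  -- Lipschitz inverse enlarges areas by at most a⁻².
  have h := hg.hausdorffMeasure_image_le (d := (Fintype.card (Fin 2) : ℝ)) (by positivity)
  rw [hausdorffMeasure_pi_real, hinj.leftInvOn_invFunOn.image_image] at h
  refine h.trans (le_of_eq ?_)
  congr 1
  rw [Fintype.card_fin, ENNReal.ofReal_pow (by positivity)]
  exact ENNReal.rpow_natCast _ 2

namespace Triangulation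

variable {Γ : Set E3} (M : Triangulation Γ)

lemma convexHull_subset_image_pt (K : Fin M.nK) :
    convexHull ℝ (range fun l => M.vert (M.tri K l)) ⊆ M.pt K '' refTriangle := by
  refine convexHull_min ?_ ?_
  · rintro _ ⟨l, rfl⟩
    exact ⟨refVtx l, refVtx_mem l, M.pt_refVtx K l⟩
  · rintro _ ⟨x, hx, rfl⟩ _ ⟨y, hy, rfl⟩ a b ha hb hab
    refine ⟨a • x + b • y, convex_refTriangle hx hy ha hb hab, ?_⟩
    simp only [pt, bary_combo x y hab, Finset.smul_sum, add_smul, Finset.sum_add_distrib, mul_smul]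

lemma exists_proj_eq {y : E3} (hy : y ∈ Γ) : ∃ K, ∃ x ∈ refTriangle, M.proj K x = y := by
  obtain ⟨w, hw, rfl⟩ := M.proj_bijOn.surjOn hy
  obtain ⟨K, hK⟩ := mem_iUnion.1 hw
  obtain ⟨x, hx, rfl⟩ := M.convexHull_subset_image_pt K hK
  exact ⟨K, x, hx, rfl⟩

lemma pt_eq_of_proj_eq {K K' : Fin M.nK} {x x' : R2} (hx : x ∈ refTriangle) (hx' : x' ∈ refTriangle)
    (h : M.proj K x = M.proj K' x') : M.pt K x = M.pt K' x' :=
  M.proj_bijOn.injOn (mem_iUnion.2 ⟨K, M.pt_mem_convexHull K hx⟩)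
    (mem_iUnion.2 ⟨K', M.pt_mem_convexHull K' hx'⟩) h

/-- The mesh is so fine that the closest point projection is bi-Lipschitz on all its triangles. -/
structure IsFine (h c : ℝ) : Prop where
  c_pos : 0 < c
  h_pos : 0 < h
  near : ∀ K, ∀ x ∈ refTriangle, ‖M.proj K x - M.vert (M.tri K 0)‖ ≤ 2 * h
  lower : ∀ K, ∀ x ∈ refTriangle, ∀ y ∈ refTriangle,
    c * h * ‖x - y‖ ≤ ‖M.proj K x - M.proj K y‖
  upper : ∀ K, ∀ x ∈ refTriangle, ∀ y ∈ refTriangle,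
    ‖M.proj K x - M.proj K y‖ ≤ 6 * h * ‖x - y‖

variable {M}

lemma IsFine.continuousOn_proj {h c : ℝ} (F : M.IsFine h c) (K : Fin M.nK) :
    ContinuousOn (M.proj K) refTriangle := by
  have : LipschitzOnWith (Real.toNNReal (6 * h)) (M.proj K) refTriangle := by
    refine LipschitzOnWith.of_dist_le_mul fun x hx y hy => ?_
    have := F.h_pos
    rw [dist_eq_norm, dist_eq_norm, Real.coe_toNNReal _ (by positivity)]
    exact F.upper K x hx y hy
  exact this.continuousOn

lemma IsFine.isClosed_image_proj {h c : ℝ} (F : M.IsFine h c) (K : Fin M.nK) :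
    IsClosed (M.proj K '' refTriangle) :=
  (isCompact_refTriangle.image_of_continuousOn (F.continuousOn_proj K)).isClosed

/-- The number of elements whose projections lie in a planar region is bounded by its area. -/
lemma IsFine.card_mul_le {h c : ℝ} (F : M.IsFine h c) {κ : E3 → R2} {z : E3} {r : ℝ}
    (hκ : ∀ y y', ‖κ y - κ y'‖ ≤ ‖y - y'‖)
    (hinj : ∀ y ∈ Γ ∩ Metric.ball z r, ∀ y' ∈ Γ ∩ Metric.ball z r, ‖y - y'‖ ≤ 2 * ‖κ y - κ y'‖)
    {G : Finset (Fin M.nK)} {B : Set R2} (hB : volume B < ⊤)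
    (hG : ∀ K ∈ G, ∀ x ∈ refTriangle, M.proj K x ∈ Metric.ball z r ∧ κ (M.proj K x) ∈ B) :
    G.card * ((c * h / 2) ^ 2 * volume.real innerTriangle) ≤ volume.real B := by
  have hc := F.c_pos
  have hh := F.h_pos
  have ha : 0 < c * h / 2 := by positivity
  have hmem : ∀ K ∈ G, ∀ x ∈ refTriangle, M.proj K x ∈ Γ ∩ Metric.ball z r := fun K hK x hx =>
    ⟨(M.proj_spec K hx).1, (hG K hK x hx).1⟩
  set f : Fin M.nK → R2 → R2 := fun K x => κ (M.proj K x) with hf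
  have hexp : ∀ K ∈ G, ∀ x ∈ innerTriangle, ∀ y ∈ innerTriangle,
      c * h / 2 * ‖x - y‖ ≤ ‖f K x - f K y‖ := by
    intro K hK x hx y hy
    have h1 := F.lower K x (innerTriangle_subset hx) y (innerTriangle_subset hy)
    have h2 := hinj _ (hmem K hK x (innerTriangle_subset hx)) _
      (hmem K hK y (innerTriangle_subset hy))
    simp only [hf]
    linarith
  have hκc : Continuous κ := by
    refine (LipschitzWith.of_dist_le_mul (K := 1) fun y y' => ?_).continuous
    rw [dist_eq_norm, dist_eq_norm, NNReal.coe_one, one_mul]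
    exact hκ y y'
  have hcomp : ∀ K, IsCompact (f K '' innerTriangle) := fun K =>
    isCompact_innerTriangle.image_of_continuousOn
      (hκc.comp_continuousOn ((F.continuousOn_proj K).mono innerTriangle_subset))
  -- Full triangles share edges; inner triangles have positive barycentric coordinates, so a common
  -- image point would force the elements to coincide.
  have hdisj : (G : Set (Fin M.nK)).PairwiseDisjoint fun K => f K '' innerTriangle := by
    intro K hK K' hK' hne
    rw [Function.onFun, Set.disjoint_left]
    rintro _ ⟨x, hx, rfl⟩ ⟨x', hx', he⟩
    refine hne ?_
    have h2 := hinj _ (hmem K hK x (innerTriangle_subset hx)) _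
      (hmem K' hK' x' (innerTriangle_subset hx'))
    have he' : κ (M.proj K x) - κ (M.proj K' x') = 0 := sub_eq_zero.2 he.symm
    rw [he', norm_zero, mul_zero] at h2
    have h3 := M.pt_eq_of_proj_eq (innerTriangle_subset hx) (innerTriangle_subset hx')
      (sub_eq_zero.1 (norm_le_zero_iff.1 h2))
    exact M.eq_of_pt_eq_of_pos (fun l => lt_of_lt_of_le (by norm_num) (hx l))
      (innerTriangle_subset hx') h3
  have hsum : ∑ K ∈ G, volume.real (f K '' innerTriangle) ≤ volume.real B := by
    rw [← measureReal_biUnion_finset hdisj (fun K _ => (hcomp K).measurableSet)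
      (fun K _ => (hcomp K).measure_lt_top.ne)]
    refine measureReal_mono (iUnion₂_subset fun K hK => ?_) hB.ne
    rintro _ ⟨x, hx, rfl⟩
    exact (hG K hK x (innerTriangle_subset hx)).2
  refine le_trans ?_ hsum
  rw [← nsmul_eq_mul]
  refine Finset.card_nsmul_le_sum _ _ _ fun K hK => ?_
  have hv := volume_le_of_expanding ha (hexp K hK)
  have hv' := ENNReal.toReal_mono (ENNReal.mul_ne_top ENNReal.ofReal_ne_top
    (hcomp K).measure_lt_top.ne) hv
  rw [ENNReal.toReal_mul, ENNReal.toReal_ofReal (by positivity)] at hv'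
  calc (c * h / 2) ^ 2 * volume.real innerTriangle
      ≤ (c * h / 2) ^ 2 * ((c * h / 2)⁻¹ ^ 2 * volume.real (f K '' innerTriangle)) :=
        mul_le_mul_of_nonneg_left hv' (by positivity)
    _ = _ := by field_simp

end Triangulation

/-- Cauchy–Schwarz in each strip gives one factor N. After exchanging the sums, the symmetry of the
condition shows that each L lies in at most N strips, which gives the second. -/
lemma sum_sq_sum_filter_le {ι : Type*} {J G : Finset ι} (hJG : J ⊆ G) (o : ι → ℝ) (s : ι → ℝ)
    {b N : ℝ} (hN : ∀ K, ((G.filter fun L => |s L - s K| ≤ b).card : ℝ) ≤ N) :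
    ∑ K ∈ J, (∑ L ∈ G.filter (fun L => |s L - s K| ≤ b), o L) ^ 2 ≤ N ^ 2 * ∑ L ∈ G, o L ^ 2 := by
  rcases G.eq_empty_or_nonempty with rfl | ⟨L₀, -⟩
  · rw [Finset.subset_empty.1 hJG]; simp
  have hN0 : 0 ≤ N := (Nat.cast_nonneg _).trans (hN L₀)
  have h1 : ∀ K ∈ J, (∑ L ∈ G.filter (fun L => |s L - s K| ≤ b), o L) ^ 2 ≤
      N * ∑ L ∈ G, if |s L - s K| ≤ b then o L ^ 2 else 0 := by
    intro K _
    rw [← Finset.sum_filter]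
    exact sq_sum_le_card_mul_sum_sq.trans (mul_le_mul_of_nonneg_right (hN K)
      (Finset.sum_nonneg fun _ _ => sq_nonneg _))
  refine (Finset.sum_le_sum h1).trans ?_
  rw [← Finset.mul_sum, Finset.sum_comm, sq, mul_assoc]
  refine mul_le_mul_of_nonneg_left ?_ hN0
  rw [Finset.mul_sum]
  refine Finset.sum_le_sum fun L _ => ?_
  rw [← Finset.sum_filter, Finset.sum_const, nsmul_eq_mul]
  refine mul_le_mul_of_nonneg_right (le_trans ?_ (hN L)) (sq_nonneg _)
  refine Nat.cast_le.2 (Finset.card_le_card fun K hK => ?_)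
  rw [Finset.mem_filter] at hK ⊢
  rw [abs_sub_comm]
  exact ⟨hJG hK.1, hK.2⟩

namespace EvolvingSurface

variable (S : EvolvingSurface)

/-- Element values `u` and tolerances `o` are admissible if values on elements with a common
vertex agree up to the tolerances. -/
def IsTolerance {S : EvolvingSurface} (M : Triangulation (S.Γ 0)) (u o : Fin M.nK → ℝ) : Prop :=
  (∀ K, 0 ≤ o K) ∧ ∀ K L l l', M.tri K l = M.tri L l' → |u K - u L| ≤ o K + o L

open Classical in
/-- The pairs of elements whose first vertices form a pair in `s`. -/
noncomputable def elemPairs {S : EvolvingSurface} (M : Triangulation (S.Γ 0)) (s : Set (E3 × E3)) :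
    Finset (Fin M.nK × Fin M.nK) :=
  Finset.univ.filter fun p => (M.vert (M.tri p.1 0), M.vert (M.tri p.2 0)) ∈ s

/-- The discrete Poincaré inequality for the pairs of elements in `s`. -/
def PoincareOn (c : ℝ) (s : Set (E3 × E3)) : Prop :=
  ∃ C ≥ (0 : ℝ), ∃ h₀ > (0 : ℝ), ∀ (M : Triangulation (S.Γ 0)) (h : ℝ), M.IsFine h c → h < h₀ →
    ∀ u o : Fin M.nK → ℝ, IsTolerance M u o →
      h ^ 4 * ∑ p ∈ elemPairs M s, (u p.1 - u p.2) ^ 2 ≤ C * ∑ K, o K ^ 2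

/-- Counting by area: each element occupies at least a multiple of h² in the chart, the square has
area of order r² and a strip of order r h. -/
lemma exists_card_strip_le {c : ℝ} {z : E3} {κ : E3 → R2} {r : ℝ} (hr : 0 < r) (hc : 0 < c)
    (hκ : ∀ y y', ‖κ y - κ y'‖ ≤ ‖y - y'‖) (hκz : κ z = 0)
    (hinj : ∀ y ∈ S.Γ 0 ∩ Metric.ball z r, ∀ y' ∈ S.Γ 0 ∩ Metric.ball z r,
      ‖y - y'‖ ≤ 2 * ‖κ y - κ y'‖) : ∃ N > 0,
    ∀ (M : Triangulation (S.Γ 0)) (h : ℝ), M.IsFine h c → h < r / 8 → ∀ G : Finset (Fin M.nK),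
      (∀ K ∈ G, M.vert (M.tri K 0) ∈ Metric.ball z (r / 2 + 2 * h)) →
      G.card * h ^ 2 ≤ N ∧ ∀ (i : Fin 2) (s : ℝ),
        (∀ K ∈ G, |κ (M.vert (M.tri K 0)) i - s| ≤ 2 * h) → G.card * h ≤ N := by
  set v := volume.real innerTriangle with hv
  have hv0 : 0 < v := volume_real_innerTriangle_pos
  refine ⟨16 * r ^ 2 / (c ^ 2 * v) + 64 * r / (c ^ 2 * v), by positivity, fun M h F hh G hG => ?_⟩
  have h0 := F.h_pos
  have hball : ∀ K ∈ G, ∀ x ∈ refTriangle, M.proj K x ∈ Metric.ball z r := by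
    intro K hK x hx
    have h1 := hG K hK
    have h2 := F.near K x hx
    rw [mem_ball_iff_norm] at h1 ⊢
    have := norm_sub_le_norm_sub_add_norm_sub (M.proj K x) (M.vert (M.tri K 0)) z
    linarith
  have hbd : ∀ K ∈ G, ∀ x ∈ refTriangle, ∀ j, |κ (M.proj K x) j| ≤ r := by
    intro K hK x hx j
    have h1 := hball K hK x hx
    rw [mem_ball_iff_norm] at h1
    have h2 := hκ (M.proj K x) z
    rw [hκz, sub_zero] at h2
    exact (norm_le_pi_norm (κ (M.proj K x)) j).trans (h2.trans h1.le)
  have hp1 : 0 < 16 * r ^ 2 / (c ^ 2 * v) := by positivity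
  have hp2 : 0 < 64 * r / (c ^ 2 * v) := by positivity
  constructor
  · have hB : volume (Icc (fun _ => -r) (fun _ => r) : Set R2) < ⊤ := isCompact_Icc.measure_lt_top
    have h1 := F.card_mul_le hκ hinj hB fun K hK x hx => ⟨hball K hK x hx,
      fun j => (abs_le.1 (hbd K hK x hx j)).1, fun j => (abs_le.1 (hbd K hK x hx j)).2⟩
    have hvol : volume.real (Icc (fun _ => -r) (fun _ => r) : Set R2) = (2 * r) ^ 2 := by
      have hle : (fun _ => -r : R2) ≤ fun _ => r := fun _ => by simp only; linarith
      rw [measureReal_def, Real.volume_Icc_pi_toReal hle, Fin.prod_univ_two]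
      ring
    rw [hvol] at h1
    have h2 : G.card * h ^ 2 ≤ 16 * r ^ 2 / (c ^ 2 * v) := by
      rw [le_div_iff₀ (by positivity)]
      linarith
    linarith
  · intro i s hs
    set lo : R2 := Function.update (fun _ => -r) i (s - 4 * h) with hlo
    set hi : R2 := Function.update (fun _ => r) i (s + 4 * h) with hhi
    have hB : volume (Icc lo hi) < ⊤ := isCompact_Icc.measure_lt_top
    have hle : lo ≤ hi := by
      intro j
      rcases eq_or_ne j i with rfl | hj
      · rw [hlo, hhi, Function.update_self, Function.update_self]; linarith
      · rw [hlo, hhi, Function.update_of_ne hj, Function.update_of_ne hj]; linarith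
    have hvol : volume.real (Icc lo hi) = 2 * r * (8 * h) := by
      rw [measureReal_def, Real.volume_Icc_pi_toReal hle, Fin.prod_univ_two, hlo, hhi]
      fin_cases i
      · simp; ring
      · simp; ring
    have h1 := F.card_mul_le hκ hinj hB (G := G) fun K hK x hx => ⟨hball K hK x hx, by
      have hin : ∀ j, lo j ≤ κ (M.proj K x) j ∧ κ (M.proj K x) j ≤ hi j := by
        intro j
        rcases eq_or_ne j i with rfl | hj
        · rw [hlo, hhi, Function.update_self, Function.update_self]
          have e1 := hs K hK
          have e2 := (norm_le_pi_norm (κ (M.proj K x) - κ (M.vert (M.tri K 0))) j).trans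
            ((hκ _ _).trans (F.near K x hx))
          rw [Real.norm_eq_abs, Pi.sub_apply] at e2
          have e3 := abs_le.1 e1
          have e4 := abs_le.1 e2
          constructor <;> linarith
        · rw [hlo, hhi, Function.update_of_ne hj, Function.update_of_ne hj]
          exact abs_le.1 (hbd K hK x hx j)
      exact ⟨fun j => (hin j).1, fun j => (hin j).2⟩⟩
    rw [hvol] at h1
    have h2 : G.card * h ≤ 64 * r / (c ^ 2 * v) := by
      rw [le_div_iff₀ (by positivity)]
      refine le_of_mul_le_mul_right ?_ h0
      linarith
    linarith

/-- Two elements are joined by a path in the chart that changes first one and then the other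
coordinate. The value of u changes by at most twice the tolerances in two strips of width O(h).
Squaring and summing over pairs costs h⁻² for the free element and h⁻² for the strips, which the
weight h⁴ balances. -/
lemma exists_poincareOn_ball {c : ℝ} (hc : 0 < c) {z : E3} (hz : z ∈ S.Γ 0) :
    ∃ δ > 0, S.PoincareOn c (Metric.ball z δ ×ˢ Metric.ball z δ) := by
  obtain ⟨κ, r, hr, η, hη, hκ, hκz, hinj, hsurj⟩ := S.exists_patch hz
  obtain ⟨N, hN, hcard⟩ := S.exists_card_strip_le hr hc hκ hκz hinj
  set δ := min η (r / 2) with hδ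
  refine ⟨δ, by positivity, 16 * N ^ 3, by positivity, r / 8, by positivity,
    fun M h F hh u o huo => ?_⟩
  classical
  have h0 := F.h_pos
  set a : Fin M.nK → E3 := fun K => M.vert (M.tri K 0) with ha
  set G : Finset (Fin M.nK) := Finset.univ.filter fun K => a K ∈ Metric.ball z (r / 2 + 2 * h)
    with hG
  set J : Finset (Fin M.nK) := Finset.univ.filter fun K => a K ∈ Metric.ball z δ with hJ
  have hGmem : ∀ K ∈ G, a K ∈ Metric.ball z (r / 2 + 2 * h) := fun K hK =>
    (Finset.mem_filter.1 hK).2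
  have hJmem : ∀ K ∈ J, a K ∈ Metric.ball z δ := fun K hK => (Finset.mem_filter.1 hK).2
  have hJG : J ⊆ G := fun K hK => Finset.mem_filter.2 ⟨Finset.mem_univ _,
    Metric.ball_subset_ball ((min_le_right _ _).trans (by linarith)) (hJmem K hK)⟩
  have haΓ : ∀ K, a K ∈ S.Γ 0 := fun K => M.vert_mem _
  set H : Fin 2 → Fin M.nK → ℝ := fun i K =>
    ∑ L ∈ G.filter (fun L => |κ (a L) i - κ (a K) i| ≤ 2 * h), o L with hH
  have hstrip : ∀ i K, ((G.filter fun L => |κ (a L) i - κ (a K) i| ≤ 2 * h).card : ℝ) ≤ N / h := by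
    intro i K
    rw [le_div_iff₀ h0]
    exact (hcard M h F hh _ fun L hL => hGmem L (Finset.mem_filter.1 hL).1).2 i (κ (a K) i)
      fun L hL => (Finset.mem_filter.1 hL).2
  have hHsum : ∀ i, ∑ K ∈ J, H i K ^ 2 ≤ (N / h) ^ 2 * ∑ L, o L ^ 2 := fun i =>
    (sum_sq_sum_filter_le hJG o (fun K => κ (a K) i) (hstrip i)).trans
      (mul_le_mul_of_nonneg_left (Finset.sum_le_sum_of_subset_of_nonneg (Finset.subset_univ _)
        fun _ _ _ => sq_nonneg _) (by positivity))
  have hJcard : (J.card : ℝ) ≤ N / h ^ 2 := by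
    rw [le_div_iff₀ (by positivity)]
    exact (hcard M h F hh J fun K hK => hGmem K (hJG hK)).1
  choose! ψ hψ hκψ using hsurj
  have hψc : ContinuousOn ψ (Metric.closedBall 0 η) := by
    have : LipschitzOnWith 2 ψ (Metric.closedBall 0 η) := by
      refine LipschitzOnWith.of_dist_le_mul fun p hp p' hp' => ?_
      rw [mem_closedBall_zero_iff] at hp hp'
      have hb : ∀ p, ‖p‖ ≤ η → ψ p ∈ S.Γ 0 ∩ Metric.ball z r := fun p hp =>
        ⟨(hψ p hp).1, Metric.ball_subset_ball (by linarith) (hψ p hp).2⟩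
      have := hinj _ (hb p hp) _ (hb p' hp')
      rw [hκψ p hp, hκψ p' hp'] at this
      rw [dist_eq_norm, dist_eq_norm]
      exact this
    exact this.continuousOn
  have hψa : ∀ K ∈ J, ‖κ (a K)‖ ≤ η ∧ ψ (κ (a K)) = a K := by
    intro K hK
    have h1 := hJmem K hK
    rw [mem_ball_iff_norm] at h1
    have h2 := hκ (a K) z
    rw [hκz, sub_zero] at h2
    have h3 : ‖κ (a K)‖ ≤ η := h2.trans (h1.le.trans (min_le_left _ _))
    refine ⟨h3, ?_⟩
    have h4 := hinj (ψ (κ (a K))) ⟨(hψ _ h3).1, Metric.ball_subset_ball (by linarith) (hψ _ h3).2⟩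
      (a K) ⟨haΓ K, by
        rw [mem_ball_iff_norm]
        have := min_le_right η (r / 2)
        linarith⟩
    rw [hκψ _ h3, sub_self, norm_zero, mul_zero] at h4
    exact sub_eq_zero.1 (norm_le_zero_iff.1 h4)
  -- A segment with constant i-th coordinate lifts to a connected curve on the surface, and any
  -- element it meets has its first vertex in the strip around that coordinate.
  have hline : ∀ (i : Fin 2) (K : Fin M.nK) (p p' : R2), ‖p‖ ≤ η → ‖p'‖ ≤ η →
      p i = κ (a K) i → p' i = κ (a K) i → ∀ K₁ K₂, ψ p ∈ M.proj K₁ '' refTriangle →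
      ψ p' ∈ M.proj K₂ '' refTriangle → |u K₁ - u K₂| ≤ 2 * H i K := by
    intro i K p p' hp hp' hpi hpi' K₁ K₂ hK₁ hK₂
    have hseg : segment ℝ p p' ⊆ Metric.closedBall 0 η :=
      (convex_closedBall (0 : R2) η).segment_subset (mem_closedBall_zero_iff.2 hp)
        (mem_closedBall_zero_iff.2 hp')
    have hpre : IsPreconnected (ψ '' segment ℝ p p') :=
      (convex_segment p p').isPreconnected.image _ (hψc.mono hseg)
    have hcoord : ∀ w ∈ segment ℝ p p', w i = κ (a K) i := by
      rintro w ⟨s, t, -, -, hst, rfl⟩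
      simp only [Pi.add_apply, Pi.smul_apply, smul_eq_mul, hpi, hpi']
      rw [← add_mul, hst, one_mul]
    refine hpre.abs_sub_le_two_mul_sum (A := fun L => M.proj L '' refTriangle)
      (fun L => F.isClosed_image_proj L) ?_ huo.1 ?_ ?_ ⟨ψ p, ⟨p, left_mem_segment ℝ p p', rfl⟩, hK₁⟩
      ⟨ψ p', ⟨p', right_mem_segment ℝ p p', rfl⟩, hK₂⟩
    · rintro _ ⟨w, hw, rfl⟩
      obtain ⟨L, x, hx, hxe⟩ := M.exists_proj_eq (hψ w (mem_closedBall_zero_iff.1 (hseg hw))).1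
      exact mem_iUnion.2 ⟨L, x, hx, hxe⟩
    · rintro L L' ⟨_, ⟨x, hx, rfl⟩, ⟨x', hx', he⟩⟩
      obtain ⟨l, l', hl⟩ := M.exists_common_vertex hx hx' (M.pt_eq_of_proj_eq hx hx' he.symm)
      exact huo.2 L L' l l' hl
    · rintro L ⟨_, ⟨w, hw, rfl⟩, ⟨x, hx, hxe⟩⟩
      have hwη := mem_closedBall_zero_iff.1 (hseg hw)
      have h1 := F.near L x hx
      rw [hxe] at h1
      refine Finset.mem_filter.2 ⟨Finset.mem_filter.2 ⟨Finset.mem_univ _, ?_⟩, ?_⟩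
      · have h2 := (hψ w hwη).2
        rw [mem_ball_iff_norm] at h2 ⊢
        have h3 := norm_sub_le_norm_sub_add_norm_sub (a L) (ψ w) z
        rw [norm_sub_rev (a L) (ψ w)] at h3
        simp only [ha] at h3 ⊢
        linarith
      · have h2 := (norm_le_pi_norm (κ (a L) - κ (ψ w)) i).trans (hκ _ _)
        rw [hκψ w hwη, Pi.sub_apply, hcoord w hw, norm_sub_rev (a L)] at h2
        exact h2.trans h1
  have hpair : ∀ K ∈ J, ∀ K' ∈ J, |u K - u K'| ≤ 2 * H 1 K + 2 * H 0 K' := by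
    intro K hK K' hK'
    obtain ⟨n1, e1⟩ := hψa K hK
    obtain ⟨n2, e2⟩ := hψa K' hK'
    -- The corner of the path; in the sup norm it stays in the square covered by the chart.
    set y : R2 := ![κ (a K') 0, κ (a K) 1] with hy
    have hyη : ‖y‖ ≤ η := by
      rw [pi_norm_le_iff_of_nonneg hη.le]
      refine Fin.forall_fin_two.2 ⟨?_, ?_⟩
      · exact (norm_le_pi_norm (κ (a K')) 0).trans n2
      · exact (norm_le_pi_norm (κ (a K)) 1).trans n1
    obtain ⟨K'', x, hx, hxe⟩ := M.exists_proj_eq (hψ y hyη).1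
    have h1 := hline 1 K (κ (a K)) y n1 hyη rfl rfl K K''
      ⟨refVtx 0, Triangulation.refVtx_mem 0, by rw [e1, M.proj_refVtx]⟩ ⟨x, hx, hxe⟩
    have h2 := hline 0 K' y (κ (a K')) hyη n2 rfl rfl K'' K' ⟨x, hx, hxe⟩
      ⟨refVtx 0, Triangulation.refVtx_mem 0, by rw [e2, M.proj_refVtx]⟩
    exact (abs_sub_le _ _ _).trans (add_le_add h1 h2)
  have hpairs : elemPairs M (Metric.ball z δ ×ˢ Metric.ball z δ) = J ×ˢ J := by
    ext p
    simp only [elemPairs, Finset.mem_filter, Finset.mem_univ, true_and, Finset.mem_product, hJ,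
      mem_prod, ha]
  rw [hpairs, Finset.sum_product]
  have hsum : ∑ K ∈ J, ∑ K' ∈ J, (u K - u K') ^ 2 ≤
      ∑ K ∈ J, ∑ K' ∈ J, (8 * H 1 K ^ 2 + 8 * H 0 K' ^ 2) := by
    refine Finset.sum_le_sum fun K hK => Finset.sum_le_sum fun K' hK' => ?_
    have h1 := pow_le_pow_left₀ (abs_nonneg _) (hpair K hK K' hK') 2
    rw [sq_abs] at h1
    linarith [sq_nonneg (2 * H 1 K - 2 * H 0 K')]
  have hsum2 : ∑ K ∈ J, ∑ K' ∈ J, (8 * H 1 K ^ 2 + 8 * H 0 K' ^ 2) =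
      8 * J.card * (∑ K ∈ J, H 1 K ^ 2 + ∑ K ∈ J, H 0 K ^ 2) := by
    simp only [Finset.sum_add_distrib, Finset.sum_const, nsmul_eq_mul, ← Finset.mul_sum]
    ring
  rw [hsum2] at hsum
  have ho : 0 ≤ ∑ L, o L ^ 2 := Finset.sum_nonneg fun _ _ => sq_nonneg _
  calc _ ≤ h ^ 4 * (8 * (N / h ^ 2) * ((N / h) ^ 2 * ∑ L, o L ^ 2 + (N / h) ^ 2 * ∑ L, o L ^ 2)) := by
        refine mul_le_mul_of_nonneg_left (hsum.trans ?_) (by positivity)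
        exact mul_le_mul (by linarith) (add_le_add (hHsum 1) (hHsum 0))
          (add_nonneg (Finset.sum_nonneg fun _ _ => sq_nonneg _)
            (Finset.sum_nonneg fun _ _ => sq_nonneg _)) (by positivity)
    _ = _ := by field_simp; ring

end EvolvingSurface

namespace EvolvingSurface

variable (S : EvolvingSurface)

open Classical in
/-- The elements whose first vertex lies in `s`. -/
noncomputable def elemsIn {S : EvolvingSurface} (M : Triangulation (S.Γ 0)) (s : Set E3) :
    Finset (Fin M.nK) :=
  Finset.univ.filter fun K => M.vert (M.tri K 0) ∈ s

variable {S} in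
lemma mem_elemsIn {M : Triangulation (S.Γ 0)} {s : Set E3} {K : Fin M.nK} :
    K ∈ elemsIn M s ↔ M.vert (M.tri K 0) ∈ s := by simp [elemsIn]

variable {S} in
lemma mem_elemPairs {M : Triangulation (S.Γ 0)} {s : Set (E3 × E3)} {p : Fin M.nK × Fin M.nK} :
    p ∈ elemPairs M s ↔ (M.vert (M.tri p.1 0), M.vert (M.tri p.2 0)) ∈ s := by simp [elemPairs]

variable {S} in
lemma elemPairs_prod (M : Triangulation (S.Γ 0)) (s t : Set E3) :
    elemPairs M (s ×ˢ t) = elemsIn M s ×ˢ elemsIn M t := by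
  ext p
  simp only [mem_elemPairs, Finset.mem_product, mem_elemsIn, mem_prod]

variable {S} in
lemma PoincareOn.mono {c : ℝ} {s t : Set (E3 × E3)} (hst : s ⊆ t) (h : S.PoincareOn c t) :
    S.PoincareOn c s := by
  obtain ⟨C, hC, h₀, hh₀, H⟩ := h
  refine ⟨C, hC, h₀, hh₀, fun M h F hlt u o huo => le_trans ?_ (H M h F hlt u o huo)⟩
  have := F.h_pos
  exact mul_le_mul_of_nonneg_left (Finset.sum_le_sum_of_subset_of_nonneg
    (fun p hp => mem_elemPairs.2 (hst (mem_elemPairs.1 hp))) fun _ _ _ => sq_nonneg _)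
    (by positivity)

lemma poincareOn_empty (c : ℝ) : S.PoincareOn c ∅ := by
  refine ⟨0, le_rfl, 1, one_pos, fun M h F hlt u o huo => ?_⟩
  have : elemPairs M (∅ : Set (E3 × E3)) = ∅ := by ext p; simp [mem_elemPairs]
  simp [this]

variable {S} in
lemma PoincareOn.union {c : ℝ} {s t : Set (E3 × E3)} (hs : S.PoincareOn c s)
    (ht : S.PoincareOn c t) : S.PoincareOn c (s ∪ t) := by
  obtain ⟨C, hC, h₀, hh₀, H⟩ := hs
  obtain ⟨C', hC', h₁, hh₁, H'⟩ := ht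
  refine ⟨C + C', by positivity, min h₀ h₁, lt_min hh₀ hh₁, fun M h F hlt u o huo => ?_⟩
  classical
  have h1 := H M h F (hlt.trans_le (min_le_left _ _)) u o huo
  have h2 := H' M h F (hlt.trans_le (min_le_right _ _)) u o huo
  have e : elemPairs M (s ∪ t) = elemPairs M s ∪ elemPairs M t := by
    ext p; simp [mem_elemPairs]
  have h3 : ∑ p ∈ elemPairs M (s ∪ t), (u p.1 - u p.2) ^ 2 ≤
      ∑ p ∈ elemPairs M s, (u p.1 - u p.2) ^ 2 + ∑ p ∈ elemPairs M t, (u p.1 - u p.2) ^ 2 := by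
    rw [e, ← Finset.sum_union_inter]
    exact le_add_of_nonneg_right (Finset.sum_nonneg fun _ _ => sq_nonneg _)
  have := F.h_pos
  have h4 := mul_le_mul_of_nonneg_left h3 (by positivity : 0 ≤ h ^ 4)
  linarith

variable {S} in
lemma PoincareOn.swap {c : ℝ} {s t : Set E3} (h : S.PoincareOn c (s ×ˢ t)) :
    S.PoincareOn c (t ×ˢ s) := by
  obtain ⟨C, hC, h₀, hh₀, H⟩ := h
  refine ⟨C, hC, h₀, hh₀, fun M h F hlt u o huo => le_of_eq_of_le ?_ (H M h F hlt u o huo)⟩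
  rw [elemPairs_prod, elemPairs_prod, Finset.sum_product, Finset.sum_product, Finset.sum_comm]
  simp only [sub_sq_comm]

lemma exists_card_elemsIn_le {c : ℝ} (hc : 0 < c) {z : E3} (hz : z ∈ S.Γ 0) :
    ∃ δ > 0, ∃ N > 0, ∃ h₀ > 0, ∀ (M : Triangulation (S.Γ 0)) (h : ℝ), M.IsFine h c → h < h₀ →
      (elemsIn M (Metric.ball z δ)).card * h ^ 2 ≤ N := by
  obtain ⟨κ, r, hr, η, hη, hκ, hκz, hinj, -⟩ := S.exists_patch hz
  obtain ⟨N, hN, hcard⟩ := S.exists_card_strip_le hr hc hκ hκz hinj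
  refine ⟨r / 2, by positivity, N, hN, r / 8, by positivity, fun M h F hh =>
    (hcard M h F hh _ fun K hK => ?_).1⟩
  have := F.h_pos
  exact Metric.ball_subset_ball (by linarith) (mem_elemsIn.1 hK)

/-- A square of fixed size in the chart is covered by balls of radius 2h around the first vertices
of the elements near z; comparing areas bounds their number below. -/
lemma exists_le_card_elemsIn {c : ℝ} {z : E3} (hz : z ∈ S.Γ 0) {δ : ℝ} (hδ : 0 < δ) :
    ∃ N > 0, ∃ h₀ > 0, ∀ (M : Triangulation (S.Γ 0)) (h : ℝ), M.IsFine h c → h < h₀ →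
      N ≤ (elemsIn M (Metric.ball z δ)).card * h ^ 2 := by
  obtain ⟨κ, r, hr, η, hη, hκ, hκz, hinj, hsurj⟩ := S.exists_patch hz
  set ε := min η (δ / 8) with hε
  have hε0 : 0 < ε := by positivity
  refine ⟨ε ^ 2 / 4, by positivity, δ / 8, by positivity, fun M h F hh => ?_⟩
  have h0 := F.h_pos
  have hcov : Metric.closedBall (0 : R2) ε ⊆ ⋃ K ∈ elemsIn M (Metric.ball z δ),
      Metric.closedBall (κ (M.vert (M.tri K 0))) (2 * h) := by
    intro p hp
    rw [mem_closedBall_zero_iff] at hp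
    obtain ⟨y, ⟨hy, hyr⟩, rfl⟩ := hsurj p (hp.trans (min_le_left _ _))
    obtain ⟨K, x, hx, rfl⟩ := M.exists_proj_eq hy
    have h1 := F.near K x hx
    have h2 := hinj (M.proj K x) ⟨hy, Metric.ball_subset_ball (by linarith) hyr⟩ z
      ⟨hz, Metric.mem_ball_self hr⟩
    rw [hκz, sub_zero] at h2
    have h3 : ε ≤ δ / 8 := min_le_right _ _
    refine mem_biUnion (x := K) (mem_elemsIn.2 ?_) ?_
    · rw [mem_ball_iff_norm]
      have h4 := norm_sub_le_norm_sub_add_norm_sub (M.vert (M.tri K 0)) (M.proj K x) z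
      rw [norm_sub_rev (M.vert (M.tri K 0)) (M.proj K x)] at h4
      linarith
    · rw [mem_closedBall_iff_norm]
      exact (hκ _ _).trans h1
  have hv : ∀ (a : R2) {r : ℝ}, 0 ≤ r → volume.real (Metric.closedBall a r) = (2 * r) ^ 2 := by
    intro a r hr
    rw [measureReal_def, Real.volume_pi_closedBall a hr, ENNReal.toReal_ofReal (by positivity),
      Fintype.card_fin]
  have h1 := measureReal_mono (μ := volume) hcov
    ((measure_biUnion_lt_top (Finset.finite_toSet _) fun K _ =>
      (isCompact_closedBall _ _).measure_lt_top).ne)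
  have h2 := h1.trans (measureReal_biUnion_finset_le _ _)
  rw [hv 0 hε0.le] at h2
  simp only [hv _ (by positivity : 0 ≤ 2 * h)] at h2
  rw [Finset.sum_const, nsmul_eq_mul] at h2
  linarith

omit S in
-- Bookkeeping for the averaging argument, with g = h², e = h⁴ and x, y, z the numbers of elements
-- near the three points.
lemma average_bound {N₁ N₂ N₃ C₁ C₂ A B D O x y z g e : ℝ} (hg : 0 ≤ g) (he : 0 ≤ e) (h1 : 0 ≤ N₁)
    (h2 : 0 ≤ N₂) (hD : 0 ≤ D) (hA : 0 ≤ A) (hB : 0 ≤ B) (a1 : x * g ≤ N₁)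
    (a2 : z * g ≤ N₂) (a3 : N₃ ≤ y * g) (a4 : e * A ≤ C₁ * O) (a5 : e * B ≤ C₂ * O)
    (key : y * D ≤ 2 * (z * A) + 2 * (x * B)) :
    N₃ * (e * D) ≤ 2 * (N₂ * C₁ + N₁ * C₂) * O := by
  have heD : 0 ≤ e * D := mul_nonneg he hD
  have heA : 0 ≤ e * A := mul_nonneg he hA
  have heB : 0 ≤ e * B := mul_nonneg he hB
  calc N₃ * (e * D) ≤ y * g * (e * D) := mul_le_mul_of_nonneg_right a3 heD
    _ = g * e * (y * D) := by ring
    _ ≤ g * e * (2 * (z * A) + 2 * (x * B)) := mul_le_mul_of_nonneg_left key (mul_nonneg hg he)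
    _ = 2 * (z * g * (e * A)) + 2 * (x * g * (e * B)) := by ring
    _ ≤ 2 * (N₂ * (C₁ * O)) + 2 * (N₁ * (C₂ * O)) :=
        add_le_add
          (mul_le_mul_of_nonneg_left ((mul_le_mul_of_nonneg_right a2 heA).trans
            (mul_le_mul_of_nonneg_left a4 h2)) (by norm_num))
          (mul_le_mul_of_nonneg_left ((mul_le_mul_of_nonneg_right a1 heB).trans
            (mul_le_mul_of_nonneg_left a5 h1)) (by norm_num))
    _ = _ := by ring

/-- Insert an intermediate element L near y and average over all such L. There are at least of order
h⁻² of them, which compensates the number of elements in the other two groups. -/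
lemma PoincareOn.trans {c : ℝ} (hc : 0 < c) {x y z : E3} (hx : x ∈ S.Γ 0) (hy : y ∈ S.Γ 0)
    (hz : z ∈ S.Γ 0)
    (hxy : ∃ δ > 0, S.PoincareOn c (Metric.ball x δ ×ˢ Metric.ball y δ))
    (hyz : ∃ δ > 0, S.PoincareOn c (Metric.ball y δ ×ˢ Metric.ball z δ)) :
    ∃ δ > 0, S.PoincareOn c (Metric.ball x δ ×ˢ Metric.ball z δ) := by
  obtain ⟨δ₁, hδ₁, P₁⟩ := hxy
  obtain ⟨δ₂, hδ₂, P₂⟩ := hyz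
  obtain ⟨δ₃, hδ₃, N₁, hN₁, h₁, hh₁, H₁⟩ := S.exists_card_elemsIn_le hc hx
  obtain ⟨δ₄, hδ₄, N₂, hN₂, h₂, hh₂, H₂⟩ := S.exists_card_elemsIn_le hc hz
  set δ := min (min δ₁ δ₂) (min δ₃ δ₄) with hδ
  have hδ0 : 0 < δ := by positivity
  have d1 : δ ≤ δ₁ := (min_le_left _ _).trans (min_le_left _ _)
  have d2 : δ ≤ δ₂ := (min_le_left _ _).trans (min_le_right _ _)
  have d3 : δ ≤ δ₃ := (min_le_right _ _).trans (min_le_left _ _)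
  have d4 : δ ≤ δ₄ := (min_le_right _ _).trans (min_le_right _ _)
  obtain ⟨N₃, hN₃, h₃, hh₃, H₃⟩ := S.exists_le_card_elemsIn (c := c) hy hδ0
  obtain ⟨C₁, hC₁, h₄, hh₄, H₄⟩ :=
    P₁.mono (prod_mono (Metric.ball_subset_ball d1) (Metric.ball_subset_ball d1))
  obtain ⟨C₂, hC₂, h₅, hh₅, H₅⟩ :=
    P₂.mono (prod_mono (Metric.ball_subset_ball d2) (Metric.ball_subset_ball d2))
  refine ⟨δ, hδ0, 2 * (N₂ * C₁ + N₁ * C₂) / N₃, by positivity,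
    min h₁ (min h₂ (min h₃ (min h₄ h₅))), by positivity, fun M h F hlt u o huo => ?_⟩
  simp only [lt_min_iff] at hlt
  obtain ⟨l1, l2, l3, l4, l5⟩ := hlt
  have h0 := F.h_pos
  set X := elemsIn M (Metric.ball x δ) with hX
  set Y := elemsIn M (Metric.ball y δ) with hY
  set Z := elemsIn M (Metric.ball z δ) with hZ
  have a1 : X.card * h ^ 2 ≤ N₁ := le_trans (mul_le_mul_of_nonneg_right (Nat.cast_le.2
    (Finset.card_le_card fun K hK => mem_elemsIn.2 (Metric.ball_subset_ball d3 (mem_elemsIn.1 hK))))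
    (by positivity)) (H₁ M h F l1)
  have a2 : Z.card * h ^ 2 ≤ N₂ := le_trans (mul_le_mul_of_nonneg_right (Nat.cast_le.2
    (Finset.card_le_card fun K hK => mem_elemsIn.2 (Metric.ball_subset_ball d4 (mem_elemsIn.1 hK))))
    (by positivity)) (H₂ M h F l2)
  have a3 : N₃ ≤ Y.card * h ^ 2 := H₃ M h F l3
  have a4 := H₄ M h F l4 u o huo
  have a5 := H₅ M h F l5 u o huo
  rw [elemPairs_prod, Finset.sum_product] at a4 a5 ⊢
  set A := ∑ K ∈ X, ∑ L ∈ Y, (u K - u L) ^ 2 with hA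
  set B := ∑ K ∈ Y, ∑ L ∈ Z, (u K - u L) ^ 2 with hB
  set D := ∑ K ∈ X, ∑ L ∈ Z, (u K - u L) ^ 2 with hD
  set O := ∑ K, o K ^ 2 with hO
  have hO0 : 0 ≤ O := Finset.sum_nonneg fun _ _ => sq_nonneg _
  have hD0 : 0 ≤ D := Finset.sum_nonneg fun _ _ => Finset.sum_nonneg fun _ _ => sq_nonneg _
  have key : Y.card * D ≤ 2 * (Z.card * A) + 2 * (X.card * B) := by
    have e1 : Y.card * D = ∑ K ∈ X, ∑ L ∈ Y, ∑ P ∈ Z, (u K - u P) ^ 2 := by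
      simp only [Finset.sum_const, nsmul_eq_mul, hD, Finset.mul_sum]
    have e2 : 2 * (Z.card * A) + 2 * (X.card * B) =
        ∑ K ∈ X, ∑ L ∈ Y, ∑ P ∈ Z, (2 * (u K - u L) ^ 2 + 2 * (u L - u P) ^ 2) := by
      simp only [Finset.sum_add_distrib, Finset.sum_const, nsmul_eq_mul, hA, hB, Finset.mul_sum]
      congr 1
      · exact Finset.sum_congr rfl fun _ _ => Finset.sum_congr rfl fun _ _ => by ring
      · exact Finset.sum_congr rfl fun _ _ => Finset.sum_congr rfl fun _ _ => by ring
    rw [e1, e2]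
    refine Finset.sum_le_sum fun K _ => Finset.sum_le_sum fun L _ => Finset.sum_le_sum fun P _ => ?_
    linarith [sq_nonneg (u K - u L - (u L - u P))]
  have k1 := average_bound (sq_nonneg h) (by positivity) hN₁.le hN₂.le hD0
    (Finset.sum_nonneg fun _ _ => Finset.sum_nonneg fun _ _ => sq_nonneg _)
    (Finset.sum_nonneg fun _ _ => Finset.sum_nonneg fun _ _ => sq_nonneg _) a1 a2 a3 a4 a5 key
  rw [div_mul_eq_mul_div, le_div_iff₀ hN₃]
  linarith

/-- Having a local inequality between two points is a symmetric and transitive relation that holds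
for nearby points; on the connected Γ(0) it relates all pairs. A finite subcover of Γ(0) × Γ(0)
combines the local constants. -/
lemma poincareOn_prod {c : ℝ} (hc : 0 < c) : S.PoincareOn c (S.Γ 0 ×ˢ S.Γ 0) := by
  have hR : ∀ x ∈ S.Γ 0, ∀ y ∈ S.Γ 0,
      ∃ δ > 0, S.PoincareOn c (Metric.ball x δ ×ˢ Metric.ball y δ) := by
    intro x hx y hy
    refine S.connected.isPreconnected.induction₂
      (fun x y => ∃ δ > 0, S.PoincareOn c (Metric.ball x δ ×ˢ Metric.ball y δ)) ?_ ?_ ?_ hx hy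
    · intro x hx
      obtain ⟨δ, hδ, P⟩ := S.exists_poincareOn_ball hc hx
      refine eventually_nhdsWithin_of_eventually_nhds ?_
      filter_upwards [Metric.ball_mem_nhds x (half_pos hδ)] with y hy
      refine ⟨δ / 2, half_pos hδ, P.mono (prod_mono (Metric.ball_subset_ball (by linarith)) ?_)⟩
      refine Metric.ball_subset_ball' ?_
      rw [Metric.mem_ball] at hy
      linarith
    · intro x y z hx hy hz hxy hyz
      exact PoincareOn.trans S hc hx hy hz hxy hyz
    · rintro x y - - ⟨δ, hδ, P⟩
      exact ⟨δ, hδ, P.swap⟩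
  refine (S.isCompact_Γ.prod S.isCompact_Γ).induction_on (p := S.PoincareOn c) (S.poincareOn_empty c)
    (fun s t hst ht => ht.mono hst) (fun s t hs ht => hs.union ht) ?_
  rintro ⟨x, y⟩ ⟨hx, hy⟩
  obtain ⟨δ, hδ, P⟩ := hR x hx y hy
  exact ⟨_, mem_nhdsWithin_of_mem_nhds (prod_mem_nhds (Metric.ball_mem_nhds x hδ)
    (Metric.ball_mem_nhds y hδ)), P⟩

end EvolvingSurface

namespace Triangulation

variable {Γ : Set E3} {M : Triangulation Γ} {k : ℕ}

lemma node_vtxIdx (hk : 1 ≤ k) {K L : Fin M.nK} {l l' : Fin 3} (h : M.tri K l = M.tri L l') :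
    M.node k K (vtxIdx k l) = M.node k L (vtxIdx k l') := by
  have e : ∀ K l, M.latticePoint k K (vtxIdx k l) = M.vert (M.tri K l) := by
    intro K l
    have hk' : (k : ℝ) ≠ 0 := by positivity
    rw [latticePoint, Finset.sum_eq_single l]
    · simp [vtxIdx, hk']
    · intro m _ hm
      simp [vtxIdx, hm]
    · simp
  refine Subtype.ext ?_
  change M.latticePoint k K _ = M.latticePoint k L _
  rw [e, e, h]

end Triangulation

lemma dofNorm_sub_const_le {k : ℕ} (z : LatticeIndex k → ℝ) (a : ℝ) :
    dofNorm (fun i => z i - a) ^ 2 ≤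
      2 * oscNorm z ^ 2 + 2 * Fintype.card (LatticeIndex k) * (z (vtxIdx k 0) - a) ^ 2 := by
  rw [oscNorm, dofNorm_sq, dofNorm_sq, Finset.mul_sum]
  have : 2 * (Fintype.card (LatticeIndex k) : ℝ) * (z (vtxIdx k 0) - a) ^ 2 =
      ∑ _i : LatticeIndex k, 2 * (z (vtxIdx k 0) - a) ^ 2 := by
    rw [Finset.sum_const, Finset.card_univ, nsmul_eq_mul]; ring
  rw [this, ← Finset.sum_add_distrib]
  refine Finset.sum_le_sum fun i _ => ?_
  simp only [Real.norm_eq_abs, sq_abs]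
  linarith [sq_nonneg (z i - z (vtxIdx k 0) - (z (vtxIdx k 0) - a))]

namespace EvolvingSurface

variable (S : EvolvingSurface)

/-- The discrete Poincaré inequality together with a lower bound for the number of elements. -/
lemma exists_poincare {kg k : ℕ} (hkg : 1 ≤ kg) (hk : 1 ≤ k) {ρ : ℝ} (hρ : 0 < ρ) :
    ∃ P > 0, ∃ h₀ > 0, ∀ (M : Triangulation (S.Γ 0)) (h : ℝ), S.IsMeshSize M kg h →
      S.IsQuasiUniform M ρ h → h < h₀ → ∀ q : M.Node k → ℝ,
        ∃ a : ℝ, M.meshNorm h (fun i => q i - a) ≤ P * M.jumpNorm q := by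
  have hκ : 0 < 3 * ρ ^ 2 := by positivity
  obtain ⟨h₁, hh₁, hbl⟩ := S.exists_proj_bilipschitz hκ
  set c := 3 * ρ ^ 2 / 4 with hc
  have hc0 : 0 < c := by positivity
  obtain ⟨C, hC, h₂, hh₂, hP⟩ := S.poincareOn_prod hc0
  obtain ⟨z, hz⟩ := S.connected.nonempty
  obtain ⟨N, hN, h₃, hh₃, hcard⟩ := S.exists_le_card_elemsIn (c := c) hz one_pos
  set m := (Fintype.card (LatticeIndex k) : ℝ) with hm
  have hm0 : 0 ≤ m := Nat.cast_nonneg _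
  refine ⟨√(2 + 2 * m * (C / N)), by positivity, min (min h₁ h₂) (min h₃ 1), by positivity,
    fun M h hh hq hlt q => ?_⟩
  simp only [lt_min_iff] at hlt
  obtain ⟨⟨l1, l2⟩, l3, l4⟩ := hlt
  have h0 : 0 < h := S.meshSize_pos hkg hh
  have hR : M.IsShapeRegular h (3 * ρ ^ 2) := by
    refine ⟨h0, S.vert_sub_le hkg hh, fun K => ?_⟩
    have := S.area_bound hkg hρ hh hq S.zero_mem K
    have e : S.vtx M 0 K = fun l => M.vert (M.tri K l) := funext fun l => S.flow_zero_vert _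
    rw [e] at this
    linarith
  have F : M.IsFine h c := ⟨hc0, h0, fun K => (hbl M h hR l1 K).1,
    fun K x hx y hy => ((hbl M h hR l1 K).2 x hx y hy).1,
    fun K x hx y hy => ((hbl M h hR l1 K).2 x hx y hy).2⟩
  set u : Fin M.nK → ℝ := fun K => q (M.node k K (vtxIdx k 0)) with hu
  set o : Fin M.nK → ℝ := fun K => oscNorm (M.dof q K) with ho
  -- Elements with a common vertex share the nodal value there, so their values at the first
  -- vertices differ by at most the two oscillations.
  have huo : IsTolerance M u o := by
    refine ⟨fun K => oscNorm_nonneg _, fun K L l l' hl => ?_⟩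
    have h1 := norm_sub_le_oscNorm (M.dof q K) (vtxIdx k l)
    have h2 := norm_sub_le_oscNorm (M.dof q L) (vtxIdx k l')
    have h3 : M.dof q K (vtxIdx k l) = M.dof q L (vtxIdx k l') :=
      congrArg q (M.node_vtxIdx hk hl)
    rw [Real.norm_eq_abs, abs_le] at h1 h2
    rw [abs_le]
    change -(oscNorm (M.dof q K) + oscNorm (M.dof q L)) ≤
      M.dof q K (vtxIdx k 0) - M.dof q L (vtxIdx k 0) ∧
      M.dof q K (vtxIdx k 0) - M.dof q L (vtxIdx k 0) ≤
        oscNorm (M.dof q K) + oscNorm (M.dof q L)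
    constructor <;> linarith [h1.1, h1.2, h2.1, h2.2]
  have hpo := hP M h F l2 u o huo
  have huniv : elemPairs M (S.Γ 0 ×ˢ S.Γ 0) = Finset.univ := by
    ext p
    simp only [mem_elemPairs, mem_prod, M.vert_mem, and_self, Finset.mem_univ]
  rw [huniv, Fintype.sum_prod_type] at hpo
  have hnK : N ≤ M.nK * h ^ 2 := by
    refine (hcard M h F l3).trans (mul_le_mul_of_nonneg_right (Nat.cast_le.2 ?_) (by positivity))
    exact (Finset.card_le_univ _).trans (by simp)
  have hnpos : 0 < M.nK := S.nK_pos hh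
  -- The inequality bounds a double sum over pairs; by averaging, some element L satisfies it with
  -- the mean over L, and its value serves as the constant a. The number of elements is at least N
  -- h⁻².
  have hmin : ∃ L, h ^ 2 * ∑ K, (u K - u L) ^ 2 ≤ C / N * ∑ K, o K ^ 2 := by
    by_contra hcon
    push Not at hcon
    have h1 : ∑ _L : Fin M.nK, C / N * ∑ K, o K ^ 2 < ∑ L, h ^ 2 * ∑ K, (u K - u L) ^ 2 :=
      Finset.sum_lt_sum_of_nonempty ⟨⟨0, hnpos⟩, Finset.mem_univ _⟩ fun L _ => hcon L
    rw [Finset.sum_const, Finset.card_univ, Fintype.card_fin, nsmul_eq_mul, ← Finset.mul_sum,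
      Finset.sum_comm] at h1
    have hO : 0 ≤ ∑ K, o K ^ 2 := Finset.sum_nonneg fun _ _ => sq_nonneg _
    have h2 := mul_lt_mul_of_pos_right h1 (by positivity : 0 < h ^ 2)
    have h3 : C * ∑ K, o K ^ 2 ≤ M.nK * h ^ 2 * (C / N * ∑ K, o K ^ 2) := by
      calc C * ∑ K, o K ^ 2 = N * (C / N * ∑ K, o K ^ 2) := by field_simp
        _ ≤ _ := mul_le_mul_of_nonneg_right hnK (by positivity)
    linarith
  obtain ⟨L, hL⟩ := hmin
  refine ⟨u L, ?_⟩
  refine le_of_sq_le_sq ?_ (mul_nonneg (Real.sqrt_nonneg _) (M.jumpNorm_nonneg q))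
  rw [mul_pow, Real.sq_sqrt (by positivity), M.jumpNorm_sq, M.meshNorm_sq]
  have h1 : ∑ K, dofNorm (M.dof (fun i => q i - u L) K) ^ 2 ≤
      ∑ K, (2 * o K ^ 2 + 2 * m * (u K - u L) ^ 2) :=
    Finset.sum_le_sum fun K _ => dofNorm_sub_const_le (M.dof q K) (u L)
  rw [Finset.sum_add_distrib, ← Finset.mul_sum, ← Finset.mul_sum] at h1
  have hO : 0 ≤ ∑ K, o K ^ 2 := Finset.sum_nonneg fun _ _ => sq_nonneg _
  have hh2 : h ^ 2 ≤ 1 := pow_le_one₀ h0.le l4.le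
  calc _ ≤ h ^ 2 * (2 * ∑ K, o K ^ 2 + 2 * m * ∑ K, (u K - u L) ^ 2) := by gcongr
    _ = h ^ 2 * (2 * ∑ K, o K ^ 2) + 2 * m * (h ^ 2 * ∑ K, (u K - u L) ^ 2) := by ring
    _ ≤ 1 * (2 * ∑ K, o K ^ 2) + 2 * m * (C / N * ∑ K, o K ^ 2) := by gcongr
    _ = _ := by simp only [ho]; ring

end EvolvingSurface

/-! ### The time-projection: solvability and estimates -/

lemma LinearMap.existsUnique_of_injective {X : Type*} [AddCommGroup X] [Module ℝ X]
    [FiniteDimensional ℝ X] (a : X →ₗ[ℝ] X →ₗ[ℝ] ℝ) (ha : ∀ x, (∀ y, a x y = 0) → x = 0)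
    (F : X →ₗ[ℝ] ℝ) : ∃! x, ∀ y, a x y = F y := by
  have hinj : Function.Injective a := by
    rw [← LinearMap.ker_eq_bot, LinearMap.ker_eq_bot']
    exact fun x hx => ha x fun y => by rw [hx]; rfl
  -- The space and its dual have equal finite dimension.
  have hsurj : Function.Surjective a :=
    (LinearMap.injective_iff_surjective_of_finrank_eq_finrank
      (Subspace.dual_finrank_eq (K := ℝ) (V := X)).symm).1 hinj
  obtain ⟨x, hx⟩ := hsurj F
  exact ⟨x, fun y => by rw [hx], fun x' hx' => hinj (by rw [hx]; exact LinearMap.ext hx')⟩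

namespace EvolvingSurface

variable {S : EvolvingSurface} {M : Triangulation (S.Γ 0)} {kg : ℕ}

lemma surfIntegral_add {t : ℝ} {f g : Fin M.nK → R2 → ℝ} (hf : ∀ K, Continuous (f K))
    (hg : ∀ K, Continuous (g K)) :
    S.surfIntegral M kg t (fun K x => f K x + g K x) =
      S.surfIntegral M kg t f + S.surfIntegral M kg t g := by
  rw [surfIntegral, surfIntegral, surfIntegral, ← Finset.sum_add_distrib]
  refine Finset.sum_congr rfl fun K _ => ?_
  simp only [add_mul]
  have hN := (S.continuous_normalVec M (kg := kg) t K).norm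
  exact integral_add (integrableOn_refTriangle ((hf K).mul hN).continuousOn)
    (integrableOn_refTriangle ((hg K).mul hN).continuousOn)

lemma surfIntegral_const_mul (t a : ℝ) (f : Fin M.nK → R2 → ℝ) :
    S.surfIntegral M kg t (fun K x => a * f K x) = a * S.surfIntegral M kg t f := by
  rw [surfIntegral, surfIntegral, Finset.mul_sum]
  refine Finset.sum_congr rfl fun K _ => ?_
  simp only [mul_assoc]
  exact integral_const_mul _ _

variable {k : ℕ}

lemma mForm_comm (t : ℝ) (w v : M.Node k → E3) : S.mForm M kg t w v = S.mForm M kg t v w := by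
  simp only [mForm, real_inner_comm]

lemma mForm_add_left (t : ℝ) (w w' v : M.Node k → E3) :
    S.mForm M kg t (w + w') v = S.mForm M kg t w v + S.mForm M kg t w' v := by
  have e : ∀ K x, M.localRep k (w + w') K x = M.localRep k w K x + M.localRep k w' K x :=
    fun K x => locFun_add (M.dof w K) (M.dof w' K) x
  simp only [mForm, e, inner_add_left]
  exact surfIntegral_add
    (fun K => (continuous_locFun (M.dof w K)).inner (continuous_locFun (M.dof v K)))
    (fun K => (continuous_locFun (M.dof w' K)).inner (continuous_locFun (M.dof v K)))

lemma mForm_smul_left (t a : ℝ) (w v : M.Node k → E3) :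
    S.mForm M kg t (a • w) v = a * S.mForm M kg t w v := by
  have e : ∀ K x, M.localRep k (a • w) K x = a • M.localRep k w K x :=
    fun K x => locFun_smul a (M.dof w K) x
  simp only [mForm, e, real_inner_smul_left]
  exact surfIntegral_const_mul _ _ _

lemma mForm_add_right (t : ℝ) (w v v' : M.Node k → E3) :
    S.mForm M kg t w (v + v') = S.mForm M kg t w v + S.mForm M kg t w v' := by
  rw [mForm_comm, mForm_add_left, mForm_comm t v, mForm_comm t v']

lemma mForm_smul_right (t a : ℝ) (w v : M.Node k → E3) :
    S.mForm M kg t w (a • v) = a * S.mForm M kg t w v := by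
  rw [mForm_comm, mForm_smul_left, mForm_comm]

lemma mForm_sub_left (t : ℝ) (w w' v : M.Node k → E3) :
    S.mForm M kg t (w - w') v = S.mForm M kg t w v - S.mForm M kg t w' v := by
  rw [sub_eq_add_neg, ← neg_one_smul ℝ w', mForm_add_left, mForm_smul_left]
  ring

variable (S M kg) in
/-- The integral over the discrete surface as a linear functional on finite element functions. -/
noncomputable def surfTotal (t : ℝ) : (M.Node k → ℝ) →ₗ[ℝ] ℝ where
  toFun q := S.surfIntegral M kg t fun K x => M.localRep k q K x
  map_add' q q' := by
    have e : ∀ K x, M.localRep k (q + q') K x = M.localRep k q K x + M.localRep k q' K x :=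
      fun K x => locFun_add (M.dof q K) (M.dof q' K) x
    simp only [e]
    exact surfIntegral_add (fun K => continuous_locFun (M.dof q K))
      (fun K => continuous_locFun (M.dof q' K))
  map_smul' a q := by
    have e : ∀ K x, M.localRep k (a • q) K x = a * M.localRep k q K x :=
      fun K x => locFun_smul a (M.dof q K) x
    simp only [e, RingHom.id_apply, smul_eq_mul]
    exact surfIntegral_const_mul _ _ _

lemma meanZero_iff {t : ℝ} {q : M.Node k → ℝ} : S.MeanZero M kg t q ↔ S.surfTotal M kg t q = 0 :=
  Iff.rfl

lemma mForm_self (t : ℝ) (w : M.Node k → E3) :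
    S.mForm M kg t w w = S.surfIntegral M kg t fun K x => ‖M.localRep k w K x‖ ^ 2 := by
  simp only [mForm, real_inner_self_eq_norm_sq]

section Mean

variable {h C : ℝ} (G : S.MeshGeom M kg h C) {t : ℝ} (ht : t ∈ Icc 0 S.T) (hk : 1 ≤ k)
include G ht

include hk in
lemma MeshGeom.surfTotal_one_ge : M.nK * (C⁻¹ * h ^ 2 * volume.real refTriangle) ≤
    S.surfTotal M kg t (fun _ : M.Node k => (1 : ℝ)) := by
  change _ ≤ ∑ K, ∫ x in refTriangle, M.localRep k (fun _ => (1 : ℝ)) K x *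
    ‖normalVec (S.elemMap M kg t K) x‖
  have e : ∀ K, C⁻¹ * h ^ 2 * volume.real refTriangle ≤
      ∫ x in refTriangle, M.localRep k (fun _ => (1 : ℝ)) K x *
        ‖normalVec (S.elemMap M kg t K) x‖ := by
    intro K
    have h1 : ∀ x, M.localRep k (fun _ => (1 : ℝ)) K x = 1 := fun x => locFun_const hk 1 x
    simp only [h1, one_mul]
    calc _ = ∫ _x in refTriangle, C⁻¹ * h ^ 2 := by rw [setIntegral_const, smul_eq_mul, mul_comm]
      _ ≤ _ := integral_refTriangle_mono continuousOn_const
        (S.continuous_normalVec M t K).norm.continuousOn fun x hx => G.normal_ge t ht K x hx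
  calc _ = ∑ _K : Fin M.nK, C⁻¹ * h ^ 2 * volume.real refTriangle := by
        rw [Finset.sum_const, Finset.card_univ, Fintype.card_fin, nsmul_eq_mul]
    _ ≤ _ := Finset.sum_le_sum fun K _ => e K

include hk in
lemma MeshGeom.surfTotal_one_pos (hn : 0 < M.nK) :
    0 < S.surfTotal M kg t (fun _ : M.Node k => (1 : ℝ)) := by
  have h1 := G.C_pos
  have h2 := G.h_pos
  have h3 := volume_real_refTriangle_pos
  have h4 : (0 : ℝ) < M.nK := by exact_mod_cast hn
  exact lt_of_lt_of_le (by positivity) (G.surfTotal_one_ge ht hk)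

omit G ht in
lemma sub_const_eq (q : M.Node k → ℝ) (a : ℝ) :
    (fun i => q i - a) = q - a • fun _ : M.Node k => (1 : ℝ) := by
  funext i
  simp

include hk in
lemma MeshGeom.exists_meanZero_sub (hn : 0 < M.nK) (q : M.Node k → ℝ) :
    ∃ a : ℝ, S.MeanZero M kg t fun i => q i - a := by
  have h1 := G.surfTotal_one_pos ht hk hn
  refine ⟨S.surfTotal M kg t q / S.surfTotal M kg t (fun _ : M.Node k => (1 : ℝ)), ?_⟩
  rw [meanZero_iff, sub_const_eq, map_sub, map_smul, smul_eq_mul, div_mul_cancel₀ _ h1.ne', sub_self]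

lemma MeshGeom.abs_surfTotal_le {c : ℝ} (hc : 0 ≤ c)
    (hE : ∀ z : LatticeIndex k → ℝ, ∀ x ∈ refTriangle, ‖locFun z x‖ ≤ c * dofNorm z)
    (q : M.Node k → ℝ) : |S.surfTotal M kg t q| ≤
      c * C ^ 2 * volume.real refTriangle * (h * √M.nK) * M.meshNorm h q := by
  have h1 := G.C_pos
  have h2 := G.h_pos
  have := abs_sum_le_of_forall_le (f := fun K => ∫ x in refTriangle,
    M.localRep k q K x * ‖normalVec (S.elemMap M kg t K) x‖)
    (a := fun _ => 1) (b := fun K => dofNorm (M.dof q K))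
    (B := c * C ^ 2 * volume.real refTriangle * h ^ 2) (by positivity) ?_
  · refine this.trans (le_of_eq ?_)
    simp only [one_pow, Finset.sum_const, Finset.card_univ, Fintype.card_fin, nsmul_eq_mul, mul_one]
    rw [Triangulation.meshNorm]; ring
  · intro K
    refine le_trans (b := c * dofNorm (M.dof q K) * (C ^ 2 * h ^ 2) * volume.real refTriangle)
      (abs_integral_refTriangle_le fun x hx => ?_) (le_of_eq (by ring))
    rw [abs_mul, abs_norm, M.localRep_eq]
    exact mul_le_mul (hE _ x hx) (G.normal_le ht K hx) (norm_nonneg _)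
      (mul_nonneg hc (dofNorm_nonneg _))

include hk in
-- For q of mean zero the integral of q - a is -a times the area, so by Cauchy–Schwarz the norm of
-- the constant a is bounded by that of q - a. Any constant in the Poincaré inequality may thus be
-- replaced by the mean.
lemma MeshGeom.meshNorm_le_of_meanZero {c : ℝ} (hc : 0 ≤ c)
    (hE : ∀ z : LatticeIndex k → ℝ, ∀ x ∈ refTriangle, ‖locFun z x‖ ≤ c * dofNorm z)
    (hn : 0 < M.nK) {q : M.Node k → ℝ} (hq : S.MeanZero M kg t q) (a : ℝ) :
    M.meshNorm h q ≤ (1 + √(Fintype.card (LatticeIndex k)) * (c * C ^ 3)) *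
      M.meshNorm h fun i => q i - a := by
  have h1 := G.C_pos
  have h2 := G.h_pos
  have hV := volume_real_refTriangle_pos
  set V := volume.real refTriangle
  set D := M.meshNorm h fun i => q i - a with hD
  have hD0 : 0 ≤ D := M.meshNorm_nonneg h2.le _
  have hn0 : (0 : ℝ) < M.nK := by exact_mod_cast hn
  have hs : √(M.nK : ℝ) * √(M.nK : ℝ) = M.nK := Real.mul_self_sqrt hn0.le
  have hs0 : 0 < √(M.nK : ℝ) := Real.sqrt_pos.2 hn0
  have e1 := G.abs_surfTotal_le ht hc hE fun i => q i - a
  have e2 := G.surfTotal_one_ge ht hk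
  have e3 : |S.surfTotal M kg t fun i => q i - a| =
      |a| * S.surfTotal M kg t (fun _ : M.Node k => (1 : ℝ)) := by
    rw [sub_const_eq, map_sub, map_smul, meanZero_iff.1 hq, zero_sub, abs_neg, smul_eq_mul, abs_mul,
      abs_of_pos (G.surfTotal_one_pos ht hk hn)]
  rw [e3] at e1
  have e4 : |a| * (h * √M.nK) ≤ c * C ^ 3 * D := by
    have e5 := (mul_le_mul_of_nonneg_left e2 (abs_nonneg a)).trans e1
    have hp : 0 < C⁻¹ * V * (h * √M.nK) := by positivity
    refine le_of_mul_le_mul_right ?_ hp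
    calc |a| * (h * √M.nK) * (C⁻¹ * V * (h * √M.nK)) =
          |a| * (√M.nK * √M.nK * (C⁻¹ * h ^ 2 * V)) := by ring
      _ ≤ c * C ^ 2 * V * (h * √M.nK) * D := by rw [hs]; exact e5
      _ = _ := by field_simp
  have e6 : M.meshNorm h (fun _ : M.Node k => a) ≤
      h * (√(Fintype.card (LatticeIndex k)) * |a| * √(∑ _K : Fin M.nK, (1 : ℝ) ^ 2)) :=
    Triangulation.meshNorm_le_of_forall h2.le (by positivity) fun K => by
      rw [mul_one]
      exact dofNorm_le (abs_nonneg a) fun i => le_rfl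
  simp only [one_pow, Finset.sum_const, Finset.card_univ, Fintype.card_fin, nsmul_eq_mul,
    mul_one] at e6
  have e7 : q = (fun i => q i - a) + fun _ => a := by funext i; simp
  have e8 := M.meshNorm_add_le h2.le (fun i => q i - a) fun _ => a
  rw [← e7] at e8
  have e9 : h * (√(Fintype.card (LatticeIndex k)) * |a| * √M.nK) ≤
      √(Fintype.card (LatticeIndex k)) * (c * C ^ 3 * D) := by
    calc _ = √(Fintype.card (LatticeIndex k)) * (|a| * (h * √M.nK)) := by ring
      _ ≤ _ := mul_le_mul_of_nonneg_left e4 (Real.sqrt_nonneg _)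
  linarith

end Mean

/-- The uniform properties of the discrete forms at two times `s` and `t` from which the
estimates for the time-projection follow. -/
structure FormBounds (S : EvolvingSurface) (M : Triangulation (S.Γ 0)) (kg ku kp kl : ℕ)
    (h A : ℝ) (s t : ℝ) : Prop where
  A_pos : 0 < A
  h_pos : 0 < h
  lower : ∀ r, (r = s ∨ r = t) → ∀ w : M.Node ku → E3,
    A⁻¹ * M.meshNorm h w ^ 2 ≤ S.mForm M kg r w w
  upper : ∀ w v : M.Node ku → E3,
    |S.mForm M kg t w v| ≤ A * (M.meshNorm h w * M.meshNorm h v)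
  m_diff : ∀ w v : M.Node ku → E3, |S.mForm M kg t w v - S.mForm M kg s w v| ≤
    A * |t - s| * (M.meshNorm h w * M.meshNorm h v)
  -- The factor σ does not affect the argument, because the divergence constraint at time s holds
  -- for every ξ.
  b_diff : ∃ σ : ℝ, ∀ (w : M.Node ku → E3) (q : M.Node kp → ℝ) (ξ : M.Node kl → ℝ),
    |S.bForm M kg t w q ξ - S.bForm M kg s w q (σ • ξ)| ≤
      A * |t - s| * (M.meshNorm h w * (M.jumpNorm q + M.meshNorm h ξ))
  infSup : ∀ (q : M.Node kp → ℝ) (ξ : M.Node kl → ℝ), ∃ v : M.Node ku → E3,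
    A⁻¹ * (M.jumpNorm q ^ 2 + M.meshNorm h ξ ^ 2) ≤ S.bForm M kg t v q ξ ∧
      M.meshNorm h v ≤ A * (M.jumpNorm q + M.meshNorm h ξ)
  poincare : ∀ q : M.Node kp → ℝ, S.MeanZero M kg t q → M.meshNorm h q ≤ A * M.jumpNorm q
  pair : ∀ (q : M.Node kp → ℝ) (ξ : M.Node kl → ℝ),
    S.pairNormL2 M kg t q ξ ≤ A * (M.meshNorm h q + M.meshNorm h ξ)
  shift : ∀ q : M.Node kp → ℝ, ∃ a : ℝ, S.MeanZero M kg s (fun i => q i - a) ∧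
    ∀ (w : M.Node ku → E3) (ξ : M.Node kl → ℝ),
      S.bForm M kg s w (fun i => q i - a) ξ = S.bForm M kg s w q ξ
  b_add_left : ∀ (w w' : M.Node ku → E3) (q : M.Node kp → ℝ) (ξ : M.Node kl → ℝ),
    S.bForm M kg t (w + w') q ξ = S.bForm M kg t w q ξ + S.bForm M kg t w' q ξ
  b_smul_left : ∀ (a : ℝ) (w : M.Node ku → E3) (q : M.Node kp → ℝ) (ξ : M.Node kl → ℝ),
    S.bForm M kg t (a • w) q ξ = a * S.bForm M kg t w q ξ
  b_add_right : ∀ (w : M.Node ku → E3) (q q' : M.Node kp → ℝ) (ξ ξ' : M.Node kl → ℝ),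
    S.bForm M kg t w (q + q') (ξ + ξ') = S.bForm M kg t w q ξ + S.bForm M kg t w q' ξ'
  b_smul_right : ∀ (a : ℝ) (w : M.Node ku → E3) (q : M.Node kp → ℝ) (ξ : M.Node kl → ℝ),
    S.bForm M kg t w (a • q) (a • ξ) = a * S.bForm M kg t w q ξ

lemma exists_formBounds (S : EvolvingSurface) {kg ku kp kl : ℕ} (hkg : 1 ≤ kg) (hku : 2 ≤ ku)
    (hkp : kp + 1 = ku) (hkl : 1 ≤ kl) (hkl' : kl ≤ ku) {ρ : ℝ} (hρ : 0 < ρ) :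
    ∃ A > 0, ∃ h₀ > 0, ∀ (M : Triangulation (S.Γ 0)) (h : ℝ), S.IsMeshSize M kg h →
      S.IsQuasiUniform M ρ h → h < h₀ → ∀ s ∈ Icc 0 S.T, ∀ t ∈ Icc 0 S.T,
        S.FormBounds M kg ku kp kl h A s t := by
  have hkp1 : 1 ≤ kp := by omega
  have hku1 : 1 ≤ ku := by omega
  obtain ⟨C, hC, h₁, hh₁, hG⟩ := S.exists_meshGeom hkg hρ
  obtain ⟨P, hP, h₂, hh₂, hPo⟩ := S.exists_poincare hkg hkp1 hρ
  obtain ⟨β, hβ, B, hB, h₃, hh₃, hIS⟩ := exists_infSup hku hkp hkl hkl' hC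
  obtain ⟨cu, hcu, hU⟩ := exists_locFun_bound E3 ku
  obtain ⟨cp, hcp, hPb⟩ := exists_locFun_bound ℝ kp
  obtain ⟨cl, hcl, hL⟩ := exists_locFun_bound ℝ kl
  obtain ⟨dp, hdp, hF⟩ := exists_fderiv_locFun_bound ℝ hkp1
  obtain ⟨α, hα, hαE⟩ := exists_dofNorm_le_integral_E3 hku1
  set V := volume.real refTriangle with hV
  have hV0 : 0 < V := volume_real_refTriangle_pos
  set a₁ := (C⁻¹ * α)⁻¹ with ha₁
  set a₂ := cu ^ 2 * C ^ 2 * V with ha₂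
  set a₃ := cu ^ 2 * (2 * C ^ 2) * V with ha₃
  set a₄ := V * cu * (2 * dp * (C + 4 * C ^ 4) + cl * (2 * C ^ 2)) with ha₄
  set a₅ := (1 + √(Fintype.card (LatticeIndex kp)) * (cp * C ^ 3)) * P with ha₅
  set a₆ := √(cp ^ 2 * C ^ 2 * V + cl ^ 2 * C ^ 2 * V) with ha₆
  have p1 : 0 < a₁ := by positivity
  have p2 : 0 < a₂ := by positivity
  have p3 : 0 < a₃ := by positivity
  have p4 : 0 < a₄ := by positivity
  have p5 : 0 < a₅ := by positivity
  have p6 : 0 < a₆ := by positivity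
  have p7 : 0 < β⁻¹ := by positivity
  -- One constant for all bounds; a₁ and β⁻¹ are reciprocals because A⁻¹ serves as the lower
  -- constant in the mass and inf-sup bounds.
  set A := a₁ + a₂ + a₃ + a₄ + a₅ + a₆ + β⁻¹ + B with hA
  have hA0 : 0 < A := by positivity
  refine ⟨A, hA0, min h₁ (min h₂ h₃), by positivity, fun M h hh hq hlt s hs t ht => ?_⟩
  simp only [lt_min_iff] at hlt
  obtain ⟨l1, l2, l3⟩ := hlt
  have G := hG M h hh hq l1
  have h0 := G.h_pos
  have hn := S.nK_pos hh
  refine ⟨hA0, h0, ?_, ?_, ?_, ?_, ?_, ?_, ?_, ?_, G.bForm_add_left ht, G.bForm_smul_left ht,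
    G.bForm_add_right ht, G.bForm_smul_right ht⟩
  · intro r hr w
    have hr' : r ∈ Icc 0 S.T := by rcases hr with rfl | rfl <;> assumption
    rw [mForm_self]
    refine le_trans (mul_le_mul_of_nonneg_right ?_ (sq_nonneg _)) (G.sqNorm_lower hαE hr' w)
    rw [inv_le_comm₀ hA0 (by positivity)]
    linarith
  · intro w v
    refine (G.abs_mForm_le hcu.le hU ht w v).trans (mul_le_mul_of_nonneg_right (by linarith) ?_)
    exact mul_nonneg (M.meshNorm_nonneg h0.le _) (M.meshNorm_nonneg h0.le _)
  · intro w v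
    refine (G.abs_mForm_sub_le hcu.le hU ht hs w v).trans (mul_le_mul_of_nonneg_right
      (mul_le_mul_of_nonneg_right (by linarith) (abs_nonneg _)) ?_)
    exact mul_nonneg (M.meshNorm_nonneg h0.le _) (M.meshNorm_nonneg h0.le _)
  · obtain ⟨σ, hσ⟩ := G.abs_bForm_sub_le hcu.le hdp.le hcl.le hU hF hL ht hs
    refine ⟨σ, fun w q ξ => (hσ w q ξ).trans (mul_le_mul_of_nonneg_right
      (mul_le_mul_of_nonneg_right (by linarith) (abs_nonneg _)) ?_)⟩
    exact mul_nonneg (M.meshNorm_nonneg h0.le _)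
      (add_nonneg (M.jumpNorm_nonneg _) (M.meshNorm_nonneg h0.le _))
  · intro q ξ
    obtain ⟨v, hv1, hv2⟩ := hIS S M kg h G l3 t ht q ξ
    refine ⟨v, le_trans (mul_le_mul_of_nonneg_right ?_ (by positivity)) hv1,
      hv2.trans (mul_le_mul_of_nonneg_right (by linarith) ?_)⟩
    · rw [inv_le_comm₀ hA0 hβ]
      linarith
    · exact add_nonneg (M.jumpNorm_nonneg _) (M.meshNorm_nonneg h0.le _)
  · intro q hq0
    obtain ⟨a, ha⟩ := hPo M h hh hq l2 q
    have hj := M.jumpNorm_nonneg q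
    refine (G.meshNorm_le_of_meanZero ht hkp1 hcp.le hPb hn hq0 a).trans ?_
    calc _ ≤ (1 + √(Fintype.card (LatticeIndex kp)) * (cp * C ^ 3)) * (P * M.jumpNorm q) :=
          mul_le_mul_of_nonneg_left ha (by positivity)
      _ = a₅ * M.jumpNorm q := by rw [ha₅]; ring
      _ ≤ _ := mul_le_mul_of_nonneg_right (by linarith) hj
  · intro q ξ
    have n1 := M.meshNorm_nonneg h0.le q
    have n2 := M.meshNorm_nonneg h0.le ξ
    have hnn : ∀ {k : ℕ} (z : M.Node k → ℝ), 0 ≤ S.surfIntegral M kg t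
        fun K x => M.localRep k z K x ^ 2 := fun z =>
      Finset.sum_nonneg fun K _ => setIntegral_nonneg measurableSet_refTriangle fun x _ =>
        mul_nonneg (sq_nonneg _) (norm_nonneg _)
    have e1 := G.sqNorm_upper hPb ht q
    have e2 := G.sqNorm_upper hL ht ξ
    simp only [Real.norm_eq_abs, sq_abs] at e1 e2
    rw [pairNormL2, scalarNormL2, scalarNormL2, Real.sq_sqrt (hnn q), Real.sq_sqrt (hnn ξ)]
    have e3 : a₆ * (M.meshNorm h q + M.meshNorm h ξ) ≤ A * (M.meshNorm h q + M.meshNorm h ξ) :=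
      mul_le_mul_of_nonneg_right (by linarith) (add_nonneg n1 n2)
    refine le_trans ?_ e3
    rw [ha₆]
    refine Real.sqrt_le_iff.2 ⟨by positivity, ?_⟩
    rw [mul_pow, Real.sq_sqrt (by positivity)]
    have e4 : M.meshNorm h q ^ 2 ≤ (M.meshNorm h q + M.meshNorm h ξ) ^ 2 :=
      pow_le_pow_left₀ n1 (by linarith) 2
    have e5 : M.meshNorm h ξ ^ 2 ≤ (M.meshNorm h q + M.meshNorm h ξ) ^ 2 :=
      pow_le_pow_left₀ n2 (by linarith) 2
    rw [add_mul]
    exact add_le_add (e1.trans (mul_le_mul_of_nonneg_left e4 (by positivity)))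
      (e2.trans (mul_le_mul_of_nonneg_left e5 (by positivity)))
  · intro q
    obtain ⟨a, ha⟩ := G.exists_meanZero_sub hs hkp1 hn q
    exact ⟨a, ha, fun w ξ => bForm_sub_const hkp1 s w q a ξ⟩

end EvolvingSurface

/-- If y ≤ x there is nothing to do; otherwise x² ≤ x y and one factor y cancels. -/
lemma le_of_sq_le_mul_add {α a b x y : ℝ} (hα : 0 < α) (ha : 0 ≤ a) (hb : 0 ≤ b) (hx : 0 ≤ x)
    (h : α * y ^ 2 ≤ a * x * y + b * x ^ 2) : y ≤ ((a + b) / α + 1) * x := by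
  have hK : 0 ≤ (a + b) / α := by positivity
  rcases le_or_gt y x with hyx | hyx
  · nlinarith [mul_nonneg hK hx]
  have hy : 0 < y := hx.trans_lt hyx
  have h1 : α * y * y ≤ (a + b) * x * y := by nlinarith [mul_nonneg hb hx]
  have h2 : α * y ≤ (a + b) * x := le_of_mul_le_mul_right h1 hy
  have h3 : y ≤ (a + b) / α * x := by
    rw [div_mul_eq_mul_div, le_div_iff₀ hα]
    linarith
  linarith

namespace EvolvingSurface

variable {S : EvolvingSurface} {M : Triangulation (S.Γ 0)} {kg ku kp kl : ℕ} {h A s t : ℝ}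

/-- The stability constant of the time-projection in the discrete norms. -/
noncomputable def projConst (A : ℝ) : ℝ := (A + A * (2 * A * A * A) + A * (2 * A * A * A)) / A⁻¹ + 1

lemma projConst_pos (hA : 0 < A) : 0 < projConst A := by
  rw [projConst]; positivity

section Projection

variable (B : S.FormBounds M kg ku kp kl h A s t)
include B

/-- The inf-sup test field is inserted into the error equation; the factor 2 comes from comparing
the square of the sum J with the sum of squares. -/
lemma FormBounds.multiplier_le {e w : M.Node ku → E3} {p : M.Node kp → ℝ} {l : M.Node kl → ℝ}
    (hv : ∀ v : M.Node ku → E3, S.bForm M kg t v p l =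
      S.mForm M kg t e v - (S.mForm M kg t w v - S.mForm M kg s w v)) :
    M.jumpNorm p + M.meshNorm h l ≤
      2 * A * A * A * (M.meshNorm h e + |t - s| * M.meshNorm h w) := by
  have hA := B.A_pos
  have h0 := B.h_pos
  obtain ⟨v, hv1, hv2⟩ := B.infSup p l
  have n1 := M.jumpNorm_nonneg p
  have n2 := M.meshNorm_nonneg h0.le l
  have n3 := M.meshNorm_nonneg h0.le e
  have n4 := M.meshNorm_nonneg h0.le w
  have n5 := M.meshNorm_nonneg h0.le v
  set J := M.jumpNorm p + M.meshNorm h l with hJ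
  have hJ0 : 0 ≤ J := add_nonneg n1 n2
  have e1 := (abs_le.1 (B.upper e v)).2
  have e2 := (abs_le.1 (B.m_diff w v)).1
  have e3 : S.bForm M kg t v p l ≤
      A * (M.meshNorm h e + |t - s| * M.meshNorm h w) * M.meshNorm h v := by
    rw [hv]
    linarith
  have e4 : A⁻¹ * (M.jumpNorm p ^ 2 + M.meshNorm h l ^ 2) ≤
      A * (M.meshNorm h e + |t - s| * M.meshNorm h w) * (A * J) :=
    hv1.trans (e3.trans (mul_le_mul_of_nonneg_left hv2 (by positivity)))
  have e5 : J * J ≤ 2 * (M.jumpNorm p ^ 2 + M.meshNorm h l ^ 2) := by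
    rw [hJ]
    linarith [sq_nonneg (M.jumpNorm p - M.meshNorm h l)]
  rcases hJ0.eq_or_lt with hz | hpos
  · rw [← hz]; positivity
  refine le_of_mul_le_mul_right ?_ hpos
  calc J * J ≤ 2 * A * (A⁻¹ * (M.jumpNorm p ^ 2 + M.meshNorm h l ^ 2)) := by
        rw [mul_assoc, mul_inv_cancel_left₀ hA.ne']; exact e5
    _ ≤ 2 * A * (A * (M.meshNorm h e + |t - s| * M.meshNorm h w) * (A * J)) :=
        mul_le_mul_of_nonneg_left e4 (by positivity)
    _ = _ := by ring

/-- The error equation is tested with e itself. Its multiplier term is small because both divergence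
constraints hold, each at its own time, and the form b changes by O(|t - s|) only. -/
lemma FormBounds.projection_bounds {w w' : M.Node ku → E3} {p : M.Node kp → ℝ} {l : M.Node kl → ℝ}
    (hw : S.IsWeaklyDivFree M kg kp kl s w)
    (H : S.IsLerayProjection M kg (ku := ku) (kp := kp) (kl := kl) s t w w' p l) :
    M.meshNorm h (w - w') ≤ projConst A * (|t - s| * M.meshNorm h w) ∧
    M.jumpNorm p + M.meshNorm h l ≤
      2 * A * A * A * ((projConst A + 1) * (|t - s| * M.meshNorm h w)) := by
  have hA := B.A_pos
  have h0 := B.h_pos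
  obtain ⟨hp, hm, hdiv⟩ := H
  have hv : ∀ v : M.Node ku → E3, S.bForm M kg t v p l =
      S.mForm M kg t (w - w') v - (S.mForm M kg t w v - S.mForm M kg s w v) := by
    intro v
    have h1 := hm v
    have h2 := mForm_sub_left (S := S) (kg := kg) t w w' v
    change S.mForm M kg t w' v + S.bForm M kg t v p l = S.mForm M kg s w v at h1
    linarith
  have hJ := B.multiplier_le hv
  set e := w - w' with he
  have n3 := M.meshNorm_nonneg h0.le e
  have n4 := M.meshNorm_nonneg h0.le w
  set x := |t - s| * M.meshNorm h w with hx
  have hx0 : 0 ≤ x := by positivity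
  set y := M.meshNorm h e with hy
  set J := M.jumpNorm p + M.meshNorm h l with hJdef
  -- At time t the field w' contributes nothing. At time s the field w contributes nothing, once p
  -- has been shifted by a constant to mean zero at s. What remains is the time difference of b
  -- applied to w.
  have hbe : |S.bForm M kg t e p l| ≤ A * x * J := by
    obtain ⟨σ, hσ⟩ := B.b_diff
    obtain ⟨a, ha, hab⟩ := B.shift p
    have h1 : S.bForm M kg s w p (σ • l) = 0 := by
      rw [← hab]
      exact hw _ _ ha
    have h2 : S.bForm M kg t e p l = S.bForm M kg t w p l := by
      have h3 : w = e + w' := by rw [he, sub_add_cancel]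
      have h4 := B.b_add_left e w' p l
      rw [← h3] at h4
      have h5 : S.bForm M kg t w' p l = 0 := hdiv p l hp
      linarith
    have h6 := hσ w p l
    rw [h1, sub_zero, ← h2] at h6
    refine h6.trans (le_of_eq ?_)
    rw [hx]; ring
  have hlow := B.lower t (Or.inr rfl) e
  have hupp : S.mForm M kg t e e ≤ A * x * y + A * x * J := by
    have h1 := hv e
    have h2 := (abs_le.1 (B.m_diff w e)).2
    have h3 := (abs_le.1 hbe).2
    have h4 : A * |t - s| * (M.meshNorm h w * M.meshNorm h e) = A * x * y := by rw [hx, hy]; ring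
    linarith
  have hy2 : y ≤ projConst A * x := by
    -- Here α = A⁻¹, a = A + A·2A³ and b = A·2A³; the resulting constant is `projConst A`.
    refine le_of_sq_le_mul_add (inv_pos.2 hA) (by positivity) (by positivity) hx0 ?_
    calc A⁻¹ * y ^ 2 ≤ A * x * y + A * x * J := hlow.trans hupp
      _ ≤ A * x * y + A * x * (2 * A * A * A * (y + x)) := by
          have := mul_le_mul_of_nonneg_left hJ (by positivity : 0 ≤ A * x)
          linarith
      _ = _ := by ring
  refine ⟨hy2, hJ.trans (mul_le_mul_of_nonneg_left ?_ (by positivity))⟩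
  linarith

/-- The system is square on velocity, mean-zero pressure and normal multiplier, so uniqueness
suffices. The latter is the case w = 0 of the bounds for the projection. -/
lemma FormBounds.existsUnique (w : M.Node ku → E3) :
    ∃! z : (M.Node ku → E3) × (M.Node kp → ℝ) × (M.Node kl → ℝ),
      S.IsLerayProjection M kg (ku := ku) (kp := kp) (kl := kl) s t w z.1 z.2.1 z.2.2 := by
  have hA := B.A_pos
  have h0 := B.h_pos
  have hb0 : ∀ v : M.Node ku → E3, S.bForm M kg t v (0 : M.Node kp → ℝ) (0 : M.Node kl → ℝ) = 0 := by
    intro v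
    have := B.b_smul_right 0 v 0 0
    rwa [smul_zero, smul_zero, zero_mul] at this
  have hb0' : ∀ (q : M.Node kp → ℝ) (ξ : M.Node kl → ℝ),
      S.bForm M kg t (0 : M.Node ku → E3) q ξ = 0 := by
    intro q ξ
    have := B.b_smul_left 0 0 q ξ
    rwa [smul_zero, zero_mul] at this
  have hm0 : ∀ (r : ℝ) (v : M.Node ku → E3), S.mForm M kg r v 0 = 0 := by
    intro r v
    have := mForm_smul_right (S := S) (kg := kg) r 0 v 0
    rwa [smul_zero, zero_mul] at this
  set Q := LinearMap.ker (S.surfTotal M kg t (k := kp)) with hQ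
  set a : ((M.Node ku → E3) × Q × (M.Node kl → ℝ)) →ₗ[ℝ]
      ((M.Node ku → E3) × Q × (M.Node kl → ℝ)) →ₗ[ℝ] ℝ := LinearMap.mk₂ ℝ
    (fun x y => S.mForm M kg t x.1 y.1 + S.bForm M kg t y.1 x.2.1.1 x.2.2 +
      S.bForm M kg t x.1 y.2.1.1 y.2.2)
    (fun x x' y => by
      simp only [Prod.fst_add, Prod.snd_add, Submodule.coe_add]
      rw [mForm_add_left, B.b_add_right, B.b_add_left]; ring)
    (fun c x y => by
      simp only [Prod.smul_fst, Prod.smul_snd, Submodule.coe_smul, smul_eq_mul]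
      rw [mForm_smul_left, B.b_smul_right, B.b_smul_left]; ring)
    (fun x y y' => by
      simp only [Prod.fst_add, Prod.snd_add, Submodule.coe_add]
      rw [mForm_add_right, B.b_add_right, B.b_add_left]; ring)
    (fun c x y => by
      simp only [Prod.smul_fst, Prod.smul_snd, Submodule.coe_smul, smul_eq_mul]
      rw [mForm_smul_right, B.b_smul_right, B.b_smul_left]; ring) with ha
  -- Testing with (v, 0, 0) and (0, q, ξ) separates the single equation into the momentum equation
  -- and the constraint.
  have hsys : ∀ (f : M.Node ku → E3) (x : (M.Node ku → E3) × Q × (M.Node kl → ℝ)),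
      (∀ y, a x y = S.mForm M kg s f y.1) ↔
      S.IsLerayProjection M kg (ku := ku) (kp := kp) (kl := kl) s t f x.1 x.2.1.1 x.2.2 := by
    intro f x
    constructor
    · intro hx
      refine ⟨meanZero_iff.2 (LinearMap.mem_ker.1 x.2.1.2), fun v => ?_, fun q ξ hq => ?_⟩
      · have h1 : S.mForm M kg t x.1 v + S.bForm M kg t v x.2.1.1 x.2.2 +
            S.bForm M kg t x.1 0 0 = S.mForm M kg s f v := hx (v, 0, 0)
        rw [hb0, add_zero] at h1
        exact h1
      · have h1 : S.mForm M kg t x.1 0 + S.bForm M kg t 0 x.2.1.1 x.2.2 +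
            S.bForm M kg t x.1 q ξ = S.mForm M kg s f 0 :=
          hx (0, ⟨q, LinearMap.mem_ker.2 (meanZero_iff.1 hq)⟩, ξ)
        rwa [hm0, hm0, hb0', zero_add, zero_add] at h1
    · rintro ⟨-, h2, h3⟩ y
      have e1 : S.mForm M kg t x.1 y.1 + S.bForm M kg t y.1 x.2.1.1 x.2.2 = S.mForm M kg s f y.1 :=
        h2 y.1
      have e2 : S.bForm M kg t x.1 y.2.1.1 y.2.2 = 0 :=
        h3 _ _ (meanZero_iff.2 (LinearMap.mem_ker.1 y.2.1.2))
      change S.mForm M kg t x.1 y.1 + S.bForm M kg t y.1 x.2.1.1 x.2.2 +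
        S.bForm M kg t x.1 y.2.1.1 y.2.2 = _
      rw [e1, e2, add_zero]
  have hms0 : ∀ v : M.Node ku → E3, S.mForm M kg s 0 v = 0 := fun v => by rw [mForm_comm, hm0]
  have hnondeg : ∀ x, (∀ y, a x y = 0) → x = 0 := by
    intro x hx
    have H := (hsys 0 x).1 fun y => by rw [hx, hms0]
    have hz : S.IsWeaklyDivFree M kg (ku := ku) kp kl s 0 := by
      intro q ξ hq
      simp only [bForm, surfIntegral]
      have e : ∀ K y, M.localRep ku (0 : M.FEFun ku E3 s) K y = 0 := fun K y => by
        simp [Triangulation.localRep]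
      simp [e]
    obtain ⟨h1, h2⟩ := B.projection_bounds hz H
    have h3 : M.meshNorm h (0 : M.Node ku → E3) = 0 := by
      have := M.meshNorm_smul h 0 (0 : M.Node ku → E3)
      rwa [smul_zero, abs_zero, zero_mul] at this
    rw [h3, mul_zero, mul_zero] at h1
    rw [h3, mul_zero, mul_zero, mul_zero] at h2
    have h4 : 0 - x.1 = 0 := Triangulation.eq_zero_of_meshNorm_eq_zero h0.ne'
      (le_antisymm h1 (M.meshNorm_nonneg h0.le _))
    have n1 := M.jumpNorm_nonneg x.2.1.1
    have n2 := M.meshNorm_nonneg h0.le x.2.2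
    have h5 : x.2.2 = 0 := Triangulation.eq_zero_of_meshNorm_eq_zero h0.ne' (by linarith)
    -- The inf-sup bound controls the pressure only up to constants; the zero mean removes them.
    have h6 := B.poincare x.2.1.1 H.1
    have h7 : M.jumpNorm x.2.1.1 = 0 := by linarith
    rw [h7, mul_zero] at h6
    have h8 : x.2.1.1 = 0 := Triangulation.eq_zero_of_meshNorm_eq_zero h0.ne'
      (le_antisymm h6 (M.meshNorm_nonneg h0.le _))
    refine Prod.ext ?_ (Prod.ext (Subtype.ext h8) h5)
    rw [zero_sub, neg_eq_zero] at h4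
    exact h4
  have : Finite (M.Node ku) := inferInstance
  obtain ⟨x, hx, hxu⟩ := LinearMap.existsUnique_of_injective a hnondeg
    { toFun := fun y => S.mForm M kg s w y.1
      map_add' := fun y y' => by rw [Prod.fst_add, mForm_add_right]
      map_smul' := fun c y => by
        rw [Prod.smul_fst, mForm_smul_right, RingHom.id_apply, smul_eq_mul] }
  refine ⟨(x.1, x.2.1.1, x.2.2), (hsys w x).1 hx, ?_⟩
  rintro ⟨w', p, l⟩ H
  have h1 := hxu (w', ⟨p, LinearMap.mem_ker.2 (meanZero_iff.1 H.1)⟩, l)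
    ((hsys w (w', ⟨p, LinearMap.mem_ker.2 (meanZero_iff.1 H.1)⟩, l)).2 H)
  rw [← h1]

lemma FormBounds.meshNorm_le_normL2 {r : ℝ} (hr : r = s ∨ r = t) (w : M.Node ku → E3) :
    M.meshNorm h w ≤ √A * S.normL2 M kg r w := by
  have hA := B.A_pos
  have h1 := B.lower r hr w
  rw [normL2, ← Real.sqrt_mul hA.le]
  refine Real.le_sqrt_of_sq_le ?_
  rwa [inv_mul_le_iff₀ hA] at h1

lemma FormBounds.normL2_le (w : M.Node ku → E3) : S.normL2 M kg t w ≤ √A * M.meshNorm h w := by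
  have hA := B.A_pos
  have h1 := (abs_le.1 (B.upper w w)).2
  have n := M.meshNorm_nonneg B.h_pos.le w
  rw [normL2]
  refine Real.sqrt_le_iff.2 ⟨by positivity, ?_⟩
  rw [mul_pow, Real.sq_sqrt hA.le]
  linarith

end Projection

end EvolvingSurface

theorem mainTheorem7 (S : EvolvingSurface) (kg ku kp kl : ℕ) (hkg : 1 ≤ kg) (hku : 2 ≤ ku)
    (hkp : kp + 1 = ku) (hkl : 1 ≤ kl) (hkl' : kl ≤ ku) (ρ : ℝ) (hρ : 0 < ρ) :
    ∃ c > (0 : ℝ), ∃ h₀ > (0 : ℝ), ∃ τ₀ > (0 : ℝ),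
      ∀ (M : Triangulation (S.Γ 0)) (h : ℝ), S.IsMeshSize M kg h → S.IsQuasiUniform M ρ h →
        h < h₀ →
      ∀ N n : ℕ, 1 ≤ n → n ≤ N → S.T / N ≤ τ₀ →
      ∀ w : M.FEFun ku E3 (S.time N (n - 1)),
        S.IsWeaklyDivFree M kg kp kl (S.time N (n - 1)) w →
        (∃! z : M.FEFun ku E3 (S.time N n) × M.FEFun kp ℝ (S.time N n) ×
            M.FEFun kl ℝ (S.time N n),
          S.IsLerayProjection M kg (S.time N (n - 1)) (S.time N n) w z.1 z.2.1 z.2.2) ∧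
        ∀ (w' : M.FEFun ku E3 (S.time N n)) (p : M.FEFun kp ℝ (S.time N n))
          (l : M.FEFun kl ℝ (S.time N n)),
          S.IsLerayProjection M kg (S.time N (n - 1)) (S.time N n) w w' p l →
          S.IsWeaklyDivFree M kg kp kl (S.time N n) w' ∧
          S.normL2 M kg (S.time N n) w' ≤ c * S.normL2 M kg (S.time N (n - 1)) w ∧
          S.pairNormL2 M kg (S.time N n) p l ≤
            S.normL2 M kg (S.time N n) (M.timeLift (S.time N n) w - w') +
              c * (S.T / N) * S.normL2 M kg (S.time N (n - 1)) w ∧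
          S.normL2 M kg (S.time N n) (M.timeLift (S.time N n) w - w') ≤
            c * (S.T / N) * S.energyNorm M kg (S.time N (n - 1)) w := by
  obtain ⟨A, hA, h₀, hh₀, hB⟩ := S.exists_formBounds hkg hku hkp hkl hkl' hρ
  set κ := EvolvingSurface.projConst A with hκ
  have hκ0 : 0 < κ := EvolvingSurface.projConst_pos hA
  set D := A * (A + 1) * (2 * A * A * A * (κ + 1)) * √A with hD
  have hD0 : 0 < D := by positivity
  -- The restriction on the time step is only needed to bound it by one in the L² stability; the
  -- other two estimates hold without it.
  refine ⟨A * (1 + κ) + D, by positivity, h₀, hh₀, 1, one_pos,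
    fun M h hh hq hlt N n hn hnN hτ w hw => ?_⟩
  have hN0 : (0 : ℝ) < N := by exact_mod_cast (by omega : 0 < N)
  have hTN : 0 < S.T / N := div_pos S.T_pos hN0
  have hmem : ∀ m : ℕ, m ≤ N → S.time N m ∈ Icc 0 S.T := by
    intro m hm
    rw [EvolvingSurface.time]
    refine ⟨by positivity, ?_⟩
    calc (m : ℝ) * (S.T / N) ≤ N * (S.T / N) := by gcongr
      _ = S.T := by field_simp
  have hdiff : |S.time N n - S.time N (n - 1)| = S.T / N := by
    rw [EvolvingSurface.time, EvolvingSurface.time, Nat.cast_sub hn, Nat.cast_one, ← sub_mul,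
      sub_sub_cancel, one_mul, abs_of_pos hTN]
  have B := hB M h hh hq hlt _ (hmem (n - 1) (by omega)) _ (hmem n hnN)
  refine ⟨B.existsUnique w, fun w' p l H => ⟨H.2.2, ?_⟩⟩
  obtain ⟨b1, b2⟩ := B.projection_bounds hw H
  rw [hdiff] at b1 b2
  have h0 := B.h_pos
  set τ := S.T / N with hτdef
  have hAA : √A * √A = A := Real.mul_self_sqrt hA.le
  have hs0 : 0 < √A := Real.sqrt_pos.2 hA
  set L := S.normL2 M kg (S.time N (n - 1)) w with hL
  have hL0 : 0 ≤ L := Real.sqrt_nonneg _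
  have c1 : M.meshNorm h w ≤ √A * L := B.meshNorm_le_normL2 (Or.inl rfl) w
  have c2 : M.meshNorm h (w - w') ≤ κ * (τ * (√A * L)) := b1.trans (by gcongr)
  have c3 : S.normL2 M kg (S.time N n) (w - w') ≤ A * κ * (τ * L) := by
    refine (B.normL2_le (w - w')).trans ?_
    calc √A * M.meshNorm h (w - w') ≤ √A * (κ * (τ * (√A * L))) := by gcongr
      _ = √A * √A * κ * (τ * L) := by ring
      _ = _ := by rw [hAA]
  have hDL : 0 ≤ D * L := by positivity
  have hDτL : 0 ≤ D * (τ * L) := by positivity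
  refine ⟨?_, ?_, ?_⟩
  · have e1 : M.meshNorm h w' ≤ M.meshNorm h w + M.meshNorm h (w - w') := by
      have e2 := M.meshNorm_add_le h0.le w ((-1 : ℝ) • (w - w'))
      have e3 : w + (-1 : ℝ) • (w - w') = w' := by rw [neg_one_smul]; abel
      rw [M.meshNorm_smul, abs_neg, abs_one, one_mul, e3] at e2
      exact e2
    have e4 : M.meshNorm h w' ≤ (1 + κ) * (√A * L) := by
      have : κ * (τ * (√A * L)) ≤ κ * (1 * (√A * L)) := by gcongr
      linarith
    refine (B.normL2_le w').trans ?_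
    calc √A * M.meshNorm h w' ≤ √A * ((1 + κ) * (√A * L)) := by gcongr
      _ = √A * √A * (1 + κ) * L := by ring
      _ = A * (1 + κ) * L := by rw [hAA]
      _ ≤ _ := by rw [add_mul]; linarith
  · have e1 := B.pair p l
    have e2 := B.poincare p H.1
    have n1 := M.jumpNorm_nonneg p
    have n2 := M.meshNorm_nonneg h0.le l
    -- The multipliers are of order τ‖w‖ by themselves, so the norm of the difference on the right
    -- of the claim is simply added as a nonnegative term.
    have e3 : S.pairNormL2 M kg (S.time N n) p l ≤ D * (τ * L) := by
      refine e1.trans ?_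
      calc A * (M.meshNorm h p + M.meshNorm h l) ≤
            A * ((A + 1) * (M.jumpNorm p + M.meshNorm h l)) := by
            refine mul_le_mul_of_nonneg_left ?_ hA.le
            linarith [mul_nonneg hA.le n2]
        _ ≤ A * ((A + 1) * (2 * A * A * A * ((κ + 1) * (τ * (√A * L))))) := by
            refine mul_le_mul_of_nonneg_left (mul_le_mul_of_nonneg_left (b2.trans ?_)
              (by positivity)) hA.le
            gcongr
        _ = _ := by rw [hD]; ring
    have e4 : 0 ≤ S.normL2 M kg (S.time N n) (M.timeLift (S.time N n) w - w') := Real.sqrt_nonneg _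
    have e5 : 0 ≤ A * (1 + κ) * (τ * L) := by positivity
    calc _ ≤ D * (τ * L) := e3
      _ ≤ _ := by linarith
  -- The difference is already bounded by the L² norm of w; the energy norm enters only because it
  -- is larger.
  · have e1 : L ≤ S.energyNorm M kg (S.time N (n - 1)) w := by
      rw [EvolvingSurface.energyNorm]
      exact le_add_of_nonneg_left (Real.sqrt_nonneg _)
    refine c3.trans ?_
    calc A * κ * (τ * L) ≤ (A * (1 + κ) + D) * (τ * L) := by
          refine mul_le_mul_of_nonneg_right ?_ (by positivity)
          linarith
      _ = (A * (1 + κ) + D) * τ * L := by ring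
      _ ≤ _ := mul_le_mul_of_nonneg_left e1 (by positivity)
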